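/- **Setting.** Let $X_N=\frac1{\sqrt N}W_N$, where $W_N$, $N\ge 1$, are $N\times N$ random matrices of one of the following two kinds, with constants $\sigma>0$, $\sigma_1$, $m_4<\infty$ not depending on $N$. *Real symmetric Wigner matrix:* $W_N$ is real symmetric, the entries $(W_N)_{jk}$, $1\le j\le k\le N$, are independent (not necessarily identically distributed) and centred, and $$\mathbb V (W_N)_{jk}=\sigma^2\ (j<k),\qquad \sup_{j\ne k,\,N}\mathbb E (W_N)_{jk}^4\le m_4,\qquad \sup_{i,N}\mathbb E|(W_N)_{ii}|^2\le\sigma_1^2 .$$ *Hermitian Wigner matrix:* $W_N$ is Hermitian, the random variables $\Re (W_N)_{jk}$, $\Im (W_N)_{jk}$ ($j<k$) and $(W_N)_{ii}$ ($1\le i\le N$) are independent and centred, and $$\mathbb V\,\Re (W_N)_{jk}=\mathbb V\,\Im (W_N)_{jk}=\tfrac{\sigma^2}{2}\ (j<k),\qquad \sup_{j\ne k,\,N}\mathbb E |(W_N)_{jk}|^4\le m_4,\qquad \sup_{i,N}\mathbb E|(W_N)_{ii}|^2\le\sigma_1^2 .$$ For $f:\mathbb R\to\mathbb R$, the matrix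 $f(X_N)$ is defined by the functional calculus, $\mathbb V(\xi)=\mathbb E|\xi-\mathbb E\xi|^2$, $f^{(l)}$ is the $l$-th derivative, and $$\|f\|_{C^n([-L,L])}=\max_{0\le l\le n}\max_{|x|\le L}|f^{(l)}(x)|,\quad \|f\|_{n,1}=\max_{0\le l\le n}\int_{\mathbb R}|f^{(l)}(x)|\,dx,\quad \|f\|_{n,1,+}=\max_{0\le l\le n}\int_{\mathbb R}(|x|+1)|f^{(l)}(x)|\,dx .$$ Write $$\int f\,d\mu_{sc}=\int_{-2\sigma}^{2\sigma} f(x)\,\frac{1}{2\pi\sigma^2}\sqrt{4\sigma^2-x^2}\,dx .$$ **Proposition.** In the real symmetric case and in the Hermitian case the following holds for every $N\ge1$. (i) For every $L>0$ there is a constant $C=C(L,\sigma,\sigma_1,m_4)$ such that for every $f\in C^7(\mathbb R)$ with $\operatorname{supp} f\subset[-L,L]$, $$\Big|\mathbb E\big(f(X_N)_{ii}\big)-\int f\,d\mu_{sc}\Big|\le C\,\frac{\|f\|_{C^7([-L,L])}}{N},\qquad 1\le i\le N.$$ (ii) There is a constant $C=C(\sigma,\sigma_1,m_4)$ such that for every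 $f\in C^8(\mathbb R)$ with $\|f\|_{8,1,+}<\infty$, $$\Big|\mathbb E\big(f(X_N)_{ii}\big)-\int f\,d\mu_{sc}\Big|\le C\,\frac{\|f\|_{8,1,+}}{N},\qquad 1\le i\le N.$$ (iii) There is a constant $C=C(\sigma,\sigma_1,m_4)$ such that for every $f\in C^6(\mathbb R)$ with $\|f\|_{6,1}<\infty$, $$\big|\mathbb E\big(f(X_N)_{jk}\big)\big|\le C\,\frac{\|f\|_{6,1}}{N},\qquad 1\le j<k\le N.$$ (iv) There is a constant $C=C(\sigma,\sigma_1,m_4)$ such that for every $f\in C^4(\mathbb R)$ with $\|f\|_{4,1}<\infty$, $$\mathbb V\big(f(X_N)_{ij}\big)\le C\,\frac{\|f\|_{4,1}^2}{N},\qquad 1\le i,j\le N.$$ (v) Suppose in addition that $$\sup_{i\ne j,\,N}\mathbb E|(W_N)_{ij}|^5\le m_5<\infty,\qquad \sup_{i,N}\mathbb E|(W_N)_{ii}|^3\le\mu_3<\infty .$$ Then there is a constant $C=C(m_5,\mu_3)$ such that for every $f\in C^{10}(\mathbb R)$ with $\|f\|_{10,1}<\infty$, $$\big|\mathbb E\big(f(X_N)_{jk}\big)\big|\le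 C\,\frac{\|f\|_{10,1}}{N^{3/2}},\qquad 1\le j<k\le N.$$ The random variables whose expectations and variances occur above are integrable, respectively square integrable. -/

import Mathlib

open MeasureTheory ProbabilityTheory Set
open scoped ENNReal

universe u

noncomputable section

namespace Wigner

/-- A random real symmetric `N × N` Wigner matrix: the entries on and above the diagonal are
independent and centred, the off-diagonal entries have variance `σ²` and fourth moment at most
`m₄`, and the diagonal entries have second moment at most `σ₁²`. -/
structure IsRealWigner {Ω : Type u} [MeasurableSpace Ω] (P : Measure Ω) {N : ℕ} (σ σ₁ m₄ : ℝ)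
    (W : Ω → Matrix (Fin N) (Fin N) ℝ) : Prop where
  symm : ∀ ω, (W ω).IsSymm
  meas : ∀ j k, Measurable fun ω => W ω j k
  indep : iIndepFun (fun (p : {p : Fin N × Fin N // p.1 ≤ p.2}) ω => W ω p.1.1 p.1.2) P
  memLp_off : ∀ j k, j < k → MemLp (fun ω => W ω j k) 4 P
  mean_off : ∀ j k, j < k → ∫ ω, W ω j k ∂P = 0
  var_off : ∀ j k, j < k → Var[fun ω => W ω j k; P] = σ ^ 2
  fourth_off : ∀ j k, j < k → ∫ ω, W ω j k ^ 4 ∂P ≤ m₄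
  memLp_diag : ∀ i, MemLp (fun ω => W ω i i) 2 P
  mean_diag : ∀ i, ∫ ω, W ω i i ∂P = 0
  second_diag : ∀ i, ∫ ω, |W ω i i| ^ 2 ∂P ≤ σ₁ ^ 2

/-- The real random variables that determine a Hermitian matrix: the real parts and the imaginary
parts of the entries strictly above the diagonal, and the diagonal entries. -/
def hermitianCoords {Ω : Type u} {N : ℕ} (W : Ω → Matrix (Fin N) (Fin N) ℂ) :
    {p : Fin N × Fin N // p.1 < p.2} ⊕ ({p : Fin N × Fin N // p.1 < p.2} ⊕ Fin N) → Ω → ℝ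
  | .inl p => fun ω => (W ω p.1.1 p.1.2).re
  | .inr (.inl p) => fun ω => (W ω p.1.1 p.1.2).im
  | .inr (.inr i) => fun ω => (W ω i i).re

/-- A random Hermitian `N × N` Wigner matrix: the real and imaginary parts of the entries above the
diagonal, together with the diagonal entries, are independent and centred; the real and imaginary
parts of the off-diagonal entries have variance `σ² / 2`, the off-diagonal entries have absolute
fourth moment at most `m₄`, and the diagonal entries have second moment at most `σ₁²`. -/
structure IsHermitianWigner {Ω : Type u} [MeasurableSpace Ω] (P : Measure Ω) {N : ℕ}
    (σ σ₁ m₄ : ℝ) (W : Ω → Matrix (Fin N) (Fin N) ℂ) : Prop where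
  herm : ∀ ω, (W ω).IsHermitian
  meas : ∀ j k, Measurable fun ω => W ω j k
  indep : iIndepFun (hermitianCoords W) P
  memLp_off : ∀ j k, j < k → MemLp (fun ω => W ω j k) 4 P
  mean_re_off : ∀ j k, j < k → ∫ ω, (W ω j k).re ∂P = 0
  mean_im_off : ∀ j k, j < k → ∫ ω, (W ω j k).im ∂P = 0
  var_re_off : ∀ j k, j < k → Var[fun ω => (W ω j k).re; P] = σ ^ 2 / 2
  var_im_off : ∀ j k, j < k → Var[fun ω => (W ω j k).im; P] = σ ^ 2 / 2
  fourth_off : ∀ j k, j < k → ∫ ω, ‖W ω j k‖ ^ 4 ∂P ≤ m₄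
  memLp_diag : ∀ i, MemLp (fun ω => W ω i i) 2 P
  mean_diag : ∀ i, ∫ ω, W ω i i ∂P = 0
  second_diag : ∀ i, ∫ ω, ‖W ω i i‖ ^ 2 ∂P ≤ σ₁ ^ 2

section RCLike

variable {𝕜 : Type} [RCLike 𝕜] {Ω : Type u} [MeasurableSpace Ω] {N : ℕ}

/-- The off-diagonal entries have absolute fifth moment at most `m₅` and the diagonal entries have
absolute third moment at most `μ₃`. -/
structure HasHigherMoments (P : Measure Ω) (m₅ μ₃ : ℝ) (W : Ω → Matrix (Fin N) (Fin N) 𝕜) :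
    Prop where
  memLp_off : ∀ j k, j ≠ k → MemLp (fun ω => W ω j k) 5 P
  fifth_off : ∀ j k, j ≠ k → ∫ ω, ‖W ω j k‖ ^ 5 ∂P ≤ m₅
  memLp_diag : ∀ i, MemLp (fun ω => W ω i i) 3 P
  third_diag : ∀ i, ∫ ω, ‖W ω i i‖ ^ 3 ∂P ≤ μ₃

/-- The rescaled matrix `X_N = W_N / √N`. -/
def rescale (A : Matrix (Fin N) (Fin N) 𝕜) : Matrix (Fin N) (Fin N) 𝕜 :=
  (1 / √(N : ℝ)) • A

/-- The random variable `f(X_N)_{jk}`, where `f(X_N)` is given by the functional calculus for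
self-adjoint matrices. -/
def entry (f : ℝ → ℝ) (W : Ω → Matrix (Fin N) (Fin N) 𝕜) (j k : Fin N) (ω : Ω) : 𝕜 :=
  cfc f (rescale (W ω)) j k

/-- The variance `𝔼 |Y - 𝔼 Y|²` of a real or complex random variable. -/
def totalVariance (P : Measure Ω) (Y : Ω → 𝕜) : ℝ :=
  ∫ ω, ‖Y ω - ∫ ω', Y ω' ∂P‖ ^ 2 ∂P

end RCLike

/-- The integral of `f` against the semicircle distribution of variance `σ²`. -/
def semicircleIntegral (σ : ℝ) (f : ℝ → ℝ) : ℝ :=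
  ∫ x in (-2 * σ)..(2 * σ), f x * (1 / (2 * Real.pi * σ ^ 2) * √(4 * σ ^ 2 - x ^ 2))

/-- `‖f‖_{Cⁿ([-L, L])}`: the maximum of `|f⁽ˡ⁾(x)|` over `x ∈ [-L, L]` and `0 ≤ l ≤ n`. -/
def cNorm (n : ℕ) (L : ℝ) (f : ℝ → ℝ) : ℝ :=
  sSup {y | ∃ l ≤ n, ∃ x ∈ Icc (-L) L, y = |iteratedDeriv l f x|}

/-- `‖f‖_{n,1}`: the maximum of `∫ |f⁽ˡ⁾(x)| dx` over `0 ≤ l ≤ n`, possibly infinite. -/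
def norm1 (n : ℕ) (f : ℝ → ℝ) : ℝ≥0∞ :=
  (Finset.range (n + 1)).sup fun l => ∫⁻ x, ENNReal.ofReal |iteratedDeriv l f x|

/-- `‖f‖_{n,1,+}`: the maximum of `∫ (|x| + 1) |f⁽ˡ⁾(x)| dx` over `0 ≤ l ≤ n`, possibly
infinite. -/
def norm1Plus (n : ℕ) (f : ℝ → ℝ) : ℝ≥0∞ :=
  (Finset.range (n + 1)).sup fun l => ∫⁻ x, ENNReal.ofReal ((|x| + 1) * |iteratedDeriv l f x|)

end Wigner

end

/-! By Fourier inversion, `f(X)` is the superposition of the unitary matrices `U(t) = exp(itX)`, at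
times `2πt`, with the Fourier transform of `f` as weight. All five estimates thus follow from
estimates of the entries of `U(t)` that grow polynomially in `t`, and the power of `t` decides how
many derivatives of `f` are spent. Weighting the transform by the power `m` costs `m + 2` integrable
derivatives (a bounded transform, and two powers for integrability). For compact support it costs `m
+ 1`, by Plancherel and Cauchy–Schwarz. The powers used are 6 for the mean of a diagonal entry, 3
and 7 for the two bounds on the mean of an off-diagonal entry, and 2 for the variance.

To study `U`, remove row and column `k` from `X`. Write `M` for what is left and `x` for the `k`-th
column without its diagonal entry; `x` is independent of `M`. Duhamel's formula expresses `U_jk`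
through the linear form `(exp(isM)x)_j` and `U_kk` (`evol_off_diag`). It also gives `U_kk' = i X_kk
U_kk - q * U_kk` with the quadratic form `q(s) = x* exp(isM) x` and `*` the Volterra convolution
(`hasDerivAt_evol_diag`). Conditionally on `M`, `q` concentrates around `σ²` times the normalized
trace `τ` of `U`, with error of order `N^(-1/2)`. Averaging over `k` gives `τ' ≈ -σ² τ * τ`. The
characteristic function `φ` of the semicircle law solves this equation exactly, which is Segner's
recursion for the Catalan numbers (`hasDerivAt_scChar_conv`).

Stability is the point where polynomial growth is won. Both `τ` and `φ` are superpositions of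
characters, hence positive definite, so the convolution term has a favourable sign in the energy of
the difference and the error grows linearly in time where Gronwall's inequality would give an
exponential (`IsPosDef.norm_le`). The result is concentration of the diagonal entries around `φ` at
scale `N^(-1/2)` (`l2Bound_evol_diag`), from which the variance bound follows, together with the
smallness of off-diagonal entries.

Means are better by another factor `N^(-1/2)`. Linear forms and centred quadratic forms have zero
conditional mean, so `U_kk` may be replaced by its fluctuation and only products of two small
factors survive. This gives order `1/N` in `norm_integral_evol_off_diag_le` and, after solving the
linearised equation, in `norm_meanDiag_sub_le`. For order `N^(-3/2)`, the mean of linear form times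
`U_kk` is itself shown to solve the linear equation with kernel `σ²φ` and zero initial value. Its
forcing splits into centred parts, to which the same replacement applies, and cubic terms `x_a
|x_a|²`, whose third moments meet off-diagonal entries with mean of order `1/N`
(`norm_integral_evol_off_diag_le_refined`). -/

namespace Wigner

/-! ### Bounds in `L²` -/

/-- The random variable `f` is square integrable with `L²` norm at most `B`. -/
structure L2Bound {Ω : Type*} [MeasurableSpace Ω] (P : Measure Ω) (f : Ω → ℂ) (B : ℝ) : Prop where
  meas : AEStronglyMeasurable f P
  nonneg : 0 ≤ B
  le : eLpNorm f 2 P ≤ ENNReal.ofReal B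

namespace L2Bound

variable {Ω : Type*} [MeasurableSpace Ω] {P : Measure Ω} {f g : Ω → ℂ} {A B : ℝ}

theorem memLp (h : L2Bound P f B) : MemLp f 2 P := ⟨h.meas, h.le.trans_lt ENNReal.ofReal_lt_top⟩

theorem mono (h : L2Bound P f A) (hAB : A ≤ B) : L2Bound P f B :=
  ⟨h.meas, h.nonneg.trans hAB, h.le.trans (ENNReal.ofReal_le_ofReal hAB)⟩

theorem of_norm_le (h : L2Bound P f B) (hg : AEStronglyMeasurable g P)
    (hgf : ∀ ω, ‖g ω‖ ≤ ‖f ω‖) : L2Bound P g B :=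
  ⟨hg, h.nonneg, (eLpNorm_mono hgf).trans h.le⟩

theorem congr_norm (h : L2Bound P f B) (hg : AEStronglyMeasurable g P)
    (hgf : ∀ ω, ‖g ω‖ = ‖f ω‖) : L2Bound P g B :=
  h.of_norm_le hg fun ω => (hgf ω).le

theorem add (hf : L2Bound P f A) (hg : L2Bound P g B) :
    L2Bound P (fun ω => f ω + g ω) (A + B) := by
  refine ⟨hf.meas.add hg.meas, add_nonneg hf.nonneg hg.nonneg, ?_⟩
  rw [ENNReal.ofReal_add hf.nonneg hg.nonneg]
  exact (eLpNorm_add_le hf.meas hg.meas (by norm_num)).trans (add_le_add hf.le hg.le)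

theorem neg (hf : L2Bound P f A) : L2Bound P (fun ω => -f ω) A :=
  hf.congr_norm hf.meas.neg fun _ => norm_neg _

theorem sub (hf : L2Bound P f A) (hg : L2Bound P g B) :
    L2Bound P (fun ω => f ω - g ω) (A + B) := by
  simpa [sub_eq_add_neg] using hf.add hg.neg

theorem const_mul (hf : L2Bound P f A) (c : ℂ) : L2Bound P (fun ω => c * f ω) (‖c‖ * A) := by
  refine ⟨hf.meas.const_mul c, mul_nonneg (norm_nonneg _) hf.nonneg, ?_⟩
  have := eLpNorm_const_smul_le (c := c) (f := f) (p := 2) (μ := P)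
  refine (this).trans ?_
  rw [ENNReal.ofReal_mul (norm_nonneg _), ofReal_norm]
  gcongr
  exact hf.le

theorem norm (hf : L2Bound P f A) : L2Bound P (fun ω => (‖f ω‖ : ℂ)) A :=
  hf.congr_norm (Complex.continuous_ofReal.comp_aestronglyMeasurable hf.meas.norm) fun ω => by simp

theorem star (hf : L2Bound P f A) : L2Bound P (fun ω => starRingEnd ℂ (f ω)) A :=
  hf.congr_norm (Complex.continuous_conj.comp_aestronglyMeasurable hf.meas) fun ω => by simp

theorem zero : L2Bound P (fun _ => 0) 0 := ⟨aestronglyMeasurable_const, le_rfl, by simp⟩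

theorem sum {ι : Type*} (s : Finset ι) {F : ι → Ω → ℂ} {b : ι → ℝ}
    (h : ∀ i ∈ s, L2Bound P (F i) (b i)) : L2Bound P (fun ω => ∑ i ∈ s, F i ω) (∑ i ∈ s, b i) := by
  classical
  induction s using Finset.induction_on with
  | empty => simpa using zero
  | insert a s ha ih =>
    simp only [Finset.sum_insert ha]
    exact (h a (Finset.mem_insert_self _ _)).add
      (ih fun i hi => h i (Finset.mem_insert_of_mem hi))

theorem mul_bounded (hf : L2Bound P f A) (hg : AEStronglyMeasurable g P) (hb : ∀ ω, ‖g ω‖ ≤ 1) :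
    L2Bound P (fun ω => f ω * g ω) A :=
  hf.of_norm_le (hf.meas.mul hg) fun ω => by
    rw [norm_mul]; exact mul_le_of_le_one_right (norm_nonneg _) (hb ω)

theorem of_bounded [IsProbabilityMeasure P] (hf : AEStronglyMeasurable f P) (hA : 0 ≤ A)
    (hb : ∀ ω, ‖f ω‖ ≤ A) : L2Bound P f A := by
  refine ⟨hf, hA, ?_⟩
  have := eLpNorm_le_of_ae_bound (p := 2) (μ := P) (f := f) (ae_of_all _ hb)
  simpa using this

theorem _root_.Wigner.l2Bound_iff_lintegral (hA : 0 ≤ A) (hf : AEStronglyMeasurable f P) :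
    L2Bound P f A ↔ ∫⁻ ω, ‖f ω‖ₑ ^ 2 ∂P ≤ ENNReal.ofReal (A ^ 2) := by
  have key : eLpNorm f 2 P ≤ ENNReal.ofReal A ↔
      ∫⁻ ω, ‖f ω‖ₑ ^ 2 ∂P ≤ ENNReal.ofReal (A ^ 2) := by
    have h1 : eLpNorm f 2 P ^ 2 = ∫⁻ ω, ‖f ω‖ₑ ^ 2 ∂P := by
      have := eLpNorm_nnreal_pow_eq_lintegral (f := f) (μ := P) (p := 2) (by norm_num)
      simpa using this
    rw [← h1, ENNReal.ofReal_pow hA, ENNReal.pow_le_pow_left_iff (by norm_num)]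
  exact ⟨fun h => key.1 h.le, fun h => ⟨hf, hA, key.2 h⟩⟩

theorem lintegral_le (h : L2Bound P f A) : ∫⁻ ω, ‖f ω‖ₑ ^ 2 ∂P ≤ ENNReal.ofReal (A ^ 2) :=
  (l2Bound_iff_lintegral h.nonneg h.meas).1 h

theorem of_integral (hf : MemLp f 2 P) (hA : 0 ≤ A) (h : ∫ ω, ‖f ω‖ ^ 2 ∂P ≤ A ^ 2) :
    L2Bound P f A := by
  rw [l2Bound_iff_lintegral hA hf.1]
  have h2 : Integrable (fun ω => ‖f ω‖ ^ 2) P := hf.integrable_norm_pow (by norm_num)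
  have := ofReal_integral_eq_lintegral_ofReal h2 (ae_of_all _ fun ω => by positivity)
  have h3 : ∫⁻ ω, ‖f ω‖ₑ ^ 2 ∂P = ENNReal.ofReal (∫ ω, ‖f ω‖ ^ 2 ∂P) := by
    rw [this]
    refine lintegral_congr fun ω => ?_
    rw [ENNReal.ofReal_pow (norm_nonneg _), ofReal_norm]
  rw [h3]
  exact ENNReal.ofReal_le_ofReal h

theorem integral_sq_le (h : L2Bound P f A) : ∫ ω, ‖f ω‖ ^ 2 ∂P ≤ A ^ 2 := by
  have h2 : Integrable (fun ω => ‖f ω‖ ^ 2) P := h.memLp.integrable_norm_pow (by norm_num)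
  rw [integral_eq_lintegral_of_nonneg_ae (ae_of_all _ fun ω => by positivity) h2.1]
  refine ENNReal.toReal_le_of_le_ofReal (by positivity) ?_
  refine le_trans (le_of_eq (lintegral_congr fun ω => ?_)) h.lintegral_le
  rw [ENNReal.ofReal_pow (norm_nonneg _), ofReal_norm]

theorem integrable_mul (hf : L2Bound P f A) (hg : L2Bound P g B) :
    Integrable (fun ω => f ω * g ω) P := hf.memLp.integrable_mul hg.memLp

theorem lintegral_mul_le (hf : L2Bound P f A) (hg : L2Bound P g B) :
    ∫⁻ ω, ‖f ω * g ω‖ₑ ∂P ≤ ENNReal.ofReal (A * B) := by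
  have : eLpNorm (fun ω => f ω * g ω) 1 P ≤ eLpNorm f 2 P * eLpNorm g 2 P :=
    eLpNorm_smul_le_mul_eLpNorm (φ := f) (f := g) (p := 2) (q := 2) (r := 1) hg.meas hf.meas
  rw [eLpNorm_one_eq_lintegral_enorm] at this
  refine this.trans ?_
  rw [ENNReal.ofReal_mul hf.nonneg]
  exact mul_le_mul' hf.le hg.le

theorem integral_norm_mul_le (hf : L2Bound P f A) (hg : L2Bound P g B) :
    ∫ ω, ‖f ω‖ * ‖g ω‖ ∂P ≤ A * B := by
  have h2 := (hf.integrable_mul hg).norm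
  simp_rw [← norm_mul]
  rw [integral_eq_lintegral_of_nonneg_ae (ae_of_all _ fun ω => by positivity) h2.1]
  refine ENNReal.toReal_le_of_le_ofReal (mul_nonneg hf.nonneg hg.nonneg) ?_
  refine le_trans (le_of_eq (lintegral_congr fun ω => ?_)) (hf.lintegral_mul_le hg)
  rw [ofReal_norm]

theorem norm_integral_mul_le (hf : L2Bound P f A) (hg : L2Bound P g B) :
    ‖∫ ω, f ω * g ω ∂P‖ ≤ A * B := by
  refine (norm_integral_le_integral_norm _).trans ?_
  simpa [norm_mul] using hf.integral_norm_mul_le hg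

theorem norm_integral_le [IsProbabilityMeasure P] (hf : L2Bound P f A) : ‖∫ ω, f ω ∂P‖ ≤ A := by
  have := hf.norm_integral_mul_le (of_bounded (f := fun _ => (1 : ℂ)) (A := 1)
    aestronglyMeasurable_const zero_le_one fun _ => by simp)
  simpa using this

theorem integrable [IsFiniteMeasure P] (hf : L2Bound P f A) : Integrable f P :=
  hf.memLp.integrable (by norm_num)

/-- Products of independent square integrable variables. -/
theorem indep_mul (hf : L2Bound P f A) (hg : L2Bound P g B) (hfg : IndepFun f g P) :
    L2Bound P (fun ω => f ω * g ω) (A * B) := by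
  have hm0 : AEStronglyMeasurable (fun ω => f ω * g ω) P := hf.meas.mul hg.meas
  rw [l2Bound_iff_lintegral (mul_nonneg hf.nonneg hg.nonneg) hm0]
  have hm : Measurable fun z : ℂ => ‖z‖ₑ ^ 2 := by fun_prop
  have h := lintegral_mul_eq_lintegral_mul_lintegral_of_indepFun''
    (hm.comp_aemeasurable hf.meas.aemeasurable) (hm.comp_aemeasurable hg.meas.aemeasurable)
    (hfg.comp hm hm)
  simp only [Function.comp_def] at h
  simp_rw [enorm_mul, mul_pow]
  rw [h, ENNReal.ofReal_mul (by positivity)]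
  exact mul_le_mul' hf.lintegral_le hg.lintegral_le

/-- Conditioning on an independent variable: if the `L²` norm of `G (x, m)` is at most `A ‖h m‖` for
every fixed `m`, the `L²` norm of `G (x, M)` is at most `A` times the one of `h (M)`. -/
theorem of_fiber [IsProbabilityMeasure P] {E F : Type*} [MeasurableSpace E] [MeasurableSpace F]
    {x : Ω → E} {M : Ω → F} (hx : Measurable x) (hM : Measurable M) (hxM : IndepFun x M P)
    {G : E → F → ℂ} (hG : Measurable (Function.uncurry G)) {h : F → ℂ} (hA : 0 ≤ A)
    (hb : ∀ ω, ∫⁻ ω', ‖G (x ω') (M ω)‖ₑ ^ 2 ∂P ≤ ENNReal.ofReal (A ^ 2) * ‖h (M ω)‖ₑ ^ 2)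
    (hh : L2Bound P (fun ω => h (M ω)) B) :
    L2Bound P (fun ω => G (x ω) (M ω)) (A * B) := by
  have hmeas : Measurable fun ω => G (x ω) (M ω) := hG.comp (hx.prodMk hM)
  rw [l2Bound_iff_lintegral (mul_nonneg hA hh.nonneg) hmeas.aestronglyMeasurable]
  -- Independence makes the joint law a product, so Tonelli lets `x` be integrated first with `M`
  -- frozen.
  have hmap := (indepFun_iff_map_prod_eq_prod_map_map hx.aemeasurable hM.aemeasurable).1 hxM
  have hm2 : Measurable fun p : E × F => ‖G p.1 p.2‖ₑ ^ 2 := by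
    have : Measurable fun p : E × F => G p.1 p.2 := hG
    fun_prop
  have e1 : ∫⁻ ω, ‖G (x ω) (M ω)‖ₑ ^ 2 ∂P =
      ∫⁻ ω, ∫⁻ ω', ‖G (x ω') (M ω)‖ₑ ^ 2 ∂P ∂P := by
    have := lintegral_map hm2 (hx.prodMk hM) (μ := P)
    simp only at this
    rw [← this, hmap, lintegral_prod_symm' _ hm2, lintegral_map _ hM]
    · refine lintegral_congr fun ω => ?_
      rw [lintegral_map _ hx]
      exact hm2.comp (measurable_id.prodMk measurable_const)
    · exact hm2.lintegral_prod_left'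
  rw [e1]
  refine (lintegral_mono hb).trans ?_
  rw [lintegral_const_mul' _ _ ENNReal.ofReal_ne_top, mul_pow, ENNReal.ofReal_mul (by positivity)]
  exact mul_le_mul' le_rfl hh.lintegral_le

theorem of_fiber_const [IsProbabilityMeasure P] {E F : Type*} [MeasurableSpace E]
    [MeasurableSpace F] {x : Ω → E} {M : Ω → F} (hx : Measurable x) (hM : Measurable M)
    (hxM : IndepFun x M P) {G : E → F → ℂ} (hG : Measurable (Function.uncurry G))
    (hb : ∀ ω, L2Bound P (fun ω' => G (x ω') (M ω)) A) :
    L2Bound P (fun ω => G (x ω) (M ω)) A := by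
  have hA : 0 ≤ A := by
    -- A probability space has a point, and the bound on any one fiber contains `0 ≤ A`.
    obtain ⟨ω⟩ := P.nonempty_of_neZero
    exact (hb ω).nonneg
  have := of_fiber (h := fun _ => 1) (B := 1) hx hM hxM hG hA
    (fun ω => by simpa using (hb ω).lintegral_le)
    (of_bounded aestronglyMeasurable_const zero_le_one fun _ => by simp)
  simpa using this

/-- Minkowski's integral inequality, in the form of a weighted bound. -/
theorem integral_norm {T : Type*} [MeasurableSpace T] {ν : Measure T} [SFinite ν] [SFinite P]
    {η : T → Ω → ℂ} (hη : Measurable (Function.uncurry η)) {w : T → ℝ} (hw : Integrable w ν)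
    (hb : ∀ᵐ s ∂ν, L2Bound P (η s) (w s)) :
    L2Bound P (fun ω => ((∫ s, ‖η s ω‖ ∂ν : ℝ) : ℂ)) (∫ s, w s ∂ν) := by
  have hw0 : 0 ≤ᵐ[ν] w := hb.mono fun s h => h.nonneg
  have hm : Measurable fun p : T × Ω => η p.1 p.2 := hη
  have hme : Measurable fun p : T × Ω => ‖η p.1 p.2‖ₑ := hm.enorm
  have hmr : Measurable fun ω => ((∫ s, ‖η s ω‖ ∂ν : ℝ) : ℂ) :=
    Complex.measurable_ofReal.comp
      (hm.norm.stronglyMeasurable.integral_prod_left').measurable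
  rw [l2Bound_iff_lintegral (integral_nonneg_of_ae hw0) hmr.aestronglyMeasurable]
  have h1 : ∀ ω, ‖((∫ s, ‖η s ω‖ ∂ν : ℝ) : ℂ)‖ₑ ≤ ∫⁻ s, ‖η s ω‖ₑ ∂ν := fun ω => by
    have e : ‖((∫ s, ‖η s ω‖ ∂ν : ℝ) : ℂ)‖ₑ = ‖∫ s, ‖η s ω‖ ∂ν‖ₑ := by
      rw [← ofReal_norm, ← ofReal_norm, Complex.norm_real]
    rw [e]
    refine (enorm_integral_le_lintegral_enorm _).trans (le_of_eq (lintegral_congr fun s => ?_))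
    simp
  -- The square of the time integral is a double integral over `(s, t)`. Tonelli moves the
  -- expectation inside, Cauchy–Schwarz bounds each pair by `w s * w t`, and the double integral
  -- factors again.
  calc ∫⁻ ω, ‖((∫ s, ‖η s ω‖ ∂ν : ℝ) : ℂ)‖ₑ ^ 2 ∂P
      ≤ ∫⁻ ω, ∫⁻ s, ∫⁻ t, ‖η s ω‖ₑ * ‖η t ω‖ₑ ∂ν ∂ν ∂P := by
        refine lintegral_mono fun ω => (pow_le_pow_left' (h1 ω) 2).trans (le_of_eq ?_)
        have hs : Measurable fun s => ‖η s ω‖ₑ := hme.comp (measurable_id.prodMk measurable_const)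
        rw [sq, ← lintegral_mul_const _ hs]
        exact lintegral_congr fun s => (lintegral_const_mul _ hs).symm
    _ = ∫⁻ s, ∫⁻ t, ∫⁻ ω, ‖η s ω‖ₑ * ‖η t ω‖ₑ ∂P ∂ν ∂ν := by
        have m3 : Measurable fun p : (Ω × T) × T => ‖η p.1.2 p.1.1‖ₑ * ‖η p.2 p.1.1‖ₑ :=
          (hme.comp (by fun_prop : Measurable fun p : (Ω × T) × T => (p.1.2, p.1.1))).mul
            (hme.comp (by fun_prop : Measurable fun p : (Ω × T) × T => (p.2, p.1.1)))
        rw [lintegral_lintegral_swap (m3.lintegral_prod_right').aemeasurable]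
        refine lintegral_congr fun s => ?_
        rw [lintegral_lintegral_swap]
        exact (m3.comp (by fun_prop : Measurable fun p : Ω × T =>
          ((p.1, s), p.2))).aemeasurable
    _ ≤ ∫⁻ s, ∫⁻ t, ENNReal.ofReal (w s) * ENNReal.ofReal (w t) ∂ν ∂ν := by
        refine lintegral_mono_ae (hb.mono fun s hs => lintegral_mono_ae (hb.mono fun t ht => ?_))
        have := hs.lintegral_mul_le ht
        simp_rw [enorm_mul] at this
        rwa [← ENNReal.ofReal_mul hs.nonneg]
    _ = ENNReal.ofReal ((∫ s, w s ∂ν) ^ 2) := by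
        have hwm : AEMeasurable (fun s => ENNReal.ofReal (w s)) ν :=
          hw.1.aemeasurable.ennreal_ofReal
        simp_rw [lintegral_const_mul'' _ hwm]
        rw [lintegral_mul_const'' _ hwm, ← ofReal_integral_eq_lintegral_ofReal hw hw0, ← sq,
          ENNReal.ofReal_pow (integral_nonneg_of_ae hw0)]

/-- The `L²` norm of a time integral over `[0, T]`. -/
theorem intervalIntegral_norm [SFinite P] {η : ℝ → Ω → ℂ} (hη : Measurable (Function.uncurry η))
    {T : ℝ} (hT : 0 ≤ T) (hb : ∀ s ∈ Icc 0 T, L2Bound P (η s) B) :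
    L2Bound P (fun ω => ((∫ s in (0 : ℝ)..T, ‖η s ω‖ : ℝ) : ℂ)) (T * B) := by
  have := integral_norm (ν := volume.restrict (Ioc 0 T)) (P := P) hη (w := fun _ => B)
    (integrable_const _) ((ae_restrict_mem measurableSet_Ioc).mono fun s hs =>
      hb s ⟨hs.1.le, hs.2⟩)
  simp_rw [intervalIntegral.integral_of_le hT]
  refine this.mono (le_of_eq ?_)
  simp [hT]

end L2Bound

/-- Interchange of expectation and time integral. -/
theorem integral_intervalIntegral_comm {Ω : Type*} [MeasurableSpace Ω] {P : Measure Ω}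
    [IsProbabilityMeasure P] {F : ℝ → Ω → ℂ} (hF : Measurable (Function.uncurry F)) {T : ℝ}
    (hT : 0 ≤ T) {G : Ω → ℝ} (hG : Integrable G P)
    (hFG : ∀ s ∈ Icc 0 T, ∀ ω, ‖F s ω‖ ≤ G ω) :
    ∫ ω, (∫ s in (0 : ℝ)..T, F s ω) ∂P = ∫ s in (0 : ℝ)..T, ∫ ω, F s ω ∂P := by
  simp_rw [intervalIntegral.integral_of_le hT]
  refine integral_integral_swap ?_
  have hm : Measurable fun p : Ω × ℝ => F p.2 p.1 := hF.comp measurable_swap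
  refine Integrable.mono' (g := fun p : Ω × ℝ => G p.1) ?_ hm.aestronglyMeasurable ?_
  · exact hG.comp_fst _
  · have : ∀ᵐ p : Ω × ℝ ∂(P.prod (volume.restrict (Ioc 0 T))), p.2 ∈ Ioc 0 T :=
      Measure.quasiMeasurePreserving_snd.ae (ae_restrict_mem measurableSet_Ioc)
    exact this.mono fun p hp => hFG _ ⟨hp.1.le, hp.2⟩ _

end Wigner

namespace Wigner

/-! ### Unitary evolutions of Hermitian matrices -/

/-- The product `σ`-algebra on matrices. -/
noncomputable instance matrixMeasurableSpace {m n : Type*} : MeasurableSpace (Matrix m n ℂ) :=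
  inferInstanceAs (MeasurableSpace (m → n → ℂ))

instance matrixBorelSpace {m n : Type*} [Fintype m] [Fintype n] : BorelSpace (Matrix m n ℂ) :=
  inferInstanceAs (BorelSpace (m → n → ℂ))

instance matrixSecondCountable {m n : Type*} [Fintype m] [Fintype n] :
    SecondCountableTopology (Matrix m n ℂ) :=
  inferInstanceAs (SecondCountableTopology (m → n → ℂ))

/-- The unitary evolution `exp (i t X)`. -/
noncomputable def evol {N : ℕ} (X : Matrix (Fin N) (Fin N) ℂ) (t : ℝ) : Matrix (Fin N) (Fin N) ℂ :=
  NormedSpace.exp (t • (Complex.I • X))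

section Evol

variable {N : ℕ} {X Y : Matrix (Fin N) (Fin N) ℂ}

@[simp] theorem evol_zero : evol X 0 = 1 := by simp [evol]

theorem evol_conjTranspose (hX : X.IsHermitian) (t : ℝ) :
    (evol X t).conjTranspose = evol X (-t) := by
  rw [evol, evol, ← Matrix.exp_conjTranspose]
  congr 1
  rw [Matrix.conjTranspose_smul, Matrix.conjTranspose_smul, hX.eq]
  simp

theorem evol_neg_apply (hX : X.IsHermitian) (t : ℝ) (i j : Fin N) :
    evol X (-t) i j = starRingEnd ℂ (evol X t j i) := by
  rw [← evol_conjTranspose hX]; rfl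

theorem evol_add (s t : ℝ) : evol X (s + t) = evol X s * evol X t := by
  rw [evol, add_smul, Matrix.exp_add_of_commute]
  · rfl
  · exact ((Commute.refl (Complex.I • X)).smul_left s).smul_right t

theorem evol_mul_neg (t : ℝ) : evol X t * evol X (-t) = 1 := by
  rw [← evol_add]; simp

/-- Unitarity, read on the diagonal. It supplies the deterministic bound on entries and the unit
coefficient vectors of the linear forms. -/
theorem sum_norm_sq_evol_row (hX : X.IsHermitian) (t : ℝ) (i : Fin N) :
    ∑ j, ‖evol X t i j‖ ^ 2 = 1 := by
  have h := congrFun (congrFun (evol_mul_neg (X := X) t) i) i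
  rw [Matrix.mul_apply] at h
  simp_rw [evol_neg_apply hX, Complex.mul_conj'] at h
  rw [Matrix.one_apply_eq] at h
  exact_mod_cast h

theorem sum_norm_sq_evol_col (hX : X.IsHermitian) (t : ℝ) (j : Fin N) :
    ∑ i, ‖evol X t i j‖ ^ 2 = 1 := by
  rw [← sum_norm_sq_evol_row hX (-t) j]
  refine Finset.sum_congr rfl fun i _ => ?_
  rw [evol_neg_apply hX, RCLike.norm_conj]

theorem norm_evol_le (hX : X.IsHermitian) (t : ℝ) (i j : Fin N) : ‖evol X t i j‖ ≤ 1 := by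
  have h := Finset.single_le_sum (f := fun j => ‖evol X t i j‖ ^ 2) (fun j _ => by positivity)
    (Finset.mem_univ j)
  rw [sum_norm_sq_evol_row hX] at h
  nlinarith [norm_nonneg (evol X t i j)]

section

attribute [local instance] Matrix.linftyOpNormedRing Matrix.linftyOpNormedAlgebra
  Matrix.linftyOpNormedAddCommGroup Matrix.linftyOpNormedSpace

theorem hasDerivAt_evol (t : ℝ) :
    HasDerivAt (evol X) (Complex.I • X * evol X t) t :=
  hasDerivAt_exp_smul_const' (𝕂 := ℝ) (Complex.I • X) t

theorem hasDerivAt_evol_apply (t : ℝ) (i j : Fin N) :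
    HasDerivAt (fun t => evol X t i j) ((Complex.I • X * evol X t) i j) t := by
  let ℓ : Matrix (Fin N) (Fin N) ℂ →ₗ[ℝ] ℂ :=
    { toFun := fun A => A i j, map_add' := fun _ _ => rfl, map_smul' := fun _ _ => rfl }
  exact (LinearMap.toContinuousLinearMap ℓ).hasFDerivAt.comp_hasDerivAt t (hasDerivAt_evol t)

theorem continuous_evol_uncurry :
    Continuous fun p : ℝ × Matrix (Fin N) (Fin N) ℂ => evol p.2 p.1 := by
  let : NormedAlgebra ℚ (Matrix (Fin N) (Fin N) ℂ) := NormedAlgebra.restrictScalars ℚ ℝ _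
  have h : Continuous (NormedSpace.exp : Matrix (Fin N) (Fin N) ℂ → _) :=
    NormedSpace.exp_continuous
  exact h.comp (by fun_prop)

theorem evol_mul_comm (t : ℝ) : X * evol X t = evol X t * X := by
  have h := (((Commute.refl X).smul_left Complex.I).smul_left t).exp_left
  exact h.eq.symm

/-- Duhamel's formula. -/
theorem evol_sub_evol (t : ℝ) (i j : Fin N) :
    evol X t i j - evol Y t i j =
      ∫ s in (0 : ℝ)..t, Complex.I * (evol Y s * (X - Y) * evol X (t - s)) i j := by
  -- The path `-(evol Y s * evol X (t - s))` runs from `-evol X t` at `s = 0` to `-evol Y t` at `s =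
  -- t`. Since a matrix commutes with its evolution, its derivative carries exactly `X - Y` in the
  -- middle.
  have hd : ∀ s, HasDerivAt (fun s => -(evol Y s * evol X (t - s)))
      (Complex.I • (evol Y s * (X - Y) * evol X (t - s))) s := fun s => by
    have h1 := hasDerivAt_evol (X := Y) s
    have h2 : HasDerivAt (fun s => evol X (t - s)) (-(Complex.I • X * evol X (t - s))) s := by
      simpa using! (hasDerivAt_evol (X := X) (t - s)).scomp s ((hasDerivAt_id s).const_sub t)
    have h3 := (h1.mul h2).neg
    refine h3.congr_deriv ?_
    rw [Matrix.smul_mul, evol_mul_comm]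
    simp only [Matrix.mul_sub, Matrix.sub_mul, Matrix.smul_mul, Matrix.mul_smul, mul_neg, smul_sub,
      Matrix.mul_assoc]
    abel
  let ℓ : Matrix (Fin N) (Fin N) ℂ →ₗ[ℝ] ℂ :=
    { toFun := fun A => A i j, map_add' := fun _ _ => rfl, map_smul' := fun _ _ => rfl }
  have hd' : ∀ s, HasDerivAt (fun s => -(evol Y s * evol X (t - s)) i j)
      (Complex.I * (evol Y s * (X - Y) * evol X (t - s)) i j) s := fun s =>
    (LinearMap.toContinuousLinearMap ℓ).hasFDerivAt.comp_hasDerivAt s (hd s)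
  rw [intervalIntegral.integral_eq_sub_of_hasDerivAt (fun s _ => hd' s)]
  · simp; ring
  · apply Continuous.intervalIntegrable
    have c1 : Continuous (evol Y) := continuous_evol_uncurry.comp (by fun_prop : Continuous fun s : ℝ => (s, Y))
    have c2 : Continuous fun s => evol X (t - s) :=
      continuous_evol_uncurry.comp (by fun_prop : Continuous fun s : ℝ => (t - s, X))
    have c3 : Continuous fun s => (evol Y s * (X - Y) * evol X (t - s)) :=
      (c1.mul continuous_const).mul c2
    exact continuous_const.mul (c3.matrix_elem i j)

end

theorem continuous_evol_apply (i j : Fin N) : Continuous fun t => evol X t i j :=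
  (continuous_evol_uncurry.comp (by fun_prop : Continuous fun s : ℝ => (s, X))).matrix_elem i j

theorem measurable_evol_apply (i j : Fin N) :
    Measurable fun p : ℝ × Matrix (Fin N) (Fin N) ℂ => evol p.2 p.1 i j :=
  (continuous_evol_uncurry.matrix_elem i j).measurable

end Evol

/-! ### Removing a row and a column, or a pair of entries -/

section Cut

variable {N : ℕ}

/-- The matrix `X` with the `k`-th row and column set to zero. -/
def cutRow (k : Fin N) (X : Matrix (Fin N) (Fin N) ℂ) : Matrix (Fin N) (Fin N) ℂ :=
  Matrix.of fun a b => if a = k ∨ b = k then 0 else X a b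

/-- The matrix `X` with the entries `(k, a)` and `(a, k)` set to zero. -/
def cutEntry (k a : Fin N) (X : Matrix (Fin N) (Fin N) ℂ) : Matrix (Fin N) (Fin N) ℂ :=
  Matrix.of fun i j => if (i = k ∧ j = a) ∨ (i = a ∧ j = k) then 0 else X i j

/-- The `k`-th column of `X` with the diagonal entry set to zero. -/
def offCol (k : Fin N) (X : Matrix (Fin N) (Fin N) ℂ) : Fin N → ℂ :=
  fun a => if a = k then 0 else X a k

variable {X : Matrix (Fin N) (Fin N) ℂ} (k : Fin N)

theorem cutRow_isHermitian (hX : X.IsHermitian) : (cutRow k X).IsHermitian := by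
  refine Matrix.IsHermitian.ext fun i j => ?_
  simp only [cutRow, Matrix.of_apply, or_comm (a := j = k)]
  split_ifs
  · simp
  · exact hX.apply i j

theorem cutEntry_isHermitian (a : Fin N) (hX : X.IsHermitian) : (cutEntry k a X).IsHermitian := by
  refine Matrix.IsHermitian.ext fun i j => ?_
  have : ((j = k ∧ i = a) ∨ (j = a ∧ i = k)) ↔ ((i = k ∧ j = a) ∨ (i = a ∧ j = k)) := by tauto
  simp only [cutEntry, Matrix.of_apply, this]
  split_ifs
  · simp
  · exact hX.apply i j

/-- The removed pair already lies in row or column `k`. Hence the matrix without row `k` is a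
function of the matrix without the pair, and so is independent of the entry `(a, k)`. -/
theorem cutRow_cutEntry (a : Fin N) : cutRow k (cutEntry k a X) = cutRow k X := by
  ext i j
  simp only [cutRow, cutEntry, Matrix.of_apply]
  split_ifs <;> tauto

theorem measurable_cutRow : Measurable (cutRow k : Matrix (Fin N) (Fin N) ℂ → _) := by
  refine measurable_pi_lambda _ fun a => measurable_pi_lambda _ fun b => ?_
  simp only [cutRow, Matrix.of_apply]
  split_ifs
  · exact measurable_const
  · exact (measurable_pi_apply b).comp (measurable_pi_apply a)

theorem measurable_cutEntry (a : Fin N) :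
    Measurable (cutEntry k a : Matrix (Fin N) (Fin N) ℂ → _) := by
  refine measurable_pi_lambda _ fun i => measurable_pi_lambda _ fun j => ?_
  simp only [cutEntry, Matrix.of_apply]
  split_ifs
  · exact measurable_const
  · exact (measurable_pi_apply j).comp (measurable_pi_apply i)

theorem measurable_offCol : Measurable (offCol k : Matrix (Fin N) (Fin N) ℂ → _) := by
  refine measurable_pi_lambda _ fun a => ?_
  simp only [offCol]
  split_ifs
  · exact measurable_const
  · exact (measurable_pi_apply k).comp (measurable_pi_apply a)

/-- The `k`-th basis vector is in the kernel of the cut matrix, so the evolution leaves it fixed. -/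
theorem evol_cutRow_right (b : Fin N) (t : ℝ) :
    evol (cutRow k X) t b k = (1 : Matrix (Fin N) (Fin N) ℂ) b k := by
  have hd : ∀ t, HasDerivAt (fun t => evol (cutRow k X) t b k) 0 t := fun t => by
    refine (hasDerivAt_evol_apply (X := cutRow k X) t b k).congr_deriv ?_
    rw [Matrix.smul_mul, evol_mul_comm]
    simp [Matrix.mul_apply, cutRow]
  have := is_const_of_deriv_eq_zero (fun t => (hd t).differentiableAt) (fun t => (hd t).deriv) t 0
  simpa using this

/-- The linear form `(exp (i s X⁽ᵏ⁾) x)_j` in the `k`-th column `x` of `X`. -/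
noncomputable def linForm (M : Matrix (Fin N) (Fin N) ℂ) (x : Fin N → ℂ) (j : Fin N) (s : ℝ) : ℂ :=
  ∑ a, evol M s j a * x a

/-- The quadratic form `x* exp (i s M) x`. -/
noncomputable def quadForm (M : Matrix (Fin N) (Fin N) ℂ) (x : Fin N → ℂ) (s : ℝ) : ℂ :=
  ∑ a, ∑ b, starRingEnd ℂ (x a) * evol M s a b * x b

theorem continuous_linForm (M : Matrix (Fin N) (Fin N) ℂ) (x : Fin N → ℂ) (j : Fin N) :
    Continuous (linForm M x j) :=
  continuous_finsetSum _ fun a _ => (continuous_evol_apply j a).mul continuous_const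

theorem continuous_quadForm (M : Matrix (Fin N) (Fin N) ℂ) (x : Fin N → ℂ) :
    Continuous (quadForm M x) :=
  continuous_finsetSum _ fun a _ => continuous_finsetSum _ fun b _ =>
    (continuous_const.mul (continuous_evol_apply a b)).mul continuous_const

theorem quadForm_eq_sum_linForm (M : Matrix (Fin N) (Fin N) ℂ) (x : Fin N → ℂ) (s : ℝ) :
    quadForm M x s = ∑ a, starRingEnd ℂ (x a) * linForm M x a s := by
  simp only [quadForm, linForm, Finset.mul_sum, mul_assoc]

theorem sum_norm_sq_linForm {M : Matrix (Fin N) (Fin N) ℂ} (hM : M.IsHermitian) (x : Fin N → ℂ)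
    (s : ℝ) : ∑ j, ‖linForm M x j s‖ ^ 2 = ∑ a, ‖x a‖ ^ 2 := by
  have key : ∀ y : Fin N → ℂ, ((∑ j, ‖y j‖ ^ 2 : ℝ) : ℂ) = dotProduct (star y) y := by
    intro y
    simp [dotProduct, Complex.conj_mul']
  have h : (fun j => linForm M x j s) = (evol M s).mulVec x := rfl
  have : ((∑ j, ‖linForm M x j s‖ ^ 2 : ℝ) : ℂ) = ((∑ a, ‖x a‖ ^ 2 : ℝ) : ℂ) := by
    rw [key, key, h, Matrix.star_mulVec, Matrix.dotProduct_mulVec, Matrix.vecMul_vecMul,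
      evol_conjTranspose hM, ← evol_add]
    simp
  exact_mod_cast this

/-- Cutting row and column `k` is a perturbation of rank at most two: a column without its diagonal
entry, plus a full row. The diagonal entry is counted with the row, so that the column part is the
centred vector `offCol`. -/
theorem mul_sub_cutRow_mul_apply (A C : Matrix (Fin N) (Fin N) ℂ) (i j : Fin N) :
    (A * (X - cutRow k X) * C) i j =
      (∑ a, A i a * offCol k X a) * C k j + A i k * (∑ b, X k b * C b j) := by
  have hD : ∀ a b, (X - cutRow k X) a b =
      offCol k X a * (1 : Matrix (Fin N) (Fin N) ℂ) k b + (if a = k then X k b else 0) := by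
    intro a b
    simp only [cutRow, offCol, Matrix.sub_apply, Matrix.of_apply, Matrix.one_apply]
    by_cases ha : a = k
    · subst ha; simp
    · by_cases hb : b = k
      · subst hb; simp [ha]
      · simp [ha, hb, Ne.symm hb]
  simp only [Matrix.mul_apply, hD, mul_add, add_mul, Finset.sum_add_distrib, Finset.sum_mul,
    Finset.mul_sum]
  congr 1
  · rw [Finset.sum_comm]
    refine Finset.sum_congr rfl fun a _ => ?_
    rw [Finset.sum_eq_single k (fun b _ hb => by simp [Matrix.one_apply_ne hb.symm]) (by simp)]
    simp
  · refine Finset.sum_congr rfl fun b _ => ?_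
    rw [Finset.sum_eq_single k (fun a _ ha => by simp [ha]) (by simp)]
    simp [mul_assoc]

/-- An off-diagonal entry in terms of a diagonal one. -/
theorem evol_off_diag {j : Fin N} (hjk : j ≠ k) (t : ℝ) :
    evol X t j k = ∫ s in (0 : ℝ)..t,
      Complex.I * (linForm (cutRow k X) (offCol k X) j s * evol X (t - s) k k) := by
  have h := evol_sub_evol (X := X) (Y := cutRow k X) t j k
  rw [evol_cutRow_right, Matrix.one_apply_ne hjk, sub_zero] at h
  rw [h]
  refine intervalIntegral.integral_congr fun s _ => ?_
  -- The row part of the perturbation is multiplied by the entry `(j, k)` of the cut evolution,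
  -- which vanishes; only the column part survives.
  rw [mul_sub_cutRow_mul_apply, evol_cutRow_right, Matrix.one_apply_ne hjk]
  simp [linForm]

/-- The entries of the evolution with a row removed. -/
theorem evol_sub_evol_cutRow {l : Fin N} (hl : l ≠ k) (m : Fin N) (t : ℝ) :
    evol X t l m - evol (cutRow k X) t l m = ∫ s in (0 : ℝ)..t, Complex.I *
      (linForm (cutRow k X) (offCol k X) l s * evol X (t - s) k m) := by
  rw [evol_sub_evol]
  refine intervalIntegral.integral_congr fun s _ => ?_
  rw [mul_sub_cutRow_mul_apply, evol_cutRow_right, Matrix.one_apply_ne hl]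
  simp [linForm]

/-- The integro-differential equation of a diagonal entry. -/
theorem hasDerivAt_evol_diag (hX : X.IsHermitian) (t : ℝ) :
    HasDerivAt (fun t => evol X t k k) (Complex.I * X k k * evol X t k k -
      ∫ s in (0 : ℝ)..t, quadForm (cutRow k X) (offCol k X) s * evol X (t - s) k k) t := by
  refine (hasDerivAt_evol_apply (X := X) t k k).congr_deriv ?_
  rw [Matrix.smul_mul, Matrix.smul_apply, Matrix.mul_apply, ← Finset.add_sum_erase _ _
    (Finset.mem_univ k)]
  -- Inserting the formula for off-diagonal entries closes the equation: the sum over `j` assembles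
  -- the quadratic form, and the two factors `i` produce the minus sign.
  have h1 : ∀ j ∈ Finset.univ.erase k, X k j * evol X t j k = ∫ s in (0 : ℝ)..t,
      Complex.I * ((starRingEnd ℂ (offCol k X j) * linForm (cutRow k X) (offCol k X) j s) *
        evol X (t - s) k k) := by
    intro j hj
    have hjk := Finset.ne_of_mem_erase hj
    rw [evol_off_diag k hjk, ← intervalIntegral.integral_const_mul]
    refine intervalIntegral.integral_congr fun s _ => ?_
    have : starRingEnd ℂ (offCol k X j) = X k j := by
      simp only [offCol, if_neg hjk]; exact hX.apply k j
    simp only [this]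
    ring
  rw [Finset.sum_congr rfl h1, ← intervalIntegral.integral_finsetSum]
  · have h2 : ∀ s, ∑ j ∈ Finset.univ.erase k, Complex.I *
        ((starRingEnd ℂ (offCol k X j) * linForm (cutRow k X) (offCol k X) j s) *
        evol X (t - s) k k) =
        Complex.I * (quadForm (cutRow k X) (offCol k X) s * evol X (t - s) k k) := by
      intro s
      rw [quadForm_eq_sum_linForm, Finset.sum_mul, Finset.mul_sum,
        ← Finset.add_sum_erase _ _ (Finset.mem_univ k)]
      simp [offCol]
    simp_rw [h2]
    rw [intervalIntegral.integral_const_mul, smul_eq_mul, mul_add, ← mul_assoc, ← mul_assoc,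
      Complex.I_mul_I]
    ring
  · intro j _
    apply Continuous.intervalIntegrable
    exact continuous_const.mul ((continuous_const.mul (continuous_linForm _ _ _)).mul
      ((continuous_evol_apply k k).comp (by fun_prop)))

/-- The effect of removing a pair of entries on a diagonal entry of the evolution. -/
theorem norm_evol_sub_evol_cutEntry_le {a : Fin N} (hak : a ≠ k) (hX : X.IsHermitian) {t : ℝ}
    (ht : 0 ≤ t) (i j : Fin N) :
    ‖evol X t i j - evol (cutEntry k a X) t i j‖ ≤ 2 * t * ‖offCol k X a‖ := by
  -- As `a ≠ k`, the two removed positions are distinct and no entry is counted twice.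
  have hD : X - cutEntry k a X =
      Matrix.single k a (X k a) + Matrix.single a k (X a k) := by
    ext i j
    simp only [cutEntry, Matrix.sub_apply, Matrix.of_apply, Matrix.add_apply, Matrix.single_apply]
    by_cases h1 : i = k ∧ j = a
    · obtain ⟨rfl, rfl⟩ := h1
      simp [hak]
    · by_cases h2 : i = a ∧ j = k
      · obtain ⟨rfl, rfl⟩ := h2
        simp [hak.symm]
      · simp only [h1, h2, or_self, if_false, sub_self]
        rw [if_neg (by tauto), if_neg (by tauto), add_zero]
  have hn : ‖X k a‖ = ‖offCol k X a‖ := by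
    rw [offCol, if_neg hak, ← hX.apply k a, RCLike.star_def, RCLike.norm_conj]
  have hn' : ‖X a k‖ = ‖offCol k X a‖ := by rw [offCol, if_neg hak]
  rw [evol_sub_evol]
  have hb : ∀ s ∈ Set.uIoc 0 t, ‖Complex.I * (evol (cutEntry k a X) s * (X - cutEntry k a X) *
      evol X (t - s)) i j‖ ≤ 2 * ‖offCol k X a‖ := by
    intro s _
    have hx := norm_evol_le hX (t - s)
    have hy := norm_evol_le (cutEntry_isHermitian k a hX) s
    rw [norm_mul, Complex.norm_I, one_mul, hD, Matrix.mul_add, Matrix.add_mul, Matrix.add_apply]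
    have e : ∀ (p q : Fin N) (c : ℂ) (A B : Matrix (Fin N) (Fin N) ℂ),
        (A * Matrix.single p q c * B) i j = A i p * c * B q j := by
      intro p q c A B
      rw [Matrix.mul_apply, Finset.sum_eq_single q]
      · simp
      · intro b _ hb
        simp [Matrix.mul_apply, hb.symm]
      · simp
    rw [e, e]
    refine (norm_add_le _ _).trans ?_
    simp only [norm_mul, hn, hn']
    have p : ∀ u v : ℝ, 0 ≤ u → 0 ≤ v → u ≤ 1 → v ≤ 1 →
        u * ‖offCol k X a‖ * v ≤ ‖offCol k X a‖ := by
      intro u v hu hv hu1 hv1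
      calc u * ‖offCol k X a‖ * v ≤ 1 * ‖offCol k X a‖ * 1 := by gcongr
        _ = _ := by ring
    linarith [p _ _ (norm_nonneg _) (norm_nonneg _) (hy i k) (hx a j),
      p _ _ (norm_nonneg _) (norm_nonneg _) (hy i a) (hx k j)]
  refine (intervalIntegral.norm_integral_le_of_norm_le_const hb).trans (le_of_eq ?_)
  rw [sub_zero, abs_of_nonneg ht]; ring

/-- The effect of removing a row and a column on the trace of the evolution. -/
theorem norm_trace_sub_sum_cutRow_le (hX : X.IsHermitian) {t : ℝ} (ht : 0 ≤ t) :
    ‖∑ l, evol X t l l - ∑ l ∈ Finset.univ.erase k, evol (cutRow k X) t l l‖ ≤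
      1 + t * √(∑ a, ‖offCol k X a‖ ^ 2) := by
  set S := √(∑ a, ‖offCol k X a‖ ^ 2) with hS
  rw [← Finset.add_sum_erase _ _ (Finset.mem_univ k), add_sub_assoc, ← Finset.sum_sub_distrib]
  refine (norm_add_le _ _).trans (add_le_add (norm_evol_le hX t k k) ?_)
  rw [Finset.sum_congr rfl fun l hl => evol_sub_evol_cutRow k (Finset.ne_of_mem_erase hl) l t,
    ← intervalIntegral.integral_finsetSum]
  · have hb : ∀ s ∈ Set.uIoc 0 t, ‖∑ l ∈ Finset.univ.erase k, Complex.I *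
        (linForm (cutRow k X) (offCol k X) l s * evol X (t - s) k l)‖ ≤ S := by
      intro s _
      rw [← Finset.mul_sum, norm_mul, Complex.norm_I, one_mul]
      calc ‖∑ l ∈ Finset.univ.erase k,
            linForm (cutRow k X) (offCol k X) l s * evol X (t - s) k l‖
          ≤ ∑ l ∈ Finset.univ.erase k,
            ‖linForm (cutRow k X) (offCol k X) l s‖ * ‖evol X (t - s) k l‖ := by
            refine (norm_sum_le _ _).trans (le_of_eq ?_)
            simp_rw [norm_mul]
        _ ≤ ∑ l, ‖linForm (cutRow k X) (offCol k X) l s‖ * ‖evol X (t - s) k l‖ :=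
            Finset.sum_le_sum_of_subset_of_nonneg (Finset.erase_subset _ _)
              fun _ _ _ => by positivity
        _ ≤ √(∑ l, ‖linForm (cutRow k X) (offCol k X) l s‖ ^ 2) *
              √(∑ l, ‖evol X (t - s) k l‖ ^ 2) := Real.sum_mul_le_sqrt_mul_sqrt _ _ _
        _ = S := by
            rw [sum_norm_sq_linForm (cutRow_isHermitian k hX), sum_norm_sq_evol_row hX]
            simp [hS]
    refine (intervalIntegral.norm_integral_le_of_norm_le_const hb).trans (le_of_eq ?_)
    rw [sub_zero, abs_of_nonneg ht]; ring
  · intro l _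
    apply Continuous.intervalIntegrable
    exact continuous_const.mul ((continuous_linForm _ _ _).mul
      ((continuous_evol_apply k l).comp (by fun_prop)))

end Cut

end Wigner

namespace Wigner

/-! ### Convolution equations with positive definite kernels -/

/-- The Volterra convolution `∫₀ᵗ f(s) g(t - s) ds`. -/
noncomputable def conv (f g : ℝ → ℂ) (t : ℝ) : ℂ := ∫ s in (0 : ℝ)..t, f s * g (t - s)

theorem conv_comm (f g : ℝ → ℂ) (t : ℝ) : conv f g t = conv g f t := by
  have := intervalIntegral.integral_comp_sub_left (a := 0) (b := t)
    (fun s => f s * g (t - s)) t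
  simp only [sub_sub_cancel, sub_zero, sub_self] at this
  rw [conv, ← this, conv]
  exact intervalIntegral.integral_congr fun s _ => mul_comm _ _

theorem continuous_conv {f g : ℝ → ℂ} (hf : Continuous f) (hg : Continuous g) :
    Continuous (conv f g) :=
  intervalIntegral.continuous_parametric_intervalIntegral_of_continuous
    (f := fun t s => f s * g (t - s)) (by fun_prop) continuous_id

theorem intervalIntegrable_conv {f g : ℝ → ℂ} (hf : Continuous f) (hg : Continuous g)
    (t a b : ℝ) : IntervalIntegrable (fun s => f s * g (t - s)) volume a b :=
  (by fun_prop : Continuous fun s => f s * g (t - s)).intervalIntegrable _ _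

theorem conv_add_left {f g h : ℝ → ℂ} (hf : Continuous f) (hg : Continuous g) (hh : Continuous h)
    (t : ℝ) : conv (fun s => f s + g s) h t = conv f h t + conv g h t := by
  simp only [conv]
  rw [← intervalIntegral.integral_add (intervalIntegrable_conv hf hh t _ _)
    (intervalIntegrable_conv hg hh t _ _)]
  exact intervalIntegral.integral_congr fun s _ => add_mul _ _ _

theorem conv_sub_left {f g h : ℝ → ℂ} (hf : Continuous f) (hg : Continuous g) (hh : Continuous h)
    (t : ℝ) : conv (fun s => f s - g s) h t = conv f h t - conv g h t := by
  simp only [conv]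
  rw [← intervalIntegral.integral_sub (intervalIntegrable_conv hf hh t _ _)
    (intervalIntegrable_conv hg hh t _ _)]
  exact intervalIntegral.integral_congr fun s _ => sub_mul _ _ _

theorem conv_sub_right {f g h : ℝ → ℂ} (hf : Continuous f) (hg : Continuous g) (hh : Continuous h)
    (t : ℝ) : conv h (fun s => f s - g s) t = conv h f t - conv h g t := by
  simp only [conv_comm h, conv_sub_left hf hg hh]

theorem conv_const_mul_left (c : ℂ) (f g : ℝ → ℂ) (t : ℝ) :
    conv (fun s => c * f s) g t = c * conv f g t := by
  simp only [conv]
  rw [← intervalIntegral.integral_const_mul]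
  exact intervalIntegral.integral_congr fun s _ => mul_assoc _ _ _

theorem conv_const_mul_right (c : ℂ) (f g : ℝ → ℂ) (t : ℝ) :
    conv f (fun s => c * g s) t = c * conv f g t := by
  rw [conv_comm, conv_const_mul_left, conv_comm]

theorem conv_sum_right {ι : Type*} (s : Finset ι) {f : ℝ → ℂ} {g : ι → ℝ → ℂ} (hf : Continuous f)
    (hg : ∀ i ∈ s, Continuous (g i)) (t : ℝ) :
    conv f (fun r => ∑ i ∈ s, g i r) t = ∑ i ∈ s, conv f (g i) t := by
  simp only [conv, Finset.mul_sum]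
  exact intervalIntegral.integral_finsetSum fun i hi => intervalIntegrable_conv hf (hg i hi) t _ _

theorem norm_conv_le {f g : ℝ → ℂ} (hf : Continuous f) (hg : ∀ s, ‖g s‖ ≤ 1) {t T : ℝ}
    (ht : 0 ≤ t) (htT : t ≤ T) : ‖conv f g t‖ ≤ ∫ s in (0 : ℝ)..T, ‖f s‖ := by
  calc ‖conv f g t‖ ≤ ∫ s in (0 : ℝ)..t, ‖f s‖ := by
        refine intervalIntegral.norm_integral_le_of_norm_le ht (ae_of_all _ fun s _ => ?_)
          (hf.norm.intervalIntegrable _ _)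
        rw [norm_mul]
        exact mul_le_of_le_one_right (norm_nonneg _) (hg _)
    _ ≤ _ := intervalIntegral.integral_mono_interval le_rfl ht htT
        (ae_of_all _ fun s => norm_nonneg _) (hf.norm.intervalIntegrable _ _)

theorem integrableOn_uIoc_prod {F : ℝ × ℝ → ℂ} (hF : Continuous F) (a b c d : ℝ) :
    IntegrableOn F (uIoc a b ×ˢ uIoc c d) :=
  (hF.continuousOn.integrableOn_compact (isCompact_uIcc.prod isCompact_uIcc)).mono_set
    (prod_mono uIoc_subset_uIcc uIoc_subset_uIcc)

/-- Positive definiteness of a continuous kernel, in integrated form. -/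
structure IsPosDef (a : ℝ → ℂ) : Prop where
  cont : Continuous a
  re_nonneg : ∀ z : ℝ → ℂ, Continuous z → ∀ T : ℝ, 0 ≤ T →
    0 ≤ (∫ t in (0 : ℝ)..T, starRingEnd ℂ (z t) * conv a z t).re

namespace IsPosDef

theorem add {a b : ℝ → ℂ} (ha : IsPosDef a) (hb : IsPosDef b) : IsPosDef fun t => a t + b t := by
  refine ⟨ha.cont.add hb.cont, fun z hz T hT => ?_⟩
  have h1 := continuous_conv ha.cont hz
  have h2 := continuous_conv hb.cont hz
  have hc : Continuous fun t => starRingEnd ℂ (z t) := Complex.continuous_conj.comp hz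
  simp only [conv_add_left ha.cont hb.cont hz, mul_add]
  have e := intervalIntegral.integral_add (μ := volume) ((hc.mul h1).intervalIntegrable 0 T)
    ((hc.mul h2).intervalIntegrable 0 T)
  simp only [Pi.mul_apply] at e
  rw [e, Complex.add_re]
  exact add_nonneg (ha.re_nonneg z hz T hT) (hb.re_nonneg z hz T hT)

theorem const_mul {a : ℝ → ℂ} (ha : IsPosDef a) {c : ℝ} (hc : 0 ≤ c) :
    IsPosDef fun t => (c : ℂ) * a t := by
  refine ⟨continuous_const.mul ha.cont, fun z hz T hT => ?_⟩
  simp only [conv_const_mul_left, mul_left_comm _ (c : ℂ)]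
  rw [intervalIntegral.integral_const_mul, Complex.re_ofReal_mul]
  exact mul_nonneg hc (ha.re_nonneg z hz T hT)

theorem zero : IsPosDef fun _ => 0 :=
  ⟨continuous_const, fun z _ T _ => by simp [conv]⟩

theorem sum {ι : Type*} (s : Finset ι) {a : ι → ℝ → ℂ} (ha : ∀ i ∈ s, IsPosDef (a i)) :
    IsPosDef fun t => ∑ i ∈ s, a i t := by
  classical
  induction s using Finset.induction_on with
  | empty => simpa using zero
  | insert j s hj ih =>
    simp only [Finset.sum_insert hj]
    exact (ha j (Finset.mem_insert_self _ _)).add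
      (ih fun i hi => ha i (Finset.mem_insert_of_mem hi))

/-- With `w(t) = ∫₀ᵗ exp(-isx) z(s) ds`, the integrand equals the conjugate of `w'` times `w`. Its
real part is half the derivative of `|w|²`, so the energy is `|w(T)|² / 2`. -/
theorem character (x : ℝ) : IsPosDef fun t => Complex.exp (Complex.I * t * x) := by
  refine ⟨by fun_prop, fun z hz T hT => ?_⟩
  set w : ℝ → ℂ := fun t => ∫ s in (0 : ℝ)..t, Complex.exp (-(Complex.I * s * x)) * z s with hw
  have hi : Continuous fun s : ℝ => Complex.exp (-(Complex.I * s * x)) * z s := by fun_prop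
  have hwd : ∀ t : ℝ, HasDerivAt w (Complex.exp (-(Complex.I * t * x)) * z t) t := fun t =>
    intervalIntegral.integral_hasDerivAt_right (hi.intervalIntegrable _ _)
      hi.stronglyMeasurable.stronglyMeasurableAtFilter hi.continuousAt
  have hwc : Continuous w := continuous_iff_continuousAt.2 fun t => (hwd t).continuousAt
  have e : ∀ t : ℝ, starRingEnd ℂ (z t) * conv (fun t : ℝ => Complex.exp (Complex.I * t * x)) z t =
      starRingEnd ℂ (Complex.exp (-(Complex.I * t * x)) * z t) * w t := by
    intro t
    rw [conv_comm, conv]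
    have : ∀ s : ℝ, z s * Complex.exp (Complex.I * ((t - s : ℝ) : ℂ) * x) =
        Complex.exp (Complex.I * t * x) * (Complex.exp (-(Complex.I * s * x)) * z s) := by
      intro s
      rw [← mul_assoc, ← Complex.exp_add]
      push_cast
      ring_nf
    simp_rw [this]
    rw [intervalIntegral.integral_const_mul, map_mul, ← Complex.exp_conj]
    simp only [map_neg, map_mul, Complex.conj_I, Complex.conj_ofReal, neg_mul, neg_neg]
    ring
  simp_rw [e]
  have hre : ∀ t : ℝ, HasDerivAt (fun t => ‖w t‖ ^ 2)
      (2 * (starRingEnd ℂ (Complex.exp (-(Complex.I * t * x)) * z t) * w t).re) t := fun t => by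
    have := (hwd t).norm_sq
    refine this.congr_deriv ?_
    rw [real_inner_comm, Complex.inner]
    ring_nf
  have hc : Continuous fun t : ℝ => starRingEnd ℂ (Complex.exp (-(Complex.I * t * x)) * z t) * w t :=
    (Complex.continuous_conj.comp hi).mul hwc
  have h1 := intervalIntegral.integral_eq_sub_of_hasDerivAt (a := 0) (b := T) (fun t _ => hre t)
    ((by fun_prop : Continuous fun t : ℝ => 2 * (starRingEnd ℂ (Complex.exp (-(Complex.I * t * x)) *
      z t) * w t).re).intervalIntegrable _ _)
  have hw0 : w 0 = 0 := by simp [hw]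
  rw [hw0, intervalIntegral.integral_const_mul] at h1
  have h2 : (∫ t in (0 : ℝ)..T, starRingEnd ℂ (Complex.exp (-(Complex.I * t * x)) * z t) * w t).re =
      ∫ t in (0 : ℝ)..T, (starRingEnd ℂ (Complex.exp (-(Complex.I * t * x)) * z t) * w t).re := by
    have := Complex.reCLM.intervalIntegral_comp_comm (hc.intervalIntegrable (μ := volume) 0 T)
    simpa using this.symm
  rw [h2]
  have : (0 : ℝ) ≤ ‖w T‖ ^ 2 := by positivity
  simp only [norm_zero, ne_eq, OfNat.ofNat_ne_zero, not_false_eq_true, zero_pow, sub_zero] at h1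
  linarith

/-- Superpositions of characters with a continuous nonnegative density. -/
theorem integral_character {ρ : ℝ → ℝ} (hρ : Continuous ρ) {a b : ℝ} (hab : a ≤ b)
    (h0 : ∀ x ∈ Icc a b, 0 ≤ ρ x) :
    IsPosDef fun t => ∫ x in a..b, Complex.exp (Complex.I * t * x) * ρ x := by
  have hcont : Continuous fun p : ℝ × ℝ => Complex.exp (Complex.I * p.1 * p.2) * (ρ p.2 : ℂ) := by
    fun_prop
  refine ⟨intervalIntegral.continuous_parametric_intervalIntegral_of_continuous hcont
    continuous_const, fun z hz T hT => ?_⟩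
  have h1 : ∀ t, conv (fun t => ∫ x in a..b, Complex.exp (Complex.I * t * x) * ρ x) z t =
      ∫ x in a..b, ρ x * conv (fun t : ℝ => Complex.exp (Complex.I * t * x)) z t := by
    intro t
    simp only [conv]
    simp_rw [← intervalIntegral.integral_mul_const, ← intervalIntegral.integral_const_mul]
    rw [intervalIntegral_intervalIntegral_swap]
    · refine intervalIntegral.integral_congr fun x _ => intervalIntegral.integral_congr fun s _ => ?_
      ring
    · refine integrableOn_uIoc_prod ?_ _ _ _ _
      simp only [Function.uncurry_def]
      fun_prop
  have hjoint : Continuous fun p : ℝ × ℝ =>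
      conv (fun t : ℝ => Complex.exp (Complex.I * t * p.2)) z p.1 := by
    simp only [conv]
    refine intervalIntegral.continuous_parametric_intervalIntegral_of_continuous
      (f := fun (p : ℝ × ℝ) s => Complex.exp (Complex.I * s * p.2) * z (p.1 - s)) ?_ continuous_fst
    fun_prop
  -- By Fubini the energy of the superposition is the integral of the energies of the characters
  -- against the nonnegative density `ρ`.
  have h2 : ∫ t in (0 : ℝ)..T, starRingEnd ℂ (z t) *
      conv (fun t => ∫ x in a..b, Complex.exp (Complex.I * t * x) * ρ x) z t =
      ∫ x in a..b, ρ x * ∫ t in (0 : ℝ)..T, starRingEnd ℂ (z t) *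
        conv (fun t : ℝ => Complex.exp (Complex.I * t * x)) z t := by
    simp_rw [h1, ← intervalIntegral.integral_const_mul]
    rw [intervalIntegral_intervalIntegral_swap]
    · refine intervalIntegral.integral_congr fun x _ => intervalIntegral.integral_congr fun s _ => ?_
      ring
    · refine integrableOn_uIoc_prod ?_ _ _ _ _
      simp only [Function.uncurry_def]
      fun_prop
  rw [h2]
  have hin : Continuous fun x : ℝ => (ρ x : ℂ) * ∫ t in (0 : ℝ)..T, starRingEnd ℂ (z t) *
        conv (fun t : ℝ => Complex.exp (Complex.I * t * x)) z t := by
    refine (Complex.continuous_ofReal.comp hρ).mul ?_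
    refine intervalIntegral.continuous_parametric_intervalIntegral_of_continuous
      (f := fun (x t : ℝ) => starRingEnd ℂ (z t) *
        conv (fun t : ℝ => Complex.exp (Complex.I * t * x)) z t) ?_ continuous_const
    have := hjoint.comp continuous_swap
    simp only [Function.uncurry_def]
    fun_prop
  have h3 := Complex.reCLM.intervalIntegral_comp_comm (hin.intervalIntegrable (μ := volume) a b)
  simp only [Complex.reCLM_apply] at h3
  rw [← h3]
  refine intervalIntegral.integral_nonneg hab fun x hx => ?_
  rw [Complex.re_ofReal_mul]
  exact mul_nonneg (h0 x hx) ((character x).re_nonneg z hz T hT)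

/-- Stability of the equation `δ' = -a * δ + e` for a positive definite kernel `a`. -/
theorem norm_le {a δ δ' : ℝ → ℂ} (ha : IsPosDef a) (h0 : δ 0 = 0) {T M : ℝ} (hT : 0 ≤ T)
    (hδ : ∀ t, HasDerivAt δ (δ' t) t) (hM : ∀ t ∈ Icc 0 T, ‖δ' t + conv a δ t‖ ≤ M) :
    ‖δ T‖ ≤ 2 * M * T := by
  have hc : Continuous δ := continuous_iff_continuousAt.2 fun t => (hδ t).continuousAt
  -- The energy inequality is evaluated at a maximum point `t₀` of `|δ|`, so that one factor of the
  -- maximum `S` can be divided out at the end.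
  obtain ⟨t₀, ht₀, hmax⟩ := isCompact_Icc.exists_isMaxOn ⟨0, left_mem_Icc.2 hT⟩ hc.norm.continuousOn
  set S := ‖δ t₀‖ with hS
  have hM0 : 0 ≤ M := (norm_nonneg _).trans (hM 0 (left_mem_Icc.2 hT))
  have hS0 : 0 ≤ S := norm_nonneg _
  have hconv := continuous_conv ha.cont hc
  have hint : Continuous fun r => starRingEnd ℂ (δ r) * conv a δ r :=
    (Complex.continuous_conj.comp hc).mul hconv
  set W : ℝ → ℂ := fun t => ∫ r in (0 : ℝ)..t, starRingEnd ℂ (δ r) * conv a δ r with hW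
  have hWd : ∀ t, HasDerivAt W (starRingEnd ℂ (δ t) * conv a δ t) t := fun t =>
    intervalIntegral.integral_hasDerivAt_right (hint.intervalIntegrable _ _)
      hint.stronglyMeasurable.stronglyMeasurableAtFilter hint.continuousAt
  -- Multiplying the equation by the conjugate of `δ` shows that `|δ|² + 2 Re W` has derivative at
  -- most `2MS`, so `G` decreases. Positive definiteness gives `Re W ≥ 0` at `t₀`, whence `S² ≤ 2MS
  -- t₀`, with no exponential factor.
  set G : ℝ → ℝ := fun t => ‖δ t‖ ^ 2 + 2 * (W t).re - 2 * (M * S) * t with hG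
  have hGd : ∀ t, HasDerivAt G
      (2 * (starRingEnd ℂ (δ t) * (δ' t + conv a δ t)).re - 2 * (M * S)) t := fun t => by
    have h1 := (hδ t).norm_sq
    have h2 : HasDerivAt (fun t => (W t).re) (starRingEnd ℂ (δ t) * conv a δ t).re t :=
      Complex.reCLM.hasFDerivAt.comp_hasDerivAt t (hWd t)
    have h3 := (h1.add (h2.const_mul 2)).sub ((hasDerivAt_id t).const_mul (2 * (M * S)))
    refine h3.congr_deriv ?_
    rw [Complex.inner, mul_add, Complex.add_re]
    ring_nf
  have hanti : AntitoneOn G (Icc 0 T) := by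
    refine antitoneOn_of_deriv_nonpos (convex_Icc _ _)
      (fun t _ => (hGd t).continuousAt.continuousWithinAt)
      (fun t _ => (hGd t).differentiableAt.differentiableWithinAt) fun t ht => ?_
    rw [interior_Icc] at ht
    have ht' := Ioo_subset_Icc_self ht
    rw [(hGd t).deriv]
    have h1 : (starRingEnd ℂ (δ t) * (δ' t + conv a δ t)).re ≤ M * S := by
      refine (Complex.re_le_norm _).trans ?_
      rw [norm_mul, RCLike.norm_conj, mul_comm]
      exact mul_le_mul (hM t ht') (hmax ht') (norm_nonneg _) hM0
    linarith
  have h := hanti (left_mem_Icc.2 hT) ht₀ ht₀.1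
  have hG0 : G 0 = 0 := by simp [hG, hW, h0]
  rw [hG0] at h
  have hpos := ha.re_nonneg δ hc t₀ ht₀.1
  have h2 : S ^ 2 ≤ 2 * (M * S) * t₀ := by
    simp only [hG] at h
    simp only [hW] at h
    linarith
  have h3 : S ≤ 2 * M * t₀ := by
    rcases hS0.eq_or_lt with h4 | h4
    · rw [← h4]; have := ht₀.1; positivity
    · nlinarith
  calc ‖δ T‖ ≤ S := hmax (right_mem_Icc.2 hT)
    _ ≤ 2 * M * t₀ := h3
    _ ≤ 2 * M * T := by have := ht₀.2; gcongr

end IsPosDef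

end Wigner

namespace Wigner

/-! ### The characteristic function of the semicircle distribution -/

/-- The density of the semicircle distribution. -/
noncomputable def scDensity (σ x : ℝ) : ℝ := 1 / (2 * Real.pi * σ ^ 2) * √(4 * σ ^ 2 - x ^ 2)

/-- The characteristic function of the semicircle distribution. -/
noncomputable def scChar (σ t : ℝ) : ℂ :=
  ∫ x in (-2 * σ)..(2 * σ), Complex.exp (Complex.I * t * x) * scDensity σ x

/-- The moments of the semicircle distribution. -/
noncomputable def scMoment (σ : ℝ) (n : ℕ) : ℝ := ∫ x in (-2 * σ)..(2 * σ), x ^ n * scDensity σ x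

theorem continuous_scDensity (σ : ℝ) : Continuous (scDensity σ) := by
  unfold scDensity; fun_prop

theorem scDensity_nonneg (σ x : ℝ) : 0 ≤ scDensity σ x := by unfold scDensity; positivity

theorem isPosDef_scChar {σ : ℝ} (hσ : 0 < σ) : IsPosDef (scChar σ) :=
  IsPosDef.integral_character (continuous_scDensity σ) (by linarith)
    fun x _ => scDensity_nonneg σ x

/-- The substitution `x = 2σu` reduces the total mass to the area of a half disc. -/
theorem scMoment_zero {σ : ℝ} (hσ : 0 < σ) : scMoment σ 0 = 1 := by
  have h := intervalIntegral.integral_comp_div (a := -2 * σ) (b := 2 * σ)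
    (fun x => √(1 - x ^ 2)) (c := 2 * σ) (by positivity)
  rw [show -2 * σ / (2 * σ) = -1 by field_simp, show 2 * σ / (2 * σ) = 1 by field_simp,
    integral_sqrt_one_sub_sq] at h
  have e : ∀ x, x ^ 0 * scDensity σ x =
      1 / (Real.pi * σ) * √(1 - (x / (2 * σ)) ^ 2) := by
    intro x
    rw [scDensity, show 4 * σ ^ 2 - x ^ 2 = (2 * σ) ^ 2 * (1 - (x / (2 * σ)) ^ 2) by field_simp; ring,
      Real.sqrt_mul (by positivity), Real.sqrt_sq (by positivity)]
    field_simp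
  rw [scMoment]
  simp_rw [e]
  rw [intervalIntegral.integral_const_mul, h]
  simp
  field_simp

/-- The function `x^(n+1) (4σ² - x²)^(3/2)` vanishes at both endpoints; integrating its derivative
over the support gives the relation. -/
theorem scMoment_recurrence {σ : ℝ} (hσ : 0 < σ) (n : ℕ) :
    (n + 4) * scMoment σ (n + 2) = 4 * σ ^ 2 * (n + 1) * scMoment σ n := by
  have hd : ∀ x ∈ Ioo (-2 * σ) (2 * σ),
      HasDerivAt (fun x => x ^ (n + 1) * ((4 * σ ^ 2 - x ^ 2) * √(4 * σ ^ 2 - x ^ 2)))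
        (4 * σ ^ 2 * (n + 1) * (x ^ n * √(4 * σ ^ 2 - x ^ 2)) -
          (n + 4) * (x ^ (n + 2) * √(4 * σ ^ 2 - x ^ 2))) x := by
    intro x hx
    have hp : 0 < 4 * σ ^ 2 - x ^ 2 := by nlinarith [hx.1, hx.2]
    have h1 : HasDerivAt (fun x => 4 * σ ^ 2 - x ^ 2) (-(2 * x)) x := by
      simpa using! (hasDerivAt_pow 2 x).const_sub (4 * σ ^ 2)
    have h2 := h1.sqrt hp.ne'
    have h3 := (hasDerivAt_pow (n + 1) x).mul (h1.mul h2)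
    refine h3.congr_deriv ?_
    simp only [Nat.add_sub_cancel, Pi.mul_apply]
    have hs : √(4 * σ ^ 2 - x ^ 2) ≠ 0 := (Real.sqrt_pos.2 hp).ne'
    have hs2 : √(4 * σ ^ 2 - x ^ 2) ^ 2 = 4 * σ ^ 2 - x ^ 2 := Real.sq_sqrt hp.le
    generalize √(4 * σ ^ 2 - x ^ 2) = r at hs hs2 ⊢
    have : 4 * σ ^ 2 = r ^ 2 + x ^ 2 := by rw [hs2]; ring
    rw [this]
    push_cast
    field_simp
    ring
  have hc : Continuous fun x : ℝ => x ^ (n + 1) * ((4 * σ ^ 2 - x ^ 2) * √(4 * σ ^ 2 - x ^ 2)) := by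
    fun_prop
  have hi : ∀ m : ℕ, IntervalIntegrable (fun x : ℝ => x ^ m * √(4 * σ ^ 2 - x ^ 2)) volume
      (-2 * σ) (2 * σ) := fun m => (by fun_prop : Continuous _).intervalIntegrable _ _
  have h := intervalIntegral.integral_eq_sub_of_hasDerivAt_of_le (by linarith) hc.continuousOn hd
    (((hi n).const_mul _).sub ((hi (n + 2)).const_mul _))
  rw [intervalIntegral.integral_sub ((hi n).const_mul _) ((hi (n + 2)).const_mul _),
    intervalIntegral.integral_const_mul, intervalIntegral.integral_const_mul] at h
  have z1 : 4 * σ ^ 2 - (2 * σ) ^ 2 = 0 := by ring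
  have z2 : 4 * σ ^ 2 - (-2 * σ) ^ 2 = 0 := by ring
  rw [z1, z2] at h
  simp only [Real.sqrt_zero, mul_zero, sub_zero] at h
  have e : ∀ m : ℕ, scMoment σ m = 1 / (2 * Real.pi * σ ^ 2) *
      ∫ x in (-2 * σ)..(2 * σ), x ^ m * √(4 * σ ^ 2 - x ^ 2) := by
    intro m
    rw [scMoment, ← intervalIntegral.integral_const_mul]
    refine intervalIntegral.integral_congr fun x _ => ?_
    simp only [scDensity]; ring
  rw [e, e]
  linear_combination (-(1 / (2 * Real.pi * σ ^ 2))) * h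

theorem scMoment_odd (σ : ℝ) (n : ℕ) : scMoment σ (2 * n + 1) = 0 := by
  have h := intervalIntegral.integral_comp_neg (a := -2 * σ) (b := 2 * σ)
    (fun x => x ^ (2 * n + 1) * scDensity σ x)
  have e : ∀ x, (-x) ^ (2 * n + 1) * scDensity σ (-x) = -(x ^ (2 * n + 1) * scDensity σ x) := by
    intro x
    rw [Odd.neg_pow ⟨n, rfl⟩, scDensity, scDensity, neg_sq]; ring
  simp_rw [e] at h
  rw [intervalIntegral.integral_neg, show -(2 * σ) = -2 * σ by ring,
    show -(-2 * σ) = 2 * σ by ring] at h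
  rw [scMoment]
  linarith

theorem scMoment_even {σ : ℝ} (hσ : 0 < σ) (n : ℕ) :
    scMoment σ (2 * n) = σ ^ (2 * n) * catalan n := by
  induction n with
  | zero => simp [scMoment_zero hσ]
  | succ n ih =>
    have h := scMoment_recurrence hσ (2 * n)
    rw [ih] at h
    -- The Catalan numbers satisfy the same two-term recurrence, through their expression by central
    -- binomial coefficients.
    have hc : ((n : ℝ) + 2) * catalan (n + 1) = 2 * (2 * n + 1) * catalan n := by
      have h1 := succ_mul_catalan_eq_centralBinom n
      have h2 := succ_mul_catalan_eq_centralBinom (n + 1)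
      have h3 := Nat.succ_mul_centralBinom_succ n
      have h4 : (n + 1) * ((n + 1 + 1) * catalan (n + 1)) =
          (n + 1) * (2 * (2 * n + 1) * catalan n) := by
        rw [h2, h3, ← h1]; ring
      have h5 := Nat.eq_of_mul_eq_mul_left (Nat.succ_pos n) h4
      have h6 : ((n + 1 + 1 : ℕ) : ℝ) * (catalan (n + 1) : ℝ) =
        ((2 * (2 * n + 1) : ℕ) : ℝ) * (catalan n : ℝ) := by exact_mod_cast h5
      push_cast at h6
      linarith
    have hne : (2 * (n : ℝ) + 4) ≠ 0 := by positivity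
    rw [show 2 * (n + 1) = 2 * n + 2 by ring]
    push_cast at h
    apply mul_left_cancel₀ hne
    rw [h]
    rw [show 2 * n + 2 = 2 * n + 1 + 1 by ring, pow_succ, pow_succ]
    linear_combination (-2 * σ ^ (2 * n) * σ ^ 2) * hc

/-- Segner's recursion for the Catalan numbers, with odd moments equal to zero. In terms of power
series coefficients this is the quadratic Volterra equation of the characteristic function. -/
theorem scMoment_succ {σ : ℝ} (hσ : 0 < σ) (n : ℕ) :
    scMoment σ (n + 2) = σ ^ 2 * ∑ p ∈ Finset.HasAntidiagonal.antidiagonal n, scMoment σ p.1 * scMoment σ p.2 := by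
  rcases Nat.even_or_odd' n with ⟨m, rfl | rfl⟩
  · have e : ∑ p ∈ Finset.HasAntidiagonal.antidiagonal (2 * m), scMoment σ p.1 * scMoment σ p.2 =
        ∑ p ∈ Finset.HasAntidiagonal.antidiagonal m, scMoment σ (2 * p.1) * scMoment σ (2 * p.2) := by
      symm
      refine Finset.sum_of_injOn (fun p => (2 * p.1, 2 * p.2)) ?_ ?_ ?_ ?_
      · rintro ⟨a, b⟩ _ ⟨c, d⟩ _ h
        simp only [Prod.mk.injEq] at h ⊢
        omega
      · rintro ⟨a, b⟩ h
        simp only [Finset.mem_coe, Finset.HasAntidiagonal.mem_antidiagonal] at h ⊢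
        omega
      · rintro ⟨a, b⟩ h h2
        rcases Nat.even_or_odd' a with ⟨c, rfl | rfl⟩
        · exfalso
          rw [Finset.HasAntidiagonal.mem_antidiagonal] at h
          simp only at h
          apply h2
          refine ⟨(c, m - c), ?_, ?_⟩
          · simp only [Finset.mem_coe, Finset.HasAntidiagonal.mem_antidiagonal]
            omega
          · simp only [Prod.mk.injEq, true_and]; omega
        · simp [scMoment_odd]
      · intro p _; rfl
    rw [e, show 2 * m + 2 = 2 * (m + 1) by ring, scMoment_even hσ, catalan_succ', Nat.cast_sum,
      Finset.mul_sum, Finset.mul_sum]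
    refine Finset.sum_congr rfl fun p hp => ?_
    rw [Finset.HasAntidiagonal.mem_antidiagonal] at hp
    rw [scMoment_even hσ, scMoment_even hσ, ← hp]
    push_cast
    ring
  · rw [show 2 * m + 1 + 2 = 2 * (m + 1) + 1 by ring, scMoment_odd]
    symm
    rw [mul_eq_zero]
    right
    refine Finset.sum_eq_zero ?_
    rintro ⟨a, b⟩ h
    rw [Finset.HasAntidiagonal.mem_antidiagonal] at h
    simp only at h ⊢
    rcases Nat.even_or_odd' a with ⟨c, rfl | rfl⟩
    · have : b = 2 * (m - c) + 1 := by omega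
      rw [this, scMoment_odd, mul_zero]
    · rw [scMoment_odd, zero_mul]

theorem scMoment_one (σ : ℝ) : scMoment σ 1 = 0 := scMoment_odd σ 0

theorem norm_scMoment_le {σ : ℝ} (hσ : 0 < σ) (n : ℕ) : |scMoment σ n| ≤ (2 * σ) ^ n := by
  rw [scMoment, ← Real.norm_eq_abs]
  have h2 : ∫ x in (-2 * σ)..(2 * σ), (2 * σ) ^ n * scDensity σ x = (2 * σ) ^ n := by
    rw [intervalIntegral.integral_const_mul]
    have := scMoment_zero hσ
    simp only [scMoment, pow_zero, one_mul] at this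
    rw [this, mul_one]
  refine (intervalIntegral.norm_integral_le_of_norm_le (by linarith) (ae_of_all _ fun x hx => ?_)
    ((continuous_const.mul (continuous_scDensity σ)).intervalIntegrable _ _)).trans h2.le
  rw [norm_mul, norm_pow, Real.norm_of_nonneg (scDensity_nonneg σ x)]
  have hx2 : ‖x‖ ≤ 2 * σ := abs_le.2 ⟨by linarith [hx.1], hx.2⟩
  exact mul_le_mul_of_nonneg_right (pow_le_pow_left₀ (norm_nonneg _) hx2 n) (scDensity_nonneg σ x)

theorem norm_scChar_le {σ : ℝ} (hσ : 0 < σ) (t : ℝ) : ‖scChar σ t‖ ≤ 1 := by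
  have h2 : ∫ x in (-2 * σ)..(2 * σ), scDensity σ x = 1 := by
    simpa [scMoment] using scMoment_zero hσ
  refine (intervalIntegral.norm_integral_le_of_norm_le (by linarith) (ae_of_all _ fun x hx => ?_)
    ((continuous_scDensity σ).intervalIntegrable _ _)).trans h2.le
  rw [norm_mul, Complex.norm_real, Real.norm_of_nonneg (scDensity_nonneg σ x),
    show Complex.I * (t : ℂ) * x = ((t * x : ℝ) : ℂ) * Complex.I by push_cast; ring,
    Complex.norm_exp_ofReal_mul_I, one_mul]

theorem scChar_zero {σ : ℝ} (hσ : 0 < σ) : scChar σ 0 = 1 := by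
  have h2 : ∫ x in (-2 * σ)..(2 * σ), scDensity σ x = 1 := by
    simpa [scMoment] using scMoment_zero hσ
  simp only [scChar, Complex.ofReal_zero, mul_zero, zero_mul, Complex.exp_zero, one_mul]
  rw [intervalIntegral.integral_ofReal, h2, Complex.ofReal_one]

theorem scChar_neg (σ t : ℝ) : scChar σ (-t) = starRingEnd ℂ (scChar σ t) := by
  have h : starRingEnd ℂ (scChar σ t) = ∫ x in (-2 * σ)..(2 * σ),
      starRingEnd ℂ (Complex.exp (Complex.I * t * x) * scDensity σ x) := by
    simp only [scChar, intervalIntegral, map_sub, ← integral_conj]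
  rw [h, scChar]
  refine intervalIntegral.integral_congr fun x _ => ?_
  simp only [map_mul, Complex.conj_ofReal, ← Complex.exp_conj, Complex.conj_I]
  push_cast
  ring_nf

/-- The expansion of a Fourier–Laplace integral in moments. -/
theorem hasSum_scMoment {σ : ℝ} (hσ : 0 < σ) (m : ℕ) (t : ℝ) :
    HasSum (fun n : ℕ => Complex.I ^ n * scMoment σ (n + m) / n.factorial * (t : ℂ) ^ n)
      (∫ x in (-2 * σ)..(2 * σ), (x : ℂ) ^ m * Complex.exp (Complex.I * t * x) * scDensity σ x) := by
  have hb : ∀ n : ℕ, ∀ x : ℝ, x ∈ uIoc (-2 * σ) (2 * σ) →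
      ‖(x : ℂ) ^ m * ((Complex.I * t * x) ^ n / n.factorial) * scDensity σ x‖ ≤
        (2 * σ) ^ m * ((2 * σ * |t|) ^ n / n.factorial) * (1 / (2 * Real.pi * σ ^ 2) * (2 * σ)) := by
    intro n x hx
    rw [uIoc_of_le (by linarith)] at hx
    have hx2 : |x| ≤ 2 * σ := abs_le.2 ⟨by linarith [hx.1], hx.2⟩
    have hd : scDensity σ x ≤ 1 / (2 * Real.pi * σ ^ 2) * (2 * σ) := by
      unfold scDensity
      gcongr
      exact Real.sqrt_le_iff.2 ⟨by positivity, by nlinarith⟩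
    simp only [norm_mul, norm_pow, norm_div, Complex.norm_real, Complex.norm_I, one_mul,
      Complex.norm_natCast, Real.norm_eq_abs, abs_of_nonneg (scDensity_nonneg σ x)]
    have := scDensity_nonneg σ x
    rw [mul_comm |t|]
    gcongr
  have hs := intervalIntegral.hasSum_integral_of_dominated_convergence
    (F := fun (n : ℕ) (x : ℝ) => (x : ℂ) ^ m * ((Complex.I * t * x) ^ n / n.factorial) * scDensity σ x)
    (f := fun x : ℝ => (x : ℂ) ^ m * Complex.exp (Complex.I * t * x) * scDensity σ x)
    (a := -2 * σ) (b := 2 * σ) (μ := volume)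
    (fun (n : ℕ) _ => (2 * σ) ^ m * ((2 * σ * |t|) ^ n / n.factorial) *
      (1 / (2 * Real.pi * σ ^ 2) * (2 * σ)))
    (fun n => by
      have := continuous_scDensity σ
      exact (by fun_prop : Continuous _).aestronglyMeasurable)
    (fun n => ae_of_all _ fun x hx => hb n x hx)
    (ae_of_all _ fun x _ => ((Real.summable_pow_div_factorial _).mul_left _).mul_right _)
    (by simp)
    (ae_of_all _ fun x _ => by
      have : HasSum (fun n : ℕ => (Complex.I * t * x) ^ n / n.factorial)
          (Complex.exp (Complex.I * t * x)) := by
        rw [Complex.exp_eq_exp_ℂ]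
        exact NormedSpace.expSeries_div_hasSum_exp _
      exact (this.mul_left _).mul_right _)
  refine Eq.subst (motive := fun f => HasSum f _) (funext fun n => ?_) hs
  symm
  have e : ∀ x : ℝ, (x : ℂ) ^ m * ((Complex.I * t * x) ^ n / n.factorial) * scDensity σ x =
      (Complex.I ^ n / n.factorial * (t : ℂ) ^ n) * ((x ^ (n + m) * scDensity σ x : ℝ) : ℂ) := by
    intro x; push_cast; ring
  simp_rw [e]
  rw [intervalIntegral.integral_const_mul, intervalIntegral.integral_ofReal, scMoment]
  ring

theorem hasDerivAt_scChar (σ t : ℝ) : HasDerivAt (scChar σ)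
    (∫ x in (-2 * σ)..(2 * σ), Complex.I * x * Complex.exp (Complex.I * t * x) * scDensity σ x) t := by
  have hρ := continuous_scDensity σ
  refine (intervalIntegral.hasDerivAt_integral_of_dominated_loc_of_deriv_le
    (F := fun (t x : ℝ) => Complex.exp (Complex.I * t * x) * scDensity σ x)
    (bound := fun x => |x| * scDensity σ x) Filter.univ_mem
    (Filter.Eventually.of_forall fun t => (by fun_prop : Continuous _).aestronglyMeasurable)
    ((by fun_prop : Continuous fun x : ℝ => Complex.exp (Complex.I * t * x) *
      scDensity σ x).intervalIntegrable _ _)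
    (F' := fun (t x : ℝ) => Complex.I * x * Complex.exp (Complex.I * t * x) * scDensity σ x)
    (by fun_prop : Continuous fun x : ℝ => Complex.I * x * Complex.exp (Complex.I * t * x) *
      scDensity σ x).aestronglyMeasurable
    (ae_of_all _ fun x _ t _ => ?_) ((by fun_prop : Continuous fun x : ℝ =>
      |x| * scDensity σ x).intervalIntegrable _ _)
    (ae_of_all _ fun x _ t _ => ?_)).2
  · rw [norm_mul, norm_mul, norm_mul, Complex.norm_I, Complex.norm_real, Complex.norm_real,
      Real.norm_of_nonneg (scDensity_nonneg σ x),
      show Complex.I * (t : ℂ) * x = ((t * x : ℝ) : ℂ) * Complex.I by push_cast; ring,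
      Complex.norm_exp_ofReal_mul_I, one_mul, mul_one, Real.norm_eq_abs]
  · have h1 : HasDerivAt (fun t : ℝ => Complex.I * (t : ℂ) * x) (Complex.I * x) t := by
      simpa using! ((hasDerivAt_id t).ofReal_comp.const_mul Complex.I).mul_const (x : ℂ)
    refine (h1.cexp.mul_const _).congr_deriv ?_
    ring

/-- The Beta integral. One integration by parts passes from exponents `(p, q + 1)` to `(p + 1, q)`,
so the induction on `q` needs `p` to vary. -/
theorem integral_pow_mul_sub_pow (p q : ℕ) (t : ℝ) :
    ∫ s in (0 : ℝ)..t, s ^ p * (t - s) ^ q =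
      p.factorial * q.factorial / (p + q + 1).factorial * t ^ (p + q + 1) := by
  induction q generalizing p with
  | zero =>
    simp only [pow_zero, mul_one, integral_pow, Nat.factorial_zero, add_zero, Nat.factorial_succ]
    have := Nat.factorial_pos p
    push_cast
    field_simp
    ring
  | succ q ih =>
    have hd : ∀ s ∈ uIcc 0 t, HasDerivAt (fun s => s ^ (p + 1) * (t - s) ^ (q + 1))
        ((p + 1) * (s ^ p * (t - s) ^ (q + 1)) - (q + 1) * (s ^ (p + 1) * (t - s) ^ q)) s := by
      intro s _
      have h1 := (hasDerivAt_pow (p + 1) s).mul (((hasDerivAt_id s).const_sub t).pow (q + 1))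
      refine h1.congr_deriv ?_
      simp
      ring
    have hi : ∀ a b : ℕ, IntervalIntegrable (fun s => s ^ a * (t - s) ^ b) volume 0 t :=
      fun a b => (by fun_prop : Continuous _).intervalIntegrable _ _
    have h := intervalIntegral.integral_eq_sub_of_hasDerivAt hd
      (((hi _ _).const_mul _).sub ((hi _ _).const_mul _))
    rw [intervalIntegral.integral_sub ((hi _ _).const_mul _) ((hi _ _).const_mul _),
      intervalIntegral.integral_const_mul, intervalIntegral.integral_const_mul, ih] at h
    have hp : ((p : ℝ) + 1) ≠ 0 := by positivity
    apply mul_left_cancel₀ hp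
    simp only [sub_self, ne_eq, Nat.add_eq_zero_iff, one_ne_zero, and_false, not_false_eq_true,
      zero_pow, mul_zero, zero_mul] at h
    rw [sub_eq_zero.1 h, show p + (q + 1) + 1 = p + 1 + q + 1 by ring, Nat.factorial_succ p,
      Nat.factorial_succ q]
    push_cast
    ring

/-- The quadratic Volterra equation of the semicircle distribution. -/
theorem hasDerivAt_scChar_conv {σ : ℝ} (hσ : 0 < σ) (t : ℝ) :
    HasDerivAt (scChar σ) (-((σ ^ 2 : ℝ) * conv (scChar σ) (scChar σ) t)) t := by
  refine (hasDerivAt_scChar σ t).congr_deriv ?_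
  set a : ℕ → ℂ := fun n => Complex.I ^ n * scMoment σ n / n.factorial with ha
  have hφ : ∀ s : ℝ, HasSum (fun n => a n * (s : ℂ) ^ n) (scChar σ s) := fun s => by
    simpa [scChar] using hasSum_scMoment hσ 0 s
  have hna : ∀ n, ‖a n‖ ≤ (2 * σ) ^ n / n.factorial := fun n => by
    simp only [ha, norm_div, norm_mul, norm_pow, Complex.norm_I, one_pow, one_mul,
      Complex.norm_real, Complex.norm_natCast, Real.norm_eq_abs]
    gcongr
    exact norm_scMoment_le hσ n
  have hsum : ∀ r : ℝ, 0 ≤ r → Summable fun n => ‖a n‖ * r ^ n := fun r hr => by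
    refine Summable.of_nonneg_of_le (fun n => by positivity) (fun n => ?_)
      (Real.summable_pow_div_factorial (2 * σ * r))
    rw [mul_pow, mul_div_right_comm]
    gcongr
    exact hna n
  -- Cauchy product of the two absolutely convergent series under the convolution integral.
  have hprod : ∀ s : ℝ, HasSum (fun n => ∑ p ∈ Finset.HasAntidiagonal.antidiagonal n,
      a p.1 * (s : ℂ) ^ p.1 * (a p.2 * ((t - s : ℝ) : ℂ) ^ p.2)) (scChar σ s * scChar σ (t - s)) := by
    intro s
    have s1 : ∀ r : ℝ, Summable fun n => ‖a n * (r : ℂ) ^ n‖ := fun r => by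
      simpa using hsum |r| (abs_nonneg r)
    have := (summable_norm_sum_mul_antidiagonal_of_summable_norm (s1 s) (s1 (t - s))).of_norm.hasSum
    rwa [← tsum_mul_tsum_eq_tsum_sum_antidiagonal_of_summable_norm (s1 s) (s1 (t - s)),
      (hφ s).tsum_eq, (hφ (t - s)).tsum_eq] at this
  have hconv := intervalIntegral.hasSum_integral_of_dominated_convergence
    (F := fun (n : ℕ) (s : ℝ) => ∑ p ∈ Finset.HasAntidiagonal.antidiagonal n,
      a p.1 * (s : ℂ) ^ p.1 * (a p.2 * ((t - s : ℝ) : ℂ) ^ p.2))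
    (f := fun s => scChar σ s * scChar σ (t - s)) (a := 0) (b := t) (μ := volume)
    (fun (n : ℕ) _ => ∑ p ∈ Finset.HasAntidiagonal.antidiagonal n,
      ‖a p.1‖ * |t| ^ p.1 * (‖a p.2‖ * |t| ^ p.2))
    (fun n => (by fun_prop : Continuous _).aestronglyMeasurable)
    (fun n => ae_of_all _ fun s hs => by
      refine (norm_sum_le _ _).trans (Finset.sum_le_sum fun p _ => ?_)
      have h1 : |s| ≤ |t| := by
        rcases le_total 0 t with h | h
        · rw [uIoc_of_le h] at hs; rw [abs_of_nonneg hs.1.le, abs_of_nonneg h]; exact hs.2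
        · rw [uIoc_of_ge h] at hs; rw [abs_of_nonpos hs.2, abs_of_nonpos h]; linarith [hs.1]
      have h2 : |t - s| ≤ |t| := by
        rcases le_total 0 t with h | h
        · rw [uIoc_of_le h] at hs; rw [abs_of_nonneg (by linarith [hs.2]), abs_of_nonneg h]
          linarith [hs.1]
        · rw [uIoc_of_ge h] at hs; rw [abs_of_nonpos (by linarith [hs.1]), abs_of_nonpos h]
          linarith [hs.2]
      simp only [norm_mul, norm_pow, Complex.norm_real, Real.norm_eq_abs]
      gcongr)
    (ae_of_all _ fun s _ => by
      have s1 := hsum |t| (abs_nonneg t)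
      have s2 : Summable fun n => ‖‖a n‖ * |t| ^ n‖ := by simpa using s1
      exact (summable_norm_sum_mul_antidiagonal_of_summable_norm s2 s2).of_norm)
    (by simp)
    (ae_of_all _ fun s _ => hprod s)
  -- The factorials of the Beta integral cancel those of the exponential series, and the plain
  -- convolution of moments remains.
  have hI : ∀ n, ∫ s in (0 : ℝ)..t, ∑ p ∈ Finset.HasAntidiagonal.antidiagonal n,
      a p.1 * (s : ℂ) ^ p.1 * (a p.2 * ((t - s : ℝ) : ℂ) ^ p.2) =
      Complex.I ^ n * (∑ p ∈ Finset.HasAntidiagonal.antidiagonal n,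
        scMoment σ p.1 * scMoment σ p.2 : ℝ) / (n + 1).factorial * (t : ℂ) ^ (n + 1) := by
    intro n
    rw [intervalIntegral.integral_finsetSum fun p _ =>
      (by fun_prop : Continuous _).intervalIntegrable _ _]
    rw [Complex.ofReal_sum, Finset.mul_sum, Finset.sum_div, Finset.sum_mul]
    refine Finset.sum_congr rfl fun p hp => ?_
    rw [Finset.HasAntidiagonal.mem_antidiagonal] at hp
    have e : ∀ s : ℝ, a p.1 * (s : ℂ) ^ p.1 * (a p.2 * ((t - s : ℝ) : ℂ) ^ p.2) =
        a p.1 * a p.2 * ((s ^ p.1 * (t - s) ^ p.2 : ℝ) : ℂ) := by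
      intro s; push_cast; ring
    simp_rw [e]
    rw [intervalIntegral.integral_const_mul, intervalIntegral.integral_ofReal,
      integral_pow_mul_sub_pow, ← hp, pow_add Complex.I]
    have h1 : (p.1.factorial : ℂ) ≠ 0 := by exact_mod_cast p.1.factorial_ne_zero
    have h2 : (p.2.factorial : ℂ) ≠ 0 := by exact_mod_cast p.2.factorial_ne_zero
    have h3 : ((p.1 + p.2 + 1).factorial : ℂ) ≠ 0 := by exact_mod_cast Nat.factorial_ne_zero _
    simp only [ha]
    push_cast
    field_simp
  simp_rw [hI] at hconv
  have hder := (hasSum_scMoment hσ 1 t).mul_left Complex.I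
  rw [← intervalIntegral.integral_const_mul] at hder
  have e1 : (∫ x in (-2 * σ)..(2 * σ), Complex.I * ((x : ℂ) ^ 1 * Complex.exp (Complex.I * t * x) *
      scDensity σ x)) = ∫ x in (-2 * σ)..(2 * σ),
        Complex.I * x * Complex.exp (Complex.I * t * x) * scDensity σ x :=
    intervalIntegral.integral_congr fun x _ => by ring
  rw [e1] at hder
  -- The first moment vanishes, so the series of the derivative starts in degree one, as the series
  -- of the convolution does. After this shift the coefficients match by `scMoment_succ`.
  have hder' := (hasSum_nat_add_iff' 1).2 hder
  simp only [Finset.sum_range_one, zero_add, scMoment_one, Complex.ofReal_zero, mul_zero, zero_div,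
    zero_mul, sub_zero] at hder'
  have hconv' := (hconv.mul_left ((σ ^ 2 : ℝ) : ℂ)).neg
  refine hder'.unique (Eq.subst (motive := fun f => HasSum f _) (funext fun n => ?_) hconv')
  symm
  rw [show n + 1 + 1 = n + 2 by ring, scMoment_succ hσ]
  have : Complex.I * (Complex.I ^ (n + 1)) = -Complex.I ^ n := by
    rw [pow_succ, mul_left_comm, Complex.I_mul_I]; ring
  push_cast
  rw [← mul_assoc, mul_div_assoc', ← mul_assoc, this]
  ring

end Wigner

namespace Wigner

/-! ### Linear and quadratic forms in independent centred variables -/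

/-- A vector of independent centred complex random variables whose second and fourth moments are
bounded by `κ²` and `κ⁴`. -/
structure CenteredVec {Ω : Type*} [MeasurableSpace Ω] (P : Measure Ω) {N : ℕ}
    (x : Ω → Fin N → ℂ) (κ : ℝ) : Prop where
  meas : Measurable x
  indep : ∀ a, IndepFun (fun ω => x ω a) (fun ω => Function.update (x ω) a 0) P
  mean : ∀ a, ∫ ω, x ω a ∂P = 0
  second : ∀ a, L2Bound P (fun ω => x ω a) κ
  fourth : ∀ a, L2Bound P (fun ω => x ω a * starRingEnd ℂ (x ω a)) (κ ^ 2)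

/-- The quadratic form `x* A x`. -/
noncomputable def quad {N : ℕ} (A : Matrix (Fin N) (Fin N) ℂ) (x : Fin N → ℂ) : ℂ :=
  ∑ a, ∑ b, starRingEnd ℂ (x a) * A a b * x b

namespace CenteredVec

variable {Ω : Type*} [MeasurableSpace Ω] {P : Measure Ω} {N : ℕ}
  {x : Ω → Fin N → ℂ} {κ : ℝ}

theorem meas_apply (hx : CenteredVec P x κ) (a : Fin N) : Measurable fun ω => x ω a :=
  (measurable_pi_apply a).comp hx.meas

/-- A function that does not notice when coordinate `a` is set to zero depends on the other
coordinates only. This is how independence is checked for all linear and quadratic forms below. -/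
theorem indep_comp (hx : CenteredVec P x κ) (a : Fin N) {E F : Type*} [MeasurableSpace E]
    [MeasurableSpace F] {y : ℂ → E} (hy : Measurable y) {G : (Fin N → ℂ) → F} (hG : Measurable G)
    (hGa : ∀ v, G (Function.update v a 0) = G v) :
    IndepFun (fun ω => y (x ω a)) (fun ω => G (x ω)) P := by
  have := (hx.indep a).comp hy hG
  simpa only [Function.comp_def, hGa] using this

theorem integral_mul_eq_zero (hx : CenteredVec P x κ) (a : Fin N) {y : ℂ → ℂ} (hy : Measurable y)
    (hy0 : ∫ ω, y (x ω a) ∂P = 0) {G : (Fin N → ℂ) → ℂ} (hG : Measurable G)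
    (hGa : ∀ v, G (Function.update v a 0) = G v) : ∫ ω, y (x ω a) * G (x ω) ∂P = 0 := by
  rw [(hx.indep_comp a hy hG hGa).integral_fun_mul_eq_mul_integral
    (hy.comp (hx.meas_apply a)).aestronglyMeasurable (hG.comp hx.meas).aestronglyMeasurable, hy0,
    zero_mul]

theorem update [IsProbabilityMeasure P] (hx : CenteredVec P x κ) (b : Fin N) :
    CenteredVec P (fun ω => Function.update (x ω) b 0) κ := by
  have hκ := (hx.second b).nonneg
  have hu : Measurable fun v : Fin N → ℂ => Function.update v b (0 : ℂ) := by fun_prop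
  refine ⟨hu.comp hx.meas, fun a => ?_, fun a => ?_, fun a => ?_, fun a => ?_⟩
  · by_cases hab : a = b
    · subst hab
      simp only [Function.update_self]
      exact indepFun_const_left _ _
    · simp only [Function.update_of_ne hab]
      refine hx.indep_comp a (y := fun z => z) measurable_id
        (G := fun v => Function.update (Function.update v b (0 : ℂ)) a 0) (by fun_prop) fun v => ?_
      rw [Function.update_comm hab, Function.update_idem]
  · by_cases hab : a = b
    · subst hab; simp
    · simpa [Function.update_of_ne hab] using hx.mean a
  · by_cases hab : a = b
    · subst hab; simpa using L2Bound.zero.mono hκ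
    · simpa [Function.update_of_ne hab] using hx.second a
  · by_cases hab : a = b
    · subst hab; simpa using L2Bound.zero.mono (sq_nonneg κ)
    · simpa [Function.update_of_ne hab] using hx.fourth a

/-- Second moments of `∑ₐ yₐ(xₐ) Zₐ(x)`, where `Zₐ` does not depend on `xₐ`, and `Z₂ a b` is an
approximation of `Zₐ` that does not depend on `x_b` either. -/
theorem l2Bound_sum (hx : CenteredVec P x κ) {y : Fin N → ℂ → ℂ} (hy : ∀ a, Measurable (y a))
    (hy0 : ∀ a, ∫ ω, y a (x ω a) ∂P = 0) {ρ : ℝ} (hyρ : ∀ a, L2Bound P (fun ω => y a (x ω a)) ρ)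
    {Z : Fin N → (Fin N → ℂ) → ℂ} (hZ : ∀ a, Measurable (Z a))
    (hZa : ∀ a v, Z a (Function.update v a 0) = Z a v)
    {Z₂ : Fin N → Fin N → (Fin N → ℂ) → ℂ} (hZ₂ : ∀ a b, Measurable (Z₂ a b))
    (hZ₂a : ∀ a b v, Z₂ a b (Function.update v a 0) = Z₂ a b v)
    (hZ₂b : ∀ a b v, Z₂ a b (Function.update v b 0) = Z₂ a b v)
    {ζ : Fin N → ℝ} (hζ : ∀ a, L2Bound P (fun ω => Z a (x ω)) (ζ a)) {w : Fin N → Fin N → ℝ}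
    (hw : ∀ a b, a ≠ b → L2Bound P (fun ω => Z a (x ω) - Z₂ a b (x ω)) (w a b))
    (hw0 : ∀ a b, 0 ≤ w a b) {B : ℝ} (hB : 0 ≤ B)
    (h : ρ ^ 2 * (∑ a, ζ a ^ 2 + ∑ a, ∑ b, w a b * w b a) ≤ B ^ 2) :
    L2Bound P (fun ω => ∑ a, y a (x ω a) * Z a (x ω)) B := by
  set f : Fin N → Ω → ℂ := fun a ω => y a (x ω a) * Z a (x ω) with hf
  have hfL : ∀ a, L2Bound P (f a) (ρ * ζ a) := fun a =>
    (hyρ a).indep_mul (hζ a) (hx.indep_comp a (hy a) (hZ a) (hZa a))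
  have hsum := L2Bound.sum Finset.univ fun a _ => hfL a
  -- Each factor `Z` is split into its approximation `Z₂` and the difference. A term where `y_a` or
  -- `y_b` multiplies a function free of its own variable has mean zero. Only the product of the two
  -- differences remains, and Cauchy–Schwarz bounds it by `(ρ w_ab)(ρ w_ba)`.
  have hcross : ∀ a b, a ≠ b →
      ‖∫ ω, f a ω * starRingEnd ℂ (f b ω) ∂P‖ ≤ ρ ^ 2 * (w a b * w b a) := by
    intro a b hab
    have hWa : ∀ a b : Fin N, a ≠ b →
        L2Bound P (fun ω => y a (x ω a) * (Z a (x ω) - Z₂ a b (x ω))) (ρ * w a b) := by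
      intro a b hab
      refine (hyρ a).indep_mul (hw a b hab) (hx.indep_comp a (hy a)
        (G := fun v => Z a v - Z₂ a b v) ((hZ a).sub (hZ₂ a b)) fun v => ?_)
      simp only [hZa, hZ₂a]
    have e : ∀ ω, f a ω * starRingEnd ℂ (f b ω) =
        (y a (x ω a) * (Z a (x ω) - Z₂ a b (x ω))) *
          starRingEnd ℂ (y b (x ω b) * (Z b (x ω) - Z₂ b a (x ω))) +
        (y a (x ω a) * ((Z a (x ω) - Z₂ a b (x ω)) *
          starRingEnd ℂ (y b (x ω b) * Z₂ b a (x ω)))) +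
        starRingEnd ℂ (y b (x ω b)) * (y a (x ω a) * Z₂ a b (x ω) *
          starRingEnd ℂ (Z b (x ω))) := by
      intro ω
      simp only [hf, map_mul, map_sub]
      ring
    have conj_meas : Measurable (starRingEnd ℂ) := Complex.continuous_conj.measurable
    have z2 : ∫ ω, (y a (x ω a) * ((Z a (x ω) - Z₂ a b (x ω)) *
          starRingEnd ℂ (y b (x ω b) * Z₂ b a (x ω)))) ∂P = 0 := by
      refine hx.integral_mul_eq_zero a (hy a) (hy0 a) (G := fun v => (Z a v - Z₂ a b v) *
          starRingEnd ℂ (y b (v b) * Z₂ b a v)) ?_ fun v => ?_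
      · exact ((hZ a).sub (hZ₂ a b)).mul
          (conj_meas.comp (((hy b).comp (measurable_pi_apply b)).mul (hZ₂ b a)))
      · simp only [hZa, hZ₂a, hZ₂b, Function.update_of_ne hab.symm]
    have z3 : ∫ ω, starRingEnd ℂ (y b (x ω b)) * (y a (x ω a) * Z₂ a b (x ω) *
          starRingEnd ℂ (Z b (x ω))) ∂P = 0 := by
      refine hx.integral_mul_eq_zero b (y := fun z => starRingEnd ℂ (y b z))
        (conj_meas.comp (hy b)) (by rw [integral_conj, hy0 b, map_zero])
        (G := fun v => y a (v a) * Z₂ a b v * starRingEnd ℂ (Z b v)) ?_ fun v => ?_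
      · exact (((hy a).comp (measurable_pi_apply a)).mul (hZ₂ a b)).mul (conj_meas.comp (hZ b))
      · simp only [hZa, hZ₂b, Function.update_of_ne hab]
    have i1 := (hWa a b hab).integrable_mul (hWa b a hab.symm).star
    have hZZ : ∀ a b : Fin N, a ≠ b →
        L2Bound P (fun ω => y a (x ω a) * Z₂ a b (x ω)) (ρ * ζ a + ρ * w a b) := by
      intro a b hab
      have := (hfL a).sub (hWa a b hab)
      convert this using 2 with ω
      simp only [hf]; ring
    have i2 := (hWa a b hab).integrable_mul (hZZ b a hab.symm).star
    have i3 := (hZZ a b hab).integrable_mul (hfL b).star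
    have i2' : Integrable (fun ω => (y a (x ω a) * ((Z a (x ω) - Z₂ a b (x ω)) *
          starRingEnd ℂ (y b (x ω b) * Z₂ b a (x ω))))) P := by
      refine i2.congr (ae_of_all _ fun ω => ?_); simp only; ring
    have i3' : Integrable (fun ω => starRingEnd ℂ (y b (x ω b)) * (y a (x ω a) * Z₂ a b (x ω) *
          starRingEnd ℂ (Z b (x ω)))) P := by
      refine i3.congr (ae_of_all _ fun ω => ?_); simp only [hf, map_mul]; ring
    simp_rw [e]
    have t1 := integral_add (i1.add i2') i3'
    simp only [Pi.add_apply] at t1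
    rw [t1, z3, add_zero, integral_add i1 i2', z2, add_zero]
    refine ((hWa a b hab).norm_integral_mul_le (hWa b a hab.symm).star).trans (le_of_eq (by ring))
  refine L2Bound.of_integral hsum.memLp hB (le_trans ?_ h)
  have e0 : ((∫ ω, ‖∑ a, f a ω‖ ^ 2 ∂P : ℝ) : ℂ) =
      ∑ a, ∑ b, ∫ ω, f a ω * starRingEnd ℂ (f b ω) ∂P := by
    rw [← integral_complex_ofReal]
    have : ∀ ω, ((‖∑ a, f a ω‖ ^ 2 : ℝ) : ℂ) =
        ∑ a, ∑ b, f a ω * starRingEnd ℂ (f b ω) := by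
      intro ω
      push_cast
      rw [← Complex.mul_conj', map_sum, Finset.sum_mul_sum]
    simp_rw [this]
    rw [integral_finsetSum _ fun a _ => integrable_finsetSum _ fun b _ =>
      (hfL a).integrable_mul (hfL b).star]
    refine Finset.sum_congr rfl fun a _ => ?_
    rw [integral_finsetSum _ fun b _ => (hfL a).integrable_mul (hfL b).star]
  have e1 : ∫ ω, ‖∑ a, f a ω‖ ^ 2 ∂P =
      ‖∑ a, ∑ b, ∫ ω, f a ω * starRingEnd ℂ (f b ω) ∂P‖ := by
    rw [← e0, Complex.norm_real, Real.norm_of_nonneg (integral_nonneg fun ω => by positivity)]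
  rw [e1]
  calc ‖∑ a, ∑ b, ∫ ω, f a ω * starRingEnd ℂ (f b ω) ∂P‖
      ≤ ∑ a, ∑ b, ‖∫ ω, f a ω * starRingEnd ℂ (f b ω) ∂P‖ :=
        (norm_sum_le _ _).trans (Finset.sum_le_sum fun a _ => norm_sum_le _ _)
    _ ≤ ∑ a, ∑ b, ((if a = b then ρ ^ 2 * ζ a ^ 2 else 0) + ρ ^ 2 * (w a b * w b a)) := by
        refine Finset.sum_le_sum fun a _ => Finset.sum_le_sum fun b _ => ?_
        by_cases hab : a = b
        · subst hab
          rw [if_pos rfl]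
          have h1 := (hfL a).norm_integral_mul_le (hfL a).star
          have h2 := mul_nonneg (sq_nonneg ρ) (mul_nonneg (hw0 a a) (hw0 a a))
          nlinarith
        · rw [if_neg hab, zero_add]
          exact hcross a b hab
    _ = ρ ^ 2 * (∑ a, ζ a ^ 2 + ∑ a, ∑ b, w a b * w b a) := by
        simp only [Finset.sum_add_distrib, Finset.sum_ite_eq, Finset.mem_univ, if_true, mul_add,
          Finset.mul_sum]

variable [IsProbabilityMeasure P]

theorem l2Bound_linear (hx : CenteredVec P x κ) {b : Fin N → ℂ} {β : ℝ} (hβ : 0 ≤ β)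
    (hκ : 0 ≤ κ) (hb : ∑ a, ‖b a‖ ^ 2 ≤ β ^ 2) :
    L2Bound P (fun ω => ∑ a, b a * x ω a) (κ * β) := by
  have h := hx.l2Bound_sum (y := fun _ z => z) (fun _ => measurable_id) hx.mean hx.second
    (Z := fun a _ => b a) (fun _ => measurable_const) (fun _ _ => rfl)
    (Z₂ := fun a _ _ => b a) (fun _ _ => measurable_const) (fun _ _ _ => rfl) (fun _ _ _ => rfl)
    (ζ := fun a => ‖b a‖)
    (fun a => L2Bound.of_bounded aestronglyMeasurable_const (norm_nonneg _) fun _ => le_rfl)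
    (w := fun _ _ => 0) (fun a b _ => by simpa using L2Bound.zero) (fun _ _ => le_rfl)
    (B := κ * β) (by positivity) (by
      simp only [mul_zero, Finset.sum_const_zero, add_zero, mul_pow]
      gcongr)
  simpa only [mul_comm (b _)] using h

theorem l2Bound_linear_conj (hx : CenteredVec P x κ) {b : Fin N → ℂ} {β : ℝ} (hβ : 0 ≤ β)
    (hκ : 0 ≤ κ) (hb : ∑ a, ‖b a‖ ^ 2 ≤ β ^ 2) :
    L2Bound P (fun ω => ∑ a, starRingEnd ℂ (x ω a) * b a) (κ * β) := by
  have h := (hx.l2Bound_linear (b := fun a => starRingEnd ℂ (b a)) hβ hκ (by simpa using hb)).star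
  simpa [mul_comm] using h

theorem measurable_quad (A : Matrix (Fin N) (Fin N) ℂ) : Measurable (quad A) := by
  have conj_meas : Measurable (starRingEnd ℂ) := Complex.continuous_conj.measurable
  exact Finset.measurable_sum _ fun a _ => Finset.measurable_sum _ fun b _ =>
    ((conj_meas.comp (measurable_pi_apply a)).mul_const _).mul (measurable_pi_apply b)

/-- All dependence on one coordinate `v_b` is isolated: its square times the diagonal entry, and two
terms where `v_b` multiplies a linear form in the other coordinates. -/
theorem quad_sub_update (A : Matrix (Fin N) (Fin N) ℂ) (v : Fin N → ℂ) (b : Fin N) :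
    quad A v - quad A (Function.update v b 0) =
      A b b * (v b * starRingEnd ℂ (v b)) +
      starRingEnd ℂ (v b) * (∑ l, A b l * Function.update v b 0 l) +
      v b * (∑ l, starRingEnd ℂ (Function.update v b 0 l) * A l b) := by
  set u := Function.update v b 0 with hu
  have hv : ∀ l, v l = u l + if l = b then v b else 0 := by
    intro l
    by_cases h : l = b
    · subst h; simp [hu]
    · simp [hu, h]
  have e : ∀ l m, starRingEnd ℂ (v l) * A l m * v m = starRingEnd ℂ (u l) * A l m * u m +
      (if l = b then starRingEnd ℂ (v b) else 0) * A l m * u m +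
      starRingEnd ℂ (u l) * A l m * (if m = b then v b else 0) +
      (if l = b then starRingEnd ℂ (v b) else 0) * A l m * (if m = b then v b else 0) := by
    intro l m
    nth_rw 1 [hv l, hv m]
    rw [map_add, apply_ite (starRingEnd ℂ), map_zero]
    ring
  have e1 : quad A v = quad A u + starRingEnd ℂ (v b) * (∑ l, A b l * u l) +
      v b * (∑ l, starRingEnd ℂ (u l) * A l b) + A b b * (v b * starRingEnd ℂ (v b)) := by
    simp only [quad]
    simp_rw [e, Finset.sum_add_distrib]
    congr 1
    · congr 1
      · congr 1
        rw [Finset.sum_eq_single b (fun l _ hl => by simp [hl]) (by simp), Finset.mul_sum]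
        simp [mul_assoc]
      · rw [Finset.mul_sum]
        refine Finset.sum_congr rfl fun l _ => ?_
        rw [Finset.sum_eq_single b (fun m _ hm => by simp [hm]) (by simp)]
        simp; ring
    · rw [Finset.sum_eq_single b (fun l _ hl => by simp [hl]) (by simp),
        Finset.sum_eq_single b (fun l _ hl => by simp [hl]) (by simp)]
      simp; ring
  rw [e1]; ring

/-- Matrices whose rows and columns have Euclidean norm at most one. -/
structure _root_.Wigner.RowColBounded {N : ℕ} (A : Matrix (Fin N) (Fin N) ℂ) : Prop where
  row : ∀ l, ∑ m, ‖A l m‖ ^ 2 ≤ 1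
  col : ∀ m, ∑ l, ‖A l m‖ ^ 2 ≤ 1

theorem _root_.Wigner.RowColBounded.norm_le {A : Matrix (Fin N) (Fin N) ℂ} (hA : RowColBounded A)
    (l m : Fin N) : ‖A l m‖ ≤ 1 := by
  have h : ‖A l m‖ ^ 2 ≤ 1 := (Finset.single_le_sum (f := fun m => ‖A l m‖ ^ 2)
    (fun j _ => by positivity) (Finset.mem_univ m)).trans (hA.row l)
  nlinarith [norm_nonneg (A l m)]

theorem _root_.Wigner.RowColBounded.sum_sq_le {A : Matrix (Fin N) (Fin N) ℂ}
    (hA : RowColBounded A) : ∑ l, ∑ m, ‖A l m‖ ^ 2 ≤ N := by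
  refine (Finset.sum_le_sum fun l _ => hA.row l).trans (by simp)

/-- Concentration of quadratic forms. -/
theorem l2Bound_quad (hx : CenteredVec P x κ) (hκ : 0 ≤ κ) {A : Matrix (Fin N) (Fin N) ℂ}
    (hA : RowColBounded A) :
    L2Bound P (fun ω => quad A (x ω) - ∑ a, (∫ ω, x ω a * starRingEnd ℂ (x ω a) ∂P) * A a a)
      (4 * κ ^ 2 * √N) := by
  set c : Fin N → ℂ := fun a => ∫ ω, x ω a * starRingEnd ℂ (x ω a) ∂P with hc
  have conj_meas : Measurable (starRingEnd ℂ) := Complex.continuous_conj.measurable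
  set β : Fin N → (Fin N → ℂ) → ℂ :=
    fun m v => ∑ l, starRingEnd ℂ (v l) * (if l = m then 0 else A l m) with hβ
  have hβm : ∀ m, Measurable (β m) := fun m =>
    Finset.measurable_sum _ fun l _ => (conj_meas.comp (measurable_pi_apply l)).mul_const _
  have hβa : ∀ m v, β m (Function.update v m 0) = β m v := by
    intro m v
    refine Finset.sum_congr rfl fun l _ => ?_
    by_cases h : l = m
    · simp [h]
    · simp [h]
  have hu : ∀ b : Fin N, Measurable fun v : Fin N → ℂ => Function.update v b (0 : ℂ) :=
    fun b => by fun_prop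
  have hN : √(N : ℝ) ^ 2 = N := Real.sq_sqrt (Nat.cast_nonneg N)
  -- The off-diagonal part. The form `β m` is free of `x_m`, and deleting `x_b` from it changes it
  -- by `A_bm` times the conjugate of `x_b`; this is the weight `w m b`.
  have h1 : L2Bound P (fun ω => ∑ m, x ω m * β m (x ω)) (2 * κ ^ 2 * √N) := by
    refine hx.l2Bound_sum (y := fun _ z => z) (fun _ => measurable_id) hx.mean hx.second
      hβm hβa (Z₂ := fun m b v => β m (Function.update v b 0)) (fun m b => (hβm m).comp (hu b))
      (fun m b v => ?_) (fun m b v => by simp only [Function.update_idem])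
      (ζ := fun m => κ * 1) (fun m => ?_)
      (w := fun m b => ‖A b m‖ * κ) (fun m b hmb => ?_) (fun m b => by positivity)
      (by positivity) ?_
    · by_cases h : m = b
      · simp only [h, Function.update_idem]
      · rw [Function.update_comm h, hβa]
    · refine hx.l2Bound_linear_conj zero_le_one hκ ?_
      refine le_trans (Finset.sum_le_sum fun l _ => ?_) ((hA.col m).trans (by norm_num))
      by_cases h : l = m
      · simp [h]
      · simp [h]
    · have e : ∀ ω, β m (x ω) - β m (Function.update (x ω) b 0) =
          A b m * starRingEnd ℂ (x ω b) := by
        intro ω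
        rw [hβ]
        simp only
        rw [← Finset.sum_sub_distrib, Finset.sum_eq_single b]
        · simp [hmb.symm, mul_comm]
        · intro l _ hl
          simp [hl]
        · simp
      simp only [e]
      exact (hx.second b).star.const_mul _
    · have h2 : ∑ m, ∑ b, ‖A b m‖ * κ * (‖A m b‖ * κ) ≤ κ ^ 2 * N := by
        calc ∑ m, ∑ b, ‖A b m‖ * κ * (‖A m b‖ * κ)
            ≤ ∑ m, ∑ b, (κ ^ 2 / 2 * ‖A b m‖ ^ 2 + κ ^ 2 / 2 * ‖A m b‖ ^ 2) := by
              refine Finset.sum_le_sum fun m _ => Finset.sum_le_sum fun b _ => ?_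
              nlinarith [mul_nonneg (sq_nonneg κ) (sq_nonneg (‖A b m‖ - ‖A m b‖))]
          _ = κ ^ 2 / 2 * ∑ m, ∑ b, ‖A b m‖ ^ 2 + κ ^ 2 / 2 * ∑ m, ∑ b, ‖A m b‖ ^ 2 := by
              simp only [Finset.sum_add_distrib, Finset.mul_sum]
          _ ≤ κ ^ 2 / 2 * N + κ ^ 2 / 2 * N := by
              have h3 := hA.sum_sq_le
              have h4 : ∑ m, ∑ b, ‖A b m‖ ^ 2 ≤ (N : ℝ) := by rw [Finset.sum_comm]; exact h3
              gcongr
          _ = _ := by ring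
      have h5 : ∑ m : Fin N, (κ * 1) ^ 2 = κ ^ 2 * N := by
        simp; ring
      rw [h5]
      calc κ ^ 2 * (κ ^ 2 * N + ∑ m, ∑ b, ‖A b m‖ * κ * (‖A m b‖ * κ))
          ≤ κ ^ 2 * (κ ^ 2 * N + κ ^ 2 * N) := by gcongr
        _ ≤ (2 * κ ^ 2 * √N) ^ 2 := by
          rw [mul_pow, hN]
          have : 0 ≤ κ ^ 4 * N := by positivity
          nlinarith
  have hsq : Measurable fun z : ℂ => z * starRingEnd ℂ z := measurable_id.mul conj_meas
  have hcb : ∀ m, ‖c m‖ ≤ κ ^ 2 := fun m => (hx.fourth m).norm_integral_le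
  -- The diagonal part has constant coefficients, so distinct terms are uncorrelated. The scale
  -- `2κ²` is one `κ²` for `|x_m|²` and one for its mean.
  have h2 : L2Bound P (fun ω => ∑ m, (x ω m * starRingEnd ℂ (x ω m) - c m) * A m m)
      (2 * κ ^ 2 * √N) := by
    refine hx.l2Bound_sum (y := fun m z => z * starRingEnd ℂ z - c m)
      (fun m => hsq.sub_const _) (fun m => ?_) (ρ := 2 * κ ^ 2) (fun m => ?_)
      (Z := fun m _ => A m m) (fun _ => measurable_const) (fun _ _ => rfl)
      (Z₂ := fun m _ _ => A m m) (fun _ _ => measurable_const) (fun _ _ _ => rfl)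
      (fun _ _ _ => rfl) (ζ := fun m => 1)
      (fun m => L2Bound.of_bounded aestronglyMeasurable_const zero_le_one fun _ => hA.norm_le m m)
      (w := fun _ _ => 0) (fun a b _ => by simpa using L2Bound.zero) (fun _ _ => le_rfl)
      (by positivity) ?_
    · rw [integral_sub (hx.fourth m).integrable (integrable_const _)]
      simp [hc]
    · refine ((hx.fourth m).sub (L2Bound.of_bounded aestronglyMeasurable_const (sq_nonneg κ)
        fun _ => hcb m)).mono (le_of_eq (by ring))
    · rw [mul_pow _ (√(N : ℝ)), hN]; simp
  have h3 := h1.add h2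
  refine (h3.congr_norm ?_ fun ω => ?_).mono (le_of_eq (by ring))
  · exact (((measurable_quad A).comp hx.meas).sub_const _).aestronglyMeasurable
  · congr 1
    rw [← Finset.sum_add_distrib, quad, Finset.sum_comm, ← Finset.sum_sub_distrib]
    refine Finset.sum_congr rfl fun m _ => ?_
    have : ∑ l, starRingEnd ℂ (x ω l) * A l m * x ω m =
        x ω m * β m (x ω) + x ω m * starRingEnd ℂ (x ω m) * A m m := by
      rw [hβ]
      simp only
      rw [Finset.mul_sum, ← Finset.add_sum_erase _ _ (Finset.mem_univ m),
        ← Finset.add_sum_erase (a := m) _ (fun l => x ω m * _) (Finset.mem_univ m)]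
      have : ∑ l ∈ Finset.univ.erase m, starRingEnd ℂ (x ω l) * A l m * x ω m =
          ∑ l ∈ Finset.univ.erase m,
            x ω m * (starRingEnd ℂ (x ω l) * (if l = m then 0 else A l m)) := by
        refine Finset.sum_congr rfl fun l hl => ?_
        rw [if_neg (Finset.ne_of_mem_erase hl)]; ring
      rw [this]
      simp; ring
    rw [this]; ring

end CenteredVec

end Wigner

/-! ### Products of a linear form and a centred quadratic form. -/

namespace Wigner

theorem sum_norm_le_sqrt_card {N : ℕ} {b : Fin N → ℂ} (hb : ∑ a, ‖b a‖ ^ 2 ≤ 1) :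
    ∑ a, ‖b a‖ ≤ √N := by
  have h := Real.sum_mul_le_sqrt_mul_sqrt Finset.univ (fun a => ‖b a‖) fun _ => (1 : ℝ)
  simp only [mul_one, one_pow, Finset.sum_const, Finset.card_univ, Fintype.card_fin, nsmul_eq_mul]
    at h
  refine h.trans (mul_le_of_le_one_left (Real.sqrt_nonneg _) ?_)
  rw [Real.sqrt_le_left zero_le_one]; simpa using hb

/-- The product of a linear form and a centred quadratic form, without its cubic diagonal part. -/
noncomputable def chaosRem {N : ℕ} (A : Matrix (Fin N) (Fin N) ℂ) (b : Fin N → ℂ) (S : ℂ)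
    (x : Fin N → ℂ) : ℂ :=
  (∑ a, b a * x a) * (quad A x - S) -
    ∑ a, b a * A a a * (x a * (x a * starRingEnd ℂ (x a)))

namespace CenteredVec

variable {Ω : Type*} [MeasurableSpace Ω] {P : Measure Ω} [IsProbabilityMeasure P] {N : ℕ}
  {x : Ω → Fin N → ℂ} {κ : ℝ}

/-- In the summand with `x_a`, the quadratic form is expanded around `x_a = 0`. The term `x_a
|x_a|²` is the one that `chaosRem` subtracts; every remaining term has a centred factor independent
of the rest. -/
theorem chaosRem_eq (A : Matrix (Fin N) (Fin N) ℂ) (b : Fin N → ℂ) (S : ℂ) (v : Fin N → ℂ) :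
    chaosRem A b S v = ∑ a, v a * (b a * (quad A (Function.update v a 0) - S)) +
      ∑ a, b a * ((v a * starRingEnd ℂ (v a)) * (∑ l, A a l * Function.update v a 0 l)) +
      ∑ a, b a * ((v a * v a) * (∑ l, starRingEnd ℂ (Function.update v a 0 l) * A l a)) := by
  rw [chaosRem, Finset.sum_mul, ← Finset.sum_sub_distrib, ← Finset.sum_add_distrib,
    ← Finset.sum_add_distrib]
  refine Finset.sum_congr rfl fun a _ => ?_
  linear_combination (b a * v a) * quad_sub_update A v a

variable (hx : CenteredVec P x κ) (hκ : 0 ≤ κ) {A : Matrix (Fin N) (Fin N) ℂ}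
  (hA : RowColBounded A) {b : Fin N → ℂ} (hb : ∑ a, ‖b a‖ ^ 2 ≤ 1) {S : ℂ}
  (hS : S = ∑ a, (∫ ω, x ω a * starRingEnd ℂ (x ω a) ∂P) * A a a)

include hx hκ hA in
theorem l2Bound_row (a : Fin N) :
    L2Bound P (fun ω => ∑ l, A a l * Function.update (x ω) a 0 l) κ := by
  simpa using (hx.update a).l2Bound_linear zero_le_one hκ ((hA.row a).trans (by norm_num))

include hx hκ hA in
theorem l2Bound_col (a : Fin N) :
    L2Bound P (fun ω => ∑ l, starRingEnd ℂ (Function.update (x ω) a 0 l) * A l a) κ := by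
  simpa using (hx.update a).l2Bound_linear_conj zero_le_one hκ ((hA.col a).trans (by norm_num))

include hx hκ hA in
theorem l2Bound_quad_sub_update (a : Fin N) : L2Bound P
    (fun ω => quad A (x ω) - quad A (Function.update (x ω) a 0)) (3 * κ ^ 2) := by
  have h1 := ((hx.fourth a).const_mul (A a a)).mono
    (mul_le_of_le_one_left (sq_nonneg κ) (hA.norm_le a a))
  have hsq : Measurable (starRingEnd ℂ) := Complex.continuous_conj.measurable
  have h2 := (hx.second a).star.indep_mul (hx.l2Bound_row hκ hA a)
    (hx.indep_comp a (y := fun z => starRingEnd ℂ z) hsq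
      (G := fun v => ∑ l, A a l * Function.update v a 0 l)
      (by fun_prop) fun v => by simp only [Function.update_idem])
  have h3 := (hx.second a).indep_mul (hx.l2Bound_col hκ hA a)
    (hx.indep_comp a (y := fun z => z) measurable_id
      (G := fun v => ∑ l, starRingEnd ℂ (Function.update v a 0 l) * A l a)
      (Finset.measurable_sum _ fun l _ => (hsq.comp (by fun_prop)).mul_const _)
      fun v => by simp only [Function.update_idem])
  have h := ((h1.add h2).add h3).mono (le_of_eq (by ring : _ = 3 * κ ^ 2))
  simpa only [quad_sub_update] using h

-- The first sum of `chaosRem_eq` is handled by near orthogonality (`l2Bound_sum`). The two others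
-- need only the triangle inequality and `∑ |b_a| ≤ √N`, each term being a product of independent
-- factors of total size `κ³`. For `κ` of order `N^(-1/2)` the bound is of order `1/N`.
include hx hκ hA hb hS in
theorem l2Bound_chaosRem : L2Bound P (fun ω => chaosRem A b S (x ω)) (8 * κ ^ 3 * √N) ∧
    ∫ ω, chaosRem A b S (x ω) ∂P = 0 := by
  have hN : √(N : ℝ) ^ 2 = N := Real.sq_sqrt (Nat.cast_nonneg N)
  have hN0 : 0 ≤ √(N : ℝ) := Real.sqrt_nonneg _
  have conj_meas : Measurable (starRingEnd ℂ) := Complex.continuous_conj.measurable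
  have hu : ∀ b : Fin N, Measurable fun v : Fin N → ℂ => Function.update v b (0 : ℂ) :=
    fun b => by fun_prop
  have hq := measurable_quad A
  have hcb : ∀ m, ‖∫ ω, x ω m * starRingEnd ℂ (x ω m) ∂P‖ ≤ κ ^ 2 :=
    fun m => (hx.fourth m).norm_integral_le
  -- the part with independent factors
  have hζ : ∀ a, L2Bound P (fun ω => b a * (quad A (Function.update (x ω) a 0) - S))
      (‖b a‖ * (5 * κ ^ 2 * √N)) := by
    intro a
    have hN1 : 1 ≤ √(N : ℝ) := by
      rw [Real.one_le_sqrt]; exact_mod_cast a.pos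
    have h1 := (hx.update a).l2Bound_quad hκ hA
    have h2 : L2Bound P (fun _ => (∫ ω, x ω a * starRingEnd ℂ (x ω a) ∂P) * A a a) (κ ^ 2) :=
      L2Bound.of_bounded aestronglyMeasurable_const (sq_nonneg κ) fun _ => by
        rw [norm_mul]
        exact (mul_le_of_le_one_right (norm_nonneg _) (hA.norm_le a a)).trans (hcb a)
    -- Zeroing `x_a` also removes its term from the centring `S`; the missing term costs `κ²`,
    -- absorbed because `N ≥ 1`.
    have h4 : 4 * κ ^ 2 * √N + κ ^ 2 ≤ 5 * κ ^ 2 * √N := by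
      nlinarith [mul_nonneg (sq_nonneg κ) (sub_nonneg.2 hN1)]
    refine (((h1.sub h2).mono h4).const_mul (b a)).congr_norm ?_ fun ω => ?_
    · exact (((hq.comp (hu a)).comp hx.meas).sub_const S).const_mul (b a) |>.aestronglyMeasurable
    · congr 2
      rw [hS, ← Finset.add_sum_erase _ _ (Finset.mem_univ a),
        ← Finset.add_sum_erase (a := a) _ (fun m => (∫ ω, Function.update (x ω) a 0 m *
          starRingEnd ℂ (Function.update (x ω) a 0 m) ∂P) * A m m) (Finset.mem_univ a)]
      have : ∑ m ∈ Finset.univ.erase a, (∫ ω, Function.update (x ω) a 0 m *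
          starRingEnd ℂ (Function.update (x ω) a 0 m) ∂P) * A m m =
          ∑ m ∈ Finset.univ.erase a, (∫ ω, x ω m * starRingEnd ℂ (x ω m) ∂P) * A m m := by
        refine Finset.sum_congr rfl fun m hm => ?_
        simp only [Function.update_of_ne (Finset.ne_of_mem_erase hm)]
      rw [this]
      simp
      ring
  have h1 : L2Bound P (fun ω => ∑ a, x ω a * (b a * (quad A (Function.update (x ω) a 0) - S)))
      (6 * κ ^ 3 * √N) := by
    refine hx.l2Bound_sum (y := fun _ z => z) (fun _ => measurable_id) hx.mean hx.second
      (Z := fun a v => b a * (quad A (Function.update v a 0) - S))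
      (fun a => ((hq.comp (hu a)).sub_const S).const_mul (b a))
      (fun a v => by simp only [Function.update_idem])
      (Z₂ := fun a m v => b a * (quad A (Function.update (Function.update v a 0) m 0) - S))
      (fun a m => ((hq.comp ((hu m).comp (hu a))).sub_const S).const_mul (b a))
      (fun a m v => by simp only [Function.update_idem]) (fun a m v => ?_) hζ
      (w := fun a _ => ‖b a‖ * (3 * κ ^ 2)) (fun a m ham => ?_) (fun a m => by positivity)
      (by positivity) ?_
    · by_cases h : a = m
      · simp only [h, Function.update_idem]
      · simp only [Function.update_comm (Ne.symm h), Function.update_idem]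
    · have := ((hx.update a).l2Bound_quad_sub_update hκ hA m).const_mul (b a)
      simpa only [← mul_sub, sub_sub_sub_cancel_right] using this
    · have e1 : ∑ a, (‖b a‖ * (5 * κ ^ 2 * √N)) ^ 2 ≤ 25 * κ ^ 4 * N := by
        simp only [mul_pow, ← Finset.sum_mul, hN]
        calc (∑ a, ‖b a‖ ^ 2) * (5 ^ 2 * (κ ^ 2) ^ 2 * N) ≤ 1 * (5 ^ 2 * (κ ^ 2) ^ 2 * N) := by
              gcongr
          _ = _ := by ring
      have e2 : ∑ a, ∑ m, ‖b a‖ * (3 * κ ^ 2) * (‖b m‖ * (3 * κ ^ 2)) ≤ 9 * κ ^ 4 * N := by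
        simp only [← Finset.mul_sum, ← Finset.sum_mul]
        have h := sum_norm_le_sqrt_card hb
        have h0 : 0 ≤ ∑ a, ‖b a‖ := Finset.sum_nonneg fun _ _ => norm_nonneg _
        calc (∑ a, ‖b a‖) * (3 * κ ^ 2) * ((∑ a, ‖b a‖) * (3 * κ ^ 2))
            ≤ √N * (3 * κ ^ 2) * (√N * (3 * κ ^ 2)) := by gcongr
          _ = 9 * κ ^ 4 * √N ^ 2 := by ring
          _ = _ := by rw [hN]
      calc κ ^ 2 * (∑ a, (‖b a‖ * (5 * κ ^ 2 * √N)) ^ 2 +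
            ∑ a, ∑ m, ‖b a‖ * (3 * κ ^ 2) * (‖b m‖ * (3 * κ ^ 2)))
          ≤ κ ^ 2 * (25 * κ ^ 4 * N + 9 * κ ^ 4 * N) := by gcongr
        _ ≤ (6 * κ ^ 3 * √N) ^ 2 := by
          rw [mul_pow, hN]
          have : 0 ≤ κ ^ 6 * N := by positivity
          nlinarith
  -- the parts with repeated factors
  have hrep : ∀ (F : Fin N → Ω → ℂ), (∀ a, L2Bound P (F a) (κ ^ 3)) →
      L2Bound P (fun ω => ∑ a, b a * F a ω) (κ ^ 3 * √N) := by
    intro F hF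
    refine (L2Bound.sum Finset.univ fun a _ => (hF a).const_mul (b a)).mono ?_
    rw [← Finset.sum_mul, mul_comm]
    exact mul_le_mul_of_nonneg_left (sum_norm_le_sqrt_card hb) (by positivity)
  have hG2m : ∀ a, Measurable fun v : Fin N → ℂ => ∑ l, A a l * Function.update v a 0 l :=
    fun a => by fun_prop
  have hG3m : ∀ a, Measurable fun v : Fin N → ℂ =>
      ∑ l, starRingEnd ℂ (Function.update v a 0 l) * A l a := fun a =>
    Finset.measurable_sum _ fun l _ => (conj_meas.comp (by fun_prop)).mul_const _
  have hy2 : Measurable fun z : ℂ => z * starRingEnd ℂ z := measurable_id.mul conj_meas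
  have hy3 : Measurable fun z : ℂ => z * z := measurable_id.mul measurable_id
  have i2 : ∀ a, IndepFun (fun ω => x ω a * starRingEnd ℂ (x ω a))
      (fun ω => ∑ l, A a l * Function.update (x ω) a 0 l) P := fun a =>
    hx.indep_comp a hy2 (hG2m a) fun v => by simp only [Function.update_idem]
  have i3 : ∀ a, IndepFun (fun ω => x ω a * x ω a)
      (fun ω => ∑ l, starRingEnd ℂ (Function.update (x ω) a 0 l) * A l a) P := fun a =>
    hx.indep_comp a hy3 (hG3m a) fun v => by simp only [Function.update_idem]
  have hsq : ∀ a, L2Bound P (fun ω => x ω a * x ω a) (κ ^ 2) := fun a =>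
    (hx.fourth a).congr_norm (hy3.comp (hx.meas_apply a)).aestronglyMeasurable fun ω => by simp
  have b2 : ∀ a, L2Bound P (fun ω => (x ω a * starRingEnd ℂ (x ω a)) *
      (∑ l, A a l * Function.update (x ω) a 0 l)) (κ ^ 3) := fun a =>
    ((hx.fourth a).indep_mul (hx.l2Bound_row hκ hA a) (i2 a)).mono (le_of_eq (by ring))
  have b3 : ∀ a, L2Bound P (fun ω => (x ω a * x ω a) *
      (∑ l, starRingEnd ℂ (Function.update (x ω) a 0 l) * A l a)) (κ ^ 3) := fun a =>
    ((hsq a).indep_mul (hx.l2Bound_col hκ hA a) (i3 a)).mono (le_of_eq (by ring))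
  have h2 := hrep _ b2
  have h3 := hrep _ b3
  constructor
  · simp only [chaosRem_eq]
    exact ((h1.add h2).add h3).mono (le_of_eq (by ring))
  · simp only [chaosRem_eq]
    have t1 := integral_add (h1.add h2).integrable h3.integrable
    rw [t1, integral_add h1.integrable h2.integrable]
    have z1 : ∫ ω, ∑ a, x ω a * (b a * (quad A (Function.update (x ω) a 0) - S)) ∂P = 0 := by
      rw [integral_finsetSum]
      · refine Finset.sum_eq_zero fun a _ => ?_
        exact hx.integral_mul_eq_zero a (y := fun z => z) measurable_id (hx.mean a)
          (G := fun v => b a * (quad A (Function.update v a 0) - S))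
          (((hq.comp (hu a)).sub_const S).const_mul (b a))
          fun v => by simp only [Function.update_idem]
      · exact fun a _ => (hx.second a).integrable_mul (hζ a)
    have z2 : ∫ ω, ∑ a, b a * ((x ω a * starRingEnd ℂ (x ω a)) *
        (∑ l, A a l * Function.update (x ω) a 0 l)) ∂P = 0 := by
      rw [integral_finsetSum _ fun a _ => ((b2 a).const_mul (b a)).integrable]
      refine Finset.sum_eq_zero fun a _ => ?_
      rw [integral_const_mul, (i2 a).integral_fun_mul_eq_mul_integral (hx.fourth a).meas
        (hx.l2Bound_row hκ hA a).meas]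
      have : ∫ ω, ∑ l, A a l * Function.update (x ω) a 0 l ∂P = 0 := by
        rw [integral_finsetSum _ fun l _ => (((hx.update a).second l).const_mul (A a l)).integrable]
        refine Finset.sum_eq_zero fun l _ => ?_
        rw [integral_const_mul, (hx.update a).mean l, mul_zero]
      rw [this, mul_zero, mul_zero]
    have z3 : ∫ ω, ∑ a, b a * ((x ω a * x ω a) *
        (∑ l, starRingEnd ℂ (Function.update (x ω) a 0 l) * A l a)) ∂P = 0 := by
      rw [integral_finsetSum _ fun a _ => ((b3 a).const_mul (b a)).integrable]
      refine Finset.sum_eq_zero fun a _ => ?_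
      rw [integral_const_mul, (i3 a).integral_fun_mul_eq_mul_integral (hsq a).meas
        (hx.l2Bound_col hκ hA a).meas]
      have : ∫ ω, ∑ l, starRingEnd ℂ (Function.update (x ω) a 0 l) * A l a ∂P = 0 := by
        rw [integral_finsetSum _ fun l _ => by
          simpa [mul_comm] using (((hx.update a).second l).star.const_mul (A l a)).integrable]
        refine Finset.sum_eq_zero fun l _ => ?_
        rw [integral_mul_const, integral_conj, (hx.update a).mean l, map_zero, zero_mul]
      rw [this, mul_zero, mul_zero]
    rw [z1, z2, z3]; simp

end CenteredVec

end Wigner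

namespace Wigner

/-! ### The random matrix model -/

section Measurability

variable {α : Type*} [MeasurableSpace α] {N : ℕ}

theorem measurable_evol {Y : α → Matrix (Fin N) (Fin N) ℂ} {f : α → ℝ} (hY : Measurable Y)
    (hf : Measurable f) (i j : Fin N) : Measurable fun a => evol (Y a) (f a) i j :=
  (measurable_evol_apply i j).comp (hf.prodMk hY)

theorem measurable_linForm {Y : α → Matrix (Fin N) (Fin N) ℂ} {x : α → Fin N → ℂ} {f : α → ℝ}
    (hY : Measurable Y) (hx : Measurable x) (hf : Measurable f) (j : Fin N) :
    Measurable fun a => linForm (Y a) (x a) j (f a) :=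
  Finset.measurable_sum _ fun b _ =>
    (measurable_evol hY hf j b).mul ((measurable_pi_apply b).comp hx)

theorem measurable_quadForm {Y : α → Matrix (Fin N) (Fin N) ℂ} {x : α → Fin N → ℂ} {f : α → ℝ}
    (hY : Measurable Y) (hx : Measurable x) (hf : Measurable f) :
    Measurable fun a => quadForm (Y a) (x a) (f a) :=
  Finset.measurable_sum _ fun b _ => Finset.measurable_sum _ fun c _ =>
    ((Complex.continuous_conj.measurable.comp ((measurable_pi_apply b).comp hx)).mul
      (measurable_evol hY hf b c)).mul ((measurable_pi_apply c).comp hx)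

theorem measurable_entry {Y : α → Matrix (Fin N) (Fin N) ℂ} (hY : Measurable Y) (i j : Fin N) :
    Measurable fun a => Y a i j :=
  (measurable_pi_apply j).comp ((measurable_pi_apply i).comp hY)

end Measurability

/-- A random Hermitian matrix with independent centred entries on and above the diagonal, whose
off-diagonal entries have variance `σ² / N`, with uniform moment bounds in terms of `K`. -/
structure IsModel {Ω : Type*} [MeasurableSpace Ω] (P : Measure Ω) {N : ℕ} (σ K : ℝ)
    (X : Ω → Matrix (Fin N) (Fin N) ℂ) : Prop where
  herm : ∀ ω, (X ω).IsHermitian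
  meas : Measurable X
  indep : iIndepFun (fun (p : {p : Fin N × Fin N // p.1 ≤ p.2}) ω => X ω p.1.1 p.1.2) P
  one_le : 1 ≤ K
  pos : 0 < σ
  le : σ ≤ K
  mean : ∀ j k, ∫ ω, X ω j k ∂P = 0
  second : ∀ j k, L2Bound P (fun ω => X ω j k) (K / √N)
  second_eq : ∀ j k, j ≠ k → ∫ ω, X ω j k * starRingEnd ℂ (X ω j k) ∂P = (σ ^ 2 / N : ℝ)
  fourth : ∀ j k, j ≠ k →
    L2Bound P (fun ω => X ω j k * starRingEnd ℂ (X ω j k)) ((K / √N) ^ 2)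

section Keep

variable {N : ℕ}

/-- The ordered pair of indices of an entry. -/
def sortedPair (i j : Fin N) : {p : Fin N × Fin N // p.1 ≤ p.2} :=
  ⟨(min i j, max i j), min_le_max⟩

theorem sortedPair_comm (i j : Fin N) : sortedPair i j = sortedPair j i := by
  simp [sortedPair, min_comm, max_comm]

open Classical in
/-- The matrix with the entries whose index pair lies outside `S` set to zero. -/
noncomputable def keep (S : Finset {p : Fin N × Fin N // p.1 ≤ p.2})
    (X : Matrix (Fin N) (Fin N) ℂ) : Matrix (Fin N) (Fin N) ℂ :=
  Matrix.of fun i j => if sortedPair i j ∈ S then X i j else 0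

end Keep

namespace IsModel

variable {Ω : Type*} [MeasurableSpace Ω] {P : Measure Ω} {N : ℕ} {σ K : ℝ}
  {X : Ω → Matrix (Fin N) (Fin N) ℂ}

theorem meas_entry (h : IsModel P σ K X) (i j : Fin N) : Measurable fun ω => X ω i j :=
  measurable_entry h.meas i j

-- Entries indexed by disjoint sets of ordered pairs are independent families. By Hermitian symmetry
-- each kept matrix, including its lower triangle, is a measurable function of its family.
open Classical in
theorem indepFun_keep (h : IsModel P σ K X) (S : Finset {p : Fin N × Fin N // p.1 ≤ p.2}) :
    IndepFun (fun ω => keep S (X ω)) (fun ω => keep Sᶜ (X ω)) P := by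
  have h1 := h.indep.indepFun_finset S Sᶜ disjoint_compl_right fun p => h.meas_entry _ _
  have conj_meas : Measurable (starRingEnd ℂ) := Complex.continuous_conj.measurable
  let g : ∀ S : Finset {p : Fin N × Fin N // p.1 ≤ p.2}, (S → ℂ) → Matrix (Fin N) (Fin N) ℂ :=
    fun S y => Matrix.of fun i j => if hS : sortedPair i j ∈ S then
      (if i ≤ j then y ⟨sortedPair i j, hS⟩ else starRingEnd ℂ (y ⟨sortedPair i j, hS⟩)) else 0
  have hg : ∀ S, Measurable (g S) := by
    intro S
    refine measurable_pi_lambda _ fun i => measurable_pi_lambda _ fun j => ?_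
    simp only [g, Matrix.of_apply]
    split_ifs
    · exact measurable_pi_apply _
    · exact conj_meas.comp (measurable_pi_apply _)
    · exact measurable_const
  have e : ∀ S ω, g S (fun p : S => X ω p.1.1.1 p.1.1.2) = keep S (X ω) := by
    intro S ω
    ext i j
    simp only [g, keep, Matrix.of_apply]
    by_cases hS : sortedPair i j ∈ S
    · rw [dif_pos hS, if_pos hS]
      split_ifs with hij
      · simp [sortedPair, hij]
      · have hji := (not_le.1 hij).le
        simp only [sortedPair, min_eq_right hji, max_eq_left hji]
        exact (h.herm ω).apply i j
    · rw [dif_neg hS, if_neg hS]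
  have h2 := h1.comp (hg S) (hg Sᶜ)
  have e1 : (g S ∘ fun ω (p : S) => X ω p.1.1.1 p.1.1.2) = fun ω => keep S (X ω) :=
    funext fun ω => e S ω
  have e2 : (g Sᶜ ∘ fun ω (p : ↥Sᶜ) => X ω p.1.1.1 p.1.1.2) = fun ω => keep Sᶜ (X ω) :=
    funext fun ω => e Sᶜ ω
  rwa [e1, e2] at h2

theorem sortedPair_eq_iff {i j a k : Fin N} :
    sortedPair i j = sortedPair k a ↔ (i = k ∧ j = a) ∨ (i = a ∧ j = k) := by
  simp only [sortedPair, Subtype.mk.injEq, Prod.mk.injEq]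
  constructor
  · rintro ⟨h1, h2⟩
    rcases le_total i j with h | h <;> rcases le_total k a with h' | h' <;>
      simp_all
  · rintro (⟨rfl, rfl⟩ | ⟨rfl, rfl⟩)
    · simp
    · simp [min_comm, max_comm]

/-- An entry is independent of the matrix with this entry removed. -/
theorem indep_entry (h : IsModel P σ K X) (a k : Fin N) :
    IndepFun (fun ω => X ω a k) (fun ω => cutEntry k a (X ω)) P := by
  classical
  have h1 := h.indepFun_keep {sortedPair k a}
  have h2 := h1.comp (φ := fun Y => Y a k) (ψ := fun Y => Y)
    (measurable_entry measurable_id a k) measurable_id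
  have e1 : ((fun Y : Matrix (Fin N) (Fin N) ℂ => Y a k) ∘ fun ω => keep {sortedPair k a} (X ω)) =
      fun ω => X ω a k := by
    funext ω
    simp [keep, sortedPair_comm a k]
  have e2 : ((fun Y : Matrix (Fin N) (Fin N) ℂ => Y) ∘
      fun ω => keep ({sortedPair k a} : Finset _)ᶜ (X ω)) = fun ω => cutEntry k a (X ω) := by
    funext ω
    ext i j
    simp only [Function.comp, keep, cutEntry, Matrix.of_apply, Finset.mem_compl,
      Finset.mem_singleton, sortedPair_eq_iff]
    split_ifs <;> rfl
  rwa [e1, e2] at h2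

/-- A row is independent of the matrix with this row and column removed. -/
theorem indep_row (h : IsModel P σ K X) (k : Fin N) :
    IndepFun (fun ω => (offCol k (X ω), X ω k k)) (fun ω => cutRow k (X ω)) P := by
  classical
  set S : Finset {p : Fin N × Fin N // p.1 ≤ p.2} :=
    Finset.univ.filter fun p => p.1.1 = k ∨ p.1.2 = k with hS
  have hmem : ∀ i j, sortedPair i j ∈ S ↔ (i = k ∨ j = k) := by
    intro i j
    simp only [hS, sortedPair, Finset.mem_filter, Finset.mem_univ, true_and]
    rcases le_total i j with h | h
    · simp [h]
    · simp [h, or_comm]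
  have h2 := (h.indepFun_keep S).comp (φ := fun Y => (offCol k Y, Y k k)) (ψ := fun Y => Y)
    ((measurable_offCol k).prodMk (measurable_entry measurable_id k k)) measurable_id
  have e1 : ((fun Y : Matrix (Fin N) (Fin N) ℂ => (offCol k Y, Y k k)) ∘
      fun ω => keep S (X ω)) = fun ω => (offCol k (X ω), X ω k k) := by
    funext ω
    simp only [Function.comp, keep, Matrix.of_apply, hmem, true_or, if_true, Prod.mk.injEq, and_true]
    funext a
    simp [offCol]
  have e2 : ((fun Y : Matrix (Fin N) (Fin N) ℂ => Y) ∘ fun ω => keep Sᶜ (X ω)) =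
      fun ω => cutRow k (X ω) := by
    funext ω
    ext i j
    simp only [Function.comp, keep, cutRow, Matrix.of_apply, Finset.mem_compl, hmem]
    split_ifs <;> rfl
  rwa [e1, e2] at h2

theorem meas_offCol (h : IsModel P σ K X) (k : Fin N) : Measurable fun ω => offCol k (X ω) :=
  (measurable_offCol k).comp h.meas

theorem meas_cutRow (h : IsModel P σ K X) (k : Fin N) : Measurable fun ω => cutRow k (X ω) :=
  (measurable_cutRow k).comp h.meas

theorem indep_offCol (h : IsModel P σ K X) (k : Fin N) :
    IndepFun (fun ω => offCol k (X ω)) (fun ω => cutRow k (X ω)) P :=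
  (h.indep_row k).comp measurable_fst measurable_id

theorem kappa_nonneg (h : IsModel P σ K X) : 0 ≤ K / √N :=
  div_nonneg (zero_le_one.trans h.one_le) (Real.sqrt_nonneg _)

/-- Setting the pair `(k, a)` to zero in the matrix sets coordinate `a` to zero in the column, so
the independence of one coordinate from the others comes from `indep_entry`. -/
theorem centeredVec [IsProbabilityMeasure P] (h : IsModel P σ K X) (k : Fin N) :
    CenteredVec P (fun ω => offCol k (X ω)) (K / √N) := by
  refine ⟨h.meas_offCol k, fun a => ?_, fun a => ?_, fun a => ?_, fun a => ?_⟩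
  · by_cases hak : a = k
    · simp only [offCol, hak, if_true]
      exact indepFun_const_left _ _
    · have h1 := (h.indep_entry a k).comp (φ := fun z => z) measurable_id (measurable_offCol k)
      have e : ∀ ω, offCol k (cutEntry k a (X ω)) = Function.update (offCol k (X ω)) a 0 := by
        intro ω
        funext b
        simp only [offCol, cutEntry, Matrix.of_apply, Function.update_apply]
        by_cases hb : b = a
        · subst hb; simp [hak]
        · by_cases hbk : b = k
          · simp [hbk]
          · simp [hb, hbk]
      simpa only [Function.comp_def, e, offCol, if_neg hak] using h1
  · by_cases hak : a = k
    · simp [offCol, hak]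
    · simpa [offCol, hak] using h.mean a k
  · by_cases hak : a = k
    · simpa [offCol, hak] using L2Bound.zero.mono h.kappa_nonneg
    · simpa [offCol, hak] using h.second a k
  · by_cases hak : a = k
    · simpa [offCol, hak] using L2Bound.zero.mono (sq_nonneg (K / √N))
    · simpa [offCol, hak] using h.fourth a k hak

theorem integral_offCol_mul (h : IsModel P σ K X) (k a : Fin N) :
    ∫ ω, offCol k (X ω) a * starRingEnd ℂ (offCol k (X ω) a) ∂P =
      if a = k then 0 else ((σ ^ 2 / N : ℝ) : ℂ) := by
  by_cases hak : a = k
  · simp [offCol, hak]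
  · simp only [offCol, if_neg hak]
    exact h.second_eq a k hak

theorem sum_integral_offCol_mul (h : IsModel P σ K X) (k : Fin N)
    (A : Matrix (Fin N) (Fin N) ℂ) :
    ∑ a, (∫ ω, offCol k (X ω) a * starRingEnd ℂ (offCol k (X ω) a) ∂P) * A a a =
      ((σ ^ 2 / N : ℝ) : ℂ) * ∑ l ∈ Finset.univ.erase k, A l l := by
  rw [← Finset.add_sum_erase _ _ (Finset.mem_univ k), Finset.mul_sum, h.integral_offCol_mul,
    if_pos rfl, zero_mul, zero_add]
  refine Finset.sum_congr rfl fun a ha => ?_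
  rw [h.integral_offCol_mul, if_neg (Finset.ne_of_mem_erase ha)]

theorem rowColBounded_evol {M : Matrix (Fin N) (Fin N) ℂ} (hM : M.IsHermitian) (s : ℝ) :
    RowColBounded (evol M s) :=
  ⟨fun l => (sum_norm_sq_evol_row hM s l).le, fun m => (sum_norm_sq_evol_col hM s m).le⟩

theorem _root_.Wigner.mul_div_sqrt_sq_mul_sqrt {N : ℕ} (hN : 0 < N) (c K : ℝ) :
    c * (K / √N) ^ 2 * √N = c * K ^ 2 / √N := by
  have : 0 < √(N : ℝ) := Real.sqrt_pos.2 (by exact_mod_cast hN)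
  field_simp

variable [IsProbabilityMeasure P]

/-- With the complementary matrix frozen, the coefficients form a row of a unitary matrix and hence
a unit vector, so the conditional bound is that of a single entry. -/
theorem l2Bound_linForm (h : IsModel P σ K X) (k j : Fin N) (s : ℝ) :
    L2Bound P (fun ω => linForm (cutRow k (X ω)) (offCol k (X ω)) j s) (K / √N) := by
  refine L2Bound.of_fiber_const (G := fun x M => linForm M x j s) (h.meas_offCol k)
    (h.meas_cutRow k) (h.indep_offCol k)
    (measurable_linForm measurable_snd measurable_fst measurable_const j) fun ω => ?_
  have := (h.centeredVec k).l2Bound_linear zero_le_one h.kappa_nonneg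
    (b := evol (cutRow k (X ω)) s j)
    (by rw [one_pow]; exact (sum_norm_sq_evol_row (cutRow_isHermitian k (h.herm ω)) s j).le)
  simpa [linForm] using this

/-- The conditional expectation of the quadratic form, given the complementary matrix. -/
noncomputable def _root_.Wigner.quadMean (σ : ℝ) (k : Fin N) (M : Matrix (Fin N) (Fin N) ℂ)
    (s : ℝ) : ℂ :=
  ((σ ^ 2 / N : ℝ) : ℂ) * ∑ l ∈ Finset.univ.erase k, evol M s l l

theorem l2Bound_quadForm (h : IsModel P σ K X) (k : Fin N) (s : ℝ) :
    L2Bound P (fun ω => quadForm (cutRow k (X ω)) (offCol k (X ω)) s -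
      quadMean σ k (cutRow k (X ω)) s) (4 * K ^ 2 / √N) := by
  rw [← mul_div_sqrt_sq_mul_sqrt k.pos]
  refine L2Bound.of_fiber_const (G := fun x M => quadForm M x s - quadMean σ k M s)
    (h.meas_offCol k) (h.meas_cutRow k) (h.indep_offCol k) ?_ fun ω => ?_
  · exact (measurable_quadForm measurable_snd measurable_fst measurable_const).sub
      (measurable_const.mul (Finset.measurable_sum _ fun l _ =>
        measurable_evol measurable_snd measurable_const l l))
  · have := (h.centeredVec k).l2Bound_quad h.kappa_nonneg
      (rowColBounded_evol (cutRow_isHermitian k (h.herm ω)) s)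
    rw [h.sum_integral_offCol_mul] at this
    exact this

end IsModel

end Wigner

namespace Wigner

/-! ### The spectral representation of the evolution -/

section Spectral

variable {N : ℕ} {X : Matrix (Fin N) (Fin N) ℂ}

theorem evol_eq_conj (hX : X.IsHermitian) (t : ℝ) :
    evol X t = (hX.eigenvectorUnitary : Matrix (Fin N) (Fin N) ℂ) *
      Matrix.diagonal (fun l => Complex.exp (Complex.I * t * hX.eigenvalues l)) *
      star (hX.eigenvectorUnitary : Matrix (Fin N) (Fin N) ℂ) := by
  set u := Unitary.toUnits hX.eigenvectorUnitary with hu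
  have h1 : X = (u : Matrix (Fin N) (Fin N) ℂ) *
      Matrix.diagonal (RCLike.ofReal ∘ hX.eigenvalues) * ((u⁻¹ : (Matrix (Fin N) (Fin N) ℂ)ˣ) :
        Matrix (Fin N) (Fin N) ℂ) := by
    conv_lhs => rw [hX.spectral_theorem]
    rw [Unitary.conjStarAlgAut_apply]
    rfl
  have h2 : t • (Complex.I • X) = (u : Matrix (Fin N) (Fin N) ℂ) *
      (t • (Complex.I • Matrix.diagonal (RCLike.ofReal ∘ hX.eigenvalues))) *
        ((u⁻¹ : (Matrix (Fin N) (Fin N) ℂ)ˣ) : Matrix (Fin N) (Fin N) ℂ) := by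
    conv_lhs => rw [h1]
    simp only [Matrix.mul_smul, Matrix.smul_mul]
  rw [evol, h2, Matrix.exp_units_conj, ← Matrix.diagonal_smul, ← Matrix.diagonal_smul,
    Matrix.exp_diagonal]
  have h3 : (NormedSpace.exp (t • Complex.I • (RCLike.ofReal ∘ hX.eigenvalues : Fin N → ℂ))) =
      fun l => Complex.exp (Complex.I * t * hX.eigenvalues l) := by
    funext l
    rw [Pi.coe_exp, Complex.exp_eq_exp_ℂ]
    congr 1
    simp [mul_left_comm, mul_assoc]
  rw [h3]
  rfl

theorem evol_apply_eq_sum (hX : X.IsHermitian) (t : ℝ) (i j : Fin N) :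
    evol X t i j = ∑ l, (hX.eigenvectorUnitary : Matrix (Fin N) (Fin N) ℂ) i l *
      Complex.exp (Complex.I * t * hX.eigenvalues l) *
      starRingEnd ℂ ((hX.eigenvectorUnitary : Matrix (Fin N) (Fin N) ℂ) j l) := by
  rw [evol_eq_conj hX, Matrix.mul_apply]
  refine Finset.sum_congr rfl fun l _ => ?_
  rw [Matrix.mul_diagonal]
  rfl

theorem cfc_apply_eq_sum (hX : X.IsHermitian) (f : ℝ → ℝ) (i j : Fin N) :
    cfc f X i j = ∑ l, (hX.eigenvectorUnitary : Matrix (Fin N) (Fin N) ℂ) i l *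
      (f (hX.eigenvalues l) : ℂ) *
      starRingEnd ℂ ((hX.eigenvectorUnitary : Matrix (Fin N) (Fin N) ℂ) j l) := by
  rw [hX.cfc_eq, Matrix.IsHermitian.cfc, Unitary.conjStarAlgAut_apply, Matrix.mul_apply]
  refine Finset.sum_congr rfl fun l _ => ?_
  rw [Matrix.mul_diagonal]
  rfl

theorem trace_evol (hX : X.IsHermitian) (t : ℝ) :
    ∑ l, evol X t l l = ∑ l, Complex.exp (Complex.I * t * hX.eigenvalues l) := by
  have h : (evol X t).trace = _ := congrArg Matrix.trace (evol_eq_conj hX t)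
  rw [Matrix.trace_mul_cycle, Unitary.coe_star_mul_self, Matrix.one_mul, Matrix.trace_diagonal] at h
  exact h

/-! ### Pathwise equations for the normalized trace and for the diagonal entries. -/

/-- The normalized trace of the evolution. -/
noncomputable def avgTrace (X : Matrix (Fin N) (Fin N) ℂ) (t : ℝ) : ℂ :=
  ((1 / N : ℝ) : ℂ) * ∑ l, evol X t l l

/-- The trace is a sum of characters at the eigenvalues. This holds for every realisation, so the
stability estimate can be applied pathwise with a random kernel. -/
theorem isPosDef_avgTrace (hX : X.IsHermitian) : IsPosDef (avgTrace X) := by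
  have h := (IsPosDef.sum Finset.univ fun l _ =>
    IsPosDef.character (hX.eigenvalues l)).const_mul (c := 1 / N) (by positivity)
  have e : avgTrace X = fun t : ℝ => ((1 / N : ℝ) : ℂ) *
      ∑ l, Complex.exp (Complex.I * t * hX.eigenvalues l) := by
    funext t
    rw [avgTrace, trace_evol hX]
  rw [e]
  exact h

theorem continuous_avgTrace : Continuous (avgTrace X) :=
  continuous_const.mul (continuous_finsetSum _ fun l _ => continuous_evol_apply l l)

/-- The deviation of the quadratic form of row `k` from its expected value. -/
noncomputable def quadDev (σ : ℝ) (X : Matrix (Fin N) (Fin N) ℂ) (k : Fin N) (s : ℝ) : ℂ :=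
  quadForm (cutRow k X) (offCol k X) s - ((σ ^ 2 : ℝ) : ℂ) * avgTrace X s

theorem continuous_quadDev (σ : ℝ) (k : Fin N) : Continuous (quadDev σ X k) :=
  (continuous_quadForm _ _).sub (continuous_const.mul continuous_avgTrace)

/-- The error in the equation of the `k`-th diagonal entry, uniformly on `[0, T]`. -/
noncomputable def diagErr (σ : ℝ) (X : Matrix (Fin N) (Fin N) ℂ) (T : ℝ) (k : Fin N) : ℝ :=
  (∫ s in (0 : ℝ)..T, ‖quadDev σ X k s‖) + ‖X k k‖

theorem diagErr_nonneg (σ : ℝ) {T : ℝ} (hT : 0 ≤ T) (k : Fin N) : 0 ≤ diagErr σ X T k :=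
  add_nonneg (intervalIntegral.integral_nonneg hT fun _ _ => norm_nonneg _) (norm_nonneg _)

/-- The derivative of a diagonal entry. -/
noncomputable def diagDeriv (X : Matrix (Fin N) (Fin N) ℂ) (k : Fin N) (t : ℝ) : ℂ :=
  Complex.I * X k k * evol X t k k -
    conv (quadForm (cutRow k X) (offCol k X)) (fun s => evol X s k k) t

theorem hasDerivAt_diag (hX : X.IsHermitian) (k : Fin N) (t : ℝ) :
    HasDerivAt (fun t => evol X t k k) (diagDeriv X k t) t :=
  hasDerivAt_evol_diag k hX t

/-- Replacing the quadratic form by `σ²` times the normalized trace turns the exact equation into a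
linear one whose kernel is the same for all `k`. The replacement and the diagonal entry `X_kk` make
up the error. -/
theorem norm_diagDeriv_add_le (hX : X.IsHermitian) (σ : ℝ) (k : Fin N) {t T : ℝ} (ht : 0 ≤ t)
    (htT : t ≤ T) :
    ‖diagDeriv X k t + ((σ ^ 2 : ℝ) : ℂ) * conv (avgTrace X) (fun s => evol X s k k) t‖ ≤
      diagErr σ X T k := by
  have hc := continuous_evol_apply (X := X) k k
  have e : diagDeriv X k t + ((σ ^ 2 : ℝ) : ℂ) * conv (avgTrace X) (fun s => evol X s k k) t =
      -conv (quadDev σ X k) (fun s => evol X s k k) t + Complex.I * X k k * evol X t k k := by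
    have hc2 : Continuous fun s => ((σ ^ 2 : ℝ) : ℂ) * avgTrace X s :=
      continuous_const.mul continuous_avgTrace
    have := conv_sub_left (continuous_quadForm (cutRow k X) (offCol k X)) hc2 hc t
    rw [conv_const_mul_left] at this
    rw [diagDeriv]
    unfold quadDev
    rw [this]
    ring
  rw [e, diagErr]
  refine (norm_add_le _ _).trans (add_le_add ?_ ?_)
  · rw [norm_neg]
    exact norm_conv_le (continuous_quadDev σ k) (fun s => norm_evol_le hX s k k) ht htT
  · rw [norm_mul, norm_mul, Complex.norm_I, one_mul]
    exact mul_le_of_le_one_right (norm_nonneg _) (norm_evol_le hX t k k)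

theorem hasDerivAt_avgTrace (hX : X.IsHermitian) (t : ℝ) :
    HasDerivAt (avgTrace X) (((1 / N : ℝ) : ℂ) * ∑ l, diagDeriv X l t) t :=
  (HasDerivAt.fun_sum fun l _ => hasDerivAt_diag hX l t).const_mul _

/-- Averaging the linear equations over `k` makes the solution coincide with the kernel: a
self-consistent quadratic equation. -/
theorem norm_deriv_avgTrace_add_le (hX : X.IsHermitian) (σ : ℝ) {t T : ℝ} (ht : 0 ≤ t)
    (htT : t ≤ T) :
    ‖((1 / N : ℝ) : ℂ) * ∑ l, diagDeriv X l t +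
      ((σ ^ 2 : ℝ) : ℂ) * conv (avgTrace X) (avgTrace X) t‖ ≤
      1 / N * ∑ l, diagErr σ X T l := by
  have e : conv (avgTrace X) (avgTrace X) t =
      ((1 / N : ℝ) : ℂ) * ∑ l, conv (avgTrace X) (fun s => evol X s l l) t := by
    rw [← conv_sum_right Finset.univ continuous_avgTrace fun l _ => continuous_evol_apply l l,
      ← conv_const_mul_right]
    rfl
  rw [e, mul_left_comm, ← mul_add, Finset.mul_sum, ← Finset.sum_add_distrib, norm_mul,
    Complex.norm_real, Real.norm_of_nonneg (by positivity)]
  gcongr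
  exact (norm_sum_le _ _).trans (Finset.sum_le_sum fun l _ => norm_diagDeriv_add_le hX σ l ht htT)

/-- The normalized trace is close to the characteristic function of the semicircle distribution. -/
theorem norm_avgTrace_sub_scChar_le (hX : X.IsHermitian) {σ : ℝ} (hσ : 0 < σ) (hN : 0 < N) {T : ℝ}
    (hT : 0 ≤ T) :
    ‖avgTrace X T - scChar σ T‖ ≤ 2 * (1 / N * ∑ l, diagErr σ X T l) * T := by
  have hτ := isPosDef_avgTrace hX
  have hφ := isPosDef_scChar hσ
  have h0 : avgTrace X 0 - scChar σ 0 = 0 := by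
    have : (N : ℂ) ≠ 0 := by exact_mod_cast hN.ne'
    simp [avgTrace, scChar_zero hσ, this]
  -- Since `τ * τ - φ * φ = (τ + φ) * (τ - φ)`, the difference of the two quadratic equations is
  -- linear with the positive definite kernel `σ²(τ + φ)`.
  refine ((hτ.add hφ).const_mul (sq_nonneg σ)).norm_le (δ := fun t => avgTrace X t - scChar σ t)
    h0 hT (fun t => (hasDerivAt_avgTrace hX t).sub (hasDerivAt_scChar_conv hσ t)) fun t ht => ?_
  refine le_trans (le_of_eq ?_) (norm_deriv_avgTrace_add_le hX σ ht.1 ht.2)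
  congr 1
  have hc : Continuous fun t => avgTrace X t + scChar σ t := hτ.cont.add hφ.cont
  rw [conv_const_mul_left, conv_sub_right hτ.cont hφ.cont hc,
    conv_add_left hτ.cont hφ.cont hτ.cont, conv_add_left hτ.cont hφ.cont hφ.cont,
    conv_comm (avgTrace X) (scChar σ)]
  ring

/-- The diagonal entry and the trace both solve the linear equation with kernel `σ²` times the
trace, with the same initial value, so their difference is driven by the two errors only. -/
theorem norm_evol_sub_avgTrace_le (hX : X.IsHermitian) (σ : ℝ) (k : Fin N) {T : ℝ}
    (hT : 0 ≤ T) :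
    ‖evol X T k k - avgTrace X T‖ ≤
      2 * (diagErr σ X T k + 1 / N * ∑ l, diagErr σ X T l) * T := by
  have hτ := isPosDef_avgTrace hX
  have hc := continuous_evol_apply (X := X) k k
  have h0 : evol X 0 k k - avgTrace X 0 = 0 := by
    have : (N : ℂ) ≠ 0 := by exact_mod_cast k.pos.ne'
    simp [avgTrace, this]
  refine (hτ.const_mul (sq_nonneg σ)).norm_le (δ := fun t => evol X t k k - avgTrace X t)
    h0 hT (fun t => (hasDerivAt_diag hX k t).sub (hasDerivAt_avgTrace hX t)) fun t ht => ?_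
  refine le_trans (le_of_eq ?_) ((norm_sub_le _ _).trans (add_le_add
    (norm_diagDeriv_add_le hX σ k ht.1 ht.2) (norm_deriv_avgTrace_add_le hX σ ht.1 ht.2)))
  congr 1
  rw [conv_const_mul_left, conv_sub_right hc hτ.cont hτ.cont]
  ring

end Spectral

/-! ### Concentration of the entries of the evolution in `L²`. -/

namespace IsModel

variable {Ω : Type*} [MeasurableSpace Ω] {P : Measure Ω} [IsProbabilityMeasure P] {N : ℕ}
  {σ K : ℝ} {X : Ω → Matrix (Fin N) (Fin N) ℂ}

theorem l2Bound_norm_offCol (h : IsModel P σ K X) (k : Fin N) :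
    L2Bound P (fun ω => (√(∑ a, ‖offCol k (X ω) a‖ ^ 2) : ℂ)) K := by
  have hK : 0 ≤ K := zero_le_one.trans h.one_le
  have hx := h.centeredVec k
  have hm : Measurable fun ω => (√(∑ a, ‖offCol k (X ω) a‖ ^ 2) : ℂ) := by
    have : ∀ a, Measurable fun ω => ‖offCol k (X ω) a‖ ^ 2 := fun a =>
      (hx.meas_apply a).norm.pow_const 2
    exact Complex.measurable_ofReal.comp (Finset.measurable_sum _ fun a _ => this a).sqrt
  rw [l2Bound_iff_lintegral hK hm.aestronglyMeasurable]
  have e : ∀ ω, ‖(√(∑ a, ‖offCol k (X ω) a‖ ^ 2) : ℂ)‖ₑ ^ 2 =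
      ∑ a, ‖offCol k (X ω) a‖ₑ ^ 2 := by
    intro ω
    rw [← ofReal_norm, Complex.norm_real, Real.norm_of_nonneg (Real.sqrt_nonneg _),
      ← ENNReal.ofReal_pow (Real.sqrt_nonneg _), Real.sq_sqrt (by positivity),
      ENNReal.ofReal_sum_of_nonneg fun _ _ => by positivity]
    refine Finset.sum_congr rfl fun a _ => ?_
    rw [ENNReal.ofReal_pow (norm_nonneg _), ofReal_norm]
  simp_rw [e]
  rw [lintegral_finsetSum _ fun a _ => (hx.meas_apply a).enorm.pow_const 2]
  refine (Finset.sum_le_sum fun a _ => (hx.second a).lintegral_le).trans (le_of_eq ?_)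
  have hN : (0 : ℝ) < N := by exact_mod_cast k.pos
  rw [Finset.sum_const, Finset.card_univ, Fintype.card_fin, nsmul_eq_mul, div_pow,
    Real.sq_sqrt hN.le, ← ENNReal.ofReal_natCast, ← ENNReal.ofReal_mul hN.le]
  congr 1
  field_simp

theorem measurable_quadMean {α : Type*} [MeasurableSpace α] (σ : ℝ) (k : Fin N)
    {Y : α → Matrix (Fin N) (Fin N) ℂ} {f : α → ℝ} (hY : Measurable Y) (hf : Measurable f) :
    Measurable fun a => quadMean σ k (Y a) (f a) :=
  measurable_const.mul (Finset.measurable_sum _ fun l _ => measurable_evol hY hf l l)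

theorem measurable_avgTrace {α : Type*} [MeasurableSpace α]
    {Y : α → Matrix (Fin N) (Fin N) ℂ} {f : α → ℝ} (hY : Measurable Y) (hf : Measurable f) :
    Measurable fun a => avgTrace (Y a) (f a) :=
  measurable_const.mul (Finset.measurable_sum _ fun l _ => measurable_evol hY hf l l)

/-- Passing from the trace of the complementary matrix to the full trace is a perturbation of rank
at most two, so after normalization it costs only `1/N`. -/
theorem l2Bound_quadMean_sub (h : IsModel P σ K X) (k : Fin N) {s : ℝ} (hs : 0 ≤ s) :
    L2Bound P (fun ω => quadMean σ k (cutRow k (X ω)) s - ((σ ^ 2 : ℝ) : ℂ) * avgTrace (X ω) s)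
      (K ^ 2 * (1 + s * K) / N) := by
  have hN : (0 : ℝ) < N := by exact_mod_cast k.pos
  have hK : 0 ≤ K := zero_le_one.trans h.one_le
  have h1 : L2Bound P (fun ω => ((K ^ 2 / N : ℝ) : ℂ) * (1 + (s : ℂ) *
      (√(∑ a, ‖offCol k (X ω) a‖ ^ 2) : ℂ))) (‖((K ^ 2 / N : ℝ) : ℂ)‖ * (1 + ‖(s : ℂ)‖ * K)) :=
    ((L2Bound.of_bounded aestronglyMeasurable_const zero_le_one fun _ => by simp).add
      ((h.l2Bound_norm_offCol k).const_mul (s : ℂ))).const_mul _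
  have h2 : ‖((K ^ 2 / N : ℝ) : ℂ)‖ * (1 + ‖(s : ℂ)‖ * K) = K ^ 2 * (1 + s * K) / N := by
    rw [Complex.norm_real, Complex.norm_real, Real.norm_of_nonneg hs,
      Real.norm_of_nonneg (by positivity)]
    ring
  rw [h2] at h1
  refine h1.of_norm_le ?_ fun ω => ?_
  · exact ((measurable_quadMean σ k (h.meas_cutRow k) measurable_const).sub
      (measurable_const.mul (measurable_avgTrace h.meas measurable_const))).aestronglyMeasurable
  · have e : quadMean σ k (cutRow k (X ω)) s - ((σ ^ 2 : ℝ) : ℂ) * avgTrace (X ω) s =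
        -(((σ ^ 2 / N : ℝ) : ℂ) * (∑ l, evol (X ω) s l l -
          ∑ l ∈ Finset.univ.erase k, evol (cutRow k (X ω)) s l l)) := by
      rw [quadMean, avgTrace]; push_cast; ring
    rw [e, norm_neg, norm_mul, norm_mul, Complex.norm_real, Complex.norm_real,
      Real.norm_of_nonneg (by positivity), Real.norm_of_nonneg (by positivity)]
    have e2 : ‖(1 + (s : ℂ) * (√(∑ a, ‖offCol k (X ω) a‖ ^ 2) : ℂ))‖ =
        1 + s * √(∑ a, ‖offCol k (X ω) a‖ ^ 2) := by
      rw [← Complex.ofReal_mul, ← Complex.ofReal_one, ← Complex.ofReal_add, Complex.norm_real,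
        Real.norm_of_nonneg (by positivity)]
    rw [e2]
    have := h.pos
    have := h.le
    gcongr
    exact norm_trace_sub_sum_cutRow_le k (h.herm ω) hs

theorem l2Bound_quadDev (h : IsModel P σ K X) (k : Fin N) {s T : ℝ} (hs : 0 ≤ s) (hsT : s ≤ T) :
    L2Bound P (fun ω => quadDev σ (X ω) k s) (4 * K ^ 2 / √N + K ^ 2 * (1 + T * K) / N) := by
  have hK : 0 ≤ K := zero_le_one.trans h.one_le
  have h1 := ((h.l2Bound_quadForm k s).add (h.l2Bound_quadMean_sub k hs)).mono
    (B := 4 * K ^ 2 / √N + K ^ 2 * (1 + T * K) / N) (by gcongr)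
  simpa [quadDev] using h1

theorem measurable_quadDev (h : IsModel P σ K X) (k : Fin N) :
    Measurable (Function.uncurry fun s ω => quadDev σ (X ω) k s) :=
  (measurable_quadForm ((h.meas_cutRow k).comp measurable_snd)
    ((h.meas_offCol k).comp measurable_snd) measurable_fst).sub
    (measurable_const.mul (measurable_avgTrace (h.meas.comp measurable_snd) measurable_fst))

/-- The bound on the error in the diagonal equation. -/
noncomputable def _root_.Wigner.errBound (N : ℕ) (K T : ℝ) : ℝ :=
  T * (4 * K ^ 2 / √N + K ^ 2 * (1 + T * K) / N) + K / √N

theorem l2Bound_diagErr (h : IsModel P σ K X) (k : Fin N) {T : ℝ} (hT : 0 ≤ T) :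
    L2Bound P (fun ω => (diagErr σ (X ω) T k : ℂ)) (errBound N K T) := by
  have h1 := L2Bound.intervalIntegral_norm (P := P) (h.measurable_quadDev k) hT
    (B := 4 * K ^ 2 / √N + K ^ 2 * (1 + T * K) / N) fun s hs => h.l2Bound_quadDev k hs.1 hs.2
  have := h1.add (h.second k k).norm
  simpa [diagErr, errBound] using this

theorem l2Bound_avg_diagErr (h : IsModel P σ K X) (hN : 0 < N) {T : ℝ} (hT : 0 ≤ T) :
    L2Bound P (fun ω => ((1 / N * ∑ l, diagErr σ (X ω) T l : ℝ) : ℂ)) (errBound N K T) := by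
  have h1 := (L2Bound.sum Finset.univ fun k _ => h.l2Bound_diagErr k hT).const_mul
    ((1 / N : ℝ) : ℂ)
  have hN' : (0 : ℝ) < N := by exact_mod_cast hN
  have e : ‖((1 / N : ℝ) : ℂ)‖ * ∑ _k : Fin N, errBound N K T = errBound N K T := by
    rw [Complex.norm_real, Real.norm_of_nonneg (by positivity)]
    simp
    field_simp
  rw [e] at h1
  simpa using h1

/-- For `T² ≤ √N` the contribution of order `T²/N` is dominated by the terms of order `N^(-1/2)`,
and the bound becomes linear in `T`. -/
theorem errBound_le (hK : 1 ≤ K) (hN : 0 < N) {T : ℝ} (hT : 0 ≤ T) (hTN : T ^ 2 ≤ √N) :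
    errBound N K T ≤ 7 * K ^ 3 * (1 + T) / √N := by
  have hN1 : 1 ≤ √(N : ℝ) := by rw [Real.one_le_sqrt]; exact_mod_cast hN
  have hs : (N : ℝ) = √N ^ 2 := (Real.sq_sqrt (Nat.cast_nonneg N)).symm
  have e : errBound N K T = (T * (4 * K ^ 2) + (T * K ^ 2 + T ^ 2 * K ^ 3) / √N + K) / √N := by
    rw [errBound]
    generalize √(N : ℝ) = r at *
    have hr : 0 < r := by linarith
    rw [hs]
    field_simp
  rw [e]
  clear e hs
  generalize √(N : ℝ) = r at *
  have hr : 0 < r := by linarith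
  gcongr
  have h1 : (T * K ^ 2 + T ^ 2 * K ^ 3) / r ≤ T * K ^ 2 + K ^ 3 := by
    rw [div_le_iff₀ hr]
    have h2 : T ^ 2 * K ^ 3 ≤ r * K ^ 3 := by gcongr
    have h3 : T * K ^ 2 ≤ T * K ^ 2 * r := le_mul_of_one_le_right (by positivity) hN1
    nlinarith
  have hK2 : K ^ 2 ≤ K ^ 3 := pow_le_pow_right₀ hK (by norm_num)
  have hK1 : K ≤ K ^ 3 := le_self_pow₀ hK (by norm_num)
  have h4 : T * K ^ 2 ≤ T * K ^ 3 := by gcongr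
  have h5 : 0 ≤ K ^ 3 := by positivity
  have h6 : 0 ≤ T * K ^ 3 := by positivity
  nlinarith

theorem l2Bound_avgTrace_sub (h : IsModel P σ K X) (hN : 0 < N) {T : ℝ} (hT : 0 ≤ T) :
    L2Bound P (fun ω => avgTrace (X ω) T - scChar σ T) (2 * T * errBound N K T) := by
  have h1 := (h.l2Bound_avg_diagErr hN hT).const_mul ((2 * T : ℝ) : ℂ)
  rw [Complex.norm_real, Real.norm_of_nonneg (by positivity)] at h1
  refine h1.of_norm_le ((measurable_avgTrace h.meas measurable_const).sub_const _
    |>.aestronglyMeasurable) fun ω => ?_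
  refine (norm_avgTrace_sub_scChar_le (h.herm ω) h.pos hN hT).trans (le_of_eq ?_)
  have h0 : 0 ≤ 1 / (N : ℝ) * ∑ l, diagErr σ (X ω) T l :=
    mul_nonneg (by positivity) (Finset.sum_nonneg fun l _ => diagErr_nonneg σ hT l)
  rw [norm_mul, Complex.norm_real, Complex.norm_real, Real.norm_of_nonneg (by positivity),
    Real.norm_of_nonneg h0]
  ring

theorem l2Bound_evol_sub_avgTrace (h : IsModel P σ K X) (k : Fin N) {T : ℝ} (hT : 0 ≤ T) :
    L2Bound P (fun ω => evol (X ω) T k k - avgTrace (X ω) T) (4 * T * errBound N K T) := by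
  have h1 := ((h.l2Bound_diagErr k hT).add (h.l2Bound_avg_diagErr k.pos hT)).const_mul
    ((2 * T : ℝ) : ℂ)
  rw [Complex.norm_real, Real.norm_of_nonneg (by positivity)] at h1
  refine (h1.of_norm_le (((measurable_evol h.meas measurable_const k k).sub
    (measurable_avgTrace h.meas measurable_const)).aestronglyMeasurable) fun ω => ?_).mono
      (le_of_eq (by ring))
  refine (norm_evol_sub_avgTrace_le (h.herm ω) σ k hT).trans (le_of_eq ?_)
  have h0 : 0 ≤ 1 / (N : ℝ) * ∑ l, diagErr σ (X ω) T l :=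
    mul_nonneg (by positivity) (Finset.sum_nonneg fun l _ => diagErr_nonneg σ hT l)
  rw [norm_mul, ← Complex.ofReal_add, Complex.norm_real, Complex.norm_real,
    Real.norm_of_nonneg (by positivity),
    Real.norm_of_nonneg (add_nonneg (diagErr_nonneg σ hT k) h0)]
  ring

theorem norm_avgTrace_le {A : Matrix (Fin N) (Fin N) ℂ} (hA : A.IsHermitian) (t : ℝ) :
    ‖avgTrace A t‖ ≤ 1 := by
  rw [avgTrace, norm_mul, Complex.norm_real, Real.norm_of_nonneg (by positivity)]
  calc 1 / (N : ℝ) * ‖∑ l, evol A t l l‖ ≤ 1 / N * ∑ _l : Fin N, (1 : ℝ) := by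
        gcongr
        exact (norm_sum_le _ _).trans (Finset.sum_le_sum fun l _ => norm_evol_le hA t l l)
    _ ≤ 1 := by
        simp only [Finset.sum_const, Finset.card_univ, Fintype.card_fin, nsmul_eq_mul, mul_one]
        rw [one_div]
        exact inv_mul_le_one

/-- An `L²` estimate that is only needed for times up to `N ^ (1 / 4)`. -/
theorem l2Bound_of_errBound (hK : 1 ≤ K) (hN : 0 < N) {T c : ℝ} (hT : 0 ≤ T) (hc : 2 ≤ 7 * c)
    {f : Ω → ℂ} (hf : AEStronglyMeasurable f P) (hf2 : ∀ ω, ‖f ω‖ ≤ 2)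
    (h : L2Bound P f (c * T * errBound N K T)) :
    L2Bound P f (7 * c * K ^ 3 * (1 + T) ^ 2 / √N) := by
  have hr : 0 < √(N : ℝ) := Real.sqrt_pos.2 (by exact_mod_cast hN)
  have hc0 : 0 ≤ c := by linarith
  by_cases hTN : T ^ 2 ≤ √N
  · refine h.mono ?_
    have h1 := errBound_le hK hN hT hTN
    calc c * T * errBound N K T ≤ c * (1 + T) * (7 * K ^ 3 * (1 + T) / √N) := by
          gcongr
          · have := errBound_le hK hN hT hTN
            unfold errBound
            positivity
          · linarith
      _ = _ := by ring
  -- For later times `√N < T²`, and the claimed bound already exceeds the trivial bound 2.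
  · refine (L2Bound.of_bounded hf (by norm_num) hf2).mono ?_
    rw [le_div_iff₀ hr]
    have hK3 : 1 ≤ K ^ 3 := one_le_pow₀ hK
    have h2 : √(N : ℝ) ≤ (1 + T) ^ 2 := by nlinarith
    calc 2 * √(N : ℝ) ≤ 2 * (1 + T) ^ 2 := by gcongr
      _ ≤ (7 * c) * K ^ 3 * (1 + T) ^ 2 := by
        gcongr
        nlinarith

theorem l2Bound_avgTrace (h : IsModel P σ K X) (hN : 0 < N) {T : ℝ} (hT : 0 ≤ T) :
    L2Bound P (fun ω => avgTrace (X ω) T - scChar σ T) (14 * K ^ 3 * (1 + T) ^ 2 / √N) := by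
  refine (l2Bound_of_errBound h.one_le hN hT (c := 2) (by norm_num)
    (h.l2Bound_avgTrace_sub hN hT).meas (fun ω => ?_) (h.l2Bound_avgTrace_sub hN hT)).mono
      (le_of_eq (by ring))
  refine (norm_sub_le _ _).trans ?_
  linarith [norm_avgTrace_le (h.herm ω) T, norm_scChar_le h.pos T]

/-- Concentration of the diagonal entries around the semicircle law. -/
theorem l2Bound_evol_diag (h : IsModel P σ K X) (k : Fin N) {T : ℝ} (hT : 0 ≤ T) :
    L2Bound P (fun ω => evol (X ω) T k k - scChar σ T) (42 * K ^ 3 * (1 + T) ^ 2 / √N) := by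
  have h1 : L2Bound P (fun ω => evol (X ω) T k k - scChar σ T) (6 * T * errBound N K T) := by
    have := ((h.l2Bound_evol_sub_avgTrace k hT).add (h.l2Bound_avgTrace_sub k.pos hT)).mono
      (le_of_eq (by ring : _ = 6 * T * errBound N K T))
    simpa using this
  refine (l2Bound_of_errBound h.one_le k.pos hT (c := 6) (by norm_num) h1.meas (fun ω => ?_)
    h1).mono (le_of_eq (by ring))
  refine (norm_sub_le _ _).trans ?_
  linarith [norm_evol_le (h.herm ω) T k k, norm_scChar_le h.pos T]

/-- The off-diagonal entries are small in `L²`. -/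
theorem l2Bound_evol_off_diag (h : IsModel P σ K X) {j k : Fin N} (hjk : j ≠ k) {T : ℝ}
    (hT : 0 ≤ T) : L2Bound P (fun ω => evol (X ω) T j k) (T * (K / √N)) := by
  have h1 := L2Bound.intervalIntegral_norm (P := P)
    (η := fun s ω => linForm (cutRow k (X ω)) (offCol k (X ω)) j s)
    (measurable_linForm ((h.meas_cutRow k).comp measurable_snd)
      ((h.meas_offCol k).comp measurable_snd) measurable_fst j) hT
    fun s _ => h.l2Bound_linForm k j s
  refine h1.of_norm_le (measurable_evol h.meas measurable_const j k).aestronglyMeasurable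
    fun ω => ?_
  rw [evol_off_diag k hjk, intervalIntegral.integral_const_mul, norm_mul, Complex.norm_I, one_mul,
    Complex.norm_real, Real.norm_of_nonneg
      (intervalIntegral.integral_nonneg hT fun _ _ => norm_nonneg _)]
  exact norm_conv_le (g := fun s => evol (X ω) s k k) (continuous_linForm _ _ _)
    (fun s => norm_evol_le (h.herm ω) s k k) hT le_rfl

end IsModel

end Wigner

namespace Wigner

/-! ### Expectations of the entries of the evolution -/

section Domination

variable {N : ℕ} {M : Matrix (Fin N) (Fin N) ℂ}

theorem norm_linForm_le (hM : M.IsHermitian) (x : Fin N → ℂ) (j : Fin N) (s : ℝ) :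
    ‖linForm M x j s‖ ≤ √(∑ a, ‖x a‖ ^ 2) := by
  refine Real.le_sqrt_of_sq_le ?_
  rw [← sum_norm_sq_linForm hM x s]
  exact Finset.single_le_sum (f := fun j => ‖linForm M x j s‖ ^ 2) (fun _ _ => by positivity)
    (Finset.mem_univ j)

theorem norm_quadForm_le (hM : M.IsHermitian) (x : Fin N → ℂ) (s : ℝ) :
    ‖quadForm M x s‖ ≤ ∑ a, ‖x a‖ ^ 2 := by
  rw [quadForm_eq_sum_linForm]
  calc ‖∑ a, starRingEnd ℂ (x a) * linForm M x a s‖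
      ≤ ∑ a, ‖x a‖ * ‖linForm M x a s‖ :=
        (norm_sum_le _ _).trans (le_of_eq (by simp))
    _ ≤ √(∑ a, ‖x a‖ ^ 2) * √(∑ a, ‖linForm M x a s‖ ^ 2) := Real.sum_mul_le_sqrt_mul_sqrt _ _ _
    _ = ∑ a, ‖x a‖ ^ 2 := by
        rw [sum_norm_sq_linForm hM, Real.mul_self_sqrt (by positivity)]

end Domination

/-- An expectation vanishes if all its conditional expectations do. -/
theorem integral_eq_zero_of_fiber {Ω : Type*} [MeasurableSpace Ω] {P : Measure Ω}
    [IsProbabilityMeasure P] {E F : Type*} [MeasurableSpace E] [MeasurableSpace F] {x : Ω → E}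
    {M : Ω → F} (hx : Measurable x) (hM : Measurable M) (hxM : IndepFun x M P) {G : E → F → ℂ}
    (hG : Measurable (Function.uncurry G)) (h0 : ∀ ω, ∫ ω', G (x ω') (M ω) ∂P = 0) :
    ∫ ω, G (x ω) (M ω) ∂P = 0 := by
  by_cases hi : Integrable (fun ω => G (x ω) (M ω)) P
  · have hp : P.map (fun ω => (x ω, M ω)) = (P.map x).prod (P.map M) :=
      (indepFun_iff_map_prod_eq_prod_map_map hx.aemeasurable hM.aemeasurable).1 hxM
    have : IsProbabilityMeasure (P.map x) := Measure.isProbabilityMeasure_map hx.aemeasurable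
    have : IsProbabilityMeasure (P.map M) := Measure.isProbabilityMeasure_map hM.aemeasurable
    have e : ∫ ω, G (x ω) (M ω) ∂P =
        ∫ p, Function.uncurry G p ∂(P.map fun ω => (x ω, M ω)) :=
      (integral_map (hx.prodMk hM).aemeasurable hG.aestronglyMeasurable).symm
    have hi2 : Integrable (Function.uncurry G) (P.map fun ω => (x ω, M ω)) :=
      (integrable_map_measure hG.aestronglyMeasurable (hx.prodMk hM).aemeasurable).2 hi
    rw [hp] at e hi2
    rw [e, integral_prod_symm _ hi2, integral_map hM.aemeasurable
      (f := fun y => ∫ z, Function.uncurry G (z, y) ∂P.map x)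
      hi2.swap.integral_prod_left.aestronglyMeasurable]
    refine (integral_congr_ae (Filter.Eventually.of_forall fun ω => ?_)).trans (integral_zero _ _)
    simp only [Function.uncurry]
    rw [integral_map hx.aemeasurable (hG.of_uncurry_right).aestronglyMeasurable]
    exact h0 ω
  -- A non-integrable integrand has integral zero by convention, so no integrability hypothesis is
  -- needed.
  · exact integral_undef hi

theorem CenteredVec.integral_quad {Ω : Type*} [MeasurableSpace Ω] {P : Measure Ω}
    {N : ℕ} {x : Ω → Fin N → ℂ} {κ : ℝ} (hx : CenteredVec P x κ) (A : Matrix (Fin N) (Fin N) ℂ) :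
    ∫ ω, quad A (x ω) ∂P = ∑ a, (∫ ω, x ω a * starRingEnd ℂ (x ω a) ∂P) * A a a := by
  have hi : ∀ a b, Integrable (fun ω => starRingEnd ℂ (x ω a) * A a b * x ω b) P := fun a b => by
    refine (((hx.second a).star.integrable_mul (hx.second b)).const_mul (A a b)).congr
      (Filter.Eventually.of_forall fun ω => ?_)
    simp only; ring
  unfold quad
  rw [integral_finsetSum _ fun a _ => integrable_finsetSum _ fun b _ => hi a b]
  refine Finset.sum_congr rfl fun a _ => ?_
  rw [integral_finsetSum _ fun b _ => hi a b, Finset.sum_eq_single a]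
  · rw [← integral_mul_const]
    refine integral_congr_ae (Filter.Eventually.of_forall fun ω => ?_)
    simp only; ring
  · intro b _ hba
    have := hx.integral_mul_eq_zero b (y := fun z => z) measurable_id (hx.mean b)
      (G := fun v => starRingEnd ℂ (v a) * A a b)
      (((RCLike.continuous_conj (K := ℂ)).measurable.comp (measurable_pi_apply a)).mul_const _)
      fun v => by
        rw [Function.update_of_ne hba.symm]
    rw [← this]
    refine integral_congr_ae (Filter.Eventually.of_forall fun ω => ?_)
    simp only; ring
  · simp

namespace IsModel

variable {Ω : Type*} [MeasurableSpace Ω] {P : Measure Ω} [IsProbabilityMeasure P] {N : ℕ}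
  {σ K : ℝ} {X : Ω → Matrix (Fin N) (Fin N) ℂ}

/-- The squared norm of a column without its diagonal entry. -/
noncomputable def _root_.Wigner.colSq (k : Fin N) (X : Matrix (Fin N) (Fin N) ℂ) : ℝ :=
  ∑ a, ‖offCol k X a‖ ^ 2

theorem colSq_nonneg (k : Fin N) (A : Matrix (Fin N) (Fin N) ℂ) : 0 ≤ colSq k A := by
  unfold colSq; positivity

theorem l2Bound_colSq (h : IsModel P σ K X) (k : Fin N) :
    L2Bound P (fun ω => (colSq k (X ω) : ℂ)) (K ^ 2) := by
  have h1 := L2Bound.sum Finset.univ fun a _ => (h.centeredVec k).fourth a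
  have hN : (0 : ℝ) < N := by exact_mod_cast k.pos
  have e : ∑ _a : Fin N, (K / √N) ^ 2 = K ^ 2 := by
    rw [Finset.sum_const, Finset.card_univ, Fintype.card_fin, nsmul_eq_mul, div_pow,
      Real.sq_sqrt hN.le]
    field_simp
  rw [e] at h1
  convert h1 using 2 with ω
  rw [colSq]
  push_cast
  exact Finset.sum_congr rfl fun a _ => (Complex.mul_conj' _).symm

theorem integrable_sqrt_colSq (h : IsModel P σ K X) (k : Fin N) :
    Integrable (fun ω => √(colSq k (X ω))) P := by
  simpa [colSq] using (h.l2Bound_norm_offCol k).integrable.re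

theorem norm_linForm_le_colSq (h : IsModel P σ K X) (k j : Fin N) (s : ℝ) (ω : Ω) :
    ‖linForm (cutRow k (X ω)) (offCol k (X ω)) j s‖ ≤ √(colSq k (X ω)) :=
  norm_linForm_le (cutRow_isHermitian k (h.herm ω)) _ _ _

theorem norm_quadForm_le_colSq (h : IsModel P σ K X) (k : Fin N) (s : ℝ) (ω : Ω) :
    ‖quadForm (cutRow k (X ω)) (offCol k (X ω)) s‖ ≤ colSq k (X ω) :=
  norm_quadForm_le (cutRow_isHermitian k (h.herm ω)) _ _

theorem meas_linForm (h : IsModel P σ K X) (k j : Fin N) (s : ℝ) :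
    Measurable fun ω => linForm (cutRow k (X ω)) (offCol k (X ω)) j s :=
  measurable_linForm (h.meas_cutRow k) (h.meas_offCol k) measurable_const j

theorem meas_quadForm (h : IsModel P σ K X) (k : Fin N) (s : ℝ) :
    Measurable fun ω => quadForm (cutRow k (X ω)) (offCol k (X ω)) s :=
  measurable_quadForm (h.meas_cutRow k) (h.meas_offCol k) measurable_const

theorem l2Bound_quadForm_crude (h : IsModel P σ K X) (k : Fin N) (s : ℝ) :
    L2Bound P (fun ω => quadForm (cutRow k (X ω)) (offCol k (X ω)) s) (K ^ 2) :=
  (h.l2Bound_colSq k).of_norm_le (h.meas_quadForm k s).aestronglyMeasurable fun ω => by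
    rw [Complex.norm_real, Real.norm_of_nonneg (colSq_nonneg k _)]
    exact h.norm_quadForm_le_colSq k s ω

theorem l2Bound_evol (h : IsModel P σ K X) (i j : Fin N) (t : ℝ) :
    L2Bound P (fun ω => evol (X ω) t i j) 1 :=
  L2Bound.of_bounded (measurable_evol h.meas measurable_const i j).aestronglyMeasurable
    zero_le_one fun ω => norm_evol_le (h.herm ω) t i j

theorem integrable_evol (h : IsModel P σ K X) (i j : Fin N) (t : ℝ) :
    Integrable (fun ω => evol (X ω) t i j) P :=
  (h.l2Bound_evol i j t).integrable

theorem integral_offCol (h : IsModel P σ K X) (k a : Fin N) :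
    ∫ ω, offCol k (X ω) a ∂P = 0 := (h.centeredVec k).mean a

theorem integral_linForm_mul (h : IsModel P σ K X) (k j : Fin N) (s : ℝ)
    {G : Matrix (Fin N) (Fin N) ℂ → ℂ} (hG : Measurable G) :
    ∫ ω, linForm (cutRow k (X ω)) (offCol k (X ω)) j s * G (cutRow k (X ω)) ∂P = 0 := by
  refine integral_eq_zero_of_fiber (G := fun x M => linForm M x j s * G M) (h.meas_offCol k)
    (h.meas_cutRow k) (h.indep_offCol k)
    ((measurable_linForm measurable_snd measurable_fst measurable_const j).mul
      (hG.comp measurable_snd)) fun ω => ?_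
  have hx := h.centeredVec k
  rw [integral_mul_const]
  unfold linForm
  rw [integral_finsetSum _ fun a _ => (hx.second a).integrable.const_mul _]
  simp_rw [integral_const_mul, h.integral_offCol]
  simp

theorem integral_linForm (h : IsModel P σ K X) (k j : Fin N) (s : ℝ) :
    ∫ ω, linForm (cutRow k (X ω)) (offCol k (X ω)) j s ∂P = 0 := by
  simpa using h.integral_linForm_mul k j s (G := fun _ => 1) measurable_const

theorem integral_quadForm (h : IsModel P σ K X) (k : Fin N) (s : ℝ) :
    ∫ ω, quadForm (cutRow k (X ω)) (offCol k (X ω)) s ∂P =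
      ∫ ω, quadMean σ k (cutRow k (X ω)) s ∂P := by
  have hx := h.centeredVec k
  have hq := h.l2Bound_quadForm k s
  have h0 := integral_eq_zero_of_fiber (G := fun x M => quadForm M x s - quadMean σ k M s)
    (h.meas_offCol k) (h.meas_cutRow k) (h.indep_offCol k)
    ((measurable_quadForm measurable_snd measurable_fst measurable_const).sub
      (measurable_quadMean σ k measurable_snd measurable_const)) fun ω => by
        have hi : Integrable (fun ω' => quadForm (cutRow k (X ω)) (offCol k (X ω')) s) P := by
          have := ((hx.l2Bound_quad h.kappa_nonneg (rowColBounded_evol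
            (cutRow_isHermitian k (h.herm ω)) s)).integrable).add (integrable_const
              (∑ a, (∫ ω, offCol k (X ω) a * starRingEnd ℂ (offCol k (X ω) a) ∂P) *
                evol (cutRow k (X ω)) s a a))
          refine this.congr (Filter.Eventually.of_forall fun ω' => ?_)
          simp [quadForm, quad]
        rw [integral_sub hi (integrable_const _), integral_const, probReal_univ, one_smul,
          quadMean, ← h.sum_integral_offCol_mul, ← hx.integral_quad]
        exact sub_self _
  have hi := (h.l2Bound_quadForm_crude k s).integrable
  have hi2 := (hi.sub hq.integrable).congr (Filter.Eventually.of_forall fun ω => by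
    show _ = quadMean σ k (cutRow k (X ω)) s
    simp)
  rwa [integral_sub hi hi2, sub_eq_zero] at h0

/-- The off-diagonal entries have small expectation. -/
theorem norm_integral_evol_off_diag_le (h : IsModel P σ K X) {j k : Fin N} (hjk : j ≠ k) {T : ℝ}
    (hT : 0 ≤ T) : ‖∫ ω, evol (X ω) T j k ∂P‖ ≤ 42 * K ^ 4 * (1 + T) ^ 3 / N := by
  have hN : (0 : ℝ) < N := by exact_mod_cast k.pos
  have hK : 0 ≤ K := zero_le_one.trans h.one_le
  have h1 : ∫ ω, evol (X ω) T j k ∂P = ∫ s in (0 : ℝ)..T, ∫ ω, Complex.I *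
      (linForm (cutRow k (X ω)) (offCol k (X ω)) j s * evol (X ω) (T - s) k k) ∂P := by
    simp_rw [evol_off_diag k hjk T]
    refine integral_intervalIntegral_comm ?_ hT (h.integrable_sqrt_colSq k) fun s _ ω => ?_
    · exact measurable_const.mul ((measurable_linForm ((h.meas_cutRow k).comp measurable_snd)
        ((h.meas_offCol k).comp measurable_snd) measurable_fst j).mul
        (measurable_evol (h.meas.comp measurable_snd) (measurable_const.sub measurable_fst) k k))
    · rw [norm_mul, norm_mul, Complex.norm_I, one_mul]
      exact (mul_le_of_le_one_right (norm_nonneg _) (norm_evol_le (h.herm ω) _ k k)).trans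
        (h.norm_linForm_le_colSq k j s ω)
  rw [h1]
  have h2 : ∀ s ∈ Set.uIoc 0 T, ‖∫ ω, Complex.I *
      (linForm (cutRow k (X ω)) (offCol k (X ω)) j s * evol (X ω) (T - s) k k) ∂P‖ ≤
        K / √N * (42 * K ^ 3 * (1 + T) ^ 2 / √N) := by
    intro s hs
    rw [Set.uIoc_of_le hT] at hs
    rw [integral_const_mul, norm_mul, Complex.norm_I, one_mul]
    have hl := h.l2Bound_linForm k j s
    -- The linear form has mean zero, so the deterministic limit may be subtracted from the diagonal
    -- entry. Two factors of order `N^(-1/2)` then give `1/N`.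
    have e : ∫ ω, linForm (cutRow k (X ω)) (offCol k (X ω)) j s * evol (X ω) (T - s) k k ∂P =
        ∫ ω, linForm (cutRow k (X ω)) (offCol k (X ω)) j s *
          (evol (X ω) (T - s) k k - scChar σ (T - s)) ∂P := by
      simp_rw [mul_sub]
      rw [integral_sub (hl.integrable_mul (h.l2Bound_evol k k _)) (hl.integrable.mul_const _),
        integral_mul_const, h.integral_linForm, zero_mul, sub_zero]
    rw [e]
    refine (hl.norm_integral_mul_le (h.l2Bound_evol_diag k (sub_nonneg.2 hs.2))).trans ?_
    have := hs.1
    gcongr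
    · linarith [hs.2]
    · linarith [hs.2]
  refine (intervalIntegral.norm_integral_le_of_norm_le_const h2).trans ?_
  rw [sub_zero, abs_of_nonneg hT]
  calc K / √N * (42 * K ^ 3 * (1 + T) ^ 2 / √N) * T
      = 42 * K ^ 4 * ((1 + T) ^ 2 * T) / (√N * √N) := by ring
    _ ≤ 42 * K ^ 4 * (1 + T) ^ 3 / N := by
      rw [Real.mul_self_sqrt hN.le]
      gcongr
      nlinarith [sq_nonneg (1 + T)]

/-- The expected diagonal entry. -/
noncomputable def _root_.Wigner.meanDiag (P : Measure Ω) (X : Ω → Matrix (Fin N) (Fin N) ℂ)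
    (k : Fin N) (t : ℝ) : ℂ := ∫ ω, evol (X ω) t k k ∂P

/-- The expected normalized trace. -/
noncomputable def _root_.Wigner.meanTrace (P : Measure Ω) (X : Ω → Matrix (Fin N) (Fin N) ℂ)
    (t : ℝ) : ℂ := ((1 / N : ℝ) : ℂ) * ∑ l, meanDiag P X l t

theorem integral_avgTrace (h : IsModel P σ K X) (t : ℝ) :
    ∫ ω, avgTrace (X ω) t ∂P = meanTrace P X t := by
  unfold avgTrace meanTrace meanDiag
  rw [integral_const_mul, integral_finsetSum _ fun l _ => h.integrable_evol l l t]

theorem norm_diagDeriv_le (h : IsModel P σ K X) (k : Fin N) {t T : ℝ} (htT : |t| ≤ T) (ω : Ω) :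
    ‖diagDeriv (X ω) k t‖ ≤ ‖X ω k k‖ + T * colSq k (X ω) := by
  rw [diagDeriv]
  refine (norm_sub_le _ _).trans (add_le_add ?_ ?_)
  · rw [norm_mul, norm_mul, Complex.norm_I, one_mul]
    exact mul_le_of_le_one_right (norm_nonneg _) (norm_evol_le (h.herm ω) t k k)
  · have : ∀ s ∈ Set.uIoc 0 t, ‖quadForm (cutRow k (X ω)) (offCol k (X ω)) s *
        evol (X ω) (t - s) k k‖ ≤ colSq k (X ω) := fun s _ => by
      rw [norm_mul]
      exact (mul_le_of_le_one_right (norm_nonneg _) (norm_evol_le (h.herm ω) _ k k)).trans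
        (h.norm_quadForm_le_colSq k s ω)
    refine (intervalIntegral.norm_integral_le_of_norm_le_const this).trans ?_
    rw [sub_zero, mul_comm]
    exact mul_le_mul_of_nonneg_right htT (colSq_nonneg k _)

/-- By uniqueness of the derivative, the convolution formula agrees with an entry of a matrix
product, where measurability is visible. -/
theorem measurable_diagDeriv (h : IsModel P σ K X) (k : Fin N) (t : ℝ) :
    Measurable fun ω => diagDeriv (X ω) k t := by
  have e : (fun ω => diagDeriv (X ω) k t) =
      fun ω => ((Complex.I • X ω) * evol (X ω) t) k k := by
    funext ω
    exact (hasDerivAt_diag (h.herm ω) k t).unique (hasDerivAt_evol_apply t k k)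
  rw [e]
  simp only [Matrix.mul_apply, Matrix.smul_apply, smul_eq_mul]
  exact Finset.measurable_sum _ fun l _ => (measurable_const.mul
    (measurable_entry h.meas k l)).mul (measurable_evol h.meas measurable_const l k)

/-- Differentiation under the expectation. -/
theorem hasDerivAt_integral_mul_evol (h : IsModel P σ K X) (k : Fin N) {g : Ω → ℂ}
    {B : ℝ} (hg : L2Bound P g B) (t : ℝ) :
    HasDerivAt (fun t => ∫ ω, g ω * evol (X ω) t k k ∂P)
      (∫ ω, g ω * diagDeriv (X ω) k t ∂P) t := by
  -- Times in the unit ball around `t` are at most `|t| + 1` in absolute value, which yields a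
  -- single dominating function.
  have hb : Integrable (fun ω => ‖g ω‖ * (‖X ω k k‖ + (|t| + 1) * colSq k (X ω))) P := by
    have h1 := (hg.integrable_mul (h.second k k)).norm
    have h2 := (hg.integrable_mul ((h.l2Bound_colSq k).const_mul ((|t| + 1 : ℝ) : ℂ))).norm
    refine (h1.add h2).congr (Filter.Eventually.of_forall fun ω => ?_)
    simp only [Pi.add_apply, norm_mul, Complex.norm_real, Real.norm_of_nonneg (colSq_nonneg k _),
      Real.norm_of_nonneg (by positivity : 0 ≤ |t| + 1)]
    ring
  refine (hasDerivAt_integral_of_dominated_loc_of_deriv_le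
    (F' := fun t ω => g ω * diagDeriv (X ω) k t) (Metric.ball_mem_nhds t one_pos)
    (Filter.Eventually.of_forall fun r => ?_) ?_ ?_ ?_ hb ?_).2
  · exact (hg.integrable_mul (h.l2Bound_evol k k r)).aestronglyMeasurable
  · exact hg.integrable_mul (h.l2Bound_evol k k t)
  · exact hg.meas.mul (h.measurable_diagDeriv k t).aestronglyMeasurable
  · refine Filter.Eventually.of_forall fun ω r hr => ?_
    rw [norm_mul]
    refine mul_le_mul_of_nonneg_left (h.norm_diagDeriv_le k ?_ ω) (norm_nonneg _)
    rw [Metric.mem_ball, Real.dist_eq] at hr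
    have := abs_sub_abs_le_abs_sub r t
    linarith
  · exact Filter.Eventually.of_forall fun ω r _ =>
      (hasDerivAt_diag (h.herm ω) k r).const_mul (g ω)

/-- The expectation of the derivative of a diagonal entry. -/
theorem integral_mul_diagDeriv (h : IsModel P σ K X) (k : Fin N) {g : Ω → ℂ} (hgm : Measurable g)
    {B : ℝ} (hg : L2Bound P g B) {t : ℝ} (ht : 0 ≤ t) :
    ∫ ω, g ω * diagDeriv (X ω) k t ∂P =
      Complex.I * (∫ ω, g ω * X ω k k * evol (X ω) t k k ∂P) -
        ∫ s in (0 : ℝ)..t, ∫ ω, g ω * (quadForm (cutRow k (X ω)) (offCol k (X ω)) s *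
          evol (X ω) (t - s) k k) ∂P := by
  have i1 : Integrable (fun ω => g ω * X ω k k * evol (X ω) t k k) P := by
    have := hg.integrable_mul ((h.second k k).mul_bounded
      (h.l2Bound_evol k k t).meas fun ω => norm_evol_le (h.herm ω) t k k)
    simpa [mul_assoc] using this
  have hG : Integrable (fun ω => ‖g ω‖ * colSq k (X ω)) P := by
    refine (hg.integrable_mul (h.l2Bound_colSq k)).norm.congr
      (Filter.Eventually.of_forall fun ω => ?_)
    simp only [norm_mul, Complex.norm_real, Real.norm_of_nonneg (colSq_nonneg k _)]
  have hm : Measurable (Function.uncurry fun s ω => g ω *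
      (quadForm (cutRow k (X ω)) (offCol k (X ω)) s * evol (X ω) (t - s) k k)) :=
    (hgm.comp measurable_snd).mul ((measurable_quadForm ((h.meas_cutRow k).comp measurable_snd)
      ((h.meas_offCol k).comp measurable_snd) measurable_fst).mul
      (measurable_evol (h.meas.comp measurable_snd) (measurable_const.sub measurable_fst) k k))
  have hd : ∀ s ω, ‖g ω * (quadForm (cutRow k (X ω)) (offCol k (X ω)) s *
      evol (X ω) (t - s) k k)‖ ≤ ‖g ω‖ * colSq k (X ω) := fun s ω => by
    rw [norm_mul, norm_mul]
    gcongr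
    exact (mul_le_of_le_one_right (norm_nonneg _) (norm_evol_le (h.herm ω) _ k k)).trans
        (h.norm_quadForm_le_colSq k s ω)
  rw [← integral_intervalIntegral_comm hm ht hG fun s _ ω => hd s ω, ← integral_const_mul,
    ← integral_sub (i1.const_mul _)]
  · refine integral_congr_ae (Filter.Eventually.of_forall fun ω => ?_)
    simp only [diagDeriv, conv, intervalIntegral.integral_const_mul]
    ring
  · have e : (fun ω => ∫ s in (0 : ℝ)..t, g ω * (quadForm (cutRow k (X ω)) (offCol k (X ω)) s *
        evol (X ω) (t - s) k k)) = fun ω => Complex.I * (g ω * X ω k k * evol (X ω) t k k) -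
          g ω * diagDeriv (X ω) k t := by
      funext ω
      simp only [diagDeriv, conv, intervalIntegral.integral_const_mul]
      ring
    rw [e]
    refine (i1.const_mul _).sub ?_
    refine Integrable.mono' (g := fun ω => ‖g ω‖ * ‖X ω k k‖ + t * (‖g ω‖ * colSq k (X ω))) ?_
      (hg.meas.mul (h.measurable_diagDeriv k t).aestronglyMeasurable)
      (Filter.Eventually.of_forall fun ω => ?_)
    · refine Integrable.add ?_ (hG.const_mul t)
      simpa using (hg.integrable_mul (h.second k k)).norm
    · rw [norm_mul]
      refine (mul_le_mul_of_nonneg_left (h.norm_diagDeriv_le k (abs_of_nonneg ht).le ω)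
        (norm_nonneg _)).trans (le_of_eq (by ring))

end IsModel

end Wigner

/-! ### The bias of the diagonal entries at order `1/N`. -/

namespace Wigner

namespace IsModel

variable {Ω : Type*} [MeasurableSpace Ω] {P : Measure Ω} [IsProbabilityMeasure P] {N : ℕ}
  {σ K : ℝ} {X : Ω → Matrix (Fin N) (Fin N) ℂ}

theorem inv_le_inv_sqrt {N : ℕ} (hN : 0 < N) {c : ℝ} (hc : 0 ≤ c) : c / N ≤ c / √N := by
  have hN1 : 1 ≤ √(N : ℝ) := by rw [Real.one_le_sqrt]; exact_mod_cast hN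
  have h : √(N : ℝ) ≤ N := by
    nlinarith [Real.mul_self_sqrt (Nat.cast_nonneg (α := ℝ) N)]
  gcongr

theorem l2Bound_quadMean_sub_le (h : IsModel P σ K X) (k : Fin N) {s T : ℝ} (hs : 0 ≤ s)
    (hsT : s ≤ T) :
    L2Bound P (fun ω => quadMean σ k (cutRow k (X ω)) s - ((σ ^ 2 : ℝ) : ℂ) * avgTrace (X ω) s)
      (K ^ 3 * (1 + T) / N) := by
  refine (h.l2Bound_quadMean_sub k hs).mono ?_
  have hK := h.one_le
  have : K ^ 2 * (1 + s * K) ≤ K ^ 3 * (1 + T) := by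
    calc K ^ 2 * (1 + s * K) ≤ K ^ 2 * (K + T * K) := by gcongr
      _ = K ^ 3 * (1 + T) := by ring
  gcongr

theorem l2Bound_quadMean_sub_scChar (h : IsModel P σ K X) (k : Fin N) {s T : ℝ} (hs : 0 ≤ s)
    (hsT : s ≤ T) :
    L2Bound P (fun ω => quadMean σ k (cutRow k (X ω)) s - ((σ ^ 2 : ℝ) : ℂ) * scChar σ s)
      (15 * K ^ 5 * (1 + T) ^ 2 / √N) := by
  have hK := h.one_le
  have h1 := (h.l2Bound_quadMean_sub_le k hs hsT).add
    ((h.l2Bound_avgTrace k.pos hs).const_mul ((σ ^ 2 : ℝ) : ℂ))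
  have hT : 0 ≤ T := hs.trans hsT
  have hp := h.pos
  rw [Complex.norm_real, Real.norm_of_nonneg (by positivity)] at h1
  have h2 : K ^ 3 * (1 + T) / N + σ ^ 2 * (14 * K ^ 3 * (1 + s) ^ 2 / √N) ≤
      15 * K ^ 5 * (1 + T) ^ 2 / √N := by
    calc K ^ 3 * (1 + T) / N + σ ^ 2 * (14 * K ^ 3 * (1 + s) ^ 2 / √N)
        ≤ K ^ 5 * (1 + T) ^ 2 / √N + K ^ 2 * (14 * K ^ 3 * (1 + T) ^ 2 / √N) := by
          refine add_le_add ((inv_le_inv_sqrt k.pos (by positivity)).trans ?_) ?_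
          · gcongr
            · norm_num
            · exact le_self_pow₀ (by linarith) (by norm_num)
          · have := h.le
            gcongr
      _ = _ := by ring
  refine (h1.mono h2).congr_norm ?_ fun ω => ?_
  · exact ((measurable_quadMean σ k (h.meas_cutRow k) measurable_const).sub
      measurable_const).aestronglyMeasurable
  · congr 1
    ring

theorem l2Bound_quadForm_sub_scChar (h : IsModel P σ K X) (k : Fin N) {s T : ℝ} (hs : 0 ≤ s)
    (hsT : s ≤ T) :
    L2Bound P (fun ω => quadForm (cutRow k (X ω)) (offCol k (X ω)) s -
      ((σ ^ 2 : ℝ) : ℂ) * scChar σ s) (19 * K ^ 5 * (1 + T) ^ 2 / √N) := by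
  have hK := h.one_le
  have hT : 0 ≤ T := hs.trans hsT
  have h1 := (h.l2Bound_quadForm k s).add (h.l2Bound_quadMean_sub_scChar k hs hsT)
  have h2 : 4 * K ^ 2 / √N + 15 * K ^ 5 * (1 + T) ^ 2 / √N ≤ 19 * K ^ 5 * (1 + T) ^ 2 / √N := by
    rw [← add_div]
    gcongr
    have h3 : K ^ 2 ≤ K ^ 5 * (1 + T) ^ 2 := by
      calc K ^ 2 = K ^ 2 * 1 ^ 2 := by ring
        _ ≤ K ^ 5 * (1 + T) ^ 2 := by
          gcongr
          · norm_num
          · linarith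
    linarith
  refine (h1.mono h2).congr_norm ?_ fun ω => ?_
  · exact ((h.meas_quadForm k s).sub measurable_const).aestronglyMeasurable
  · congr 1
    ring

/-- The derivative of the expected diagonal entry. -/
noncomputable def _root_.Wigner.meanDeriv (P : Measure Ω) (X : Ω → Matrix (Fin N) (Fin N) ℂ)
    (k : Fin N) (t : ℝ) : ℂ := ∫ ω, diagDeriv (X ω) k t ∂P

theorem hasDerivAt_meanDiag (h : IsModel P σ K X) (k : Fin N) (t : ℝ) :
    HasDerivAt (meanDiag P X k) (meanDeriv P X k t) t := by
  have := h.hasDerivAt_integral_mul_evol k (g := fun _ => 1)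
    (L2Bound.of_bounded aestronglyMeasurable_const zero_le_one fun _ => by simp) t
  simp only [one_mul] at this
  exact this

theorem continuous_meanDiag (h : IsModel P σ K X) (k : Fin N) : Continuous (meanDiag P X k) :=
  continuous_iff_continuousAt.2 fun t => (h.hasDerivAt_meanDiag k t).continuousAt

theorem hasDerivAt_meanTrace (h : IsModel P σ K X) (t : ℝ) :
    HasDerivAt (meanTrace P X) (((1 / N : ℝ) : ℂ) * ∑ l, meanDeriv P X l t) t :=
  (HasDerivAt.fun_sum fun l _ => h.hasDerivAt_meanDiag l t).const_mul _

theorem continuous_meanTrace (h : IsModel P σ K X) : Continuous (meanTrace P X) :=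
  continuous_iff_continuousAt.2 fun t => (h.hasDerivAt_meanTrace t).continuousAt

/-- The diagonal entry `X_kk` is centred, so it pairs with the fluctuation of the evolution only:
two factors of order `N^(-1/2)`. -/
theorem norm_integral_entry_mul_evol_le (h : IsModel P σ K X) (k : Fin N) {t T : ℝ} (ht : 0 ≤ t)
    (htT : t ≤ T) :
    ‖∫ ω, X ω k k * evol (X ω) t k k ∂P‖ ≤ 42 * K ^ 4 * (1 + T) ^ 2 / N := by
  have hx := h.second k k
  have e : ∫ ω, X ω k k * evol (X ω) t k k ∂P =
      ∫ ω, X ω k k * (evol (X ω) t k k - scChar σ t) ∂P := by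
    simp_rw [mul_sub]
    rw [integral_sub (hx.integrable_mul (h.l2Bound_evol k k _)) (hx.integrable.mul_const _),
      integral_mul_const, h.mean, zero_mul, sub_zero]
  rw [e]
  refine (hx.norm_integral_mul_le (h.l2Bound_evol_diag k ht)).trans ?_
  have hK : 0 ≤ K := zero_le_one.trans h.one_le
  calc K / √N * (42 * K ^ 3 * (1 + t) ^ 2 / √N) = 42 * K ^ 4 * (1 + t) ^ 2 / (√N * √N) := by ring
    _ ≤ _ := by
      rw [Real.mul_self_sqrt (Nat.cast_nonneg N)]
      gcongr

/-- The product is linearised around the deterministic limits `σ²φ(s)` and `φ(r)`. The first two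
terms enter the limiting linear equation. The last bracket holds the product of the two fluctuations
and the correction for using the complementary trace, both of order `1/N`. -/
theorem integral_quadForm_mul_evol (h : IsModel P σ K X) (k : Fin N) (s r : ℝ) :
    ∫ ω, quadForm (cutRow k (X ω)) (offCol k (X ω)) s * evol (X ω) r k k ∂P =
      ((σ ^ 2 : ℝ) : ℂ) * (scChar σ s * meanDiag P X k r) +
      ((σ ^ 2 : ℝ) : ℂ) * ((meanTrace P X s - scChar σ s) * scChar σ r) +
      ((∫ ω, (quadForm (cutRow k (X ω)) (offCol k (X ω)) s - ((σ ^ 2 : ℝ) : ℂ) * scChar σ s) *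
        (evol (X ω) r k k - scChar σ r) ∂P) +
      scChar σ r * ∫ ω, (quadMean σ k (cutRow k (X ω)) s -
        ((σ ^ 2 : ℝ) : ℂ) * avgTrace (X ω) s) ∂P) := by
  have hq := h.l2Bound_quadForm_crude k s
  have hu := h.l2Bound_evol k k r
  have hqm : Integrable (fun ω => quadMean σ k (cutRow k (X ω)) s) P :=
    (hq.integrable.sub (h.l2Bound_quadForm k s).integrable).congr
      (Filter.Eventually.of_forall fun ω => by
        show _ = quadMean σ k (cutRow k (X ω)) s
        simp)
  have ht : Integrable (fun ω => avgTrace (X ω) s) P :=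
    (integrable_finsetSum _ fun l _ => h.integrable_evol l l s).const_mul _
  have e1 : ∫ ω, (quadMean σ k (cutRow k (X ω)) s - ((σ ^ 2 : ℝ) : ℂ) * avgTrace (X ω) s) ∂P =
      (∫ ω, quadForm (cutRow k (X ω)) (offCol k (X ω)) s ∂P) -
        ((σ ^ 2 : ℝ) : ℂ) * meanTrace P X s := by
    rw [integral_sub hqm (ht.const_mul _), integral_const_mul, h.integral_avgTrace,
      h.integral_quadForm]
  have e2 : ∫ ω, (quadForm (cutRow k (X ω)) (offCol k (X ω)) s - ((σ ^ 2 : ℝ) : ℂ) * scChar σ s) *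
        (evol (X ω) r k k - scChar σ r) ∂P =
      (∫ ω, quadForm (cutRow k (X ω)) (offCol k (X ω)) s * evol (X ω) r k k ∂P) -
      ((∫ ω, quadForm (cutRow k (X ω)) (offCol k (X ω)) s ∂P) * scChar σ r) -
      ((σ ^ 2 : ℝ) : ℂ) * scChar σ s * (meanDiag P X k r - scChar σ r) := by
    have e3 : ∀ ω, (quadForm (cutRow k (X ω)) (offCol k (X ω)) s -
          ((σ ^ 2 : ℝ) : ℂ) * scChar σ s) * (evol (X ω) r k k - scChar σ r) =
        quadForm (cutRow k (X ω)) (offCol k (X ω)) s * evol (X ω) r k k -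
        quadForm (cutRow k (X ω)) (offCol k (X ω)) s * scChar σ r -
        ((σ ^ 2 : ℝ) : ℂ) * scChar σ s * (evol (X ω) r k k - scChar σ r) := fun ω => by ring
    simp_rw [e3]
    have i1 : Integrable (fun ω => quadForm (cutRow k (X ω)) (offCol k (X ω)) s *
        evol (X ω) r k k - quadForm (cutRow k (X ω)) (offCol k (X ω)) s * scChar σ r) P :=
      (hq.integrable_mul hu).sub (hq.integrable.mul_const _)
    have i2 : Integrable (fun ω => evol (X ω) r k k - scChar σ r) P :=
      hu.integrable.sub (integrable_const _)
    rw [integral_sub i1 (i2.const_mul _),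
      integral_sub (hq.integrable_mul hu) (hq.integrable.mul_const _), integral_mul_const,
      integral_const_mul, integral_sub hu.integrable (integrable_const _), integral_const,
      probReal_univ, one_smul, meanDiag]
  rw [e1, e2]
  ring

theorem norm_meanDeriv_add_le (h : IsModel P σ K X) (k : Fin N) {t T : ℝ} (ht : 0 ≤ t)
    (htT : t ≤ T) :
    ‖meanDeriv P X k t + (((σ ^ 2 : ℝ) : ℂ) * conv (scChar σ) (meanDiag P X k) t +
      ((σ ^ 2 : ℝ) : ℂ) * conv (fun s => meanTrace P X s - scChar σ s) (scChar σ) t)‖ ≤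
      841 * K ^ 8 * (1 + T) ^ 5 / N := by
  have hN : (0 : ℝ) < N := by exact_mod_cast k.pos
  have hK := h.one_le
  have hT : 0 ≤ T := ht.trans htT
  have hφ := (isPosDef_scChar h.pos).cont
  have hm := h.continuous_meanDiag k
  have hτ := h.continuous_meanTrace
  set e : ℝ → ℝ → ℂ := fun s r =>
    (∫ ω, (quadForm (cutRow k (X ω)) (offCol k (X ω)) s - ((σ ^ 2 : ℝ) : ℂ) * scChar σ s) *
        (evol (X ω) r k k - scChar σ r) ∂P) +
      scChar σ r * ∫ ω, (quadMean σ k (cutRow k (X ω)) s -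
        ((σ ^ 2 : ℝ) : ℂ) * avgTrace (X ω) s) ∂P with he
  have hi1 : IntervalIntegrable (fun s => ((σ ^ 2 : ℝ) : ℂ) *
      (scChar σ s * meanDiag P X k (t - s)) + ((σ ^ 2 : ℝ) : ℂ) *
      ((meanTrace P X s - scChar σ s) * scChar σ (t - s))) volume 0 t :=
    Continuous.intervalIntegrable (by fun_prop) _ _
  have hle : ∀ s ∈ Set.uIoc 0 t, ‖e s (t - s)‖ ≤ 799 * K ^ 8 * (1 + T) ^ 4 / N := by
    intro s hs
    rw [Set.uIoc_of_le ht] at hs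
    have hsT : s ≤ T := hs.2.trans htT
    have hts : 0 ≤ t - s := by linarith [hs.2]
    have htsT : t - s ≤ T := by linarith [hs.1]
    have h1 := (h.l2Bound_quadForm_sub_scChar k hs.1.le hsT).norm_integral_mul_le
      (h.l2Bound_evol_diag k hts)
    have h2 := (h.l2Bound_quadMean_sub_le k hs.1.le hsT).norm_integral_le
    have h3 := norm_scChar_le h.pos (t - s)
    calc ‖e s (t - s)‖ ≤ 19 * K ^ 5 * (1 + T) ^ 2 / √N * (42 * K ^ 3 * (1 + (t - s)) ^ 2 / √N) +
          1 * (K ^ 3 * (1 + T) / N) := by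
          refine (norm_add_le _ _).trans (add_le_add h1 ?_)
          rw [norm_mul]
          gcongr
      _ ≤ 19 * K ^ 5 * (1 + T) ^ 2 / √N * (42 * K ^ 3 * (1 + T) ^ 2 / √N) +
          1 * (K ^ 8 * (1 + T) ^ 4 / N) := by
          gcongr
          · norm_num
          · exact le_self_pow₀ (by linarith) (by norm_num)
      _ = 798 * K ^ 8 * (1 + T) ^ 4 / (√N * √N) + K ^ 8 * (1 + T) ^ 4 / N := by ring
      _ = _ := by rw [Real.mul_self_sqrt hN.le]; ring
  have e1 : meanDeriv P X k t = Complex.I * (∫ ω, X ω k k * evol (X ω) t k k ∂P) -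
      ∫ s in (0 : ℝ)..t, ((((σ ^ 2 : ℝ) : ℂ) * (scChar σ s * meanDiag P X k (t - s)) +
        ((σ ^ 2 : ℝ) : ℂ) * ((meanTrace P X s - scChar σ s) * scChar σ (t - s))) +
        e s (t - s)) := by
    have := h.integral_mul_diagDeriv k (g := fun _ => 1) measurable_const
      (L2Bound.of_bounded aestronglyMeasurable_const zero_le_one fun _ => by simp) ht
    simp only [one_mul] at this
    rw [meanDeriv, this]
    congr 1
    exact intervalIntegral.integral_congr fun s _ => h.integral_quadForm_mul_evol k s (t - s)
  -- The remainder is bounded on the interval. Its measurability in `s` is read off by writing it as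
  -- a parametric expectation minus a continuous function.
  have hi2 : IntervalIntegrable (fun s => e s (t - s)) volume 0 t := by
    have e2 : (fun s => e s (t - s)) = fun s =>
        (∫ ω, quadForm (cutRow k (X ω)) (offCol k (X ω)) s * evol (X ω) (t - s) k k ∂P) -
        (((σ ^ 2 : ℝ) : ℂ) * (scChar σ s * meanDiag P X k (t - s)) +
        ((σ ^ 2 : ℝ) : ℂ) * ((meanTrace P X s - scChar σ s) * scChar σ (t - s))) := by
      funext s
      rw [h.integral_quadForm_mul_evol]
      simp [he]
    refine (intervalIntegrable_const (c := 799 * K ^ 8 * (1 + T) ^ 4 / N)).mono_fun ?_ ?_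
    · rw [e2]
      refine AEStronglyMeasurable.sub ?_ (Continuous.aestronglyMeasurable (by fun_prop))
      have hm2 : Measurable (Function.uncurry fun s ω =>
          quadForm (cutRow k (X ω)) (offCol k (X ω)) s * evol (X ω) (t - s) k k) :=
        (measurable_quadForm ((h.meas_cutRow k).comp measurable_snd)
          ((h.meas_offCol k).comp measurable_snd) measurable_fst).mul
          (measurable_evol (h.meas.comp measurable_snd) (measurable_const.sub measurable_fst) k k)
      exact hm2.stronglyMeasurable.integral_prod_right.aestronglyMeasurable
    · filter_upwards [ae_restrict_mem measurableSet_uIoc] with s hs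
      exact (hle s hs).trans (Real.le_norm_self _)
  rw [intervalIntegral.integral_add hi1 hi2, intervalIntegral.integral_add
    (Continuous.intervalIntegrable (by fun_prop) _ _)
    (Continuous.intervalIntegrable (by fun_prop) _ _), intervalIntegral.integral_const_mul,
    intervalIntegral.integral_const_mul] at e1
  have e3 : meanDeriv P X k t + (((σ ^ 2 : ℝ) : ℂ) * conv (scChar σ) (meanDiag P X k) t +
      ((σ ^ 2 : ℝ) : ℂ) * conv (fun s => meanTrace P X s - scChar σ s) (scChar σ) t) =
      Complex.I * (∫ ω, X ω k k * evol (X ω) t k k ∂P) - ∫ s in (0 : ℝ)..t, e s (t - s) := by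
    rw [e1]
    unfold conv
    ring
  rw [e3]
  have h4 := intervalIntegral.norm_integral_le_of_norm_le_const hle
  rw [sub_zero, abs_of_nonneg ht] at h4
  calc _ ≤ 42 * K ^ 4 * (1 + T) ^ 2 / N + 799 * K ^ 8 * (1 + T) ^ 4 / N * t := by
        refine (norm_sub_le _ _).trans (add_le_add ?_ h4)
        rw [norm_mul, Complex.norm_I, one_mul]
        exact h.norm_integral_entry_mul_evol_le k ht htT
    _ ≤ 42 * K ^ 8 * (1 + T) ^ 5 / N + 799 * K ^ 8 * (1 + T) ^ 4 / N * (1 + T) := by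
        gcongr
        · norm_num
        · linarith
        · norm_num
        · linarith
    _ = _ := by ring

/-- After averaging over `k`, both linear terms contain the convolution of `φ` with the difference,
so the kernel is `2σ²φ`. It is deterministic and positive definite, and the error of order `1/N` is
preserved. -/
theorem norm_meanTrace_sub_le (h : IsModel P σ K X) (hN : 0 < N) {T : ℝ} (hT : 0 ≤ T) :
    ‖meanTrace P X T - scChar σ T‖ ≤ 2 * (841 * K ^ 8 * (1 + T) ^ 5 / N) * T := by
  have hφ := isPosDef_scChar h.pos
  have hτ := h.continuous_meanTrace
  have hN' : (N : ℂ) ≠ 0 := by exact_mod_cast hN.ne'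
  have hd : Continuous fun s => meanTrace P X s - scChar σ s := hτ.sub hφ.cont
  have h0 : meanTrace P X 0 - scChar σ 0 = 0 := by
    simp [meanTrace, meanDiag, evol_zero, scChar_zero h.pos, hN']
  refine (hφ.const_mul (c := 2 * σ ^ 2) (by positivity)).norm_le
    (δ := fun t => meanTrace P X t - scChar σ t) h0 hT
    (fun t => (h.hasDerivAt_meanTrace t).sub (hasDerivAt_scChar_conv h.pos t)) fun t ht => ?_
  have e : ((1 / N : ℝ) : ℂ) * ∑ l, meanDeriv P X l t -
      -(((σ ^ 2 : ℝ) : ℂ) * conv (scChar σ) (scChar σ) t) +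
      conv (fun s => ((2 * σ ^ 2 : ℝ) : ℂ) * scChar σ s)
        (fun t => meanTrace P X t - scChar σ t) t =
      ((1 / N : ℝ) : ℂ) * ∑ l, (meanDeriv P X l t +
        (((σ ^ 2 : ℝ) : ℂ) * conv (scChar σ) (meanDiag P X l) t +
      ((σ ^ 2 : ℝ) : ℂ) * conv (fun s => meanTrace P X s - scChar σ s) (scChar σ) t)) := by
    have e1 : conv (scChar σ) (meanTrace P X) t =
        ((1 / N : ℝ) : ℂ) * ∑ l, conv (scChar σ) (meanDiag P X l) t := by
      rw [← conv_sum_right Finset.univ hφ.cont fun l _ => h.continuous_meanDiag l,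
        ← conv_const_mul_right]
      rfl
    rw [conv_const_mul_left, Finset.sum_add_distrib, Finset.sum_add_distrib, ← Finset.mul_sum,
      Finset.sum_const, Finset.card_univ, Fintype.card_fin, nsmul_eq_mul,
      conv_comm (fun s => meanTrace P X s - scChar σ s) (scChar σ),
      conv_sub_right hτ hφ.cont hφ.cont, e1]
    push_cast
    field_simp
    ring
  rw [e, norm_mul, Complex.norm_real, Real.norm_of_nonneg (by positivity)]
  calc 1 / (N : ℝ) * _ ≤ 1 / (N : ℝ) * ∑ _l : Fin N, 841 * K ^ 8 * (1 + T) ^ 5 / N := by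
        gcongr
        exact (norm_sum_le _ _).trans
          (Finset.sum_le_sum fun l _ => h.norm_meanDeriv_add_le l ht.1 ht.2)
    _ = _ := by
        have : (N : ℝ) ≠ 0 := by exact_mod_cast hN.ne'
        rw [Finset.sum_const, Finset.card_univ, Fintype.card_fin, nsmul_eq_mul]
        field_simp

/-- The expected diagonal entries are close to the characteristic function of the semicircle
distribution. -/
theorem norm_meanDiag_sub_le (h : IsModel P σ K X) (k : Fin N) {T : ℝ} (hT : 0 ≤ T) :
    ‖meanDiag P X k T - scChar σ T‖ ≤ 5046 * K ^ 8 * (1 + T) ^ 6 / N := by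
  have hφ := isPosDef_scChar h.pos
  have hτ := h.continuous_meanTrace
  have hm := h.continuous_meanDiag k
  have hN' : (N : ℂ) ≠ 0 := by exact_mod_cast k.pos.ne'
  have hN0 : (N : ℝ) ≠ 0 := by exact_mod_cast k.pos.ne'
  have hK := h.one_le
  set M := 841 * K ^ 8 * (1 + T) ^ 5 / N with hM
  have hM0 : 0 ≤ M := by positivity
  have h0 : meanDiag P X k 0 - meanTrace P X 0 = 0 := by
    simp [meanTrace, meanDiag, evol_zero, hN']
  have h1 : ‖meanDiag P X k T - meanTrace P X T‖ ≤ 2 * (M + M) * T := by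
    -- In the difference of the entry equation and its average, the term with the trace deviation
    -- cancels and the kernel is `σ²φ`. The two errors give `4MT`, the trace another `2MT`, and `6 *
    -- 841 = 5046`.
    refine (hφ.const_mul (sq_nonneg σ)).norm_le
      (δ := fun t => meanDiag P X k t - meanTrace P X t) h0 hT
      (fun t => (h.hasDerivAt_meanDiag k t).sub (h.hasDerivAt_meanTrace t)) fun t ht => ?_
    have e : meanDeriv P X k t - ((1 / N : ℝ) : ℂ) * ∑ l, meanDeriv P X l t +
        conv (fun s => ((σ ^ 2 : ℝ) : ℂ) * scChar σ s)
          (fun t => meanDiag P X k t - meanTrace P X t) t =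
        (meanDeriv P X k t + (((σ ^ 2 : ℝ) : ℂ) * conv (scChar σ) (meanDiag P X k) t +
          ((σ ^ 2 : ℝ) : ℂ) * conv (fun s => meanTrace P X s - scChar σ s) (scChar σ) t)) -
        ((1 / N : ℝ) : ℂ) * ∑ l, (meanDeriv P X l t +
          (((σ ^ 2 : ℝ) : ℂ) * conv (scChar σ) (meanDiag P X l) t +
        ((σ ^ 2 : ℝ) : ℂ) * conv (fun s => meanTrace P X s - scChar σ s) (scChar σ) t)) := by
      have e1 : conv (scChar σ) (meanTrace P X) t =
          ((1 / N : ℝ) : ℂ) * ∑ l, conv (scChar σ) (meanDiag P X l) t := by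
        rw [← conv_sum_right Finset.univ hφ.cont fun l _ => h.continuous_meanDiag l,
          ← conv_const_mul_right]
        rfl
      rw [conv_const_mul_left, Finset.sum_add_distrib, Finset.sum_add_distrib, ← Finset.mul_sum,
        Finset.sum_const, Finset.card_univ, Fintype.card_fin, nsmul_eq_mul,
        conv_sub_right hm hτ hφ.cont, e1]
      push_cast
      field_simp
      ring
    rw [e]
    refine (norm_sub_le _ _).trans (add_le_add (h.norm_meanDeriv_add_le k ht.1 ht.2) ?_)
    rw [norm_mul, Complex.norm_real, Real.norm_of_nonneg (by positivity)]
    calc 1 / (N : ℝ) * _ ≤ 1 / (N : ℝ) * ∑ _l : Fin N, M := by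
          gcongr
          exact (norm_sum_le _ _).trans
            (Finset.sum_le_sum fun l _ => h.norm_meanDeriv_add_le l ht.1 ht.2)
      _ = _ := by
          rw [Finset.sum_const, Finset.card_univ, Fintype.card_fin, nsmul_eq_mul]
          field_simp
  have h2 := h.norm_meanTrace_sub_le k.pos hT
  calc ‖meanDiag P X k T - scChar σ T‖
      ≤ ‖meanDiag P X k T - meanTrace P X T‖ + ‖meanTrace P X T - scChar σ T‖ :=
        norm_sub_le_norm_sub_add_norm_sub _ _ _
    _ ≤ 2 * (M + M) * T + 2 * M * T := add_le_add h1 h2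
    _ = 6 * M * T := by ring
    _ ≤ 6 * M * (1 + T) := by gcongr; linarith
    _ = _ := by rw [hM]; ring

end IsModel

end Wigner

namespace Wigner

namespace IsModel

variable {Ω : Type*} [MeasurableSpace Ω] {P : Measure Ω} [IsProbabilityMeasure P] {N : ℕ}
  {σ K : ℝ} {X : Ω → Matrix (Fin N) (Fin N) ℂ}

/-! ### Comparison with the complementary matrix -/

theorem meas_minor (h : IsModel P σ K X) (k l m : Fin N) (t : ℝ) :
    Measurable fun ω => evol (cutRow k (X ω)) t l m :=
  measurable_evol (h.meas_cutRow k) measurable_const l m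

theorem meas_cutEntry_evol (h : IsModel P σ K X) (k a l m : Fin N) (t : ℝ) :
    Measurable fun ω => evol (cutEntry k a (X ω)) t l m :=
  measurable_evol ((measurable_cutEntry k a).comp h.meas) measurable_const l m

theorem norm_minor_le (h : IsModel P σ K X) (k l m : Fin N) (t : ℝ) (ω : Ω) :
    ‖evol (cutRow k (X ω)) t l m‖ ≤ 1 :=
  norm_evol_le (cutRow_isHermitian k (h.herm ω)) t l m

theorem norm_cutEntry_evol_le (h : IsModel P σ K X) (k a l m : Fin N) (t : ℝ) (ω : Ω) :
    ‖evol (cutEntry k a (X ω)) t l m‖ ≤ 1 :=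
  norm_evol_le (cutEntry_isHermitian k a (h.herm ω)) t l m

theorem l2Bound_minor (h : IsModel P σ K X) (k l m : Fin N) (t : ℝ) :
    L2Bound P (fun ω => evol (cutRow k (X ω)) t l m) 1 :=
  L2Bound.of_bounded (h.meas_minor k l m t).aestronglyMeasurable zero_le_one
    fun ω => h.norm_minor_le k l m t ω

theorem l2Bound_evol_sub_minor (h : IsModel P σ K X) {k l : Fin N} (hl : l ≠ k) (m : Fin N)
    {t : ℝ} (ht : 0 ≤ t) :
    L2Bound P (fun ω => evol (X ω) t l m - evol (cutRow k (X ω)) t l m) (t * (K / √N)) := by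
  have h1 := L2Bound.intervalIntegral_norm (P := P)
    (η := fun s ω => linForm (cutRow k (X ω)) (offCol k (X ω)) l s)
    (measurable_linForm ((h.meas_cutRow k).comp measurable_snd)
      ((h.meas_offCol k).comp measurable_snd) measurable_fst l) ht
    fun s _ => h.l2Bound_linForm k l s
  refine h1.of_norm_le ((measurable_evol h.meas measurable_const l m).sub
    (h.meas_minor k l m t)).aestronglyMeasurable fun ω => ?_
  rw [evol_sub_evol_cutRow k hl, intervalIntegral.integral_const_mul, norm_mul, Complex.norm_I,
    one_mul, Complex.norm_real, Real.norm_of_nonneg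
      (intervalIntegral.integral_nonneg ht fun _ _ => norm_nonneg _)]
  exact norm_conv_le (g := fun s => evol (X ω) s k m) (continuous_linForm _ _ _)
    (fun s => norm_evol_le (h.herm ω) s k m) ht le_rfl

/-- In mean the comparison is of order `1/N`: since `m ≠ k`, Duhamel's formula multiplies a linear
form by an off-diagonal entry, and both are of order `N^(-1/2)` in `L²`. -/
theorem norm_integral_evol_sub_minor_le (h : IsModel P σ K X) {k l m : Fin N} (hl : l ≠ k)
    (hm : m ≠ k) {t : ℝ} (ht : 0 ≤ t) :
    ‖∫ ω, (evol (X ω) t l m - evol (cutRow k (X ω)) t l m) ∂P‖ ≤ K ^ 2 * t ^ 2 / N := by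
  have hK : 0 ≤ K := zero_le_one.trans h.one_le
  have h1 : ∫ ω, (evol (X ω) t l m - evol (cutRow k (X ω)) t l m) ∂P =
      ∫ s in (0 : ℝ)..t, ∫ ω, Complex.I *
        (linForm (cutRow k (X ω)) (offCol k (X ω)) l s * evol (X ω) (t - s) k m) ∂P := by
    simp_rw [evol_sub_evol_cutRow k hl m t]
    refine integral_intervalIntegral_comm ?_ ht (h.integrable_sqrt_colSq k) fun s _ ω => ?_
    · exact measurable_const.mul ((measurable_linForm ((h.meas_cutRow k).comp measurable_snd)
        ((h.meas_offCol k).comp measurable_snd) measurable_fst l).mul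
        (measurable_evol (h.meas.comp measurable_snd) (measurable_const.sub measurable_fst) k m))
    · rw [norm_mul, norm_mul, Complex.norm_I, one_mul]
      exact (mul_le_of_le_one_right (norm_nonneg _) (norm_evol_le (h.herm ω) _ k m)).trans
        (h.norm_linForm_le_colSq k l s ω)
  have h2 : ∀ s ∈ Set.uIoc 0 t, ‖∫ ω, Complex.I *
      (linForm (cutRow k (X ω)) (offCol k (X ω)) l s * evol (X ω) (t - s) k m) ∂P‖ ≤
        K / √N * (t * (K / √N)) := by
    intro s hs
    rw [Set.uIoc_of_le ht] at hs
    rw [integral_const_mul, norm_mul, Complex.norm_I, one_mul]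
    refine ((h.l2Bound_linForm k l s).norm_integral_mul_le
      (h.l2Bound_evol_off_diag hm.symm (sub_nonneg.2 hs.2))).trans ?_
    gcongr
    linarith [hs.1]
  rw [h1]
  refine (intervalIntegral.norm_integral_le_of_norm_le_const h2).trans (le_of_eq ?_)
  rw [sub_zero, abs_of_nonneg ht]
  calc K / √N * (t * (K / √N)) * t = K ^ 2 * t ^ 2 / (√N * √N) := by ring
    _ = _ := by rw [Real.mul_self_sqrt (Nat.cast_nonneg N)]

theorem norm_integral_minor_le (h : IsModel P σ K X) {j k a : Fin N} (hj : j ≠ k) (ha : a ≠ k)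
    (haj : a ≠ j) {s T : ℝ} (hs : 0 ≤ s) (hsT : s ≤ T) :
    ‖∫ ω, evol (cutRow k (X ω)) s j a ∂P‖ ≤ 43 * K ^ 4 * (1 + T) ^ 3 / N := by
  have hK := h.one_le
  have h1 := h.norm_integral_evol_off_diag_le haj.symm hs
  have h2 := h.norm_integral_evol_sub_minor_le hj ha hs
  have hT : 0 ≤ T := hs.trans hsT
  rw [integral_sub (h.integrable_evol j a s) (h.l2Bound_minor k j a s).integrable] at h2
  have h3 : ‖∫ ω, evol (cutRow k (X ω)) s j a ∂P‖ ≤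
      42 * K ^ 4 * (1 + s) ^ 3 / N + K ^ 2 * s ^ 2 / N := by
    have := norm_sub_norm_le (∫ ω, evol (cutRow k (X ω)) s j a ∂P) (∫ ω, evol (X ω) s j a ∂P)
    rw [norm_sub_rev] at this
    linarith
  refine h3.trans ?_
  calc 42 * K ^ 4 * (1 + s) ^ 3 / N + K ^ 2 * s ^ 2 / N
      ≤ 42 * K ^ 4 * (1 + T) ^ 3 / N + K ^ 4 * (1 + T) ^ 3 / N := by
        have h4 : s ^ 2 ≤ (1 + T) ^ 3 := by
          calc s ^ 2 ≤ (1 + T) ^ 2 := by gcongr; linarith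
            _ ≤ (1 + T) ^ 3 := pow_le_pow_right₀ (by linarith) (by norm_num)
        gcongr
        · norm_num
    _ = _ := by ring

theorem l2Bound_minor_off_diag (h : IsModel P σ K X) {j k a : Fin N} (hj : j ≠ k)
    (haj : a ≠ j) {s T : ℝ} (hs : 0 ≤ s) (hsT : s ≤ T) :
    L2Bound P (fun ω => evol (cutRow k (X ω)) s j a) (2 * T * K / √N) := by
  have hK := h.one_le
  have h1 := (h.l2Bound_evol_off_diag haj.symm hs).sub (h.l2Bound_evol_sub_minor hj a hs)
  refine (h1.mono (B := 2 * T * K / √N) ?_).congr_norm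
    (h.meas_minor k j a s).aestronglyMeasurable fun ω => by simp
  calc s * (K / √N) + s * (K / √N) ≤ T * (K / √N) + T * (K / √N) := by gcongr
    _ = _ := by ring

theorem l2Bound_minor_diag (h : IsModel P σ K X) {k a : Fin N} (ha : a ≠ k) {s T : ℝ}
    (hs : 0 ≤ s) (hsT : s ≤ T) :
    L2Bound P (fun ω => evol (cutRow k (X ω)) s a a - scChar σ s)
      (43 * K ^ 3 * (1 + T) ^ 2 / √N) := by
  have hK := h.one_le
  have h1 := (h.l2Bound_evol_diag a hs).sub (h.l2Bound_evol_sub_minor ha a hs)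
  have hT : 0 ≤ T := hs.trans hsT
  refine (h1.mono (B := 43 * K ^ 3 * (1 + T) ^ 2 / √N) ?_).congr_norm
    ((h.meas_minor k a a s).sub measurable_const).aestronglyMeasurable fun ω => ?_
  · calc 42 * K ^ 3 * (1 + s) ^ 2 / √N + s * (K / √N)
        ≤ 42 * K ^ 3 * (1 + T) ^ 2 / √N + (1 + T) ^ 2 * (K ^ 3 / √N) := by
          have h4 : s ≤ (1 + T) ^ 2 := by nlinarith
          gcongr
          exact le_self_pow₀ hK (by norm_num)
      _ = _ := by ring
  · congr 1
    ring

theorem l2Bound_cutEntry_diag (h : IsModel P σ K X) {k a : Fin N} (ha : a ≠ k) {s T : ℝ}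
    (hs : 0 ≤ s) (hsT : s ≤ T) :
    L2Bound P (fun ω => evol (cutEntry k a (X ω)) s k k - scChar σ s)
      (44 * K ^ 3 * (1 + T) ^ 2 / √N) := by
  have hK := h.one_le
  have hT : 0 ≤ T := hs.trans hsT
  have h0 : L2Bound P (fun ω => evol (X ω) s k k - evol (cutEntry k a (X ω)) s k k)
      (2 * s * (K / √N)) := by
    have := ((h.centeredVec k).second a).const_mul ((2 * s : ℝ) : ℂ)
    rw [Complex.norm_real, Real.norm_of_nonneg (by positivity)] at this
    refine this.of_norm_le ((measurable_evol h.meas measurable_const k k).sub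
      (h.meas_cutEntry_evol k a k k s)).aestronglyMeasurable fun ω => ?_
    rw [norm_mul, Complex.norm_real, Real.norm_of_nonneg (by positivity)]
    exact norm_evol_sub_evol_cutEntry_le k ha (h.herm ω) hs k k
  have h1 := (h.l2Bound_evol_diag k hs).sub h0
  refine (h1.mono (B := 44 * K ^ 3 * (1 + T) ^ 2 / √N) ?_).congr_norm
    ((h.meas_cutEntry_evol k a k k s).sub measurable_const).aestronglyMeasurable fun ω => ?_
  · calc 42 * K ^ 3 * (1 + s) ^ 2 / √N + 2 * s * (K / √N)
        ≤ 42 * K ^ 3 * (1 + T) ^ 2 / √N + 2 * (1 + T) ^ 2 * (K ^ 3 / √N) := by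
          have h4 : s ≤ (1 + T) ^ 2 := by nlinarith
          gcongr
          exact le_self_pow₀ hK (by norm_num)
      _ = _ := by ring
  · congr 1
    ring

/-- The two diagonal factors are replaced by their limits one at a time. Each replacement pairs the
off-diagonal entry, of order `N^(-1/2)`, with a fluctuation of the same order. What is left is the
mean of the off-diagonal entry, of order `1/N`. -/
theorem norm_integral_triple_le (h : IsModel P σ K X) {j k a : Fin N} (hj : j ≠ k) (ha : a ≠ k)
    (haj : a ≠ j) {s p r T : ℝ} (hs : 0 ≤ s) (hsT : s ≤ T) (hp : 0 ≤ p) (hpT : p ≤ T)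
    (hr : 0 ≤ r) (hrT : r ≤ T) :
    ‖∫ ω, evol (cutRow k (X ω)) s j a * (evol (cutRow k (X ω)) p a a *
      evol (cutEntry k a (X ω)) r k k) ∂P‖ ≤ 217 * K ^ 4 * (1 + T) ^ 3 / N := by
  have hK := h.one_le
  have hT : 0 ≤ T := hs.trans hsT
  have hv := h.l2Bound_minor_off_diag hj haj hs hsT
  have h1 := (h.l2Bound_minor_diag ha hp hpT).mul_bounded
    (h.meas_cutEntry_evol k a k k r).aestronglyMeasurable
    fun ω => h.norm_cutEntry_evol_le k a k k r ω
  have h2 := (h.l2Bound_cutEntry_diag ha hr hrT).const_mul (scChar σ p)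
  have e : ∫ ω, evol (cutRow k (X ω)) s j a * (evol (cutRow k (X ω)) p a a *
      evol (cutEntry k a (X ω)) r k k) ∂P =
      (∫ ω, evol (cutRow k (X ω)) s j a * ((evol (cutRow k (X ω)) p a a - scChar σ p) *
        evol (cutEntry k a (X ω)) r k k) ∂P) +
      (∫ ω, evol (cutRow k (X ω)) s j a * (scChar σ p *
        (evol (cutEntry k a (X ω)) r k k - scChar σ r)) ∂P) +
      (∫ ω, evol (cutRow k (X ω)) s j a ∂P) * (scChar σ p * scChar σ r) := by
    have i1 := hv.integrable_mul h1
    have i2 := hv.integrable_mul h2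
    have i3 := hv.integrable.mul_const (scChar σ p * scChar σ r)
    have i12 := integral_add (i1.add i2) i3
    simp only [Pi.add_apply] at i12
    rw [← integral_add i1 i2, ← integral_mul_const, ← i12]
    refine integral_congr_ae (Filter.Eventually.of_forall fun ω => ?_)
    simp only
    ring
  have b1 := hv.norm_integral_mul_le h1
  have b2 := hv.norm_integral_mul_le h2
  have b3 := h.norm_integral_minor_le hj ha haj hs hsT
  have n1 := norm_scChar_le h.pos p
  have n2 := norm_scChar_le h.pos r
  rw [e]
  calc _ ≤ 2 * T * K / √N * (43 * K ^ 3 * (1 + T) ^ 2 / √N) +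
        2 * T * K / √N * (1 * (44 * K ^ 3 * (1 + T) ^ 2 / √N)) +
        43 * K ^ 4 * (1 + T) ^ 3 / N * (1 * 1) := by
        refine (norm_add₃_le).trans (add_le_add (add_le_add b1 (b2.trans ?_)) ?_)
        · gcongr
        · rw [norm_mul, norm_mul]
          gcongr
    _ = 174 * K ^ 4 * ((1 + T) ^ 2 * T) / (√N * √N) + 43 * K ^ 4 * (1 + T) ^ 3 / N := by ring
    _ ≤ 174 * K ^ 4 * (1 + T) ^ 3 / N + 43 * K ^ 4 * (1 + T) ^ 3 / N := by
        rw [Real.mul_self_sqrt (Nat.cast_nonneg N)]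
        have : (1 + T) ^ 2 * T ≤ (1 + T) ^ 3 := by nlinarith [sq_nonneg (1 + T)]
        gcongr
    _ = _ := by ring

/-! ### The cubic term -/

/-- The third moments of the entries. -/
theorem norm_integral_cube_le (h : IsModel P σ K X) (k a : Fin N) :
    ‖∫ ω, offCol k (X ω) a * (offCol k (X ω) a * starRingEnd ℂ (offCol k (X ω) a)) ∂P‖ ≤
      (K / √N) ^ 3 := by
  refine (((h.centeredVec k).second a).norm_integral_mul_le
    ((h.centeredVec k).fourth a)).trans (le_of_eq (by ring))

theorem integral_norm_pow_four_le (h : IsModel P σ K X) (k a : Fin N) :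
    ∫ ω, ‖offCol k (X ω) a‖ ^ 4 ∂P ≤ (K / √N) ^ 4 := by
  have := ((h.centeredVec k).fourth a).integral_sq_le
  refine le_trans (le_of_eq ?_) (this.trans (le_of_eq (by ring)))
  refine integral_congr_ae (Filter.Eventually.of_forall fun ω => ?_)
  simp only [norm_mul, RCLike.norm_conj]
  ring

theorem indepFun_offCol_cutEntry (h : IsModel P σ K X) {k a : Fin N} (ha : a ≠ k) :
    IndepFun (fun ω => offCol k (X ω) a) (fun ω => cutEntry k a (X ω)) P := by
  simpa only [offCol, if_neg ha] using h.indep_entry a k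

/-- Cutting the pair `(k, a)` decouples `x_a` from the diagonal entry of the evolution, so the third
moment factors out. The cut costs `2r |x_a|`, which raises the moment to the fourth, and this moment
is independent of the remaining minor entry. -/
theorem norm_integral_cubic_le (h : IsModel P σ K X) {j k a : Fin N} (ha : a ≠ k) (s p : ℝ)
    {r : ℝ} (hr : 0 ≤ r) :
    ‖∫ ω, evol (cutRow k (X ω)) s j a * evol (cutRow k (X ω)) p a a *
        (offCol k (X ω) a * (offCol k (X ω) a * starRingEnd ℂ (offCol k (X ω) a))) *
        evol (X ω) r k k ∂P‖ ≤
      (K / √N) ^ 3 * ‖∫ ω, evol (cutRow k (X ω)) s j a * (evol (cutRow k (X ω)) p a a *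
        evol (cutEntry k a (X ω)) r k k) ∂P‖ +
      2 * r * (K / √N) ^ 4 * ∫ ω, ‖evol (cutRow k (X ω)) s j a‖ ∂P := by
  have hx := h.centeredVec k
  have hind := h.indepFun_offCol_cutEntry ha
  have hm := h.meas_offCol k
  have hxm := hx.meas_apply a
  have hconj : Measurable (starRingEnd ℂ) := (RCLike.continuous_conj (K := ℂ)).measurable
  have hc : Measurable fun ω => cutEntry k a (X ω) := (measurable_cutEntry k a).comp h.meas
  have hmv : ∀ l m t, Measurable fun M : Matrix (Fin N) (Fin N) ℂ => evol (cutRow k M) t l m :=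
    fun l m t => measurable_evol (measurable_cutRow k) measurable_const l m
  have hi : ∀ g : Ω → ℂ, Measurable g → (∀ ω, ‖g ω‖ ≤ 1) → Integrable (fun ω =>
      evol (cutRow k (X ω)) s j a * evol (cutRow k (X ω)) p a a *
        (offCol k (X ω) a * (offCol k (X ω) a * starRingEnd ℂ (offCol k (X ω) a))) * g ω) P := by
    intro g hg hg1
    have := (hx.second a).integrable_mul ((hx.fourth a).mul_bounded
      (g := fun ω => evol (cutRow k (X ω)) s j a * (evol (cutRow k (X ω)) p a a * g ω))
      ((h.meas_minor k j a s).mul ((h.meas_minor k a a p).mul hg)).aestronglyMeasurable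
      fun ω => by
        rw [norm_mul, norm_mul]
        exact mul_le_one₀ (h.norm_minor_le k j a s ω) (by positivity)
          (mul_le_one₀ (h.norm_minor_le k a a p ω) (norm_nonneg _) (hg1 ω)))
    refine this.congr (Filter.Eventually.of_forall fun ω => ?_)
    simp only
    ring
  have i1 := hi _ (measurable_evol h.meas measurable_const k k)
    fun ω => norm_evol_le (h.herm ω) r k k
  have i2 := hi _ (h.meas_cutEntry_evol k a k k r) fun ω => h.norm_cutEntry_evol_le k a k k r ω
  have e1 : ∫ ω, evol (cutRow k (X ω)) s j a * evol (cutRow k (X ω)) p a a *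
        (offCol k (X ω) a * (offCol k (X ω) a * starRingEnd ℂ (offCol k (X ω) a))) *
        evol (cutEntry k a (X ω)) r k k ∂P =
      (∫ ω, offCol k (X ω) a * (offCol k (X ω) a * starRingEnd ℂ (offCol k (X ω) a)) ∂P) *
      ∫ ω, evol (cutRow k (X ω)) s j a * (evol (cutRow k (X ω)) p a a *
        evol (cutEntry k a (X ω)) r k k) ∂P := by
    have h1 : IndepFun
        (fun ω => offCol k (X ω) a * (offCol k (X ω) a * starRingEnd ℂ (offCol k (X ω) a)))
        (fun ω => evol (cutRow k (X ω)) s j a * (evol (cutRow k (X ω)) p a a *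
          evol (cutEntry k a (X ω)) r k k)) P := by
      have := hind.comp (φ := fun z : ℂ => z * (z * starRingEnd ℂ z))
        (ψ := fun M : Matrix (Fin N) (Fin N) ℂ => evol (cutRow k M) s j a *
          (evol (cutRow k M) p a a * evol M r k k)) (measurable_id.mul (measurable_id.mul hconj))
        ((hmv j a s).mul ((hmv a a p).mul (measurable_evol measurable_id measurable_const k k)))
      simpa only [Function.comp_def, cutRow_cutEntry] using this
    rw [← h1.integral_fun_mul_eq_mul_integral
      (hxm.mul (hxm.mul (hconj.comp hxm))).aestronglyMeasurable
      ((h.meas_minor k j a s).mul ((h.meas_minor k a a p).mul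
        (h.meas_cutEntry_evol k a k k r))).aestronglyMeasurable]
    refine integral_congr_ae (Filter.Eventually.of_forall fun ω => ?_)
    simp only
    ring
  have e2 : ∫ ω, ‖offCol k (X ω) a‖ ^ 4 * ‖evol (cutRow k (X ω)) s j a‖ ∂P =
      (∫ ω, ‖offCol k (X ω) a‖ ^ 4 ∂P) * ∫ ω, ‖evol (cutRow k (X ω)) s j a‖ ∂P := by
    have h1 : IndepFun (fun ω => ‖offCol k (X ω) a‖ ^ 4)
        (fun ω => ‖evol (cutRow k (X ω)) s j a‖) P := by
      have := hind.comp (φ := fun z : ℂ => ‖z‖ ^ 4)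
        (ψ := fun M : Matrix (Fin N) (Fin N) ℂ => ‖evol (cutRow k M) s j a‖)
        (measurable_norm.pow_const 4) (hmv j a s).norm
      simpa only [Function.comp_def, cutRow_cutEntry] using this
    exact h1.integral_fun_mul_eq_mul_integral (hxm.norm.pow_const 4).aestronglyMeasurable
      (h.meas_minor k j a s).norm.aestronglyMeasurable
  have hi4 : Integrable (fun ω => ‖offCol k (X ω) a‖ ^ 4 * ‖evol (cutRow k (X ω)) s j a‖) P := by
    have := ((hx.fourth a).integrable_mul ((hx.fourth a).mul_bounded
      (h.meas_minor k j a s).aestronglyMeasurable fun ω => h.norm_minor_le k j a s ω)).norm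
    refine this.congr (Filter.Eventually.of_forall fun ω => ?_)
    simp only [norm_mul, RCLike.norm_conj]
    ring
  have e3 : ∫ ω, evol (cutRow k (X ω)) s j a * evol (cutRow k (X ω)) p a a *
        (offCol k (X ω) a * (offCol k (X ω) a * starRingEnd ℂ (offCol k (X ω) a))) *
        evol (X ω) r k k ∂P =
      (∫ ω, evol (cutRow k (X ω)) s j a * evol (cutRow k (X ω)) p a a *
        (offCol k (X ω) a * (offCol k (X ω) a * starRingEnd ℂ (offCol k (X ω) a))) *
        evol (cutEntry k a (X ω)) r k k ∂P) +
      ∫ ω, (evol (cutRow k (X ω)) s j a * evol (cutRow k (X ω)) p a a *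
        (offCol k (X ω) a * (offCol k (X ω) a * starRingEnd ℂ (offCol k (X ω) a))) *
        evol (X ω) r k k - evol (cutRow k (X ω)) s j a * evol (cutRow k (X ω)) p a a *
        (offCol k (X ω) a * (offCol k (X ω) a * starRingEnd ℂ (offCol k (X ω) a))) *
        evol (cutEntry k a (X ω)) r k k) ∂P := by
    rw [integral_sub i1 i2]
    ring
  rw [e3, e1]
  refine (norm_add_le _ _).trans (add_le_add ?_ ?_)
  · rw [norm_mul]
    exact mul_le_mul_of_nonneg_right (h.norm_integral_cube_le k a) (norm_nonneg _)
  · refine (norm_integral_le_of_norm_le (hi4.const_mul (2 * r))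
      (Filter.Eventually.of_forall fun ω => ?_)).trans ?_
    · rw [← mul_sub, norm_mul, norm_mul, norm_mul, norm_mul, norm_mul, RCLike.norm_conj]
      have h1 := norm_evol_sub_evol_cutEntry_le k ha (h.herm ω) hr k k
      have h2 := h.norm_minor_le k a a p ω
      calc ‖evol (cutRow k (X ω)) s j a‖ * ‖evol (cutRow k (X ω)) p a a‖ *
            (‖offCol k (X ω) a‖ * (‖offCol k (X ω) a‖ * ‖offCol k (X ω) a‖)) *
            ‖evol (X ω) r k k - evol (cutEntry k a (X ω)) r k k‖
          ≤ ‖evol (cutRow k (X ω)) s j a‖ * 1 *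
            (‖offCol k (X ω) a‖ * (‖offCol k (X ω) a‖ * ‖offCol k (X ω) a‖)) *
            (2 * r * ‖offCol k (X ω) a‖) := by gcongr
        _ = _ := by ring
    · rw [integral_const_mul, e2, ← mul_assoc]
      have hi0 : 0 ≤ ∫ ω, ‖evol (cutRow k (X ω)) s j a‖ ∂P :=
        integral_nonneg fun ω => norm_nonneg _
      gcongr
      exact h.integral_norm_pow_four_le k a

theorem sum_integral_norm_minor_le (h : IsModel P σ K X) (j k : Fin N) (s : ℝ) :
    ∑ a, ∫ ω, ‖evol (cutRow k (X ω)) s j a‖ ∂P ≤ √N := by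
  rw [← integral_finsetSum _ fun a _ => (h.l2Bound_minor k j a s).integrable.norm]
  calc ∫ ω, ∑ a, ‖evol (cutRow k (X ω)) s j a‖ ∂P ≤ ∫ _ω, √(N : ℝ) ∂P := by
        refine integral_mono (integrable_finsetSum _ fun a _ =>
          (h.l2Bound_minor k j a s).integrable.norm) (integrable_const _) fun ω => ?_
        exact sum_norm_le_sqrt_card
          (sum_norm_sq_evol_row (cutRow_isHermitian k (h.herm ω)) s j).le
    _ = _ := by simp

theorem sum_norm_integral_cubic_le (h : IsModel P σ K X) {j k : Fin N} (hj : j ≠ k)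
    {s p r T : ℝ} (hs : 0 ≤ s) (hsT : s ≤ T) (hp : 0 ≤ p) (hpT : p ≤ T)
    (hr : 0 ≤ r) (hrT : r ≤ T) :
    ∑ a, ‖∫ ω, evol (cutRow k (X ω)) s j a * evol (cutRow k (X ω)) p a a *
        (offCol k (X ω) a * (offCol k (X ω) a * starRingEnd ℂ (offCol k (X ω) a))) *
        evol (X ω) r k k ∂P‖ ≤ 220 * K ^ 7 * (1 + T) ^ 3 / √N ^ 3 := by
  have hK := h.one_le
  have hT : 0 ≤ T := hs.trans hsT
  have hN : (0 : ℝ) < N := by exact_mod_cast k.pos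
  have hsN : 0 < √(N : ℝ) := Real.sqrt_pos.2 hN
  have hterm : ∀ a, ‖∫ ω, evol (cutRow k (X ω)) s j a * evol (cutRow k (X ω)) p a a *
        (offCol k (X ω) a * (offCol k (X ω) a * starRingEnd ℂ (offCol k (X ω) a))) *
        evol (X ω) r k k ∂P‖ ≤
      (K / √N) ^ 3 * (217 * K ^ 4 * (1 + T) ^ 3 / N + if a = j then 1 else 0) +
      2 * T * (K / √N) ^ 4 * ∫ ω, ‖evol (cutRow k (X ω)) s j a‖ ∂P := by
    intro a
    have hi0 : 0 ≤ ∫ ω, ‖evol (cutRow k (X ω)) s j a‖ ∂P := integral_nonneg fun _ => norm_nonneg _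
    -- For `a = k` the coordinate is zero. For `a = j` the minor entry is a diagonal one and only
    -- the trivial bound is available, but this happens for a single index.
    by_cases ha : a = k
    · have : ∀ ω, offCol k (X ω) a = 0 := fun ω => by simp [offCol, ha]
      simp only [this, zero_mul, mul_zero, integral_zero, norm_zero]
      have : (0 : ℝ) ≤ if a = j then 1 else 0 := by split_ifs <;> norm_num
      positivity
    · refine (h.norm_integral_cubic_le ha s p hr).trans ?_
      gcongr
      by_cases haj : a = j
      · rw [if_pos haj]
        have h1 : ‖∫ ω, evol (cutRow k (X ω)) s j a * (evol (cutRow k (X ω)) p a a *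
            evol (cutEntry k a (X ω)) r k k) ∂P‖ ≤ 1 := by
          refine L2Bound.norm_integral_le ((h.l2Bound_minor k j a s).mul_bounded
            ((h.meas_minor k a a p).mul (h.meas_cutEntry_evol k a k k r)).aestronglyMeasurable
            fun ω => ?_)
          rw [norm_mul]
          exact mul_le_one₀ (h.norm_minor_le k a a p ω) (norm_nonneg _)
            (h.norm_cutEntry_evol_le k a k k r ω)
        have : 0 ≤ 217 * K ^ 4 * (1 + T) ^ 3 / N := by positivity
        linarith
      · rw [if_neg haj, add_zero]
        exact h.norm_integral_triple_le hj ha haj hs hsT hp hpT hr hrT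
  refine (Finset.sum_le_sum fun a _ => hterm a).trans ?_
  rw [Finset.sum_add_distrib, ← Finset.mul_sum, ← Finset.mul_sum, Finset.sum_add_distrib,
    Finset.sum_const, Finset.card_univ, Fintype.card_fin, nsmul_eq_mul,
    Finset.sum_ite_eq' Finset.univ j, if_pos (Finset.mem_univ j)]
  -- All three contributions are of order `N^(-3/2)`: `N` terms of size `N^(-3/2) / N`, the single
  -- index `a = j` of size `N^(-3/2)`, and the fourth moments `N^(-2)` times the sum `√N` of the
  -- entries of a unit row.
  calc (K / √N) ^ 3 * (N * (217 * K ^ 4 * (1 + T) ^ 3 / N) + 1) +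
        2 * T * (K / √N) ^ 4 * ∑ a, ∫ ω, ‖evol (cutRow k (X ω)) s j a‖ ∂P
      ≤ (K / √N) ^ 3 * (N * (217 * K ^ 4 * (1 + T) ^ 3 / N) + 1) +
        2 * T * (K / √N) ^ 4 * √N := by
        gcongr
        exact h.sum_integral_norm_minor_le j k s
    _ = K ^ 3 * (217 * K ^ 4 * (1 + T) ^ 3 + 1 + 2 * T * K) / √N ^ 3 := by
        field_simp
    _ ≤ K ^ 3 * (217 * K ^ 4 * (1 + T) ^ 3 + K ^ 4 * (1 + T) ^ 3 + 2 * (1 + T) ^ 3 * K ^ 4) /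
          √N ^ 3 := by
        have h1 : 1 ≤ K ^ 4 := one_le_pow₀ hK
        have h2 : 1 ≤ (1 + T) ^ 3 := one_le_pow₀ (by linarith)
        have h3 : T ≤ (1 + T) ^ 3 := by nlinarith [sq_nonneg T, pow_nonneg hT 3]
        have h4 : 1 ≤ K ^ 4 * (1 + T) ^ 3 := one_le_mul_of_one_le_of_one_le h1 h2
        have h5 : K ≤ K ^ 4 := le_self_pow₀ hK (by norm_num)
        gcongr
    _ = _ := by ring

end IsModel

end Wigner

namespace Wigner

namespace IsModel

variable {Ω : Type*} [MeasurableSpace Ω] {P : Measure Ω} [IsProbabilityMeasure P] {N : ℕ}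
  {σ K : ℝ} {X : Ω → Matrix (Fin N) (Fin N) ℂ}

/-! ### The refined estimate of the off-diagonal entries -/

/-- Replacing a diagonal entry of the evolution by its fluctuation. -/
theorem norm_integral_mul_evol_le (h : IsModel P σ K X) (k : Fin N) {g : Ω → ℂ} {B : ℝ}
    (hg : L2Bound P g B) (h0 : ∫ ω, g ω ∂P = 0) {r T : ℝ} (hr : 0 ≤ r) (hrT : r ≤ T) :
    ‖∫ ω, g ω * evol (X ω) r k k ∂P‖ ≤ B * (42 * K ^ 3 * (1 + T) ^ 2 / √N) := by
  have hK := h.one_le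
  have hB := hg.nonneg
  have e : ∫ ω, g ω * evol (X ω) r k k ∂P =
      ∫ ω, g ω * (evol (X ω) r k k - scChar σ r) ∂P := by
    simp_rw [mul_sub]
    rw [integral_sub (hg.integrable_mul (h.l2Bound_evol k k _)) (hg.integrable.mul_const _),
      integral_mul_const, h0, zero_mul, sub_zero]
  rw [e]
  refine (hg.norm_integral_mul_le (h.l2Bound_evol_diag k hr)).trans ?_
  gcongr

/-- The column omits its diagonal entry, so removing `(k, k)` leaves it unchanged. The linear form
is therefore independent of `X_kk`. -/
theorem offCol_cutEntry_self (k : Fin N) (A : Matrix (Fin N) (Fin N) ℂ) :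
    offCol k (cutEntry k k A) = offCol k A := by
  funext a
  by_cases ha : a = k
  · simp [offCol, ha]
  · simp [offCol, cutEntry, ha]

theorem indepFun_linForm_entry (h : IsModel P σ K X) (j k : Fin N) (s : ℝ) :
    IndepFun (fun ω => linForm (cutRow k (X ω)) (offCol k (X ω)) j s) (fun ω => X ω k k) P := by
  have := (h.indep_entry k k).comp (φ := fun z : ℂ => z)
    (ψ := fun M : Matrix (Fin N) (Fin N) ℂ => linForm (cutRow k M) (offCol k M) j s)
    measurable_id (measurable_linForm (measurable_cutRow k) (measurable_offCol k)
      measurable_const j)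
  simp only [Function.comp_def, cutRow_cutEntry, offCol_cutEntry_self] at this
  exact this.symm

theorem l2Bound_linForm_mul_entry (h : IsModel P σ K X) (j k : Fin N) (s : ℝ) :
    L2Bound P (fun ω => linForm (cutRow k (X ω)) (offCol k (X ω)) j s * X ω k k)
      (K / √N * (K / √N)) :=
  (h.l2Bound_linForm k j s).indep_mul (h.second k k) (h.indepFun_linForm_entry j k s)

theorem integral_linForm_mul_entry (h : IsModel P σ K X) (j k : Fin N) (s : ℝ) :
    ∫ ω, linForm (cutRow k (X ω)) (offCol k (X ω)) j s * X ω k k ∂P = 0 := by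
  rw [(h.indepFun_linForm_entry j k s).integral_fun_mul_eq_mul_integral
    (h.meas_linForm k j s).aestronglyMeasurable (h.meas_entry k k).aestronglyMeasurable,
    h.mean, mul_zero]

/-- The centred part of the product of the linear and the quadratic form. -/
noncomputable def _root_.Wigner.rowRem (σ : ℝ) (k j : Fin N) (s p : ℝ)
    (A : Matrix (Fin N) (Fin N) ℂ) : ℂ :=
  chaosRem (evol (cutRow k A) p) (evol (cutRow k A) s j) (quadMean σ k (cutRow k A) p) (offCol k A)

/-- The estimate of `chaosRem` conditionally on the complementary matrix: with `κ = K/√N`, the bound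
`8κ³√N` equals `8K³/N`. -/
theorem l2Bound_rowRem (h : IsModel P σ K X) (k j : Fin N) (s p : ℝ) :
    L2Bound P (fun ω => rowRem σ k j s p (X ω)) (8 * K ^ 3 / N) ∧
      ∫ ω, rowRem σ k j s p (X ω) ∂P = 0 := by
  have hmeas : Measurable (Function.uncurry fun (x : Fin N → ℂ) (M : Matrix (Fin N) (Fin N) ℂ) =>
      chaosRem (evol M p) (evol M s j) (quadMean σ k M p) x) := by
    have hl : Measurable fun q : (Fin N → ℂ) × Matrix (Fin N) (Fin N) ℂ => linForm q.2 q.1 j s :=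
      measurable_linForm measurable_snd measurable_fst measurable_const j
    have hq : Measurable fun q : (Fin N → ℂ) × Matrix (Fin N) (Fin N) ℂ => quadForm q.2 q.1 p :=
      measurable_quadForm measurable_snd measurable_fst measurable_const
    have hv : ∀ l m t, Measurable fun q : (Fin N → ℂ) × Matrix (Fin N) (Fin N) ℂ =>
      evol q.2 t l m := fun l m t => measurable_evol measurable_snd measurable_const l m
    have hm : Measurable fun q : (Fin N → ℂ) × Matrix (Fin N) (Fin N) ℂ => quadMean σ k q.2 p :=
      measurable_quadMean σ k measurable_snd measurable_const
    have hx : ∀ a, Measurable fun q : (Fin N → ℂ) × Matrix (Fin N) (Fin N) ℂ => q.1 a :=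
      fun a => (measurable_pi_apply a).comp measurable_fst
    exact (hl.mul (hq.sub hm)).sub (Finset.measurable_sum _ fun a _ => ((hv j a s).mul
      (hv a a p)).mul ((hx a).mul ((hx a).mul ((RCLike.continuous_conj (K := ℂ)).measurable.comp
        (hx a)))))
  have hb : ∀ ω, L2Bound P (fun ω' => chaosRem (evol (cutRow k (X ω)) p)
      (evol (cutRow k (X ω)) s j) (quadMean σ k (cutRow k (X ω)) p) (offCol k (X ω')))
      (8 * (K / √N) ^ 3 * √N) ∧ _ := fun ω =>
    (h.centeredVec k).l2Bound_chaosRem h.kappa_nonneg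
      (rowColBounded_evol (cutRow_isHermitian k (h.herm ω)) p)
      (sum_norm_sq_evol_row (cutRow_isHermitian k (h.herm ω)) s j).le
      (S := quadMean σ k (cutRow k (X ω)) p) (by rw [h.sum_integral_offCol_mul]; rfl)
  have hN : (0 : ℝ) < N := by exact_mod_cast k.pos
  have e : 8 * (K / √N) ^ 3 * √N = 8 * K ^ 3 / N := by
    have : √(N : ℝ) ≠ 0 := (Real.sqrt_pos.2 hN).ne'
    have h2 : (N : ℝ) = √N * √N := (Real.mul_self_sqrt hN.le).symm
    rw [div_pow, eq_div_iff hN.ne']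
    nth_rewrite 3 [h2]
    field_simp
  constructor
  · rw [← e]
    exact L2Bound.of_fiber_const (h.meas_offCol k) (h.meas_cutRow k) (h.indep_offCol k) hmeas
      fun ω => (hb ω).1
  · exact integral_eq_zero_of_fiber (h.meas_offCol k) (h.meas_cutRow k) (h.indep_offCol k) hmeas
      fun ω => (hb ω).2

/-- The three parts have different reasons to be small. The first is a centred remainder of order
`1/N`. The second is a linear form times a fluctuation that depends on the complementary matrix
only, again centred of order `1/N`. The third is cubic and enters through third moments. -/
theorem linForm_mul_quadForm_eq (σ : ℝ) (k j : Fin N) (s p : ℝ)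
    (A : Matrix (Fin N) (Fin N) ℂ) :
    linForm (cutRow k A) (offCol k A) j s *
      (quadForm (cutRow k A) (offCol k A) p - ((σ ^ 2 : ℝ) : ℂ) * scChar σ p) =
    rowRem σ k j s p A + linForm (cutRow k A) (offCol k A) j s *
      (quadMean σ k (cutRow k A) p - ((σ ^ 2 : ℝ) : ℂ) * scChar σ p) +
    ∑ a, evol (cutRow k A) s j a * evol (cutRow k A) p a a *
      (offCol k A a * (offCol k A a * starRingEnd ℂ (offCol k A a))) := by
  have e1 : linForm (cutRow k A) (offCol k A) j s =
    ∑ a, evol (cutRow k A) s j a * offCol k A a := rfl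
  have e2 : quadForm (cutRow k A) (offCol k A) p = quad (evol (cutRow k A) p) (offCol k A) := rfl
  rw [rowRem, chaosRem, ← e1, ← e2]
  ring

theorem l2Bound_linForm_mul_quadMean_sub (h : IsModel P σ K X) (k j : Fin N) (s : ℝ) {p T : ℝ}
    (hp : 0 ≤ p) (hpT : p ≤ T) :
    L2Bound P (fun ω => linForm (cutRow k (X ω)) (offCol k (X ω)) j s *
      (quadMean σ k (cutRow k (X ω)) p - ((σ ^ 2 : ℝ) : ℂ) * scChar σ p))
      (K / √N * (15 * K ^ 5 * (1 + T) ^ 2 / √N)) := by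
  refine L2Bound.of_fiber
    (G := fun x M => linForm M x j s * (quadMean σ k M p - ((σ ^ 2 : ℝ) : ℂ) * scChar σ p))
    (h := fun M => quadMean σ k M p - ((σ ^ 2 : ℝ) : ℂ) * scChar σ p)
    (h.meas_offCol k) (h.meas_cutRow k) (h.indep_offCol k)
    ((measurable_linForm measurable_snd measurable_fst measurable_const j).mul
      ((measurable_quadMean σ k measurable_snd measurable_const).sub_const _))
    h.kappa_nonneg (fun ω => ?_) (h.l2Bound_quadMean_sub_scChar k hp hpT)
  have h1 := (h.centeredVec k).l2Bound_linear zero_le_one h.kappa_nonneg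
    (b := evol (cutRow k (X ω)) s j)
    (by rw [one_pow]; exact (sum_norm_sq_evol_row (cutRow_isHermitian k (h.herm ω)) s j).le)
  -- With the complementary matrix frozen, its factor is a constant and comes out of the conditional
  -- second moment. No product of fourth moments is involved.
  rw [mul_one] at h1
  simp_rw [enorm_mul, mul_pow]
  rw [lintegral_mul_const' _ _ (by finiteness)]
  gcongr
  exact h1.lintegral_le

theorem integrable_linForm_mul_quadForm_sub (h : IsModel P σ K X) (k j : Fin N) (s p : ℝ) :
    Integrable (fun ω => linForm (cutRow k (X ω)) (offCol k (X ω)) j s *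
      (quadForm (cutRow k (X ω)) (offCol k (X ω)) p - ((σ ^ 2 : ℝ) : ℂ) * scChar σ p)) P :=
  (h.l2Bound_linForm k j s).integrable_mul ((h.l2Bound_quadForm_crude k p).sub
    (L2Bound.of_bounded (A := ‖((σ ^ 2 : ℝ) : ℂ) * scChar σ p‖) aestronglyMeasurable_const
      (norm_nonneg _) fun _ => le_rfl))

/-- The first two parts are centred, so the diagonal entry counts only through its fluctuation and
supplies the missing `N^(-1/2)`. The cubic part is bounded term by term, and `336 + 630 + 220 =
1186`. -/
theorem norm_integral_linForm_mul_quadForm_sub_le (h : IsModel P σ K X) {k j : Fin N}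
    (hj : j ≠ k) {s p r T : ℝ} (hs : 0 ≤ s) (hsT : s ≤ T) (hp : 0 ≤ p) (hpT : p ≤ T)
    (hr : 0 ≤ r) (hrT : r ≤ T) :
    ‖∫ ω, linForm (cutRow k (X ω)) (offCol k (X ω)) j s *
      (quadForm (cutRow k (X ω)) (offCol k (X ω)) p - ((σ ^ 2 : ℝ) : ℂ) * scChar σ p) *
      evol (X ω) r k k ∂P‖ ≤ 1186 * K ^ 9 * (1 + T) ^ 4 / √N ^ 3 := by
  have hK := h.one_le
  have hT : 0 ≤ T := hs.trans hsT
  have hx := h.centeredVec k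
  obtain ⟨h1, h10⟩ := h.l2Bound_rowRem k j s p
  have h2 := h.l2Bound_linForm_mul_quadMean_sub k j s hp hpT
  have h20 := h.integral_linForm_mul k j s
    (G := fun M => quadMean σ k M p - ((σ ^ 2 : ℝ) : ℂ) * scChar σ p)
    ((measurable_quadMean σ k measurable_id measurable_const).sub_const _)
  have i3 : ∀ a, Integrable (fun ω => evol (cutRow k (X ω)) s j a * evol (cutRow k (X ω)) p a a *
      (offCol k (X ω) a * (offCol k (X ω) a * starRingEnd ℂ (offCol k (X ω) a))) *
        evol (X ω) r k k) P := by
    intro a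
    have := (hx.second a).integrable_mul ((hx.fourth a).mul_bounded
      (g := fun ω => evol (cutRow k (X ω)) s j a * (evol (cutRow k (X ω)) p a a *
        evol (X ω) r k k))
      ((h.meas_minor k j a s).mul ((h.meas_minor k a a p).mul
        (measurable_evol h.meas measurable_const k k))).aestronglyMeasurable
      fun ω => by
        rw [norm_mul, norm_mul]
        exact mul_le_one₀ (h.norm_minor_le k j a s ω) (by positivity)
          (mul_le_one₀ (h.norm_minor_le k a a p ω) (norm_nonneg _)
            (norm_evol_le (h.herm ω) r k k)))
    refine this.congr (Filter.Eventually.of_forall fun ω => ?_)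
    simp only
    ring
  have i1 := h1.integrable_mul (h.l2Bound_evol k k r)
  have i2 := h2.integrable_mul (h.l2Bound_evol k k r)
  have e : ∫ ω, linForm (cutRow k (X ω)) (offCol k (X ω)) j s *
      (quadForm (cutRow k (X ω)) (offCol k (X ω)) p - ((σ ^ 2 : ℝ) : ℂ) * scChar σ p) *
      evol (X ω) r k k ∂P =
      (∫ ω, rowRem σ k j s p (X ω) * evol (X ω) r k k ∂P) +
      (∫ ω, linForm (cutRow k (X ω)) (offCol k (X ω)) j s *
        (quadMean σ k (cutRow k (X ω)) p - ((σ ^ 2 : ℝ) : ℂ) * scChar σ p) *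
        evol (X ω) r k k ∂P) +
      ∑ a, ∫ ω, evol (cutRow k (X ω)) s j a * evol (cutRow k (X ω)) p a a *
        (offCol k (X ω) a * (offCol k (X ω) a * starRingEnd ℂ (offCol k (X ω) a))) *
        evol (X ω) r k k ∂P := by
    have i12 := integral_add (i1.add i2) (integrable_finsetSum Finset.univ fun a _ => i3 a)
    simp only [Pi.add_apply] at i12
    rw [← integral_add i1 i2, ← integral_finsetSum _ fun a _ => i3 a, ← i12]
    refine integral_congr_ae (Filter.Eventually.of_forall fun ω => ?_)
    simp only
    rw [linForm_mul_quadForm_eq, ← Finset.sum_mul]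
    ring
  have b1 := h.norm_integral_mul_evol_le k h1 h10 hr hrT
  have b2 := h.norm_integral_mul_evol_le k h2 h20 hr hrT
  have b3 := (norm_sum_le Finset.univ _).trans
    (h.sum_norm_integral_cubic_le hj hs hsT hp hpT hr hrT)
  rw [e]
  have hN : (0 : ℝ) < N := by exact_mod_cast k.pos
  calc _ ≤ 8 * K ^ 3 / N * (42 * K ^ 3 * (1 + T) ^ 2 / √N) +
        K / √N * (15 * K ^ 5 * (1 + T) ^ 2 / √N) * (42 * K ^ 3 * (1 + T) ^ 2 / √N) +
        220 * K ^ 7 * (1 + T) ^ 3 / √N ^ 3 :=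
        norm_add₃_le.trans (add_le_add (add_le_add b1 b2) b3)
    _ = (336 * K ^ 6 * (1 + T) ^ 2 + 630 * K ^ 9 * (1 + T) ^ 4 + 220 * K ^ 7 * (1 + T) ^ 3) /
          √N ^ 3 := by
        rw [show (8 * K ^ 3 / N : ℝ) = 8 * K ^ 3 / (√N * √N) by rw [Real.mul_self_sqrt hN.le]]
        ring
    _ ≤ (336 * K ^ 9 * (1 + T) ^ 4 + 630 * K ^ 9 * (1 + T) ^ 4 + 220 * K ^ 9 * (1 + T) ^ 4) /
          √N ^ 3 := by
        gcongr
        · norm_num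
        · linarith
        · norm_num
        · norm_num
        · linarith
        · norm_num
    _ = _ := by ring

/-- For fixed `s`, the mean of linear form times `evol X t k k` vanishes at `t = 0` and solves the
linear equation with kernel `σ²φ`. Its forcing is of order `N^(-3/2)`, and stability passes this
order to the solution. -/
theorem norm_integral_linForm_mul_evol_le (h : IsModel P σ K X) {k j : Fin N} (hj : j ≠ k)
    {s r T : ℝ} (hs : 0 ≤ s) (hsT : s ≤ T) (hr : 0 ≤ r) (hrT : r ≤ T) :
    ‖∫ ω, linForm (cutRow k (X ω)) (offCol k (X ω)) j s * evol (X ω) r k k ∂P‖ ≤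
      2 * (1228 * K ^ 9 * (1 + T) ^ 5 / √N ^ 3) * r := by
  have hK := h.one_le
  have hT : 0 ≤ T := hs.trans hsT
  have hN : (0 : ℝ) < N := by exact_mod_cast k.pos
  have hl := h.l2Bound_linForm k j s
  have hφ := isPosDef_scChar h.pos
  have hy := fun t => h.hasDerivAt_integral_mul_evol k hl t
  have hyc : Continuous fun t => ∫ ω, linForm (cutRow k (X ω)) (offCol k (X ω)) j s *
      evol (X ω) t k k ∂P := continuous_iff_continuousAt.2 fun t => (hy t).continuousAt
  refine (hφ.const_mul (sq_nonneg σ)).norm_le (T := r)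
    (δ := fun t => ∫ ω, linForm (cutRow k (X ω)) (offCol k (X ω)) j s * evol (X ω) t k k ∂P)
    ?_ hr hy fun t ht => ?_
  · simpa [evol_zero] using h.integral_linForm k j s
  have ht0 := ht.1
  have htT : t ≤ T := ht.2.trans hrT
  set g : ℝ → ℂ := fun p => ∫ ω, linForm (cutRow k (X ω)) (offCol k (X ω)) j s *
      (quadForm (cutRow k (X ω)) (offCol k (X ω)) p - ((σ ^ 2 : ℝ) : ℂ) * scChar σ p) *
      evol (X ω) (t - p) k k ∂P with hg
  -- Splitting `σ²φ(p)` off the quadratic form reproduces the unknown function inside a convolution;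
  -- `g` is the forcing.
  have hpt : ∀ p, ∫ ω, linForm (cutRow k (X ω)) (offCol k (X ω)) j s *
      (quadForm (cutRow k (X ω)) (offCol k (X ω)) p * evol (X ω) (t - p) k k) ∂P =
      g p + ((σ ^ 2 : ℝ) : ℂ) * (scChar σ p *
        ∫ ω, linForm (cutRow k (X ω)) (offCol k (X ω)) j s * evol (X ω) (t - p) k k ∂P) := by
    intro p
    have i1 : Integrable (fun ω => linForm (cutRow k (X ω)) (offCol k (X ω)) j s *
        (quadForm (cutRow k (X ω)) (offCol k (X ω)) p - ((σ ^ 2 : ℝ) : ℂ) * scChar σ p) *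
        evol (X ω) (t - p) k k) P :=
      (h.integrable_linForm_mul_quadForm_sub k j s p).mul_bdd (c := 1)
        (measurable_evol h.meas measurable_const k k).aestronglyMeasurable
        (Filter.Eventually.of_forall fun ω => norm_evol_le (h.herm ω) _ k k)
    have i2 := (hl.integrable_mul (h.l2Bound_evol k k (t - p))).const_mul
      (((σ ^ 2 : ℝ) : ℂ) * scChar σ p)
    rw [hg, ← mul_assoc, ← integral_const_mul, ← integral_add i1 i2]
    refine integral_congr_ae (Filter.Eventually.of_forall fun ω => ?_)
    simp only
    ring
  have hle : ∀ p ∈ Set.uIoc 0 t, ‖g p‖ ≤ 1186 * K ^ 9 * (1 + T) ^ 4 / √N ^ 3 := by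
    intro p hp
    rw [Set.uIoc_of_le ht0] at hp
    exact h.norm_integral_linForm_mul_quadForm_sub_le hj hs hsT hp.1.le (hp.2.trans htT)
      (sub_nonneg.2 hp.2) (by linarith [hp.1])
  have hg2 : IntervalIntegrable g volume 0 t := by
    refine (intervalIntegrable_const (c := 1186 * K ^ 9 * (1 + T) ^ 4 / √N ^ 3)).mono_fun ?_ ?_
    · have hm2 : Measurable (Function.uncurry fun p ω =>
          linForm (cutRow k (X ω)) (offCol k (X ω)) j s *
          (quadForm (cutRow k (X ω)) (offCol k (X ω)) p - ((σ ^ 2 : ℝ) : ℂ) * scChar σ p) *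
          evol (X ω) (t - p) k k) :=
        (((h.meas_linForm k j s).comp measurable_snd).mul
          ((measurable_quadForm ((h.meas_cutRow k).comp measurable_snd)
          ((h.meas_offCol k).comp measurable_snd) measurable_fst).sub
            (measurable_const.mul (hφ.cont.measurable.comp measurable_fst)))).mul
          (measurable_evol (h.meas.comp measurable_snd) (measurable_const.sub measurable_fst) k k)
      exact hm2.stronglyMeasurable.integral_prod_right.aestronglyMeasurable
    · filter_upwards [ae_restrict_mem measurableSet_uIoc] with p hp
      exact (hle p hp).trans (Real.le_norm_self _)
  rw [h.integral_mul_diagDeriv k (h.meas_linForm k j s) hl ht0, conv_const_mul_left]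
  have e1 : ∫ p in (0 : ℝ)..t, ∫ ω, linForm (cutRow k (X ω)) (offCol k (X ω)) j s *
      (quadForm (cutRow k (X ω)) (offCol k (X ω)) p * evol (X ω) (t - p) k k) ∂P =
      (∫ p in (0 : ℝ)..t, g p) + ((σ ^ 2 : ℝ) : ℂ) * conv (scChar σ)
        (fun t => ∫ ω, linForm (cutRow k (X ω)) (offCol k (X ω)) j s *
          evol (X ω) t k k ∂P) t := by
    rw [conv, ← intervalIntegral.integral_const_mul, ← intervalIntegral.integral_add hg2]
    · exact intervalIntegral.integral_congr fun p _ => hpt p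
    · exact (continuous_const.mul (hφ.cont.mul
        (hyc.comp (continuous_const.sub continuous_id)))).intervalIntegrable _ _
  rw [e1, sub_add_eq_sub_sub, sub_add_cancel]
  have h4 := intervalIntegral.norm_integral_le_of_norm_le_const hle
  rw [sub_zero, abs_of_nonneg ht0] at h4
  -- The term with `X_kk` is a product of two independent centred factors, so it is centred of order
  -- `1/N`; the fluctuation of the evolution adds `N^(-1/2)`.
  have h5 := h.norm_integral_mul_evol_le k (h.l2Bound_linForm_mul_entry j k s)
    (h.integral_linForm_mul_entry j k s) ht0 htT
  calc _ ≤ K / √N * (K / √N) * (42 * K ^ 3 * (1 + T) ^ 2 / √N) +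
        1186 * K ^ 9 * (1 + T) ^ 4 / √N ^ 3 * t := by
        refine (norm_sub_le _ _).trans (add_le_add ?_ h4)
        rw [norm_mul, Complex.norm_I, one_mul]
        exact h5
    _ = 42 * K ^ 5 * (1 + T) ^ 2 / √N ^ 3 + 1186 * K ^ 9 * (1 + T) ^ 4 / √N ^ 3 * t := by ring
    _ ≤ 42 * K ^ 9 * (1 + T) ^ 5 / √N ^ 3 +
        1186 * K ^ 9 * (1 + T) ^ 4 / √N ^ 3 * (1 + T) := by
        gcongr
        · norm_num
        · linarith
        · norm_num
        · linarith
    _ = _ := by ring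

/-- The refined estimate of the expected off-diagonal entries. -/
theorem norm_integral_evol_off_diag_le_refined (h : IsModel P σ K X) {j k : Fin N} (hjk : j ≠ k)
    {T : ℝ} (hT : 0 ≤ T) :
    ‖∫ ω, evol (X ω) T j k ∂P‖ ≤ 2456 * K ^ 9 * (1 + T) ^ 7 / √N ^ 3 := by
  have hK := h.one_le
  have h1 : ∫ ω, evol (X ω) T j k ∂P = ∫ s in (0 : ℝ)..T, ∫ ω, Complex.I *
      (linForm (cutRow k (X ω)) (offCol k (X ω)) j s * evol (X ω) (T - s) k k) ∂P := by
    simp_rw [evol_off_diag k hjk T]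
    refine integral_intervalIntegral_comm ?_ hT (h.integrable_sqrt_colSq k) fun s _ ω => ?_
    · exact measurable_const.mul ((measurable_linForm ((h.meas_cutRow k).comp measurable_snd)
        ((h.meas_offCol k).comp measurable_snd) measurable_fst j).mul
        (measurable_evol (h.meas.comp measurable_snd) (measurable_const.sub measurable_fst) k k))
    · rw [norm_mul, norm_mul, Complex.norm_I, one_mul]
      exact (mul_le_of_le_one_right (norm_nonneg _) (norm_evol_le (h.herm ω) _ k k)).trans
        (h.norm_linForm_le_colSq k j s ω)
  rw [h1]
  have h2 : ∀ s ∈ Set.uIoc 0 T, ‖∫ ω, Complex.I *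
      (linForm (cutRow k (X ω)) (offCol k (X ω)) j s * evol (X ω) (T - s) k k) ∂P‖ ≤
        2 * (1228 * K ^ 9 * (1 + T) ^ 5 / √N ^ 3) * T := by
    intro s hs
    rw [Set.uIoc_of_le hT] at hs
    rw [integral_const_mul, norm_mul, Complex.norm_I, one_mul]
    refine (h.norm_integral_linForm_mul_evol_le hjk hs.1.le hs.2 (sub_nonneg.2 hs.2)
      (by linarith [hs.1])).trans ?_
    gcongr
    linarith [hs.1]
  refine (intervalIntegral.norm_integral_le_of_norm_le_const h2).trans ?_
  rw [sub_zero, abs_of_nonneg hT]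
  calc 2 * (1228 * K ^ 9 * (1 + T) ^ 5 / √N ^ 3) * T * T
      ≤ 2 * (1228 * K ^ 9 * (1 + T) ^ 5 / √N ^ 3) * (1 + T) * (1 + T) := by
        gcongr <;> linarith
    _ = _ := by ring

end IsModel

end Wigner

namespace Wigner

/-! ### Wigner matrices as instances of the model -/

/-- Induction on the finite index set: a new variable that is independent of the earlier ones
jointly adds one factor to the product of probabilities. -/
theorem iIndepFun_of_indepFun_finset {Ω ι : Type*} [MeasurableSpace Ω] {P : Measure Ω}
    [IsProbabilityMeasure P] {E : Type*} [MeasurableSpace E] {f : ι → Ω → E}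
    (h : ∀ (i : ι) (S : Finset ι), i ∉ S → IndepFun (f i) (fun ω (j : S) => f j ω) P) :
    iIndepFun f P := by
  classical
  rw [iIndepFun_iff_measure_inter_preimage_eq_mul]
  intro S
  induction S using Finset.induction_on with
  | empty => intro s _; simp
  | insert i S hi ih =>
    intro s hs
    rw [Finset.set_biInter_insert, Finset.prod_insert hi,
      ← ih fun j hj => hs j (Finset.mem_insert_of_mem hj)]
    have e : ⋂ j ∈ S, f j ⁻¹' s j =
        (fun ω (j : S) => f j ω) ⁻¹' (Set.univ.pi fun j : S => s j) := by
      ext ω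
      simp
    rw [e]
    exact (h i S hi).measure_inter_preimage_eq_mul _ _ (hs i (Finset.mem_insert_self i S))
      (MeasurableSet.univ_pi fun j => hs j (Finset.mem_insert_of_mem j.2))

/-- Functions of disjoint groups of independent random variables are independent. -/
theorem iIndepFun.of_owner {Ω ι J : Type*} [MeasurableSpace Ω] {P : Measure Ω}
    [IsProbabilityMeasure P] [Fintype J] {E : Type*} [MeasurableSpace E] {c : J → Ω → ℝ}
    (hc : iIndepFun c P) (hcm : ∀ a, Measurable (c a)) (owner : J → ι) {g : ι → (J → ℝ) → E}
    (hg : ∀ i, Measurable (g i))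
    (hgo : ∀ i v w, (∀ a, owner a = i → v a = w a) → g i v = g i w) :
    iIndepFun (fun i ω => g i fun a => c a ω) P := by
  classical
  refine iIndepFun_of_indepFun_finset fun i S hi => ?_
  set T : Finset J := Finset.univ.filter fun a => owner a = i
  let ext : ∀ T : Finset J, (T → ℝ) → J → ℝ := fun T v a => if h : a ∈ T then v ⟨a, h⟩ else 0
  have hext : ∀ T, Measurable (ext T) := fun T => measurable_pi_lambda _ fun a => by
    by_cases h : a ∈ T
    · simp only [ext, dif_pos h]
      exact measurable_pi_apply _
    · simp only [ext, dif_neg h]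
      exact measurable_const
  have h1 := (hc.indepFun_finset T Tᶜ disjoint_compl_right hcm).comp
    (φ := fun v => g i (ext T v)) (ψ := fun v (j : S) => g j (ext Tᶜ v))
    ((hg i).comp (hext T)) (measurable_pi_lambda _ fun j => (hg j).comp (hext Tᶜ))
  convert h1 using 1
  · funext ω
    refine hgo i _ _ fun a ha => ?_
    have : a ∈ T := by simp [T, ha]
    simp [ext, this]
  · funext ω j
    refine hgo j _ _ fun a ha => ?_
    have : a ∈ Tᶜ := by
      simp only [T, Finset.mem_compl, Finset.mem_filter, Finset.mem_univ, true_and, ha]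
      rintro rfl
      exact hi j.2
    simp only [ext, dif_pos this]

/-- A random Hermitian matrix with independent centred entries on and above the diagonal. -/
structure IsComplexWigner {Ω : Type*} [MeasurableSpace Ω] (P : Measure Ω) {N : ℕ} (σ A D : ℝ)
    (W : Ω → Matrix (Fin N) (Fin N) ℂ) : Prop where
  herm : ∀ ω, (W ω).IsHermitian
  meas : ∀ j k, Measurable fun ω => W ω j k
  indep : iIndepFun (fun (p : {p : Fin N × Fin N // p.1 ≤ p.2}) ω => W ω p.1.1 p.1.2) P
  mean : ∀ j k, j ≤ k → ∫ ω, W ω j k ∂P = 0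
  memLp_off : ∀ j k, j < k → MemLp (fun ω => W ω j k) 4 P
  second_off : ∀ j k, j < k → ∫ ω, ‖W ω j k‖ ^ 2 ∂P = σ ^ 2
  fourth_off : ∀ j k, j < k → ∫ ω, ‖W ω j k‖ ^ 4 ∂P ≤ A
  memLp_diag : ∀ i, MemLp (fun ω => W ω i i) 2 P
  second_diag : ∀ i, ∫ ω, ‖W ω i i‖ ^ 2 ∂P ≤ D

section Instances

variable {Ω : Type u} [MeasurableSpace Ω] {P : Measure Ω} [IsProbabilityMeasure P] {N : ℕ}
  {σ σ₁ m₄ : ℝ}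

theorem IsRealWigner.isComplexWigner {W : Ω → Matrix (Fin N) (Fin N) ℝ}
    (h : IsRealWigner P σ σ₁ m₄ W) :
    IsComplexWigner P σ m₄ (σ₁ ^ 2) fun ω => (W ω).map Complex.ofReal where
  herm ω := by
    ext i j
    simp [Matrix.conjTranspose_apply, (h.symm ω).apply]
  meas j k := Complex.measurable_ofReal.comp (h.meas j k)
  indep := h.indep.comp (fun _ x => (x : ℂ)) fun _ => Complex.measurable_ofReal
  mean j k hjk := by
    simp only [Matrix.map_apply]
    rw [integral_complex_ofReal]
    rcases hjk.lt_or_eq with hlt | rfl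
    · rw [h.mean_off j k hlt, Complex.ofReal_zero]
    · rw [h.mean_diag j, Complex.ofReal_zero]
  memLp_off j k hjk := (h.memLp_off j k hjk).ofReal
  second_off j k hjk := by
    have := variance_of_integral_eq_zero (h.meas j k).aemeasurable (h.mean_off j k hjk)
    rw [h.var_off j k hjk] at this
    simpa using this.symm
  fourth_off j k hjk := by
    simpa [Even.pow_abs (by decide : Even 4)] using h.fourth_off j k hjk
  memLp_diag i := (h.memLp_diag i).ofReal
  second_diag i := by simpa using h.second_diag i

/-- Each real coordinate belongs to exactly one entry on or above the diagonal, and each such entry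
is a function of its own coordinates. Diagonal entries need only a real part, since they are real by
Hermitian symmetry. -/
theorem IsHermitianWigner.indep_entries {W : Ω → Matrix (Fin N) (Fin N) ℂ}
    (h : IsHermitianWigner P σ σ₁ m₄ W) :
    iIndepFun (fun (p : {p : Fin N × Fin N // p.1 ≤ p.2}) ω => W ω p.1.1 p.1.2) P := by
  let owner : {p : Fin N × Fin N // p.1 < p.2} ⊕ ({p : Fin N × Fin N // p.1 < p.2} ⊕ Fin N) →
      {p : Fin N × Fin N // p.1 ≤ p.2} :=
    Sum.elim (fun p => ⟨p.1, p.2.le⟩) (Sum.elim (fun p => ⟨p.1, p.2.le⟩) fun i => ⟨(i, i), le_rfl⟩)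
  let g : {p : Fin N × Fin N // p.1 ≤ p.2} →
      ({p : Fin N × Fin N // p.1 < p.2} ⊕ ({p : Fin N × Fin N // p.1 < p.2} ⊕ Fin N) → ℝ) → ℂ :=
    fun p v => if hp : p.1.1 < p.1.2 then
      (v (.inl ⟨p.1, hp⟩) : ℂ) + (v (.inr (.inl ⟨p.1, hp⟩)) : ℂ) * Complex.I
      else (v (.inr (.inr p.1.1)) : ℂ)
  have hcm : ∀ a, Measurable (hermitianCoords W a) := by
    rintro (p | p | i)
    · exact Complex.measurable_re.comp (h.meas _ _)
    · exact Complex.measurable_im.comp (h.meas _ _)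
    · exact Complex.measurable_re.comp (h.meas _ _)
  have hg : ∀ p, Measurable (g p) := fun p => by
    by_cases hp : p.1.1 < p.1.2
    · simp only [g, dif_pos hp]
      fun_prop
    · simp only [g, dif_neg hp]
      fun_prop
  have h1 := iIndepFun.of_owner h.indep hcm owner hg fun p v w hvw => by
    by_cases hp : p.1.1 < p.1.2
    · simp only [g, dif_pos hp]
      rw [hvw (.inl ⟨p.1, hp⟩) rfl, hvw (.inr (.inl ⟨p.1, hp⟩)) rfl]
    · simp only [g, dif_neg hp]
      rw [hvw (.inr (.inr p.1.1))]
      exact Subtype.ext (Prod.ext rfl (p.2.eq_of_not_lt hp))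
  convert h1 using 1
  funext p ω
  by_cases hp : p.1.1 < p.1.2
  · simp only [g, dif_pos hp, hermitianCoords]
    exact (Complex.re_add_im _).symm
  · simp only [g, dif_neg hp, hermitianCoords]
    rw [← p.2.eq_of_not_lt hp]
    exact (Complex.conj_eq_iff_re.1 ((h.herm ω).apply p.1.1 p.1.1)).symm

theorem IsHermitianWigner.isComplexWigner {W : Ω → Matrix (Fin N) (Fin N) ℂ}
    (h : IsHermitianWigner P σ σ₁ m₄ W) : IsComplexWigner P σ m₄ (σ₁ ^ 2) W where
  herm := h.herm
  meas := h.meas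
  indep := h.indep_entries
  mean j k hjk := by
    rcases hjk.lt_or_eq with hlt | rfl
    · have hi := ((h.memLp_off j k hlt).integrable (by norm_num))
      have h1 := integral_re_add_im hi
      have h2 := h.mean_re_off j k hlt
      have h3 := h.mean_im_off j k hlt
      simp only [RCLike.re_to_complex, RCLike.im_to_complex, h2, h3] at h1
      simpa using h1.symm
    · exact h.mean_diag j
  memLp_off := h.memLp_off
  second_off j k hjk := by
    have hL : MemLp (fun ω => W ω j k) 2 P := (h.memLp_off j k hjk).mono_exponent (by norm_num)
    have h1 := variance_of_integral_eq_zero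
      (Complex.measurable_re.comp (h.meas j k)).aemeasurable (h.mean_re_off j k hjk)
    have h2 := variance_of_integral_eq_zero
      (Complex.measurable_im.comp (h.meas j k)).aemeasurable (h.mean_im_off j k hjk)
    have e1 := h.var_re_off j k hjk
    have e2 := h.var_im_off j k hjk
    have e : ∀ ω, ‖W ω j k‖ ^ 2 = (W ω j k).re ^ 2 + (W ω j k).im ^ 2 := fun ω => by
      rw [Complex.sq_norm, Complex.normSq_apply]; ring
    simp_rw [e]
    have i1 : Integrable (fun ω => (W ω j k).re ^ 2) P := hL.re.integrable_sq
    have i2 : Integrable (fun ω => (W ω j k).im ^ 2) P := hL.im.integrable_sq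
    rw [integral_add i1 i2]
    have h1' : Var[fun ω => (W ω j k).re; P] = ∫ ω, (W ω j k).re ^ 2 ∂P := h1
    have h2' : Var[fun ω => (W ω j k).im; P] = ∫ ω, (W ω j k).im ^ 2 ∂P := h2
    rw [← h1', ← h2', e1, e2]
    ring
  fourth_off := h.fourth_off
  memLp_diag := h.memLp_diag
  second_diag := h.second_diag

end Instances

namespace IsComplexWigner

variable {Ω : Type*} [MeasurableSpace Ω] {P : Measure Ω} [IsProbabilityMeasure P] {N : ℕ}
  {σ A D K : ℝ} {W : Ω → Matrix (Fin N) (Fin N) ℂ}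

/-- Entries below the diagonal are the conjugates of those above. -/
theorem l2Bound_entry (h : IsComplexWigner P σ A D W) (hσ : 0 < σ) (hK : 1 ≤ K) (hσK : σ ≤ K)
    (hD : D ≤ K ^ 2) (j k : Fin N) : L2Bound P (fun ω => W ω j k) K := by
  have hK0 : 0 ≤ K := by linarith
  have key : ∀ j k, j ≤ k → L2Bound P (fun ω => W ω j k) K := by
    intro j k hjk
    rcases hjk.lt_or_eq with hlt | rfl
    · refine L2Bound.of_integral ((h.memLp_off j k hlt).mono_exponent (by norm_num)) hK0 ?_
      rw [h.second_off j k hlt]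
      gcongr
    · exact L2Bound.of_integral (h.memLp_diag j) hK0 ((h.second_diag j).trans hD)
  rcases le_total j k with hjk | hjk
  · exact key j k hjk
  · refine (key k j hjk).congr_norm (h.meas j k).aestronglyMeasurable fun ω => ?_
    rw [← (h.herm ω).apply j k]
    simp

theorem l2Bound_sq (h : IsComplexWigner P σ A D W) (hA : A ≤ K ^ 4) {j k : Fin N} (hjk : j ≠ k) :
    L2Bound P (fun ω => W ω j k * starRingEnd ℂ (W ω j k)) (K ^ 2) := by
  have hconj : Continuous (starRingEnd ℂ) := RCLike.continuous_conj (K := ℂ)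
  have key : ∀ j k, j < k → L2Bound P (fun ω => W ω j k * starRingEnd ℂ (W ω j k)) (K ^ 2) := by
    intro j k hlt
    have hm : MemLp (fun ω => W ω j k * starRingEnd ℂ (W ω j k)) 2 P := by
      have h4 := h.memLp_off j k hlt
      have h4' : MemLp (fun ω => starRingEnd ℂ (W ω j k)) 4 P :=
        h4.congr_norm (hconj.comp_aestronglyMeasurable h4.1)
          (Filter.Eventually.of_forall fun ω => by simp)
      have : ENNReal.HolderTriple 4 4 2 := ⟨by
        rw [show (4 : ℝ≥0∞) = 2 * 2 by norm_num,
          ENNReal.mul_inv (by norm_num) (by norm_num), ← two_mul, ← mul_assoc,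
          ENNReal.mul_inv_cancel (by norm_num) (by norm_num), one_mul]⟩
      exact h4'.mul h4
    refine L2Bound.of_integral hm (by positivity) ?_
    refine le_trans (le_of_eq ?_) ((h.fourth_off j k hlt).trans (hA.trans (le_of_eq (by ring))))
    refine integral_congr_ae (Filter.Eventually.of_forall fun ω => ?_)
    simp only [norm_mul, RCLike.norm_conj]
    ring
  rcases lt_or_gt_of_ne hjk with hlt | hlt
  · exact key j k hlt
  · refine (key k j hlt).congr_norm ((h.meas j k).mul
      (hconj.measurable.comp (h.meas j k))).aestronglyMeasurable fun ω => ?_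
    rw [← (h.herm ω).apply j k]
    simp

theorem rescale_apply_eq (B : Matrix (Fin N) (Fin N) ℂ) (j k : Fin N) :
    rescale B j k = ((1 / √N : ℝ) : ℂ) * B j k := by
  simp [rescale]

theorem isModel (h : IsComplexWigner P σ A D W) (hσ : 0 < σ) (hK : 1 ≤ K) (hσK : σ ≤ K)
    (hA : A ≤ K ^ 4) (hD : D ≤ K ^ 2) : IsModel P σ K fun ω => rescale (W ω) where
  herm ω := by
    ext j k
    rw [Matrix.conjTranspose_apply, rescale_apply_eq, rescale_apply_eq, ← (h.herm ω).apply j k]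
    simp
  meas := measurable_pi_lambda _ fun j => measurable_pi_lambda _ fun k => by
    simp only [rescale_apply_eq]
    exact (h.meas j k).const_mul _
  indep := by
    have := h.indep.comp (fun _ z => ((1 / √N : ℝ) : ℂ) * z) fun _ => measurable_const_mul _
    simpa only [Function.comp_def, rescale_apply_eq] using this
  one_le := hK
  pos := hσ
  le := hσK
  mean j k := by
    simp only [rescale_apply_eq]
    rw [integral_const_mul]
    rcases le_total j k with hjk | hjk
    · rw [h.mean j k hjk, mul_zero]
    · have : ∀ ω, W ω j k = starRingEnd ℂ (W ω k j) := fun ω => ((h.herm ω).apply j k).symm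
      simp_rw [this]
      rw [integral_conj, h.mean k j hjk, map_zero, mul_zero]
  second j k := by
    have := (h.l2Bound_entry hσ hK hσK hD j k).const_mul ((1 / √N : ℝ) : ℂ)
    rw [Complex.norm_real, Real.norm_of_nonneg (by positivity)] at this
    simp only [rescale_apply_eq]
    exact this.mono (le_of_eq (by ring))
  second_eq j k hjk := by
    have key : ∀ j k, j ≠ k → ∫ ω, ‖W ω j k‖ ^ 2 ∂P = σ ^ 2 := fun j k hjk => by
      rcases lt_or_gt_of_ne hjk with hlt | hlt
      · exact h.second_off j k hlt
      · rw [← h.second_off k j hlt]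
        refine integral_congr_ae (Filter.Eventually.of_forall fun ω => ?_)
        simp only
        rw [← (h.herm ω).apply j k]
        simp
    have e : ∀ ω, rescale (W ω) j k * starRingEnd ℂ (rescale (W ω) j k) =
        ((1 / N * ‖W ω j k‖ ^ 2 : ℝ) : ℂ) := fun ω => by
      rw [Complex.mul_conj', rescale_apply_eq, norm_mul, Complex.norm_real,
        Real.norm_of_nonneg (by positivity), ← Complex.ofReal_pow, mul_pow, div_pow,
        Real.sq_sqrt (Nat.cast_nonneg N), one_pow]
    simp_rw [e]
    rw [integral_complex_ofReal, integral_const_mul, key j k hjk]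
    congr 1
    ring
  fourth j k hjk := by
    have := (h.l2Bound_sq hA hjk).const_mul ((1 / √N * (1 / √N) : ℝ) : ℂ)
    rw [Complex.norm_real, Real.norm_of_nonneg (by positivity)] at this
    have e : ∀ ω, rescale (W ω) j k * starRingEnd ℂ (rescale (W ω) j k) =
        ((1 / √N * (1 / √N) : ℝ) : ℂ) * (W ω j k * starRingEnd ℂ (W ω j k)) := fun ω => by
      rw [rescale_apply_eq, map_mul, Complex.conj_ofReal]
      push_cast
      ring
    simp_rw [e]
    exact this.mono (le_of_eq (by ring))

/-- Higher moments control the lower ones. -/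
theorem of_higherMoments {m₅ μ₃ : ℝ} (h : IsComplexWigner P σ A D W)
    (h5 : ∀ j k, j ≠ k → MemLp (fun ω => W ω j k) 5 P)
    (h5b : ∀ j k, j ≠ k → ∫ ω, ‖W ω j k‖ ^ 5 ∂P ≤ m₅)
    (h3 : ∀ i, MemLp (fun ω => W ω i i) 3 P) (h3b : ∀ i, ∫ ω, ‖W ω i i‖ ^ 3 ∂P ≤ μ₃) :
    IsComplexWigner P σ (1 + m₅) (1 + μ₃) W where
  __ := h
  fourth_off j k hjk := by
    have i4 := (h.memLp_off j k hjk).integrable_norm_pow (p := 4) (by norm_num)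
    have i5 := (h5 j k hjk.ne).integrable_norm_pow (p := 5) (by norm_num)
    refine (integral_mono i4 ((integrable_const 1).add i5) fun ω => ?_).trans ?_
    · simp only [Pi.add_apply]
      -- Comparing with 1 gives `u⁴ ≤ 1 + u⁵`, which is where the constant `1 + m₅` comes from.
      rcases le_total ‖W ω j k‖ 1 with hle | hle
      · have := pow_le_one₀ (n := 4) (norm_nonneg (W ω j k)) hle
        have : 0 ≤ ‖W ω j k‖ ^ 5 := by positivity
        linarith
      · have := pow_le_pow_right₀ hle (by norm_num : 4 ≤ 5)
        linarith
    · simp only [Pi.add_apply]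
      rw [integral_add (integrable_const 1) i5]
      simpa using h5b j k hjk.ne
  second_diag i := by
    have i2 := (h.memLp_diag i).integrable_norm_pow (p := 2) (by norm_num)
    have i3 := (h3 i).integrable_norm_pow (p := 3) (by norm_num)
    refine (integral_mono i2 ((integrable_const 1).add i3) fun ω => ?_).trans ?_
    · simp only [Pi.add_apply]
      rcases le_total ‖W ω i i‖ 1 with hle | hle
      · have := pow_le_one₀ (n := 2) (norm_nonneg (W ω i i)) hle
        have : 0 ≤ ‖W ω i i‖ ^ 3 := by positivity
        linarith
      · have := pow_le_pow_right₀ hle (by norm_num : 2 ≤ 3)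
        linarith
    · simp only [Pi.add_apply]
      rw [integral_add (integrable_const 1) i3]
      simpa using h3b i

/-- The variance is controlled by the fourth moment. -/
theorem sq_sigma_le (h : IsComplexWigner P σ A D W) {j k : Fin N} (hjk : j < k) :
    σ ^ 2 ≤ 1 + A := by
  have i4 := (h.memLp_off j k hjk).integrable_norm_pow (p := 4) (by norm_num)
  have i2 := ((h.memLp_off j k hjk).mono_exponent (q := 4) (p := 2)
    (by norm_num)).integrable_norm_pow (p := 2) (by norm_num)
  rw [← h.second_off j k hjk]
  refine (integral_mono i2 ((integrable_const 1).add i4) fun ω => ?_).trans ?_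
  · simp only [Pi.add_apply]
    nlinarith [sq_nonneg (‖W ω j k‖ ^ 2 - 1), sq_nonneg (‖W ω j k‖)]
  · simp only [Pi.add_apply]
    rw [integral_add (integrable_const 1) i4]
    simpa using h.fourth_off j k hjk

end IsComplexWigner

end Wigner

namespace Wigner

/-! ### Fourier representation of test functions -/

section Fourier

open scoped FourierTransform

theorem iteratedDeriv_ofReal_comp {n : ℕ} {f : ℝ → ℝ} (hf : ContDiff ℝ n f) :
    ∀ {l : ℕ}, l ≤ n → iteratedDeriv l (fun x => (f x : ℂ)) = fun x => ((iteratedDeriv l f x : ℝ) : ℂ)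
  | 0, _ => by simp [iteratedDeriv_zero]
  | l + 1, hl => by
    rw [iteratedDeriv_succ, iteratedDeriv_ofReal_comp hf (Nat.le_of_succ_le hl),
      iteratedDeriv_succ]
    funext x
    exact ((hf.differentiable_iteratedDeriv l (by exact_mod_cast hl) x).hasDerivAt.ofReal_comp).deriv

theorem lintegral_iteratedDeriv_le_norm1 {n l : ℕ} (hl : l ≤ n) (f : ℝ → ℝ) :
    ∫⁻ x, ENNReal.ofReal |iteratedDeriv l f x| ≤ norm1 n f :=
  Finset.le_sup (f := fun l => ∫⁻ x, ENNReal.ofReal |iteratedDeriv l f x|)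
    (Finset.mem_range_succ_iff.2 hl)

theorem norm1_le_norm1Plus (n : ℕ) (f : ℝ → ℝ) : norm1 n f ≤ norm1Plus n f := by
  refine Finset.sup_mono_fun fun l _ => lintegral_mono fun x => ENNReal.ofReal_le_ofReal ?_
  nlinarith [abs_nonneg x, abs_nonneg (iteratedDeriv l f x)]

theorem integrable_iteratedDeriv {n l : ℕ} (hl : l ≤ n) {f : ℝ → ℝ} (hf : ContDiff ℝ n f)
    (h1 : norm1 n f < ∞) : Integrable (iteratedDeriv l f) := by
  refine ⟨(hf.continuous_iteratedDeriv l (by exact_mod_cast hl)).aestronglyMeasurable, ?_⟩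
  rw [hasFiniteIntegral_iff_norm]
  exact (lintegral_iteratedDeriv_le_norm1 hl f).trans_lt h1

theorem integral_iteratedDeriv_le {n l : ℕ} (hl : l ≤ n) {f : ℝ → ℝ} (hf : ContDiff ℝ n f)
    (h1 : norm1 n f < ∞) : ∫ x, ‖((iteratedDeriv l f x : ℝ) : ℂ)‖ ≤ (norm1 n f).toReal := by
  simp_rw [Complex.norm_real, Real.norm_eq_abs]
  rw [integral_eq_lintegral_of_nonneg_ae (Filter.Eventually.of_forall fun x => abs_nonneg _)
    (hf.continuous_iteratedDeriv l (by exact_mod_cast hl)).abs.aestronglyMeasurable]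
  exact ENNReal.toReal_mono h1.ne (lintegral_iteratedDeriv_le_norm1 hl f)

/-- The Fourier transform of a real function. -/
noncomputable def fourierCoef (f : ℝ → ℝ) : ℝ → ℂ := 𝓕 fun x => (f x : ℂ)

theorem norm_fourier_le (g : ℝ → ℂ) (t : ℝ) : ‖𝓕 g t‖ ≤ ∫ x, ‖g x‖ :=
  VectorFourier.norm_fourierIntegral_le_integral_norm _ _ _ _ _

theorem fourier_iteratedDeriv_eq {n l : ℕ} (hl : l ≤ n) {f : ℝ → ℝ} (hf : ContDiff ℝ n f)
    (h1 : norm1 n f < ∞) (t : ℝ) :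
    𝓕 (fun x => ((iteratedDeriv l f x : ℝ) : ℂ)) t =
      (2 * Real.pi * Complex.I * t) ^ l * fourierCoef f t := by
  have hF : ContDiff ℝ ((n : ℕ∞) : WithTop ℕ∞) fun x => (f x : ℂ) :=
    Complex.ofRealCLM.contDiff.comp hf
  have := Real.fourier_iteratedDeriv (n := l) hF (fun m hm => by
    have hm' : m ≤ n := by exact_mod_cast hm
    rw [iteratedDeriv_ofReal_comp hf hm']
    exact (integrable_iteratedDeriv hm' hf h1).ofReal) (by exact_mod_cast hl)
  rw [iteratedDeriv_ofReal_comp hf hl] at this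
  rw [this]
  rfl

theorem norm_fourierCoef_mul_le {n l : ℕ} (hl : l ≤ n) {f : ℝ → ℝ} (hf : ContDiff ℝ n f)
    (h1 : norm1 n f < ∞) (t : ℝ) :
    |2 * Real.pi * t| ^ l * ‖fourierCoef f t‖ ≤ (norm1 n f).toReal := by
  refine le_trans (le_of_eq ?_) ((norm_fourier_le (fun x => ((iteratedDeriv l f x : ℝ) : ℂ)) t).trans
    (integral_iteratedDeriv_le hl hf h1))
  rw [fourier_iteratedDeriv_eq hl hf h1, norm_mul, norm_pow]
  congr 2
  simp [abs_mul]

theorem one_add_pow_le {u : ℝ} (hu : 0 ≤ u) (n : ℕ) : (1 + u) ^ n ≤ 2 ^ n * (1 + u ^ n) := by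
  rcases le_total u 1 with h | h
  · calc (1 + u) ^ n ≤ 2 ^ n := by gcongr; linarith
      _ ≤ 2 ^ n * (1 + u ^ n) := le_mul_of_one_le_right (by positivity)
          (by linarith [pow_nonneg hu n])
  · calc (1 + u) ^ n ≤ (2 * u) ^ n := by gcongr; linarith
      _ = 2 ^ n * u ^ n := mul_pow _ _ _
      _ ≤ 2 ^ n * (1 + u ^ n) := by gcongr; linarith

theorem one_add_sq_le (t : ℝ) : 1 + t ^ 2 ≤ (1 + |2 * Real.pi * t|) ^ 2 := by
  have h1 : |t| ≤ |2 * Real.pi * t| := by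
    rw [abs_mul, abs_of_pos Real.two_pi_pos]
    nlinarith [abs_nonneg t, Real.pi_gt_three]
  have h2 : t ^ 2 = |t| ^ 2 := (sq_abs t).symm
  nlinarith [abs_nonneg t]

theorem continuous_fourierCoef {f : ℝ → ℝ} (hf : Integrable f) : Continuous (fourierCoef f) :=
  VectorFourier.fourierIntegral_continuous Real.continuous_fourierChar
    (by exact continuous_inner) hf.ofReal

/-- The weighted integrability of the Fourier transform. -/
theorem integral_fourierCoef_weight {n m : ℕ} (hmn : m + 2 ≤ n) {f : ℝ → ℝ} (hf : ContDiff ℝ n f)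
    (h1 : norm1 n f < ∞) :
    Integrable (fun t => ‖fourierCoef f t‖ * (1 + |2 * Real.pi * t|) ^ m) ∧
    ∫ t, ‖fourierCoef f t‖ * (1 + |2 * Real.pi * t|) ^ m ≤
      2 ^ (n + 1) * Real.pi * (norm1 n f).toReal := by
  -- Only the derivatives of order `0` and `n` are used to bound `(1 + |2πt|)^n` times the
  -- transform. Two of the powers are given up for the integrable function `1/(1 + t²)`, whose
  -- integral is `π`.
  have hb : ∀ t, ‖fourierCoef f t‖ * (1 + |2 * Real.pi * t|) ^ m ≤
      2 ^ (n + 1) * (norm1 n f).toReal * (1 + t ^ 2)⁻¹ := fun t => by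
    have e0 := norm_fourierCoef_mul_le (Nat.zero_le n) hf h1 t
    have en := norm_fourierCoef_mul_le le_rfl hf h1 t
    rw [← div_eq_mul_inv, le_div_iff₀ (by positivity)]
    calc ‖fourierCoef f t‖ * (1 + |2 * Real.pi * t|) ^ m * (1 + t ^ 2)
        ≤ ‖fourierCoef f t‖ * (1 + |2 * Real.pi * t|) ^ m * (1 + |2 * Real.pi * t|) ^ 2 := by
          gcongr; exact one_add_sq_le t
      _ = ‖fourierCoef f t‖ * (1 + |2 * Real.pi * t|) ^ (m + 2) := by ring
      _ ≤ ‖fourierCoef f t‖ * (1 + |2 * Real.pi * t|) ^ n := by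
          gcongr
          linarith [abs_nonneg (2 * Real.pi * t)]
      _ ≤ ‖fourierCoef f t‖ * (2 ^ n * (1 + |2 * Real.pi * t| ^ n)) := by
          gcongr
          exact one_add_pow_le (abs_nonneg _) n
      _ = 2 ^ n * (|2 * Real.pi * t| ^ 0 * ‖fourierCoef f t‖ +
            |2 * Real.pi * t| ^ n * ‖fourierCoef f t‖) := by ring
      _ ≤ 2 ^ n * ((norm1 n f).toReal + (norm1 n f).toReal) := by gcongr
      _ = 2 ^ (n + 1) * (norm1 n f).toReal := by ring
  have hc : Continuous (fourierCoef f) := continuous_fourierCoef (by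
    simpa [iteratedDeriv_zero] using integrable_iteratedDeriv (Nat.zero_le n) hf h1)
  have hi := integrable_inv_one_add_sq.const_mul (2 ^ (n + 1) * (norm1 n f).toReal)
  have hint : Integrable (fun t => ‖fourierCoef f t‖ * (1 + |2 * Real.pi * t|) ^ m) :=
    hi.mono' (by fun_prop) (Filter.Eventually.of_forall fun t => by
      rw [Real.norm_of_nonneg (by positivity)]
      exact hb t)
  refine ⟨hint, (integral_mono hint hi hb).trans (le_of_eq ?_)⟩
  rw [integral_const_mul, integral_univ_inv_one_add_sq]
  ring

/-- The function `f` is a superposition of characters with coefficients `h`. -/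
structure IsSuperposition (f : ℝ → ℝ) (h : ℝ → ℂ) : Prop where
  cont : Continuous h
  integrable : Integrable h
  eq : ∀ x, (f x : ℂ) = ∫ t : ℝ, h t * Complex.exp (Complex.I * ((2 * Real.pi * t : ℝ) : ℂ) * x)

theorem isSuperposition_fourierCoef {f : ℝ → ℝ} (hfc : Continuous f) (hf : Integrable f)
    (hi : Integrable (fourierCoef f)) : IsSuperposition f (fourierCoef f) where
  cont := continuous_fourierCoef hf
  integrable := hi
  eq x := by
    have h1 := (Complex.continuous_ofReal.comp hfc).fourierInv_fourier_eq hf.ofReal hi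
    have h2 : (f x : ℂ) = 𝓕⁻ (𝓕 fun x => (f x : ℂ)) x := (congrFun h1 x).symm
    rw [h2, Real.fourierInv_eq']
    refine integral_congr_ae (Filter.Eventually.of_forall fun t => ?_)
    simp only [smul_eq_mul, fourierCoef]
    rw [mul_comm]
    congr 2
    simp
    ring

theorem isSuperposition_of_norm1 {n : ℕ} (hn : 2 ≤ n) {f : ℝ → ℝ} (hf : ContDiff ℝ n f)
    (h1 : norm1 n f < ∞) : IsSuperposition f (fourierCoef f) := by
  have hi0 : Integrable f := by
    simpa [iteratedDeriv_zero] using integrable_iteratedDeriv (Nat.zero_le n) hf h1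
  refine isSuperposition_fourierCoef hf.continuous hi0 ?_
  have := (integral_fourierCoef_weight (m := 0) (by omega) hf h1).1
  simp only [pow_zero, mul_one] at this
  exact (integrable_norm_iff (continuous_fourierCoef hi0).aestronglyMeasurable).1 this

/-- Plancherel's inequality for functions that are both integrable and square integrable. -/
theorem l2Bound_fourier {g : ℝ → ℂ} (hg : Integrable g) {B : ℝ} (h2 : L2Bound volume g B) :
    L2Bound volume (𝓕 g) B := by
  set G : Lp ℂ 2 (volume : Measure ℝ) := h2.memLp.toLp g with hG
  have hc : Continuous (𝓕 g) := VectorFourier.fourierIntegral_continuous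
    Real.continuous_fourierChar (by exact continuous_inner) hg
  -- The Fourier transform on `L²` and the Fourier integral agree almost everywhere: against a
  -- smooth compactly supported test function, both equal the pairing of `g` with the transform of
  -- that function.
  have hae : ∀ᵐ t, (𝓕 G : Lp ℂ 2 (volume : Measure ℝ)) t = 𝓕 g t := by
    refine ae_eq_of_integral_contDiff_smul_eq
      ((Lp.memLp _).locallyIntegrable (by norm_num)) hc.locallyIntegrable fun φ hφ hφc => ?_
    have hφ' : ContDiff ℝ ((⊤ : ℕ∞) : WithTop ℕ∞) fun x => (φ x : ℂ) := Complex.ofRealCLM.contDiff.comp hφ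
    have hφc' : HasCompactSupport fun x => (φ x : ℂ) := hφc.comp_left (g := Complex.ofReal) rfl
    set ψ : SchwartzMap ℝ ℂ := hφc'.toSchwartzMap hφ' with hψ
    have e1 := congrArg (fun T => T ψ) (Lp.fourier_toTemperedDistribution_eq G)
    simp only [TemperedDistribution.fourier_apply, Lp.toTemperedDistribution_apply] at e1
    have e2 : ∫ ξ, 𝓕 g ξ • ψ ξ = ∫ x, g x • 𝓕 (ψ : ℝ → ℂ) x := by
      have := VectorFourier.integral_fourierIntegral_smul_eq_flip (L := innerₗ ℝ)
        Real.continuous_fourierChar continuous_inner hg ψ.integrable (μ := volume) (ν := volume)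
      rwa [flip_innerₗ] at this
    have e3 : ∫ x, (𝓕 ψ) x • G x = ∫ x, g x • 𝓕 (ψ : ℝ → ℂ) x := by
      refine integral_congr_ae ?_
      filter_upwards [h2.memLp.coeFn_toLp] with x hx
      rw [hx, SchwartzMap.fourier_coe, smul_eq_mul, smul_eq_mul, mul_comm]
    calc ∫ x, φ x • (𝓕 G : Lp ℂ 2 (volume : Measure ℝ)) x
        = ∫ x, ψ x • (𝓕 G : Lp ℂ 2 (volume : Measure ℝ)) x := by
          refine integral_congr_ae (Filter.Eventually.of_forall fun x => ?_)
          exact Complex.real_smul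
      _ = ∫ ξ, 𝓕 g ξ • ψ ξ := by rw [← e1, e3, e2]
      _ = ∫ x, φ x • 𝓕 g x := by
          refine integral_congr_ae (Filter.Eventually.of_forall fun x => ?_)
          show _ * (φ x : ℂ) = _
          rw [mul_comm]
          exact Complex.real_smul.symm
  have e : eLpNorm (𝓕 g) 2 volume = eLpNorm g 2 volume := by
    rw [← eLpNorm_congr_ae hae]
    have := Lp.norm_fourier_eq G
    rw [Lp.norm_def, Lp.norm_def, ENNReal.toReal_eq_toReal_iff' (Lp.memLp _).2.ne
      (Lp.memLp _).2.ne] at this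
    rw [this]
    exact eLpNorm_congr_ae h2.memLp.coeFn_toLp
  exact ⟨hc.aestronglyMeasurable, h2.nonneg, e.le.trans h2.le⟩

end Fourier

end Wigner

namespace Wigner

/-! ### Compactly supported test functions -/

section CompactSupport

open scoped FourierTransform

variable {n : ℕ} {L : ℝ} {f : ℝ → ℝ}

theorem cNorm_nonneg (n : ℕ) (L : ℝ) (f : ℝ → ℝ) : 0 ≤ cNorm n L f :=
  Real.sSup_nonneg fun y hy => by
    obtain ⟨l, -, x, -, rfl⟩ := hy
    exact abs_nonneg _

theorem abs_iteratedDeriv_le_cNorm (hf : ContDiff ℝ n f) {l : ℕ} (hl : l ≤ n) {x : ℝ}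
    (hx : x ∈ Icc (-L) L) : |iteratedDeriv l f x| ≤ cNorm n L f := by
  refine le_csSup ?_ ⟨l, hl, x, hx, rfl⟩
  have hb : ∀ m ≤ n, BddAbove ((fun x => |iteratedDeriv m f x|) '' Icc (-L) L) := fun m hm =>
    (isCompact_Icc.image
      (hf.continuous_iteratedDeriv m (by exact_mod_cast hm)).abs).bddAbove
  refine BddAbove.mono ?_ (((Set.finite_Iic n).bddAbove_biUnion
    (S := fun m => (fun x => |iteratedDeriv m f x|) '' Icc (-L) L)).2 fun m hm => hb m hm)
  rintro y ⟨m, hm, x, hx, rfl⟩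
  exact mem_biUnion (mem_Iic.2 hm) ⟨x, hx, rfl⟩

theorem iteratedDeriv_eq_zero_of_notMem (hs : tsupport f ⊆ Icc (-L) L) (l : ℕ) {x : ℝ}
    (hx : x ∉ Icc (-L) L) : iteratedDeriv l f x = 0 := by
  have h : iteratedFDeriv ℝ l f x = 0 := by
    by_contra h0
    exact hx (hs (support_iteratedFDeriv_subset l (Function.mem_support.2 h0)))
  simp [iteratedDeriv, h]

theorem abs_iteratedDeriv_le_indicator (hf : ContDiff ℝ n f) (hs : tsupport f ⊆ Icc (-L) L)
    {l : ℕ} (hl : l ≤ n) (x : ℝ) :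
    |iteratedDeriv l f x| ≤ (Icc (-L) L).indicator (fun _ => cNorm n L f) x := by
  by_cases hx : x ∈ Icc (-L) L
  · rw [indicator_of_mem hx]
    exact abs_iteratedDeriv_le_cNorm hf hl hx
  · rw [indicator_of_notMem hx, iteratedDeriv_eq_zero_of_notMem hs l hx, abs_zero]

theorem norm1_lt_top_of_tsupport_subset (hf : ContDiff ℝ n f) (hs : tsupport f ⊆ Icc (-L) L) :
    norm1 n f < ∞ := by
  refine (Finset.sup_lt_iff ENNReal.zero_lt_top).2 fun l hl => ?_
  refine (lintegral_mono (g := (Icc (-L) L).indicator fun _ => ENNReal.ofReal (cNorm n L f))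
    fun x => ?_).trans_lt ?_
  · have := abs_iteratedDeriv_le_indicator hf hs (Finset.mem_range_succ_iff.1 hl) x
    by_cases hx : x ∈ Icc (-L) L
    · simp only [indicator_of_mem hx] at this ⊢
      exact ENNReal.ofReal_le_ofReal this
    · simp only [indicator_of_notMem hx] at this ⊢
      simp [ENNReal.ofReal_eq_zero.2 this]
  · rw [lintegral_indicator_const measurableSet_Icc]
    exact ENNReal.mul_lt_top ENNReal.ofReal_lt_top (by simp)

theorem l2Bound_iteratedDeriv (hf : ContDiff ℝ n f) (hs : tsupport f ⊆ Icc (-L) L)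
    (hL : 0 < L) {l : ℕ} (hl : l ≤ n) :
    L2Bound volume (fun x => ((iteratedDeriv l f x : ℝ) : ℂ)) (√(2 * L) * cNorm n L f) := by
  have hc := cNorm_nonneg n L f
  have hm : Continuous fun x => ((iteratedDeriv l f x : ℝ) : ℂ) :=
    Complex.continuous_ofReal.comp (hf.continuous_iteratedDeriv l (by exact_mod_cast hl))
  refine ⟨hm.aestronglyMeasurable, by positivity, ?_⟩
  have h1 : eLpNorm (fun x => ((iteratedDeriv l f x : ℝ) : ℂ)) 2 volume ≤
      eLpNorm ((Icc (-L) L).indicator fun _ => cNorm n L f) 2 volume :=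
    eLpNorm_mono_real fun x => by
      simpa using abs_iteratedDeriv_le_indicator hf hs hl x
  refine h1.trans (le_of_eq ?_)
  rw [eLpNorm_indicator_const measurableSet_Icc (by norm_num) (by norm_num), Real.volume_Icc,
    Real.enorm_eq_ofReal hc, ENNReal.ofReal_rpow_of_nonneg (by linarith) (by norm_num),
    ← ENNReal.ofReal_mul hc, mul_comm, Real.sqrt_eq_rpow]
  congr 3
  ring

/-- The weight for Cauchy–Schwarz on the Fourier side: one extra power is square integrable,
although it is not integrable. -/
theorem l2Bound_one_add_inv :
    L2Bound volume (fun t : ℝ => (((1 + |2 * Real.pi * t|)⁻¹ : ℝ) : ℂ)) (√Real.pi) := by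
  have hm : Continuous fun t : ℝ => (((1 + |2 * Real.pi * t|)⁻¹ : ℝ) : ℂ) :=
    Complex.continuous_ofReal.comp (Continuous.inv₀ (by fun_prop) fun t => by positivity)
  have hb : ∀ t : ℝ, ‖(((1 + |2 * Real.pi * t|)⁻¹ : ℝ) : ℂ)‖ ^ 2 ≤ (1 + t ^ 2)⁻¹ := fun t => by
    rw [Complex.norm_real, Real.norm_of_nonneg (by positivity), inv_pow]
    exact inv_anti₀ (by positivity) (one_add_sq_le t)
  have hi : Integrable fun t : ℝ => ‖(((1 + |2 * Real.pi * t|)⁻¹ : ℝ) : ℂ)‖ ^ 2 :=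
    integrable_inv_one_add_sq.mono' (hm.norm.pow 2).aestronglyMeasurable
      (Filter.Eventually.of_forall fun t => by
        rw [Real.norm_of_nonneg (by positivity)]
        exact hb t)
  refine L2Bound.of_integral ((memLp_two_iff_integrable_sq_norm hm.aestronglyMeasurable).2 hi) (Real.sqrt_nonneg _) ?_
  rw [Real.sq_sqrt Real.pi_pos.le]
  exact (integral_mono hi integrable_inv_one_add_sq hb).trans integral_univ_inv_one_add_sq.le

/-- Compact support puts the derivatives in `L²`. Plancherel and Cauchy–Schwarz then need one
derivative beyond the weight, so the weight of power 6 is reached with seven derivatives. -/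
theorem integral_fourierCoef_weight_of_tsupport_subset (hf : ContDiff ℝ (n + 1 : ℕ) f)
    (hs : tsupport f ⊆ Icc (-L) L) (hL : 0 < L) :
    Integrable (fun t => ‖fourierCoef f t‖ * (1 + |2 * Real.pi * t|) ^ n) ∧
    ∫ t, ‖fourierCoef f t‖ * (1 + |2 * Real.pi * t|) ^ n ≤
      2 ^ (n + 2) * √(2 * L) * √Real.pi * cNorm (n + 1) L f := by
  have h1 := norm1_lt_top_of_tsupport_subset hf hs
  have hc : Continuous (fourierCoef f) := continuous_fourierCoef (by
    simpa [iteratedDeriv_zero] using integrable_iteratedDeriv (Nat.zero_le _) hf h1)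
  have hl : ∀ l ≤ n + 1, L2Bound volume (𝓕 fun x => ((iteratedDeriv l f x : ℝ) : ℂ))
      (√(2 * L) * cNorm (n + 1) L f) := fun l hl =>
    l2Bound_fourier (integrable_iteratedDeriv hl hf h1).ofReal (l2Bound_iteratedDeriv hf hs hL hl)
  have h2 := (((hl 0 (Nat.zero_le _)).norm.add (hl (n + 1) le_rfl).norm).const_mul
    ((2 : ℂ) ^ (n + 1)))
  have h3 : L2Bound volume (fun t => fourierCoef f t * ((1 + |2 * Real.pi * t| : ℝ) : ℂ) ^ (n + 1))
      (2 ^ (n + 2) * √(2 * L) * cNorm (n + 1) L f) := by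
    refine (h2.of_norm_le (by fun_prop) fun t => ?_).mono (le_of_eq ?_)
    · rw [fourier_iteratedDeriv_eq (Nat.zero_le _) hf h1, fourier_iteratedDeriv_eq le_rfl hf h1]
      rw [← Complex.ofReal_add, norm_mul, norm_mul, norm_pow, norm_pow, Complex.norm_real,
        Complex.norm_real, Real.norm_of_nonneg (by positivity), Real.norm_of_nonneg (by positivity)]
      simp only [pow_zero, one_mul, norm_mul, norm_pow, Complex.norm_ofNat, Complex.norm_real,
        Complex.norm_I, mul_one, Real.norm_eq_abs, abs_of_pos Real.pi_pos]
      have e : |2 * Real.pi * t| = 2 * Real.pi * |t| := by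
        rw [abs_mul, abs_of_pos Real.two_pi_pos]
      have := one_add_pow_le (abs_nonneg (2 * Real.pi * t)) (n + 1)
      rw [← e]
      calc ‖fourierCoef f t‖ * (1 + |2 * Real.pi * t|) ^ (n + 1)
          ≤ ‖fourierCoef f t‖ * (2 ^ (n + 1) * (1 + |2 * Real.pi * t| ^ (n + 1))) := by gcongr
        _ = _ := by ring
    · rw [norm_pow, Complex.norm_ofNat]
      ring
  have e : ∀ t, ‖fourierCoef f t‖ * (1 + |2 * Real.pi * t|) ^ n =
      ‖fourierCoef f t * ((1 + |2 * Real.pi * t| : ℝ) : ℂ) ^ (n + 1)‖ *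
        ‖(((1 + |2 * Real.pi * t|)⁻¹ : ℝ) : ℂ)‖ := fun t => by
    rw [norm_mul, norm_pow, Complex.norm_real, Complex.norm_real,
      Real.norm_of_nonneg (by positivity), Real.norm_of_nonneg (by positivity), pow_succ]
    field_simp
  simp_rw [e]
  refine ⟨?_, (h3.integral_norm_mul_le l2Bound_one_add_inv).trans (le_of_eq (by ring))⟩
  simpa only [norm_mul] using (h3.integrable_mul l2Bound_one_add_inv).norm

end CompactSupport

end Wigner

namespace Wigner

/-! ### Transfer from the evolution to test functions -/

theorem continuous_scChar (σ : ℝ) : Continuous (scChar σ) :=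
  continuous_iff_continuousAt.2 fun t => (hasDerivAt_scChar σ t).continuousAt

namespace IsSuperposition

variable {f : ℝ → ℝ} {g : ℝ → ℂ}

theorem integrable_mul_of_norm_le_one (hs : IsSuperposition f g) {b : ℝ → ℂ}
    (hb : AEStronglyMeasurable b volume) (hb1 : ∀ t, ‖b t‖ ≤ 1) :
    Integrable fun t => g t * b t :=
  hs.integrable.mul_bdd hb (Filter.Eventually.of_forall hb1)

theorem norm_exp_char (s x : ℝ) : ‖Complex.exp (Complex.I * s * x)‖ = 1 := by
  rw [mul_assoc, ← Complex.ofReal_mul, mul_comm]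
  exact Complex.norm_exp_ofReal_mul_I _

theorem integrable_mul_exp (hs : IsSuperposition f g) (x : ℝ) :
    Integrable fun t : ℝ =>
      g t * Complex.exp (Complex.I * ((2 * Real.pi * t : ℝ) : ℂ) * x) :=
  hs.integrable_mul_of_norm_le_one (by fun_prop) fun t => (norm_exp_char _ _).le

/-- Both sides are sums over the eigenbasis with the same coefficients, so the scalar inversion
formula at each eigenvalue is enough. -/
theorem cfc_apply {N : ℕ} {X : Matrix (Fin N) (Fin N) ℂ} (hs : IsSuperposition f g)
    (hX : X.IsHermitian) (i j : Fin N) :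
    cfc f X i j = ∫ t : ℝ, g t * evol X (2 * Real.pi * t) i j := by
  simp_rw [cfc_apply_eq_sum hX, evol_apply_eq_sum hX, Finset.mul_sum]
  rw [integral_finsetSum]
  · refine Finset.sum_congr rfl fun l _ => ?_
    rw [hs.eq, ← integral_const_mul, ← integral_mul_const]
    refine integral_congr_ae (Filter.Eventually.of_forall fun t => ?_)
    ring
  · intro l _
    refine (((hs.integrable_mul_exp (hX.eigenvalues l)).const_mul
      ((hX.eigenvectorUnitary : Matrix (Fin N) (Fin N) ℂ) i l)).mul_const
      (starRingEnd ℂ ((hX.eigenvectorUnitary : Matrix (Fin N) (Fin N) ℂ) j l))).congr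
      (Filter.Eventually.of_forall fun t => ?_)
    ring

theorem semicircleIntegral_eq (hs : IsSuperposition f g) {σ : ℝ} (hσ : 0 < σ) :
    (semicircleIntegral σ f : ℂ) = ∫ t : ℝ, g t * scChar σ (2 * Real.pi * t) := by
  have hle : -2 * σ ≤ 2 * σ := by linarith
  have hprod : Integrable (Function.uncurry fun (t x : ℝ) => g t *
      (Complex.exp (Complex.I * ((2 * Real.pi * t : ℝ) : ℂ) * x) * scDensity σ x))
      (volume.prod (volume.restrict (Ioc (-2 * σ) (2 * σ)))) := by
    have h1 : Integrable (fun x => (scDensity σ x : ℂ))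
        (volume.restrict (Ioc (-2 * σ) (2 * σ))) :=
      ((Complex.continuous_ofReal.comp (continuous_scDensity σ)).integrableOn_Icc).mono_set
        Ioc_subset_Icc_self
    refine ((hs.integrable.mul_prod h1).mul_bdd (c := 1)
      (g := fun p : ℝ × ℝ => Complex.exp (Complex.I * ((2 * Real.pi * p.1 : ℝ) : ℂ) * p.2))
      (Continuous.aestronglyMeasurable (by fun_prop))
      (Filter.Eventually.of_forall fun p => (norm_exp_char _ _).le)).congr
      (Filter.Eventually.of_forall fun p => ?_)
    simp only [Function.uncurry]
    ring
  have hsw := integral_integral_swap hprod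
  simp only [scChar]
  simp_rw [intervalIntegral.integral_of_le hle, ← integral_const_mul]
  rw [hsw, semicircleIntegral, intervalIntegral.integral_of_le hle, ← integral_complex_ofReal]
  refine integral_congr_ae (Filter.Eventually.of_forall fun x => ?_)
  show ((f x * scDensity σ x : ℝ) : ℂ) = _
  rw [Complex.ofReal_mul, hs.eq, ← integral_mul_const]
  refine integral_congr_ae (Filter.Eventually.of_forall fun t => ?_)
  ring

end IsSuperposition

namespace IsModel

variable {Ω : Type u} [MeasurableSpace Ω] {P : Measure Ω} [IsProbabilityMeasure P] {N : ℕ}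
  {σ K : ℝ} {X : Ω → Matrix (Fin N) (Fin N) ℂ} {f : ℝ → ℝ} {g : ℝ → ℂ}

theorem measurable_uncurry_evol (h : IsModel P σ K X) (i j : Fin N) :
    Measurable fun p : ℝ × Ω => evol (X p.2) (2 * Real.pi * p.1) i j :=
  measurable_evol (h.meas.comp measurable_snd) (by fun_prop) i j

theorem measurable_cfc_apply (h : IsModel P σ K X) (hs : IsSuperposition f g) (i j : Fin N) :
    Measurable fun ω => cfc f (X ω) i j := by
  simp_rw [fun ω => hs.cfc_apply (h.herm ω) i j]
  exact (((hs.cont.measurable.comp measurable_fst).mul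
    (h.measurable_uncurry_evol i j)).stronglyMeasurable.integral_prod_left').measurable

theorem integrable_uncurry_mul_evol (h : IsModel P σ K X) (hs : IsSuperposition f g)
    (i j : Fin N) :
    Integrable (fun p : ℝ × Ω => g p.1 * evol (X p.2) (2 * Real.pi * p.1) i j)
      ((volume : Measure ℝ).prod P) := by
  have h1 := hs.integrable.comp_fst P
  exact h1.mul_bdd (h.measurable_uncurry_evol i j).aestronglyMeasurable
    (Filter.Eventually.of_forall fun p => norm_evol_le (h.herm p.2) _ i j)

theorem integrable_cfc_apply (h : IsModel P σ K X) (hs : IsSuperposition f g) (i j : Fin N) :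
    Integrable (fun ω => cfc f (X ω) i j) P := by
  simp_rw [fun ω => hs.cfc_apply (h.herm ω) i j]
  exact (h.integrable_uncurry_mul_evol hs i j).integral_prod_right

theorem integral_cfc_apply (h : IsModel P σ K X) (hs : IsSuperposition f g) (i j : Fin N) :
    ∫ ω, cfc f (X ω) i j ∂P = ∫ t, g t * ∫ ω, evol (X ω) (2 * Real.pi * t) i j ∂P := by
  simp_rw [fun ω => hs.cfc_apply (h.herm ω) i j, ← integral_const_mul]
  exact (integral_integral_swap (h.integrable_uncurry_mul_evol hs i j)).symm

/-- A bound of the expected evolution gives a bound of the expected functional calculus. -/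
theorem norm_integral_cfc_sub_le (h : IsModel P σ K X) (hs : IsSuperposition f g) {i j : Fin N}
    {c : ℝ → ℂ} (hc : Continuous c) (hc1 : ∀ t, ‖c t‖ ≤ 1) {B : ℝ} {m : ℕ}
    (hb : ∀ s, ‖(∫ ω, evol (X ω) s i j ∂P) - c s‖ ≤ B * (1 + |s|) ^ m)
    (hi : Integrable fun t => ‖g t‖ * (1 + |2 * Real.pi * t|) ^ m) :
    ‖(∫ ω, cfc f (X ω) i j ∂P) - ∫ t, g t * c (2 * Real.pi * t)‖ ≤
      B * ∫ t, ‖g t‖ * (1 + |2 * Real.pi * t|) ^ m := by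
  rw [h.integral_cfc_apply hs, ← integral_sub, ← integral_const_mul]
  · refine norm_integral_le_of_norm_le (hi.const_mul B)
      (Filter.Eventually.of_forall fun t => ?_)
    rw [← mul_sub, norm_mul]
    calc ‖g t‖ * _ ≤ ‖g t‖ * (B * (1 + |2 * Real.pi * t|) ^ m) := by gcongr; exact hb _
      _ = _ := by ring
  · simp_rw [← integral_const_mul]
    exact (h.integrable_uncurry_mul_evol hs i j).integral_prod_left
  · exact hs.integrable_mul_of_norm_le_one
      (hc.comp (continuous_const.mul continuous_id)).aestronglyMeasurable fun t => hc1 _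

/-- An `L²` bound of the evolution gives an `L²` bound of the functional calculus. -/
theorem l2Bound_cfc_sub (h : IsModel P σ K X) (hs : IsSuperposition f g) {i j : Fin N}
    {c : ℝ → ℂ} (hc : Continuous c) (hc1 : ∀ t, ‖c t‖ ≤ 1) {B : ℝ} {m : ℕ}
    (hb : ∀ s, L2Bound P (fun ω => evol (X ω) s i j - c s) (B * (1 + |s|) ^ m))
    (hi : Integrable fun t => ‖g t‖ * (1 + |2 * Real.pi * t|) ^ m) :
    L2Bound P (fun ω => cfc f (X ω) i j - ∫ t, g t * c (2 * Real.pi * t))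
      (B * ∫ t, ‖g t‖ * (1 + |2 * Real.pi * t|) ^ m) := by
  have hcc : Continuous fun t => c (2 * Real.pi * t) :=
    hc.comp (continuous_const.mul continuous_id)
  have hη : Measurable (Function.uncurry fun (t : ℝ) ω =>
      g t * (evol (X ω) (2 * Real.pi * t) i j - c (2 * Real.pi * t))) :=
    (hs.cont.measurable.comp measurable_fst).mul
      ((h.measurable_uncurry_evol i j).sub (hcc.measurable.comp measurable_fst))
  have h1 := L2Bound.integral_norm (P := P) (ν := volume) hη (hi.const_mul B)
    (Filter.Eventually.of_forall fun t => ((hb (2 * Real.pi * t)).const_mul (g t)).mono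
      (le_of_eq (by ring)))
  rw [integral_const_mul] at h1
  refine h1.of_norm_le ((h.measurable_cfc_apply hs i j).sub_const _).aestronglyMeasurable
    fun ω => ?_
  rw [hs.cfc_apply (h.herm ω), ← integral_sub, Complex.norm_real,
    Real.norm_of_nonneg (integral_nonneg fun _ => norm_nonneg _)]
  · simp_rw [← mul_sub]
    exact norm_integral_le_integral_norm _
  · exact hs.integrable_mul_of_norm_le_one (measurable_evol measurable_const
      (by fun_prop) i j).aestronglyMeasurable fun t => norm_evol_le (h.herm ω) _ i j
  · exact hs.integrable_mul_of_norm_le_one hcc.aestronglyMeasurable fun t => hc1 _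

theorem integral_evol_neg (h : IsModel P σ K X) (i j : Fin N) (t : ℝ) :
    ∫ ω, evol (X ω) (-t) i j ∂P = starRingEnd ℂ (∫ ω, evol (X ω) t j i ∂P) := by
  simp_rw [fun ω => evol_neg_apply (h.herm ω) t i j]
  exact integral_conj

theorem norm_integral_evol_diag_sub_le_abs (h : IsModel P σ K X) (k : Fin N) (s : ℝ) :
    ‖(∫ ω, evol (X ω) s k k ∂P) - scChar σ s‖ ≤ 5046 * K ^ 8 / N * (1 + |s|) ^ 6 := by
  have e : ∀ T : ℝ, 5046 * K ^ 8 / N * (1 + T) ^ 6 = 5046 * K ^ 8 * (1 + T) ^ 6 / N :=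
    fun T => by ring
  rw [e]
  rcases le_total 0 s with hs | hs
  · rw [abs_of_nonneg hs]
    exact h.norm_meanDiag_sub_le k hs
  · rw [abs_of_nonpos hs]
    have := h.norm_meanDiag_sub_le k (neg_nonneg.2 hs)
    rw [← RCLike.norm_conj, map_sub, ← scChar_neg, neg_neg, meanDiag, ← h.integral_evol_neg,
      neg_neg] at this
    exact this

/-- Reversing time conjugates and transposes the evolution, so negative times for `(j, k)` need the
hypothesis for `(k, j)`. The bound `φ` is left abstract to serve both the crude and the refined
estimate. -/
theorem norm_integral_evol_off_diag_le_abs (h : IsModel P σ K X) {j k : Fin N} (hjk : j ≠ k)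
    {φ : ℝ → ℝ} (hφ : ∀ {j k : Fin N}, j ≠ k → ∀ {T : ℝ}, 0 ≤ T →
      ‖∫ ω, evol (X ω) T j k ∂P‖ ≤ φ T) (s : ℝ) :
    ‖∫ ω, evol (X ω) s j k ∂P‖ ≤ φ |s| := by
  rcases le_total 0 s with hs | hs
  · rw [abs_of_nonneg hs]
    exact hφ hjk hs
  · rw [abs_of_nonpos hs]
    have := hφ hjk.symm (neg_nonneg.2 hs)
    rwa [← RCLike.norm_conj, ← h.integral_evol_neg, neg_neg] at this

/-- Diagonal and off-diagonal entries are put under one bound with a deterministic centring, as the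
variance estimate concerns all pairs of indices. -/
theorem l2Bound_evol_sub_abs (h : IsModel P σ K X) (i j : Fin N) (s : ℝ) :
    L2Bound P (fun ω => evol (X ω) s i j - if i = j then scChar σ s else 0)
      (42 * K ^ 3 / √N * (1 + |s|) ^ 2) := by
  have key : ∀ (i j : Fin N) {T : ℝ}, 0 ≤ T →
      L2Bound P (fun ω => evol (X ω) T i j - if i = j then scChar σ T else 0)
        (42 * K ^ 3 / √N * (1 + T) ^ 2) := fun i j T hT => by
    by_cases hij : i = j
    · subst hij
      simp only [if_true]
      exact (h.l2Bound_evol_diag i hT).mono (le_of_eq (by ring))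
    · simp only [hij, if_false, sub_zero]
      refine (h.l2Bound_evol_off_diag hij hT).mono ?_
      have hK := h.one_le
      have hK0 : 0 ≤ K := by linarith
      have h1 : T * K ≤ 42 * K ^ 3 * (1 + T) ^ 2 := by
        have a : K ≤ K ^ 3 := le_self_pow₀ hK (by norm_num)
        have b : T ≤ (1 + T) ^ 2 := by nlinarith
        calc T * K ≤ (1 + T) ^ 2 * K ^ 3 := by gcongr
          _ ≤ 42 * ((1 + T) ^ 2 * K ^ 3) := le_mul_of_one_le_left (by positivity) (by norm_num)
          _ = _ := by ring
      calc T * (K / √N) = T * K / √N := by ring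
        _ ≤ 42 * K ^ 3 * (1 + T) ^ 2 / √N := by gcongr
        _ = _ := by ring
  rcases le_total 0 s with hs | hs
  · rw [abs_of_nonneg hs]
    exact key i j hs
  · rw [abs_of_nonpos hs]
    refine (key j i (neg_nonneg.2 hs)).congr_norm ?_ fun ω => ?_
    · exact ((measurable_evol h.meas measurable_const i j).sub_const _).aestronglyMeasurable
    · rw [← RCLike.norm_conj, map_sub, ← evol_neg_apply (h.herm ω)]
      by_cases hij : i = j
      · simp [hij, scChar_neg]
      · simp [hij, Ne.symm hij]

/-- The expectation of the diagonal entries of the functional calculus. -/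
theorem norm_integral_cfc_diag_sub_le (h : IsModel P σ K X) (hs : IsSuperposition f g)
    (hi : Integrable fun t => ‖g t‖ * (1 + |2 * Real.pi * t|) ^ 6) (i : Fin N) :
    ‖(∫ ω, cfc f (X ω) i i ∂P) - (semicircleIntegral σ f : ℂ)‖ ≤
      5046 * K ^ 8 / N * ∫ t, ‖g t‖ * (1 + |2 * Real.pi * t|) ^ 6 := by
  rw [hs.semicircleIntegral_eq h.pos]
  exact h.norm_integral_cfc_sub_le hs (continuous_scChar σ) (norm_scChar_le h.pos)
    (h.norm_integral_evol_diag_sub_le_abs i) hi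

theorem norm_integral_cfc_off_diag_le (h : IsModel P σ K X) (hs : IsSuperposition f g)
    {j k : Fin N} (hjk : j ≠ k)
    (hi : Integrable fun t => ‖g t‖ * (1 + |2 * Real.pi * t|) ^ 3) :
    ‖∫ ω, cfc f (X ω) j k ∂P‖ ≤
      42 * K ^ 4 / N * ∫ t, ‖g t‖ * (1 + |2 * Real.pi * t|) ^ 3 := by
  have := h.norm_integral_cfc_sub_le hs (i := j) (j := k) (c := fun _ => 0)
    (B := 42 * K ^ 4 / N) continuous_const (by simp) (fun s => by
      rw [sub_zero]
      exact (h.norm_integral_evol_off_diag_le_abs hjk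
        (fun hjk _ hT => h.norm_integral_evol_off_diag_le hjk hT) s).trans
          (le_of_eq (by ring))) hi
  simpa using this

theorem norm_integral_cfc_off_diag_le_refined (h : IsModel P σ K X) (hs : IsSuperposition f g)
    {j k : Fin N} (hjk : j ≠ k)
    (hi : Integrable fun t => ‖g t‖ * (1 + |2 * Real.pi * t|) ^ 7) :
    ‖∫ ω, cfc f (X ω) j k ∂P‖ ≤
      2456 * K ^ 9 / √N ^ 3 * ∫ t, ‖g t‖ * (1 + |2 * Real.pi * t|) ^ 7 := by
  have := h.norm_integral_cfc_sub_le hs (i := j) (j := k) (c := fun _ => 0)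
    (B := 2456 * K ^ 9 / √N ^ 3) continuous_const (by simp) (fun s => by
      rw [sub_zero]
      exact (h.norm_integral_evol_off_diag_le_abs hjk
        (fun hjk _ hT => h.norm_integral_evol_off_diag_le_refined hjk hT) s).trans
          (le_of_eq (by ring))) hi
  simpa using this

/-- The deterministic centring of the entries of the functional calculus. -/
theorem exists_l2Bound_cfc_sub (h : IsModel P σ K X) (hs : IsSuperposition f g) (i j : Fin N)
    (hi : Integrable fun t => ‖g t‖ * (1 + |2 * Real.pi * t|) ^ 2) :
    ∃ c : ℂ, L2Bound P (fun ω => cfc f (X ω) i j - c)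
      (42 * K ^ 3 / √N * ∫ t, ‖g t‖ * (1 + |2 * Real.pi * t|) ^ 2) := by
  refine ⟨_, h.l2Bound_cfc_sub hs (c := fun s => if i = j then scChar σ s else 0) ?_ ?_
    (h.l2Bound_evol_sub_abs i j) hi⟩
  · by_cases hij : i = j
    · simpa [hij] using continuous_scChar σ
    · simpa [hij] using continuous_const
  · intro t
    by_cases hij : i = j
    · simpa [hij] using norm_scChar_le h.pos t
    · simp [hij]

end IsModel

/-- The variance is at most the mean square deviation from any constant. -/
theorem L2Bound.totalVariance_le {Ω : Type u} [MeasurableSpace Ω] {P : Measure Ω}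
    [IsProbabilityMeasure P] {Y : Ω → ℂ} {c : ℂ} {B : ℝ} (h : L2Bound P (fun ω => Y ω - c) B) :
    MemLp Y 2 P ∧ totalVariance P Y ≤ (2 * B) ^ 2 := by
  have hY : MemLp Y 2 P := by
    refine (h.memLp.add (memLp_const c)).ae_eq (Filter.Eventually.of_forall fun ω => ?_)
    simp
  have hYi : Integrable Y P := hY.integrable (by norm_num)
  have h1 : ‖∫ ω, (Y ω - c) ∂P‖ ≤ B := h.norm_integral_le
  have h2 : L2Bound P (fun _ => ∫ ω, (Y ω - c) ∂P) B :=
    .of_bounded aestronglyMeasurable_const h.nonneg fun _ => h1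
  refine ⟨hY, ?_⟩
  have h3 := ((h.sub h2).mono (le_of_eq (two_mul B).symm)).integral_sq_le
  refine le_trans (le_of_eq ?_) h3
  refine integral_congr_ae (Filter.Eventually.of_forall fun ω => ?_)
  simp only
  rw [integral_sub hYi (integrable_const c)]
  simp

end Wigner

namespace Wigner

/-! ### Real symmetric matrices as complex matrices -/

section OfReal

variable {N : ℕ}

/-- The inclusion of real matrices into complex matrices. -/
noncomputable def matrixOfReal : Matrix (Fin N) (Fin N) ℝ →⋆ₐ[ℝ] Matrix (Fin N) (Fin N) ℂ where
  toAlgHom := Complex.ofRealAm.mapMatrix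
  map_star' A := by
    ext i j
    simp [Matrix.star_apply]

theorem matrixOfReal_apply (A : Matrix (Fin N) (Fin N) ℝ) :
    matrixOfReal A = A.map Complex.ofReal := rfl

/-- Entrywise inclusion is a continuous star homomorphism, and such maps commute with the functional
calculus of self-adjoint elements. -/
theorem map_ofReal_cfc {f : ℝ → ℝ} (hf : Continuous f) {A : Matrix (Fin N) (Fin N) ℝ}
    (hA : A.IsSymm) (i j : Fin N) :
    ((cfc f A i j : ℝ) : ℂ) = cfc f (A.map Complex.ofReal) i j := by
  have hA' : IsSelfAdjoint A := by
    rw [isSelfAdjoint_iff, Matrix.star_eq_conjTranspose, Matrix.conjTranspose_eq_transpose_of_trivial]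
    exact hA
  have hc : Continuous (matrixOfReal (N := N)) :=
    Continuous.matrix_map continuous_id Complex.continuous_ofReal
  have := StarAlgHom.map_cfc (S := ℝ) (matrixOfReal (N := N)) f A hf.continuousOn hc hA'
    (hA'.map _)
  rw [← matrixOfReal_apply, ← this, matrixOfReal_apply, Matrix.map_apply]

theorem map_ofReal_rescale (A : Matrix (Fin N) (Fin N) ℝ) :
    (rescale A).map Complex.ofReal = rescale (A.map Complex.ofReal) := by
  ext i j
  simp [rescale]

theorem ofReal_entry {Ω : Type u} {W : Ω → Matrix (Fin N) (Fin N) ℝ} [MeasurableSpace Ω]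
    {f : ℝ → ℝ} (hf : Continuous f) (hW : ∀ ω, (W ω).IsSymm) (j k : Fin N) (ω : Ω) :
    ((entry f W j k ω : ℝ) : ℂ) = entry f (fun ω => (W ω).map Complex.ofReal) j k ω := by
  have h : (rescale (W ω)).IsSymm := by
    ext a b
    simp [rescale, (hW ω).apply]
  rw [entry, map_ofReal_cfc hf h, map_ofReal_rescale]
  rfl

end OfReal

end Wigner

namespace Wigner

/-! ### Reduction of the real symmetric case to the complex one. -/

section Reduction

variable {Ω : Type u} [MeasurableSpace Ω] {P : Measure Ω} {N : ℕ} {f : ℝ → ℝ}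
  {W : Ω → Matrix (Fin N) (Fin N) ℝ}

theorem integral_ofReal_entry (hf : Continuous f) (hW : ∀ ω, (W ω).IsSymm) (j k : Fin N) :
    ∫ ω, entry f (fun ω => (W ω).map Complex.ofReal) j k ω ∂P =
      ((∫ ω, entry f W j k ω ∂P : ℝ) : ℂ) := by
  rw [← integral_complex_ofReal]
  exact integral_congr_ae (Filter.Eventually.of_forall fun ω => (ofReal_entry hf hW j k ω).symm)

theorem memLp_entry_of_ofReal {p : ℝ≥0∞} (hf : Continuous f) (hW : ∀ ω, (W ω).IsSymm)
    {j k : Fin N} (h : MemLp (entry f (fun ω => (W ω).map Complex.ofReal) j k) p P) :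
    MemLp (entry f W j k) p P := by
  refine h.re.ae_eq (Filter.Eventually.of_forall fun ω => ?_)
  show (entry f (fun ω => (W ω).map Complex.ofReal) j k ω).re = _
  rw [← ofReal_entry hf hW, Complex.ofReal_re]

theorem integrable_entry_of_ofReal (hf : Continuous f) (hW : ∀ ω, (W ω).IsSymm) {j k : Fin N}
    (h : Integrable (entry f (fun ω => (W ω).map Complex.ofReal) j k) P) :
    Integrable (entry f W j k) P :=
  memLp_one_iff_integrable.1 (memLp_entry_of_ofReal hf hW (memLp_one_iff_integrable.2 h))

theorem totalVariance_ofReal_entry (hf : Continuous f) (hW : ∀ ω, (W ω).IsSymm) (j k : Fin N) :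
    totalVariance P (entry f (fun ω => (W ω).map Complex.ofReal) j k) =
      totalVariance P (entry f W j k) := by
  unfold totalVariance
  rw [integral_ofReal_entry hf hW]
  refine integral_congr_ae (Filter.Eventually.of_forall fun ω => ?_)
  simp only
  rw [← ofReal_entry hf hW, ← Complex.ofReal_sub, Complex.norm_real]

theorem HasHigherMoments.map_ofReal {m₅ μ₃ : ℝ} (h : HasHigherMoments P m₅ μ₃ W) :
    HasHigherMoments P m₅ μ₃ fun ω => (W ω).map Complex.ofReal where
  memLp_off j k hjk := (h.memLp_off j k hjk).ofReal
  fifth_off j k hjk := by simpa using h.fifth_off j k hjk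
  memLp_diag i := (h.memLp_diag i).ofReal
  third_diag i := by simpa using h.third_diag i

end Reduction

/-! ### The five estimates with explicit constants. -/

namespace IsComplexWigner

variable {Ω : Type u} [MeasurableSpace Ω] {P : Measure Ω} [IsProbabilityMeasure P] {N : ℕ}
  {σ σ₁ m₄ : ℝ} {W : Ω → Matrix (Fin N) (Fin N) ℂ} {f : ℝ → ℝ}

/-- One number at least 1 dominates `σ`, `|σ₁|` and the fourth root of the fourth moment, so that a
single parameter `K` carries all the constants. -/
theorem isModel_of_params (h : IsComplexWigner P σ m₄ (σ₁ ^ 2) W) (hσ : 0 < σ) :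
    IsModel P σ (1 + σ + |σ₁| + |m₄|) fun ω => rescale (W ω) := by
  have h1 := abs_nonneg σ₁
  have h4 := abs_nonneg m₄
  have hK : 1 ≤ 1 + σ + |σ₁| + |m₄| := by linarith
  refine h.isModel hσ hK (by linarith) ?_ ?_
  · exact (le_abs_self m₄).trans (le_trans (by linarith) (le_self_pow₀ hK (by norm_num)))
  · rw [← sq_abs]
    gcongr
    linarith

/-- Here `K` may depend on `m₅` and `μ₃` only. The pair `j < k` provides an actual off-diagonal
entry, whose second moment `σ²` is then controlled by its fifth moment. -/
theorem isModel_of_higherMoments {A D m₅ μ₃ : ℝ} (h : IsComplexWigner P σ A D W) (hσ : 0 < σ)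
    (h5 : HasHigherMoments P m₅ μ₃ W) {j k : Fin N} (hjk : j < k) :
    IsModel P σ (2 + |m₅| + |μ₃|) fun ω => rescale (W ω) := by
  have h' := h.of_higherMoments h5.memLp_off h5.fifth_off h5.memLp_diag h5.third_diag
  have h1 := abs_nonneg m₅
  have h2 := abs_nonneg μ₃
  have h3 := le_abs_self m₅
  have h4 := le_abs_self μ₃
  have hK : 1 ≤ 2 + |m₅| + |μ₃| := by linarith
  refine h'.isModel hσ hK ?_ ?_ ?_
  · refine abs_le_of_sq_le_sq' ?_ (by linarith) |>.2
    -- The chain is `σ² ≤ 1 + (1 + m₅) ≤ 2 + |m₅| ≤ K²`.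
    have := h'.sq_sigma_le hjk
    nlinarith
  · exact le_trans (by linarith) (le_self_pow₀ hK (by norm_num))
  · exact le_trans (by linarith) (le_self_pow₀ hK (by norm_num))

theorem norm_integral_entry_diag_sub_le_cNorm (h : IsComplexWigner P σ m₄ (σ₁ ^ 2) W)
    (hσ : 0 < σ) {L : ℝ} (hL : 0 < L) (hf : ContDiff ℝ 7 f) (hs : tsupport f ⊆ Icc (-L) L)
    (i : Fin N) :
    Integrable (entry f W i i) P ∧
    ‖(∫ ω, entry f W i i ω ∂P) - (semicircleIntegral σ f : ℂ)‖ ≤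
      5046 * (1 + σ + |σ₁| + |m₄|) ^ 8 * (2 ^ 8 * √(2 * L) * √Real.pi) * cNorm 7 L f / N := by
  have hm := h.isModel_of_params hσ
  have hf' : ContDiff ℝ (6 + 1 : ℕ) f := by exact_mod_cast hf
  have hsup := isSuperposition_of_norm1 (by norm_num) hf' (norm1_lt_top_of_tsupport_subset hf' hs)
  have hw := integral_fourierCoef_weight_of_tsupport_subset hf' hs hL
  refine ⟨hm.integrable_cfc_apply hsup i i, ?_⟩
  refine (hm.norm_integral_cfc_diag_sub_le hsup hw.1 i).trans ?_
  have hK := hm.one_le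
  have hK0 : 0 ≤ 1 + σ + |σ₁| + |m₄| := by linarith
  refine (mul_le_mul_of_nonneg_left hw.2 (by positivity)).trans (le_of_eq ?_)
  ring

theorem norm_integral_entry_diag_sub_le_norm1 (h : IsComplexWigner P σ m₄ (σ₁ ^ 2) W)
    (hσ : 0 < σ) (hf : ContDiff ℝ 8 f) (h1 : norm1Plus 8 f < ∞) (i : Fin N) :
    Integrable (entry f W i i) P ∧
    ‖(∫ ω, entry f W i i ω ∂P) - (semicircleIntegral σ f : ℂ)‖ ≤
      5046 * (1 + σ + |σ₁| + |m₄|) ^ 8 * (2 ^ 9 * Real.pi) * (norm1Plus 8 f).toReal / N := by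
  have hm := h.isModel_of_params hσ
  have hf' : ContDiff ℝ (8 : ℕ) f := by exact_mod_cast hf
  have hle := norm1_le_norm1Plus 8 f
  have h1' := hle.trans_lt h1
  -- The Fourier estimates are stated for the norm without the factor `|x| + 1`, which the weighted
  -- norm dominates.
  have hsup := isSuperposition_of_norm1 (by norm_num) hf' h1'
  have hw := integral_fourierCoef_weight (m := 6) (by norm_num) hf' h1'
  refine ⟨hm.integrable_cfc_apply hsup i i, ?_⟩
  refine (hm.norm_integral_cfc_diag_sub_le hsup hw.1 i).trans ?_
  have hK := hm.one_le
  have hK0 : 0 ≤ 1 + σ + |σ₁| + |m₄| := by linarith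
  have hw' := hw.2.trans (mul_le_mul_of_nonneg_left (ENNReal.toReal_mono h1.ne hle)
    (by positivity))
  refine (mul_le_mul_of_nonneg_left hw' (by positivity)).trans (le_of_eq ?_)
  ring

theorem norm_integral_entry_off_diag_le (h : IsComplexWigner P σ m₄ (σ₁ ^ 2) W)
    (hσ : 0 < σ) (hf : ContDiff ℝ 6 f) (h1 : norm1 6 f < ∞) {j k : Fin N} (hjk : j < k) :
    Integrable (entry f W j k) P ∧
    ‖∫ ω, entry f W j k ω ∂P‖ ≤
      42 * (1 + σ + |σ₁| + |m₄|) ^ 4 * (2 ^ 7 * Real.pi) * (norm1 6 f).toReal / N := by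
  have hm := h.isModel_of_params hσ
  have hf' : ContDiff ℝ (6 : ℕ) f := by exact_mod_cast hf
  have hsup := isSuperposition_of_norm1 (by norm_num) hf' h1
  have hw := integral_fourierCoef_weight (m := 3) (by norm_num) hf' h1
  refine ⟨hm.integrable_cfc_apply hsup j k, ?_⟩
  refine (hm.norm_integral_cfc_off_diag_le hsup hjk.ne hw.1).trans ?_
  have hK := hm.one_le
  have hK0 : 0 ≤ 1 + σ + |σ₁| + |m₄| := by linarith
  refine (mul_le_mul_of_nonneg_left hw.2 (by positivity)).trans (le_of_eq ?_)
  ring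

theorem totalVariance_entry_le (h : IsComplexWigner P σ m₄ (σ₁ ^ 2) W)
    (hσ : 0 < σ) (hf : ContDiff ℝ 4 f) (h1 : norm1 4 f < ∞) (i j : Fin N) :
    MemLp (entry f W i j) 2 P ∧
    totalVariance P (entry f W i j) ≤
      (84 * (1 + σ + |σ₁| + |m₄|) ^ 3 * (2 ^ 5 * Real.pi)) ^ 2 * (norm1 4 f).toReal ^ 2 / N := by
  have hm := h.isModel_of_params hσ
  have hf' : ContDiff ℝ (4 : ℕ) f := by exact_mod_cast hf
  have hsup := isSuperposition_of_norm1 (by norm_num) hf' h1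
  have hw := integral_fourierCoef_weight (m := 2) (by norm_num) hf' h1
  have hK := hm.one_le
  have hK0 : 0 ≤ 1 + σ + |σ₁| + |m₄| := by linarith
  obtain ⟨c, hc⟩ := hm.exists_l2Bound_cfc_sub hsup i j hw.1
  -- Passing from an arbitrary centring `c` to the mean doubles the bound, whence `84 = 2 * 42`
  -- before squaring.
  have := (hc.mono (mul_le_mul_of_nonneg_left hw.2 (by positivity))).totalVariance_le
  refine ⟨this.1, this.2.trans (le_of_eq ?_)⟩
  have e : √(N : ℝ) ^ 2 = N := Real.sq_sqrt (Nat.cast_nonneg N)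
  calc _ = (84 * (1 + σ + |σ₁| + |m₄|) ^ 3 * (2 ^ 5 * Real.pi)) ^ 2 *
        (norm1 4 f).toReal ^ 2 / √(N : ℝ) ^ 2 := by ring
    _ = _ := by rw [e]

theorem norm_integral_entry_off_diag_le_refined {A D m₅ μ₃ : ℝ} (h : IsComplexWigner P σ A D W)
    (hσ : 0 < σ) (h5 : HasHigherMoments P m₅ μ₃ W) (hf : ContDiff ℝ 10 f)
    (h1 : norm1 10 f < ∞) {j k : Fin N} (hjk : j < k) :
    Integrable (entry f W j k) P ∧
    ‖∫ ω, entry f W j k ω ∂P‖ ≤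
      2456 * (2 + |m₅| + |μ₃|) ^ 9 * (2 ^ 11 * Real.pi) * (norm1 10 f).toReal /
        (N : ℝ) ^ (3 / 2 : ℝ) := by
  have hm := h.isModel_of_higherMoments hσ h5 hjk
  have hf' : ContDiff ℝ (10 : ℕ) f := by exact_mod_cast hf
  have hsup := isSuperposition_of_norm1 (by norm_num) hf' h1
  have hw := integral_fourierCoef_weight (m := 7) (by norm_num) hf' h1
  refine ⟨hm.integrable_cfc_apply hsup j k, ?_⟩
  refine (hm.norm_integral_cfc_off_diag_le_refined hsup hjk.ne hw.1).trans ?_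
  have hK0 : 0 ≤ 2 + |m₅| + |μ₃| := by positivity
  -- The model estimates carry the cube of `√N`, the statement a real power.
  have e : (N : ℝ) ^ (3 / 2 : ℝ) = √(N : ℝ) ^ 3 := by
    rw [Real.sqrt_eq_rpow, ← Real.rpow_natCast, ← Real.rpow_mul (Nat.cast_nonneg N)]
    norm_num
  rw [e]
  refine (mul_le_mul_of_nonneg_left hw.2 (by positivity)).trans (le_of_eq ?_)
  ring

end IsComplexWigner

section RealCase

variable {Ω : Type u} [MeasurableSpace Ω] {P : Measure Ω} {N : ℕ} {f : ℝ → ℝ}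
  {W : Ω → Matrix (Fin N) (Fin N) ℝ} {B : ℝ}

theorem real_of_complex_sub_le (hf : Continuous f) (hW : ∀ ω, (W ω).IsSymm) {j k : Fin N} {a : ℝ}
    (h : Integrable (entry f (fun ω => (W ω).map Complex.ofReal) j k) P ∧
      ‖(∫ ω, entry f (fun ω => (W ω).map Complex.ofReal) j k ω ∂P) - (a : ℂ)‖ ≤ B) :
    Integrable (entry f W j k) P ∧ ‖(∫ ω, entry f W j k ω ∂P) - a‖ ≤ B := by
  refine ⟨integrable_entry_of_ofReal hf hW h.1, ?_⟩
  have := h.2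
  rwa [integral_ofReal_entry hf hW, ← Complex.ofReal_sub, Complex.norm_real] at this

theorem real_of_complex_le (hf : Continuous f) (hW : ∀ ω, (W ω).IsSymm) {j k : Fin N}
    (h : Integrable (entry f (fun ω => (W ω).map Complex.ofReal) j k) P ∧
      ‖∫ ω, entry f (fun ω => (W ω).map Complex.ofReal) j k ω ∂P‖ ≤ B) :
    Integrable (entry f W j k) P ∧ ‖∫ ω, entry f W j k ω ∂P‖ ≤ B := by
  refine ⟨integrable_entry_of_ofReal hf hW h.1, ?_⟩
  have := h.2
  rwa [integral_ofReal_entry hf hW, Complex.norm_real] at this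

theorem real_of_complex_totalVariance_le (hf : Continuous f) (hW : ∀ ω, (W ω).IsSymm)
    {j k : Fin N}
    (h : MemLp (entry f (fun ω => (W ω).map Complex.ofReal) j k) 2 P ∧
      totalVariance P (entry f (fun ω => (W ω).map Complex.ofReal) j k) ≤ B) :
    MemLp (entry f W j k) 2 P ∧ totalVariance P (entry f W j k) ≤ B :=
  ⟨memLp_entry_of_ofReal hf hW h.1, (totalVariance_ofReal_entry hf hW j k).symm.le.trans h.2⟩

end RealCase

end Wigner

theorem proposition4p1 :
    (∀ σ σ₁ m₄ L : ℝ, 0 < σ → 0 < L → ∃ C : ℝ, ∀ (N : ℕ) (f : ℝ → ℝ),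
      ContDiff ℝ 7 f → tsupport f ⊆ Icc (-L) L →
        (∀ (Ω : Type u) [MeasurableSpace Ω] (P : Measure Ω) [IsProbabilityMeasure P]
          (W : Ω → Matrix (Fin N) (Fin N) ℝ), Wigner.IsRealWigner P σ σ₁ m₄ W →
          ∀ i : Fin N,
            Integrable (Wigner.entry f W i i) P ∧
            ‖(∫ ω, Wigner.entry f W i i ω ∂P) - Wigner.semicircleIntegral σ f‖ ≤
              C * Wigner.cNorm 7 L f / N) ∧
        (∀ (Ω : Type u) [MeasurableSpace Ω] (P : Measure Ω) [IsProbabilityMeasure P]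
          (W : Ω → Matrix (Fin N) (Fin N) ℂ), Wigner.IsHermitianWigner P σ σ₁ m₄ W →
          ∀ i : Fin N,
            Integrable (Wigner.entry f W i i) P ∧
            ‖(∫ ω, Wigner.entry f W i i ω ∂P) - (Wigner.semicircleIntegral σ f : ℂ)‖ ≤
              C * Wigner.cNorm 7 L f / N)) ∧
    (∀ σ σ₁ m₄ : ℝ, 0 < σ → ∃ C : ℝ, ∀ (N : ℕ) (f : ℝ → ℝ),
      ContDiff ℝ 8 f → Wigner.norm1Plus 8 f < ∞ →
        (∀ (Ω : Type u) [MeasurableSpace Ω] (P : Measure Ω) [IsProbabilityMeasure P]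
          (W : Ω → Matrix (Fin N) (Fin N) ℝ), Wigner.IsRealWigner P σ σ₁ m₄ W →
          ∀ i : Fin N,
            Integrable (Wigner.entry f W i i) P ∧
            ‖(∫ ω, Wigner.entry f W i i ω ∂P) - Wigner.semicircleIntegral σ f‖ ≤
              C * (Wigner.norm1Plus 8 f).toReal / N) ∧
        (∀ (Ω : Type u) [MeasurableSpace Ω] (P : Measure Ω) [IsProbabilityMeasure P]
          (W : Ω → Matrix (Fin N) (Fin N) ℂ), Wigner.IsHermitianWigner P σ σ₁ m₄ W →
          ∀ i : Fin N,
            Integrable (Wigner.entry f W i i) P ∧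
            ‖(∫ ω, Wigner.entry f W i i ω ∂P) - (Wigner.semicircleIntegral σ f : ℂ)‖ ≤
              C * (Wigner.norm1Plus 8 f).toReal / N)) ∧
    (∀ σ σ₁ m₄ : ℝ, 0 < σ → ∃ C : ℝ, ∀ (N : ℕ) (f : ℝ → ℝ),
      ContDiff ℝ 6 f → Wigner.norm1 6 f < ∞ →
        (∀ (Ω : Type u) [MeasurableSpace Ω] (P : Measure Ω) [IsProbabilityMeasure P]
          (W : Ω → Matrix (Fin N) (Fin N) ℝ), Wigner.IsRealWigner P σ σ₁ m₄ W →
          ∀ j k : Fin N, j < k →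
            Integrable (Wigner.entry f W j k) P ∧
            ‖∫ ω, Wigner.entry f W j k ω ∂P‖ ≤
              C * (Wigner.norm1 6 f).toReal / N) ∧
        (∀ (Ω : Type u) [MeasurableSpace Ω] (P : Measure Ω) [IsProbabilityMeasure P]
          (W : Ω → Matrix (Fin N) (Fin N) ℂ), Wigner.IsHermitianWigner P σ σ₁ m₄ W →
          ∀ j k : Fin N, j < k →
            Integrable (Wigner.entry f W j k) P ∧
            ‖∫ ω, Wigner.entry f W j k ω ∂P‖ ≤
              C * (Wigner.norm1 6 f).toReal / N)) ∧
    (∀ σ σ₁ m₄ : ℝ, 0 < σ → ∃ C : ℝ, ∀ (N : ℕ) (f : ℝ → ℝ),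
      ContDiff ℝ 4 f → Wigner.norm1 4 f < ∞ →
        (∀ (Ω : Type u) [MeasurableSpace Ω] (P : Measure Ω) [IsProbabilityMeasure P]
          (W : Ω → Matrix (Fin N) (Fin N) ℝ), Wigner.IsRealWigner P σ σ₁ m₄ W →
          ∀ i j : Fin N,
            MemLp (Wigner.entry f W i j) 2 P ∧
            Wigner.totalVariance P (Wigner.entry f W i j) ≤
              C * (Wigner.norm1 4 f).toReal ^ 2 / N) ∧
        (∀ (Ω : Type u) [MeasurableSpace Ω] (P : Measure Ω) [IsProbabilityMeasure P]
          (W : Ω → Matrix (Fin N) (Fin N) ℂ), Wigner.IsHermitianWigner P σ σ₁ m₄ W →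
          ∀ i j : Fin N,
            MemLp (Wigner.entry f W i j) 2 P ∧
            Wigner.totalVariance P (Wigner.entry f W i j) ≤
              C * (Wigner.norm1 4 f).toReal ^ 2 / N)) ∧
    (∀ m₅ μ₃ : ℝ, ∃ C : ℝ, ∀ (σ σ₁ m₄ : ℝ), 0 < σ → ∀ (N : ℕ) (f : ℝ → ℝ),
      ContDiff ℝ 10 f → Wigner.norm1 10 f < ∞ →
        (∀ (Ω : Type u) [MeasurableSpace Ω] (P : Measure Ω) [IsProbabilityMeasure P]
          (W : Ω → Matrix (Fin N) (Fin N) ℝ), Wigner.IsRealWigner P σ σ₁ m₄ W → Wigner.HasHigherMoments P m₅ μ₃ W →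
          ∀ j k : Fin N, j < k →
            Integrable (Wigner.entry f W j k) P ∧
            ‖∫ ω, Wigner.entry f W j k ω ∂P‖ ≤
              C * (Wigner.norm1 10 f).toReal / (N : ℝ) ^ (3 / 2 : ℝ)) ∧
        (∀ (Ω : Type u) [MeasurableSpace Ω] (P : Measure Ω) [IsProbabilityMeasure P]
          (W : Ω → Matrix (Fin N) (Fin N) ℂ), Wigner.IsHermitianWigner P σ σ₁ m₄ W → Wigner.HasHigherMoments P m₅ μ₃ W →
          ∀ j k : Fin N, j < k →
            Integrable (Wigner.entry f W j k) P ∧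
            ‖∫ ω, Wigner.entry f W j k ω ∂P‖ ≤
              C * (Wigner.norm1 10 f).toReal / (N : ℝ) ^ (3 / 2 : ℝ))) := by
  -- The witnesses are the explicit constants of the complex estimates. In the last part the
  -- constant is fixed before `σ`, `σ₁` and `m₄` are introduced.
  refine ⟨fun σ σ₁ m₄ L hσ hL =>
      ⟨5046 * (1 + σ + |σ₁| + |m₄|) ^ 8 * (2 ^ 8 * √(2 * L) * √Real.pi), fun N f hf hs => ⟨?_, ?_⟩⟩,
    fun σ σ₁ m₄ hσ =>
      ⟨5046 * (1 + σ + |σ₁| + |m₄|) ^ 8 * (2 ^ 9 * Real.pi), fun N f hf h1 => ⟨?_, ?_⟩⟩,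
    fun σ σ₁ m₄ hσ =>
      ⟨42 * (1 + σ + |σ₁| + |m₄|) ^ 4 * (2 ^ 7 * Real.pi), fun N f hf h1 => ⟨?_, ?_⟩⟩,
    fun σ σ₁ m₄ hσ =>
      ⟨(84 * (1 + σ + |σ₁| + |m₄|) ^ 3 * (2 ^ 5 * Real.pi)) ^ 2, fun N f hf h1 => ⟨?_, ?_⟩⟩,
    fun m₅ μ₃ => ⟨2456 * (2 + |m₅| + |μ₃|) ^ 9 * (2 ^ 11 * Real.pi),
      fun σ σ₁ m₄ hσ N f hf h1 => ⟨?_, ?_⟩⟩⟩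
  · intro Ω _ P _ W hW i
    exact Wigner.real_of_complex_sub_le hf.continuous hW.symm
      (hW.isComplexWigner.norm_integral_entry_diag_sub_le_cNorm hσ hL hf hs i)
  · intro Ω _ P _ W hW i
    exact hW.isComplexWigner.norm_integral_entry_diag_sub_le_cNorm hσ hL hf hs i
  · intro Ω _ P _ W hW i
    exact Wigner.real_of_complex_sub_le hf.continuous hW.symm
      (hW.isComplexWigner.norm_integral_entry_diag_sub_le_norm1 hσ hf h1 i)
  · intro Ω _ P _ W hW i
    exact hW.isComplexWigner.norm_integral_entry_diag_sub_le_norm1 hσ hf h1 i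
  · intro Ω _ P _ W hW j k hjk
    exact Wigner.real_of_complex_le hf.continuous hW.symm
      (hW.isComplexWigner.norm_integral_entry_off_diag_le hσ hf h1 hjk)
  · intro Ω _ P _ W hW j k hjk
    exact hW.isComplexWigner.norm_integral_entry_off_diag_le hσ hf h1 hjk
  · intro Ω _ P _ W hW i j
    exact Wigner.real_of_complex_totalVariance_le hf.continuous hW.symm
      (hW.isComplexWigner.totalVariance_entry_le hσ hf h1 i j)
  · intro Ω _ P _ W hW i j
    exact hW.isComplexWigner.totalVariance_entry_le hσ hf h1 i j
  · intro Ω _ P _ W hW h5 j k hjk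
    exact Wigner.real_of_complex_le hf.continuous hW.symm
      (hW.isComplexWigner.norm_integral_entry_off_diag_le_refined hσ h5.map_ofReal hf h1 hjk)
  · intro Ω _ P _ W hW h5 j k hjk
    exact hW.isComplexWigner.norm_integral_entry_off_diag_le_refined hσ h5 hf h1 hjk
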